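/- Let $k$ be an algebraically closed field of characteristic $p\neq 2$ ($p=0$ is allowed, and then the condition $(m,p)=1$ below just means $m\ge 1$). The group $PGL_2(k)$ acts on the rational function field $k(x)$ by fractional linear substitutions $x\mapsto \frac{ax+b}{cx+d}$. Let $\bar G$ be a finite subgroup of $PGL_2(k)$. Notation. $C_m$ is the cyclic group of order $m$ and $D_{2m}$ the dihedral group of order $2m$. If $p>0$, let $q=p^f$ with $f\ge 1$, and let $t\ge 1$; $U=C_p^t$ is the elementary abelian group of order $p^t$. For $m\mid p^t-1$, a primitive $2m$-th root of unity $\xi\in k$ and distinct $b_j\in k^*$, $0\le j<\frac{p^t-1}{m}$, such that $\mathcal U_m=\{a\in k : a\prod_j(a^m-b_j)=0\}$ is a subgroup of the additive group of $k$, let $K_m\le PGL_2(k)$ be the group generated by $x\mapsto \xi^2x$ and all $x\mapsto x+a$, $a\in\mathcal U_m$. A cover $z:\mathbb P^1_x\to\mathbb P^1_z$ is said to have ramification $(e_1,\dots,e_r)$ if there are distinct points $Q_1,\dots,Q_r$ of $\mathbb P^1_z$ such that all points above $Q_i$ have ramification index $e_i$ and the cover is unramified over all other points (entries $e_i=1$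 are allowed). Lemma 1. $\bar G$ is isomorphic to one of the groups: $C_m$ with $(m,p)=1$; $D_{2m}$ with $m\ge 2$, $(m,p)=1$; $A_4$ or $S_4$ with $p\ne 3$; $A_5$ with $p\neq 5$; $U=C_p^t$, $K_m$ ($m\ge 2$), $PSL_2(q)$ or $PGL_2(q)$ with $p>0$. Moreover, for a suitable choice of the coordinate $x$ (that is, after replacing $x$ by $\frac{ax+b}{cx+d}$ for some matrix in $GL_2(k)$), the fixed field is $k(x)^{\bar G}=k(z)$, where $z$ and the ramification of the cover $z:\mathbb P^1_x\to\mathbb P^1_z$ are as follows. 1. If $\bar G\cong C_m$, $(m,p)=1$: $z=x^m$, ramification $(m,m)$. 2. If $\bar G\cong D_{2m}$, $(m,p)=1$: $z=x^m+\frac1{x^m}$, ramification $(2,2,m)$. 3. If $\bar G\cong A_4$, $p\ne 3$: $z=\frac{x^{12}-33x^8-33x^4+1}{x^2(x^4-1)^2}$, ramification $(2,3,3)$. 4. If $\bar G\cong S_4$, $p\neq 3$: $z=\frac{(x^8+14x^4+1)^3}{108(x(x^4-1))^4}$, ramification $(2,3,4)$. 5. If $\bar G\cong A_5$, $p\ne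 3,5$: $z=\frac{(-x^{20}+228x^{15}-494x^{10}-228x^5-1)^3}{(x(x^{10}+11x^5-1))^5}$, ramification $(2,3,5)$. If $\bar G\cong A_5$, $p=3$: $z=\frac{(x^{10}-1)^6}{(x(x^{10}+2ix^5+1))^5}$ with $i^2=-1$, ramification $(6,5)$. 6. If $\bar G\cong U=C_p^t$: $z=\prod_{a\in H_t}(x+a)$ for some subgroup $H_t$ of the additive group of $k$ with $|H_t|=p^t$, ramification $(p^t)$. 7. If $\bar G$ is isomorphic to a group $K_m$ for some $t,m,\xi,(b_j)$ as above: $z=\bigl(x\prod_{j}(x^m-b_j)\bigr)^m$ for some $(b_j)$ as above (with the same $t,m,\xi$, possibly after changing the $b_j$) whose group $K_m$ is also isomorphic to $\bar G$, ramification $(mp^t,m)$. 8. If $\bar G\cong PSL_2(q)$: $z=\frac{((x^q-x)^{q-1}+1)^{(q+1)/2}}{(x^q-x)^{q(q-1)/2}}$, ramification $\bigl(\frac{q(q-1)}2,\frac{q+1}2\bigr)$. 9. If $\bar G\cong PGL_2(q)$: $z=\frac{((x^q-x)^{q-1}+1)^{q+1}}{(x^q-x)^{q(q-1)}}$, ramification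 $(q(q-1),q+1)$. -/

import Mathlib

open scoped IntermediateField

noncomputable section

namespace FiniteMoebius

variable {k : Type*} [Field k]

/-- The fractional linear function `(a x + b) / (c x + d)` of a matrix `g = (a b; c d)`. -/
def moebius (g : GL (Fin 2) k) : RatFunc k :=
  (RatFunc.C (g.1 0 0) * RatFunc.X + RatFunc.C (g.1 0 1)) /
    (RatFunc.C (g.1 1 0) * RatFunc.X + RatFunc.C (g.1 1 1))

theorem linear_eq_zero {a b : k}
    (h : RatFunc.C a * RatFunc.X + RatFunc.C b = (0 : RatFunc k)) : a = 0 ∧ b = 0 := by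
  have h1 : (Polynomial.C a * Polynomial.X + Polynomial.C b : Polynomial k) = 0 := by
    apply RatFunc.algebraMap_injective k
    simpa using h
  constructor
  · simpa using congrArg (fun q => Polynomial.coeff q 1) h1
  · simpa using congrArg (fun q => Polynomial.coeff q 0) h1

theorem transcendental_moebius (g : GL (Fin 2) k) : Transcendental k (moebius g) := by
  apply RatFunc.transcendental_of_ne_C
  rintro ⟨c, hc⟩
  have hdet : g.1 0 0 * g.1 1 1 - g.1 0 1 * g.1 1 0 ≠ 0 := by
    have := (Matrix.isUnit_iff_isUnit_det _).1 g.isUnit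
    rw [Matrix.det_fin_two] at this
    exact this.ne_zero
  have hden : (RatFunc.C (g.1 1 0) * RatFunc.X + RatFunc.C (g.1 1 1) : RatFunc k) ≠ 0 := by
    intro h
    obtain ⟨h1, h2⟩ := linear_eq_zero h
    exact hdet (by simp [h1, h2])
  rw [moebius, div_eq_iff hden] at hc
  have h : RatFunc.C (g.1 0 0 - c * g.1 1 0) * RatFunc.X + RatFunc.C (g.1 0 1 - c * g.1 1 1)
      = (0 : RatFunc k) := by
    simp only [map_sub, map_mul]
    linear_combination hc
  obtain ⟨h1, h2⟩ := linear_eq_zero h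
  apply hdet
  linear_combination g.1 1 1 * h1 - g.1 1 0 * h2

/-- The action of a matrix on `k(x)`: the `k`-endomorphism `f(x) ↦ f((a x + b) / (c x + d))`. -/
def subst (g : GL (Fin 2) k) : RatFunc k →ₐ[k] RatFunc k :=
  RatFunc.liftAlgHom (Polynomial.aeval (moebius g))
    (nonZeroDivisors_le_comap_nonZeroDivisors_of_injective _
      (transcendental_iff_injective.1 (transcendental_moebius g)))

/-- The fixed field `k(x)^G` of a subgroup `G` of `PGL₂(k)`. Matrices that differ by a scalar act
in the same way, so the condition runs over all matrices representing an element of `G`. -/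
def fixedField (G : Subgroup (Matrix.ProjGenLinGroup (Fin 2) k)) :
    IntermediateField k (RatFunc k) where
  carrier := {f | ∀ g : GL (Fin 2) k, Matrix.ProjGenLinGroup.mk g ∈ G → subst g f = f}
  mul_mem' ha hb g hg := by rw [map_mul, ha g hg, hb g hg]
  add_mem' ha hb g hg := by rw [map_add, ha g hg, hb g hg]
  algebraMap_mem' r g _ := (subst g).commutes r
  inv_mem' _ ha g hg := by rw [map_inv₀, ha g hg]

/-- The order of a rational function at a point of `ℙ¹(k) = k ∪ {∞}`. -/
def ordAt (P : OnePoint k) (f : RatFunc k) : ℤ :=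
  P.elim (-f.intDegree) fun a =>
    (f.num.rootMultiplicity a : ℤ) - (f.denom.rootMultiplicity a : ℤ)

/-- The standard local parameter of the `z`-line at the point `Q`, as a function on the
`x`-line: `z - c` at `Q = c`, and `1 / z` at `Q = ∞`. For nonconstant `z`, a point `P` lies
above `Q` if and only if this function vanishes at `P`, and then its order at `P` is the
ramification index of `P` over `Q`. -/
def pullParam (z : RatFunc k) (Q : OnePoint k) : RatFunc k :=
  Q.elim z⁻¹ fun c => z - RatFunc.C c

/-- The cover `z : ℙ¹ → ℙ¹` has ramification `(e₁, …, eᵣ)`: there are distinct points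
`Q₁, …, Qᵣ` of the target such that all points above `Qᵢ` have ramification index `eᵢ`, and
every point above any other point of the target is unramified. -/
def HasRamification (z : RatFunc k) (e : List ℕ) : Prop :=
  ∃ Q : Fin e.length → OnePoint k, Function.Injective Q ∧
    (∀ i P, 0 < ordAt P (pullParam z (Q i)) → ordAt P (pullParam z (Q i)) = e.get i) ∧
    ∀ R, R ∉ Set.range Q → ∀ P, 0 < ordAt P (pullParam z R) → ordAt P (pullParam z R) = 1

/-- After a change of the coordinate `x` of the projective line, the fixed field of `G` is `k(z)`,
and the corresponding cover has ramification `e`. -/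
def FixedFieldGivenBy (G : Subgroup (Matrix.ProjGenLinGroup (Fin 2) k)) (z : RatFunc k)
    (e : List ℕ) : Prop :=
  ∃ γ : GL (Fin 2) k, fixedField G = k⟮subst γ z⟯ ∧ HasRamification (subst γ z) e

/-- The set `𝒰ₘ` of the roots in `k` of `a ∏ⱼ (aᵐ - bⱼ)`. -/
def rootSetU (m : ℕ) {n : ℕ} (b : Fin n → k) : Set k :=
  {a | a * ∏ j, (a ^ m - b j) = 0}

/-- The conditions on the data that define `Kₘ`: `m ∣ pᵗ - 1`, the element `ξ` is a primitive
`2m`-th root of unity, the `bⱼ` are distinct and nonzero, and `𝒰ₘ` is an additive subgroup. -/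
structure IsKmData (p t m : ℕ) (ξ : k) (b : Fin ((p ^ t - 1) / m) → k) : Prop where
  prime : p.Prime
  pos : 0 < t
  dvd : m ∣ p ^ t - 1
  primitive : IsPrimitiveRoot ξ (2 * m)
  injective : Function.Injective b
  ne_zero : ∀ j, b j ≠ 0
  additive : ∃ H : AddSubgroup k, (H : Set k) = rootSetU m b

/-- The group `Kₘ`, generated by `x ↦ x + a` for `a ∈ 𝒰ₘ` and by `x ↦ ξ² x`. -/
def groupK (m : ℕ) (ξ : k) {n : ℕ} (b : Fin n → k) :
    Subgroup (Matrix.ProjGenLinGroup (Fin 2) k) :=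
  Subgroup.closure (Matrix.ProjGenLinGroup.mk ''
    {g | (∃ a ∈ rootSetU m b, g.1 = !![1, a; 0, 1]) ∨ g.1 = !![ξ ^ 2, 0; 0, 1]})

end FiniteMoebius

end

noncomputable section

namespace FiniteMoebius

/-! ### The action of `PGL2 k` on the projective line -/

section

open Matrix OnePoint

/-! The classification comes from counting fixed points on the projective line. A nontrivial element
of PGL₂(k) has two fixed points with multiplicity: one with a single fixed point is conjugate to a
translation and counts twice. Let u(P) be the number of nontrivial elements of G fixing P alone.
Summing over the elements gives Σ_P (|G_P| - 1 + u(P)) = 2(|G| - 1), which is Riemann-Hurwitz for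
the quotient by G; it is grouped into orbits in `exists_orbit_representatives`.

Tame case: if u = 0 everywhere, the count reads Σ (1 - 1/eᵢ) = 2 - 2/|G| over the nonfree orbits.
Besides the trivial group this leaves (n,n), (2,2,m), (2,3,3), (2,3,4), (2,3,5), see `tame_types`.
The last three groups are recognized from faithful permutation actions: on an orbit of four points,
on the four Sylow 3-subgroups, on the five Sylow 2-subgroups.

Wild case: a point with u ≠ 0 is moved to ∞. Its stabilizer consists of maps x ↦ ax + b, with
translation part H of order q = pᵗ and multiplier group D of order d dividing q - 1. The count
allows at most one further nonfree orbit, and arithmetic leaves three sizes for the orbit of ∞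
(`wild_cases`). One point: G is affine, so it is U or some Kₘ. Ten points, with q = 3 and d = 2: G
is A₅ in characteristic 3. And q + 1 points: in a suitable coordinate the orbit is H ∪ {∞} with 1 ∈
H, some c/x belongs to G, so H is stable under h ↦ c/h and a form of Hua's theorem makes H a field
of q elements. The Bruhat decomposition puts G inside PGL₂(q), and d is (q - 1)/2 or q - 1.

Fixed fields: an invariant z of degree |G| generates, because |G| ≤ [k(x) : k(x)^G] ≤ [k(x) : k(z)]
= |G|. Invariance is verified on generators after conjugating G into standard position.
Ramification: a local parameter of the quotient vanishes exactly on one orbit, to the order of the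
stabilizer (`zeros_of_generator`), so the ramification list is the list of stabilizer orders.

Since the formulas are claimed for every G of a given isomorphism type, the orbit structure must be
recovered from that type: through element orders in the tame case, through the p-part of |G| in the
wild case. -/

/-- The group `PGL₂(k)`. -/
abbrev PGL2 (k : Type*) [Field k] : Type _ := Matrix.ProjGenLinGroup (Fin 2) k

variable {k : Type*} [Field k]

/-- The invertible matrix with the given entries. -/
def glOf (a b c d : k) (h : a * d - b * c ≠ 0) : GL (Fin 2) k :=
  GeneralLinearGroup.mkOfDetNeZero !![a, b; c, d] (by rwa [det_fin_two_of])

@[simp] theorem glOf_val (a b c d : k) (h : a * d - b * c ≠ 0) :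
    (glOf a b c d h).1 = !![a, b; c, d] := rfl

theorem det_ne_zero' (g : GL (Fin 2) k) : g.1 0 0 * g.1 1 1 - g.1 0 1 * g.1 1 0 ≠ 0 := by
  have := (Matrix.isUnit_iff_isUnit_det _).1 g.isUnit
  rw [Matrix.det_fin_two] at this
  exact this.ne_zero

open Classical in
theorem scalar_smul_onePoint (u : kˣ) (P : OnePoint k) :
    GeneralLinearGroup.scalar (Fin 2) u • P = P := by
  cases P with
  | infty => simp [smul_infty_eq_ite]
  | coe x => simp [smul_some_eq_ite]

/-- The action of `PGL₂(k)` on the projective line by fractional linear transformations. -/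
instance : MulAction (PGL2 k) (OnePoint k) :=
  letI := Classical.decEq k
  ProjGenLinGroup.mulActionOfGL scalar_smul_onePoint

open Classical in
theorem mk_smul_infty (g : GL (Fin 2) k) :
    ProjGenLinGroup.mk g • (∞ : OnePoint k) =
      if g.1 1 0 = 0 then ∞ else ((g.1 0 0 / g.1 1 0 : k) : OnePoint k) := by
  have : ProjGenLinGroup.mk g • (∞ : OnePoint k) = g • (∞ : OnePoint k) := rfl
  rw [this]
  convert smul_infty_eq_ite g

open Classical in
theorem mk_smul_coe (g : GL (Fin 2) k) (x : k) :
    ProjGenLinGroup.mk g • (x : OnePoint k) =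
      if g.1 1 0 * x + g.1 1 1 = 0 then ∞ else
        (((g.1 0 0 * x + g.1 0 1) / (g.1 1 0 * x + g.1 1 1) : k) : OnePoint k) := by
  have : ProjGenLinGroup.mk g • (x : OnePoint k) = g • (x : OnePoint k) := rfl
  rw [this]
  convert! smul_some_eq_ite (g := g) (k := x)

/-- Identities in `PGL2 k` are reduced to this: the scalar u is exhibited and the four matrix
entries are compared. -/
theorem mk_eq_mk_of_smul {g h : GL (Fin 2) k} (u : k) (hu : u ≠ 0) (H : u • g.1 = h.1) :
    ProjGenLinGroup.mk g = ProjGenLinGroup.mk h := by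
  rw [ProjGenLinGroup.mk_eq_mk_iff]
  refine ⟨Units.mk0 u hu, ?_⟩
  ext i j
  have := congrFun (congrFun H i) j
  simp [Matrix.scalar_apply] at this ⊢
  rw [← this, mul_comm]

theorem exists_smul_of_mk_eq_mk {g h : GL (Fin 2) k}
    (H : ProjGenLinGroup.mk g = ProjGenLinGroup.mk h) : ∃ u : k, u ≠ 0 ∧ u • g.1 = h.1 := by
  rw [ProjGenLinGroup.mk_eq_mk_iff] at H
  obtain ⟨u, rfl⟩ := H
  refine ⟨u, u.ne_zero, ?_⟩
  ext i j
  simp [Matrix.scalar_apply, mul_comm]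

/-- The class of the affine transformation `x ↦ a x + b`. -/
def aff (a : kˣ) (b : k) : PGL2 k := ProjGenLinGroup.mk (glOf a b 0 1 (by simp))

/-- The class of the transformation `x ↦ c / x`. -/
def inver (c : kˣ) : PGL2 k := ProjGenLinGroup.mk (glOf 0 c 1 0 (by simp))

@[simp] theorem aff_smul_infty (a : kˣ) (b : k) : aff a b • (∞ : OnePoint k) = ∞ := by
  simp [aff, mk_smul_infty]

@[simp] theorem aff_smul_coe (a : kˣ) (b x : k) :
    aff a b • (x : OnePoint k) = ((a * x + b : k) : OnePoint k) := by
  simp [aff, mk_smul_coe]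

@[simp] theorem inver_smul_infty (c : kˣ) : inver c • (∞ : OnePoint k) = ((0 : k) : OnePoint k) :=
    by
  simp [inver, mk_smul_infty]

@[simp] theorem inver_smul_zero (c : kˣ) : inver c • ((0 : k) : OnePoint k) = ∞ := by
  simp [inver, mk_smul_coe]

theorem inver_smul_coe (c : kˣ) {x : k} (hx : x ≠ 0) :
    inver c • (x : OnePoint k) = ((c / x : k) : OnePoint k) := by
  simp [inver, mk_smul_coe, hx]

theorem aff_mul_aff (a a' : kˣ) (b b' : k) :
    aff a b * aff a' b' = aff (a * a') (a * b' + b) := by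
  rw [aff, aff, aff, ← map_mul]
  congr 1
  ext i j
  fin_cases i <;> fin_cases j <;> simp

@[simp] theorem aff_one_zero : aff (1 : kˣ) (0 : k) = 1 := by
  rw [aff, ← map_one ProjGenLinGroup.mk]
  congr 1
  ext i j
  fin_cases i <;> fin_cases j <;> simp

theorem aff_inv (a : kˣ) (b : k) : (aff a b)⁻¹ = aff a⁻¹ (-((a⁻¹ : kˣ) * b)) := by
  rw [inv_eq_iff_mul_eq_one, aff_mul_aff]
  simp

theorem aff_inj {a a' : kˣ} {b b' : k} : aff a b = aff a' b' ↔ a = a' ∧ b = b' := by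
  refine ⟨fun h => ?_, by rintro ⟨rfl, rfl⟩; rfl⟩
  have h0 := congrArg (· • ((0 : k) : OnePoint k)) h
  have h1 := congrArg (· • ((1 : k) : OnePoint k)) h
  simp only [aff_smul_coe, mul_zero, zero_add, mul_one, OnePoint.coe_eq_coe] at h0 h1
  exact ⟨Units.ext (by simpa [h0] using h1), h0⟩

theorem aff_eq_one {a : kˣ} {b : k} : aff a b = 1 ↔ a = 1 ∧ b = 0 := by
  rw [← aff_one_zero, aff_inj]

theorem aff_pow_zero (a : kˣ) (n : ℕ) : aff a (0 : k) ^ n = aff (a ^ n) 0 := by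
  induction n with
  | zero => simp
  | succ n ih => rw [pow_succ, ih, aff_mul_aff, pow_succ]; simp

theorem aff_one_pow (b : k) (n : ℕ) : aff (1 : kˣ) b ^ n = aff 1 (n * b) := by
  induction n with
  | zero => simp
  | succ n ih =>
    rw [pow_succ, ih, aff_mul_aff]
    congr 1
    · simp
    · push_cast
      simp
      ring

theorem aff_conj_translation (a : kˣ) (b h : k) :
    aff a b * aff 1 h * (aff a b)⁻¹ = aff 1 (a * h) := by
  rw [mul_inv_eq_iff_eq_mul, aff_mul_aff, aff_mul_aff]
  congr 1
  · simp
  · simp; ring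

theorem exists_aff {g : PGL2 k} (h : g • (∞ : OnePoint k) = ∞) : ∃ a b, g = aff a b := by
  induction g using ProjGenLinGroup.induction_on with | mk g =>
  rw [mk_smul_infty] at h
  have h10 : g.1 1 0 = 0 := by
    by_contra hc
    simp [hc] at h
  have hdet := det_ne_zero' g
  have h11 : g.1 1 1 ≠ 0 := fun hc => hdet (by simp [h10, hc])
  have h00 : g.1 0 0 ≠ 0 := fun hc => hdet (by simp [h10, hc])
  refine ⟨Units.mk0 (g.1 0 0 / g.1 1 1) (div_ne_zero h00 h11), g.1 0 1 / g.1 1 1, ?_⟩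
  refine mk_eq_mk_of_smul (g.1 1 1)⁻¹ (inv_ne_zero h11) ?_
  ext i j
  fin_cases i <;> fin_cases j <;> simp [h10, h11, div_eq_inv_mul]

theorem exists_aff_zero {g : PGL2 k} (h : g • (∞ : OnePoint k) = ∞)
    (h0 : g • ((0 : k) : OnePoint k) = ((0 : k) : OnePoint k)) : ∃ a, g = aff a 0 := by
  obtain ⟨a, b, rfl⟩ := exists_aff h
  simp only [aff_smul_coe, mul_zero, zero_add, OnePoint.coe_eq_coe] at h0
  exact ⟨a, by rw [h0]⟩

theorem inver_mul_aff (c a : kˣ) : inver c * aff a 0 = inver (c * a⁻¹) := by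
  rw [inver, aff, inver, ← map_mul]
  refine mk_eq_mk_of_smul ((a⁻¹ : kˣ) : k) (Units.ne_zero _) ?_
  ext i j
  fin_cases i <;> fin_cases j <;> simp [mul_comm]

theorem aff_mul_inver (c a : kˣ) : aff a 0 * inver c = inver (a * c) := by
  rw [inver, aff, inver, ← map_mul]
  congr 1
  ext i j
  fin_cases i <;> fin_cases j <;> simp

theorem inver_mul_inver (c c' : kˣ) : inver c * inver c' = aff (c * c'⁻¹) (0 : k) := by
  rw [inver, aff, inver, ← map_mul]
  refine mk_eq_mk_of_smul ((c'⁻¹ : kˣ) : k) (Units.ne_zero _) ?_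
  ext i j
  fin_cases i <;> fin_cases j <;> simp [mul_comm]

theorem inver_mul_self (c : kˣ) : inver c * inver c = (1 : PGL2 k) := by
  simp [inver_mul_inver]

theorem exists_inver {g : PGL2 k} (h : g • (∞ : OnePoint k) = ((0 : k) : OnePoint k))
    (h0 : g • ((0 : k) : OnePoint k) = ∞) : ∃ c, g = inver c := by
  obtain ⟨a, ha⟩ := exists_aff_zero (g := g * inver 1) (by simp [mul_smul, h0])
    (by simp [mul_smul, h])
  refine ⟨a, ?_⟩
  have : g = aff a 0 * inver 1 := by rw [← ha, mul_assoc, inver_mul_self, mul_one]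
  rw [this, aff_mul_inver, mul_one]

theorem inver_inj {c c' : kˣ} : (inver c : PGL2 k) = inver c' ↔ c = c' := by
  refine ⟨fun h => ?_, by rintro rfl; rfl⟩
  have h1 := congrArg (· • ((1 : k) : OnePoint k)) h
  simp only [inver_smul_coe _ one_ne_zero, div_one, OnePoint.coe_eq_coe] at h1
  exact Units.ext h1

theorem inver_ne_aff (c a : kˣ) (b : k) : inver c ≠ aff a b := fun h => by
  have h1 := congrArg (· • (∞ : OnePoint k)) h
  simp at h1

theorem conj_inver (u c : kˣ) (b : k) (hb : b = 0) :
    aff u b * inver c * (aff u b)⁻¹ = inver (u ^ 2 * c) := by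
  subst hb
  rw [aff_mul_inver, aff_inv]
  simp only [mul_zero, neg_zero, inver_mul_aff, inv_inv]
  rw [pow_two, mul_right_comm]

theorem conj_aff_zero (u a : kˣ) : aff u 0 * aff a 0 * (aff u 0)⁻¹ = aff a (0 : k) := by
  rw [mul_inv_eq_iff_eq_mul, aff_mul_aff, aff_mul_aff, mul_comm]
  simp

/-- `PGL₂(k)` acts transitively on pairs of distinct points. -/
theorem exists_smul_pair {P Q : OnePoint k} (h : P ≠ Q) :
    ∃ γ : PGL2 k, γ • P = ∞ ∧ γ • Q = ((0 : k) : OnePoint k) := by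
  have key : ∀ (x : k) (Q : OnePoint k), (x : OnePoint k) ≠ Q →
      ∃ γ : PGL2 k, γ • (x : OnePoint k) = ∞ ∧ γ • Q = ((0 : k) : OnePoint k) := by
    intro x Q hQ
    cases Q with
    | infty => exact ⟨inver 1 * aff 1 (-x), by simp [mul_smul], by simp [mul_smul]⟩
    | coe y =>
      have hxy : y - x ≠ 0 := fun h0 => hQ (by rw [sub_eq_zero.1 h0])
      -- Translating by -x and inverting sends x to ∞ and y to 1/(y - x), which the last translation
      -- moves to 0.
      refine ⟨aff 1 (-(y - x)⁻¹) * inver 1 * aff 1 (-x), by simp [mul_smul], ?_⟩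
      have : (1 : kˣ) * y + -x = y - x := by simp [sub_eq_add_neg]
      rw [mul_smul, mul_smul, aff_smul_coe, this, inver_smul_coe _ hxy, aff_smul_coe]
      simp
  cases P with
  | coe x => exact key x Q h
  | infty =>
    cases Q with
    | infty => exact absurd rfl h
    | coe y => exact ⟨aff 1 (-y), by simp, by simp⟩

theorem exists_smul_eq_infty (P : OnePoint k) : ∃ γ : PGL2 k, γ • P = ∞ := by
  cases P with
  | infty => exact ⟨1, one_smul _ _⟩
  | coe x => exact ⟨inver 1 * aff 1 (-x), by simp [mul_smul]⟩

/-- With two of the points moved to ∞ and 0 the element is a homothety x ↦ ax, and a third fixed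
point, finite and nonzero, forces a = 1. -/
theorem eq_one_of_fix_three {g : PGL2 k} {P Q R : OnePoint k} (hPQ : P ≠ Q) (hPR : P ≠ R)
    (hQR : Q ≠ R) (hP : g • P = P) (hQ : g • Q = Q) (hR : g • R = R) : g = 1 := by
  obtain ⟨γ, h1, h2⟩ := exists_smul_pair hPQ
  have fix : ∀ S : OnePoint k, g • S = S → (γ * g * γ⁻¹) • γ • S = γ • S := fun S h => by
    rw [mul_smul, mul_smul, inv_smul_smul, h]
  have fP := fix P hP
  have fQ := fix Q hQ
  have fR := fix R hR
  rw [h1] at fP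
  rw [h2] at fQ
  obtain ⟨a, ha⟩ := exists_aff_zero fP fQ
  have hR1 : γ • R ≠ ∞ := fun h => hPR (MulAction.injective γ (h1.trans h.symm))
  have hR0 : γ • R ≠ ((0 : k) : OnePoint k) :=
    fun h => hQR (MulAction.injective γ (h2.trans h.symm))
  obtain ⟨x, hx⟩ := OnePoint.ne_infty_iff_exists.1 hR1
  rw [← hx] at hR0 fR
  have hx0 : x ≠ 0 := fun h => hR0 (by rw [h])
  rw [ha, aff_smul_coe, OnePoint.coe_eq_coe] at fR
  have : a = 1 := Units.ext (by simpa [hx0] using fR)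
  rw [this, aff_one_zero] at ha
  rw [mul_inv_eq_one] at ha
  simpa using ha

/-- For g = (a b; c d) with c ≠ 0 a fixed point is a root of c x² + (d - a) x - b. Such a root is
not a pole of g: if cx + d = 0 then ax + b = 0 as well, and the determinant vanishes. -/
theorem exists_fixed_point [IsAlgClosed k] (g : PGL2 k) : ∃ P : OnePoint k, g • P = P := by
  induction g using ProjGenLinGroup.induction_on with | mk g =>
  by_cases h10 : g.1 1 0 = 0
  · exact ⟨∞, by simp [mk_smul_infty, h10]⟩
  · obtain ⟨x, hx⟩ := IsAlgClosed.exists_root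
      (Polynomial.C (g.1 1 0) * Polynomial.X ^ 2 + Polynomial.C (g.1 1 1 - g.1 0 0) * Polynomial.X
        + Polynomial.C (-g.1 0 1)) (by rw [Polynomial.degree_quadratic h10]; decide)
    simp only [Polynomial.IsRoot.def, Polynomial.eval_add, Polynomial.eval_mul, Polynomial.eval_C,
      Polynomial.eval_pow, Polynomial.eval_X] at hx
    refine ⟨x, ?_⟩
    have hden : g.1 1 0 * x + g.1 1 1 ≠ 0 := by
      intro h
      apply det_ne_zero' g
      have h1 : g.1 0 0 * x + g.1 0 1 = 0 := by linear_combination (x) * h - hx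
      have : g.1 1 0 * (g.1 0 0 * g.1 1 1 - g.1 0 1 * g.1 1 0) = 0 := by
        linear_combination g.1 1 0 * g.1 0 0 * h - g.1 1 0 * g.1 1 0 * h1
      exact (mul_eq_zero.1 this).resolve_left h10
    rw [mk_smul_coe, if_neg hden, OnePoint.coe_eq_coe, div_eq_iff hden]
    linear_combination -hx

/-- The fixed points of a nontrivial element: two points, which may coincide. -/
theorem exists_fixed_points [IsAlgClosed k] {g : PGL2 k} (hg : g ≠ 1) :
    ∃ P R : OnePoint k, ∀ Q, g • Q = Q ↔ Q = P ∨ Q = R := by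
  obtain ⟨P, hP⟩ := exists_fixed_point g
  by_cases h : ∃ R, R ≠ P ∧ g • R = R
  · obtain ⟨R, hRP, hR⟩ := h
    refine ⟨P, R, fun Q => ⟨fun hQ => ?_, by rintro (rfl | rfl) <;> assumption⟩⟩
    by_contra! hc
    exact hg (eq_one_of_fix_three hRP.symm hc.1.symm hc.2.symm hP hR hQ)
  · push Not at h
    refine ⟨P, P, fun Q => ⟨fun hQ => ?_, by rintro (rfl | rfl) <;> assumption⟩⟩
    by_contra! hc
    exact h Q hc.1 hQ

end

/-! ### The action on `RatFunc k`, fixed fields and degrees -/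

section

open Matrix OnePoint

variable {k : Type*} [Field k]

theorem subst_algebraMap (g : GL (Fin 2) k) (p : Polynomial k) :
    subst g (algebraMap (Polynomial k) (RatFunc k) p) = Polynomial.aeval (moebius g) p := by
  have h := RatFunc.liftAlgHom_apply_div' (Polynomial.aeval (moebius g))
    (nonZeroDivisors_le_comap_nonZeroDivisors_of_injective _
      (transcendental_iff_injective.1 (transcendental_moebius g))) p 1
  simpa [subst] using h

@[simp] theorem subst_X (g : GL (Fin 2) k) : subst g RatFunc.X = moebius g := by
  rw [← RatFunc.algebraMap_X, subst_algebraMap, Polynomial.aeval_X]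

@[simp] theorem subst_C (g : GL (Fin 2) k) (c : k) : subst g (RatFunc.C c) = RatFunc.C c :=
  (subst g).commutes c

theorem ratFunc_algHom_ext {A : Type*} [Field A] [Algebra k A] {φ ψ : RatFunc k →ₐ[k] A}
    (h : φ RatFunc.X = ψ RatFunc.X) : φ = ψ := by
  have key : ∀ p : Polynomial k, φ (algebraMap (Polynomial k) (RatFunc k) p) =
      ψ (algebraMap (Polynomial k) (RatFunc k) p) := fun p => by
    rw [← RatFunc.aeval_X_left_eq_algebraMap, ← Polynomial.aeval_algHom_apply,
      ← Polynomial.aeval_algHom_apply, h]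
  ext f
  rw [← RatFunc.num_div_denom f, map_div₀, map_div₀, key, key]

theorem linear_ne_zero {a b : k} (h : a ≠ 0 ∨ b ≠ 0) :
    RatFunc.C a * RatFunc.X + RatFunc.C b ≠ (0 : RatFunc k) := fun h0 => by
  obtain ⟨h1, h2⟩ := linear_eq_zero h0
  tauto

theorem moebius_denom_ne_zero (g : GL (Fin 2) k) :
    RatFunc.C (g.1 1 0) * RatFunc.X + RatFunc.C (g.1 1 1) ≠ (0 : RatFunc k) := by
  apply linear_ne_zero
  by_contra! h
  exact det_ne_zero' g (by simp [h.1, h.2])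

/-- The product is reversed because substitution is contravariant in the matrix. After clearing
denominators the two sides differ by det h times the relation defining `moebius g`. -/
theorem subst_moebius (g h : GL (Fin 2) k) : subst g (moebius h) = moebius (h * g) := by
  have h1 := moebius_denom_ne_zero g
  have h2 : RatFunc.C (h.1 1 0) * moebius g + RatFunc.C (h.1 1 1) ≠ 0 := by
    have := (map_ne_zero (subst g)).2 (moebius_denom_ne_zero h)
    simpa using this
  have h3 := moebius_denom_ne_zero (h * g)
  rw [moebius, map_div₀]
  simp only [map_add, map_mul, subst_C, subst_X]
  rw [show moebius (h * g) = _ / _ from rfl, div_eq_div_iff h2 h3]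
  have hy : moebius g * (RatFunc.C (g.1 1 0) * RatFunc.X + RatFunc.C (g.1 1 1)) =
      RatFunc.C (g.1 0 0) * RatFunc.X + RatFunc.C (g.1 0 1) := div_mul_cancel₀ _ h1
  simp only [Units.val_mul, Matrix.mul_apply, Fin.sum_univ_two, map_add, map_mul]
  linear_combination (RatFunc.C (h.1 0 0) * RatFunc.C (h.1 1 1) -
    RatFunc.C (h.1 0 1) * RatFunc.C (h.1 1 0)) * hy

theorem subst_mul (g h : GL (Fin 2) k) : subst (h * g) = (subst g).comp (subst h) :=
  ratFunc_algHom_ext (by simp [subst_moebius])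

theorem subst_subst (g h : GL (Fin 2) k) (f : RatFunc k) :
    subst g (subst h f) = subst (h * g) f := by rw [subst_mul]; rfl

@[simp] theorem subst_one : subst (1 : GL (Fin 2) k) = AlgHom.id k _ :=
  ratFunc_algHom_ext (by simp [moebius])

theorem subst_eq_of_mk_eq {g h : GL (Fin 2) k}
    (H : ProjGenLinGroup.mk g = ProjGenLinGroup.mk h) : subst g = subst h := by
  obtain ⟨u, hu, H⟩ := exists_smul_of_mk_eq_mk H
  apply ratFunc_algHom_ext
  have hu' : (RatFunc.C u : RatFunc k) ≠ 0 := (map_ne_zero _).2 hu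
  rw [subst_X, subst_X, moebius, moebius, ← H]
  simp only [Matrix.smul_apply, smul_eq_mul, map_mul]
  rw [mul_assoc, mul_assoc, ← mul_add, ← mul_add, mul_div_mul_left _ _ hu']

/-- Comparing coefficients in x(cx + d) = ax + b gives c = b = 0 and a = d: the action of `PGL2 k`
on k(x) is faithful. -/
theorem mk_eq_one_of_subst_eq {g : GL (Fin 2) k} (H : subst g = AlgHom.id k _) :
    ProjGenLinGroup.mk g = 1 := by
  have hX := congrArg (fun φ => φ RatFunc.X) H
  simp only [subst_X, AlgHom.id_apply] at hX
  rw [moebius, div_eq_iff (moebius_denom_ne_zero g)] at hX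
  have h1 : (Polynomial.C (g.1 0 0) * Polynomial.X + Polynomial.C (g.1 0 1) : Polynomial k) =
      Polynomial.X * (Polynomial.C (g.1 1 0) * Polynomial.X + Polynomial.C (g.1 1 1)) := by
    apply RatFunc.algebraMap_injective k
    simpa using hX
  have c0 := congrArg (fun q => Polynomial.coeff q 0) h1
  have c1 := congrArg (fun q => Polynomial.coeff q 1) h1
  have c2 := congrArg (fun q => Polynomial.coeff q 2) h1
  simp [Polynomial.coeff_X, Polynomial.coeff_C] at c0 c1 c2
  have hdet := det_ne_zero' g
  have h11 : g.1 1 1 ≠ 0 := fun hc => hdet (by simp [← c2, hc])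
  rw [← map_one ProjGenLinGroup.mk]
  refine mk_eq_mk_of_smul (g.1 1 1)⁻¹ (inv_ne_zero h11) ?_
  ext i j
  fin_cases i <;> fin_cases j <;> simp [← c2, c1, c0, h11]

theorem mk_eq_of_subst_eq {g h : GL (Fin 2) k} (H : subst g = subst h) :
    ProjGenLinGroup.mk g = ProjGenLinGroup.mk h := by
  have : subst (g * h⁻¹) = AlgHom.id k _ := by
    rw [subst_mul, H, ← subst_mul, mul_inv_cancel, subst_one]
  have := mk_eq_one_of_subst_eq this
  rwa [map_mul, map_inv, mul_inv_eq_one] at this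

/-- The subgroup of `PGL₂(k)` that fixes the rational function `z`. -/
def invariance (z : RatFunc k) : Subgroup (PGL2 k) where
  carrier := {g | ∀ h : GL (Fin 2) k, ProjGenLinGroup.mk h = g → subst h z = z}
  one_mem' h hh := by
    rw [subst_eq_of_mk_eq (hh.trans (map_one ProjGenLinGroup.mk).symm), subst_one]; rfl
  mul_mem' := by
    intro a b ha hb h hh
    obtain ⟨a, rfl⟩ := ProjGenLinGroup.mk_surjective a
    obtain ⟨b, rfl⟩ := ProjGenLinGroup.mk_surjective b
    rw [← map_mul] at hh
    rw [subst_eq_of_mk_eq hh, ← subst_subst, ha a rfl, hb b rfl]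
  inv_mem' := by
    intro a ha h hh
    obtain ⟨a, rfl⟩ := ProjGenLinGroup.mk_surjective a
    rw [← map_inv] at hh
    rw [subst_eq_of_mk_eq hh]
    conv_lhs => rw [← ha a rfl]
    rw [subst_subst, mul_inv_cancel, subst_one]; rfl

theorem mk_mem_invariance {z : RatFunc k} {h : GL (Fin 2) k} :
    ProjGenLinGroup.mk h ∈ invariance z ↔ subst h z = z :=
  ⟨fun H => H h rfl, fun H h' hh => by rw [subst_eq_of_mk_eq hh, H]⟩

theorem mem_fixedField_iff {G : Subgroup (PGL2 k)} {z : RatFunc k} :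
    z ∈ fixedField G ↔ G ≤ invariance z :=
  ⟨fun H _ hg h hh => H h (hh ▸ hg), fun H h hh => H hh h rfl⟩

/-- The automorphism of `k(x)` defined by a matrix, over a field that it fixes. -/
def substEquiv (L : IntermediateField k (RatFunc k)) (g : GL (Fin 2) k)
    (hg : ∀ f ∈ L, subst g f = f) : RatFunc k ≃ₐ[L] RatFunc k where
  toFun := subst g
  invFun := subst g⁻¹
  left_inv f := by rw [subst_subst, mul_inv_cancel, subst_one]; rfl
  right_inv f := by rw [subst_subst, inv_mul_cancel, subst_one]; rfl
  map_mul' := map_mul _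
  map_add' := map_add _
  commutes' f := hg _ f.2

/-- One half of Artin's theorem: distinct elements of G give distinct automorphisms over the fixed
field, and a finite extension has no more automorphisms than its degree. The other inequality comes
from an explicit invariant. -/
theorem card_le_finrank (G : Subgroup (PGL2 k)) [Finite G]
    [FiniteDimensional (fixedField G) (RatFunc k)] :
    Nat.card G ≤ Module.finrank (fixedField G) (RatFunc k) := by
  refine le_trans ?_ (AlgEquiv.card_le (F := fixedField G) (K := RatFunc k))
  rw [← Nat.card_eq_fintype_card]
  choose rep hrep using ProjGenLinGroup.mk_surjective (n := Fin 2) (R := k)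
  refine Nat.card_le_card_of_injective
    (fun g : G => substEquiv (fixedField G) (rep g) fun f hf => hf _ (by rw [hrep]; exact g.2)) ?_
  intro g h hgh
  apply Subtype.ext
  rw [← hrep g, ← hrep h]
  apply mk_eq_of_subst_eq
  ext f
  exact congrArg (fun φ : RatFunc k ≃ₐ[fixedField G] RatFunc k => φ f) hgh

theorem finiteDimensional_adjoin {z : RatFunc k} (hz : ¬ ∃ c, z = RatFunc.C c) :
    FiniteDimensional k⟮z⟯ (RatFunc k) := by
  apply Module.finite_of_finrank_pos
  rw [RatFunc.finrank_eq_max_natDegree]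
  rw [RatFunc.eq_C_iff] at hz
  omega

theorem finiteDimensional_of_adjoin_le {z : RatFunc k} (hz : ¬ ∃ c, z = RatFunc.C c)
    {L : IntermediateField k (RatFunc k)} (h : k⟮z⟯ ≤ L) : FiniteDimensional L (RatFunc k) := by
  have := finiteDimensional_adjoin hz
  let := (IntermediateField.inclusion h).toAlgebra
  have : IsScalarTower k⟮z⟯ L (RatFunc k) := IsScalarTower.of_algebraMap_eq fun x => rfl
  exact FiniteDimensional.right k⟮z⟯ L (RatFunc k)

/-- An invariant function of degree at most `|G|` generates the fixed field. -/
theorem fixedField_eq_adjoin {G : Subgroup (PGL2 k)} [Finite G] {z : RatFunc k}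
    (hG : G ≤ invariance z) (hz : ¬ ∃ c, z = RatFunc.C c)
    (h1 : z.num.natDegree ≤ Nat.card G) (h2 : z.denom.natDegree ≤ Nat.card G) :
    fixedField G = k⟮z⟯ := by
  have hle : k⟮z⟯ ≤ fixedField G :=
    IntermediateField.adjoin_simple_le_iff.2 (mem_fixedField_iff.2 hG)
  have := finiteDimensional_adjoin hz
  have := finiteDimensional_of_adjoin_le hz hle
  -- Over k(z) the degree of k(x) is the larger of the degrees of numerator and denominator, hence
  -- at most |G|, hence at most the degree over the fixed field; so the inclusion of fields is an
  -- equality.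
  refine (IntermediateField.eq_of_le_of_finrank_le' hle ?_).symm
  rw [RatFunc.finrank_eq_max_natDegree]
  exact (max_le h1 h2).trans (card_le_finrank G)

/-- The conjugate `γ G γ⁻¹`. -/
def conjSubgroup (γ : PGL2 k) (G : Subgroup (PGL2 k)) : Subgroup (PGL2 k) :=
  G.map (MulAut.conj γ).toMonoidHom

theorem mem_conjSubgroup {γ g : PGL2 k} {G : Subgroup (PGL2 k)} :
    g ∈ conjSubgroup γ G ↔ γ⁻¹ * g * γ ∈ G := by
  rw [conjSubgroup, Subgroup.mem_map]
  constructor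
  · rintro ⟨h, hh, rfl⟩
    simpa [mul_assoc] using hh
  · intro h
    exact ⟨_, h, by simp [mul_assoc]⟩

theorem conj_mem_conjSubgroup {γ g : PGL2 k} {G : Subgroup (PGL2 k)} (hg : g ∈ G) :
    γ * g * γ⁻¹ ∈ conjSubgroup γ G := ⟨g, hg, rfl⟩

/-- Conjugate subgroups are isomorphic. -/
def conjSubgroupEquiv (γ : PGL2 k) (G : Subgroup (PGL2 k)) : G ≃* conjSubgroup γ G :=
  G.equivMapOfInjective _ (MulAut.conj γ).injective

instance (γ : PGL2 k) (G : Subgroup (PGL2 k)) [Finite G] : Finite (conjSubgroup γ G) :=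
  Finite.of_equiv _ (conjSubgroupEquiv γ G).toEquiv

theorem card_conjSubgroup (γ : PGL2 k) (G : Subgroup (PGL2 k)) :
    Nat.card (conjSubgroup γ G) = Nat.card G :=
  (Nat.card_congr (conjSubgroupEquiv γ G).toEquiv).symm

/-- A change of coordinate conjugates the group. This allows G to be put in standard position before
an invariant is written down, the invariant being pulled back along γ. -/
theorem fixedField_eq_map_conj (γ : GL (Fin 2) k) (G : Subgroup (PGL2 k)) :
    fixedField G = (fixedField (conjSubgroup (ProjGenLinGroup.mk γ) G)).map (subst γ) := by
  ext f
  rw [IntermediateField.mem_map]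
  constructor
  · intro hf
    refine ⟨subst γ⁻¹ f, fun g hg => ?_, by rw [subst_subst, inv_mul_cancel, subst_one]; rfl⟩
    rw [mem_conjSubgroup, ← map_inv, ← map_mul, ← map_mul] at hg
    have := hf _ hg
    conv_rhs => rw [← this]
    rw [subst_subst, subst_subst]
    congr 2
    group
  · rintro ⟨f, hf, rfl⟩ g hg
    have := hf (γ * g * γ⁻¹) (by
      rw [map_mul, map_mul, map_inv]; exact conj_mem_conjSubgroup hg)
    conv_rhs => rw [← this]
    rw [subst_subst, subst_subst]
    congr 2
    group

theorem fixedField_eq_adjoin_subst {G : Subgroup (PGL2 k)} [Finite G] {z : RatFunc k}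
    (γ : GL (Fin 2) k) (hG : conjSubgroup (ProjGenLinGroup.mk γ) G ≤ invariance z)
    (hz : ¬ ∃ c, z = RatFunc.C c)
    (h1 : z.num.natDegree ≤ Nat.card G) (h2 : z.denom.natDegree ≤ Nat.card G) :
    fixedField G = k⟮subst γ z⟯ := by
  rw [← card_conjSubgroup (ProjGenLinGroup.mk γ) G] at h1 h2
  rw [fixedField_eq_map_conj γ G, fixedField_eq_adjoin hG hz h1 h2,
    IntermediateField.adjoin_map]
  simp

theorem natDegree_num_div_le {p q : Polynomial k} (hp : p ≠ 0) (hq : q ≠ 0) :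
    (algebraMap _ (RatFunc k) p / algebraMap _ _ q).num.natDegree ≤ p.natDegree :=
  Polynomial.natDegree_le_of_dvd (RatFunc.num_div_dvd p hq) hp

theorem natDegree_denom_div_le {p q : Polynomial k} (hq : q ≠ 0) :
    (algebraMap _ (RatFunc k) p / algebraMap _ _ q).denom.natDegree ≤ q.natDegree :=
  Polynomial.natDegree_le_of_dvd (RatFunc.denom_div_dvd p q) hq

/-- Coprimality of p and q is not needed, since cancellation only lowers the degrees. The strict
inequality for q excludes constants: p = cq would have degree below |G|. -/
theorem fixedField_eq_adjoin_div {G : Subgroup (PGL2 k)} [Finite G] {p q : Polynomial k}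
    {z : RatFunc k} (hz : z = algebraMap _ (RatFunc k) p / algebraMap _ _ q)
    (γ : GL (Fin 2) k) (hG : conjSubgroup (ProjGenLinGroup.mk γ) G ≤ invariance z)
    (hp : p.natDegree = Nat.card G) (hq : q.natDegree < Nat.card G) (hq0 : q ≠ 0) :
    fixedField G = k⟮subst γ z⟯ := by
  have hp0 : p ≠ 0 := by
    rintro rfl
    rw [Polynomial.natDegree_zero] at hp
    exact (Nat.card_pos (α := G)).ne hp
  refine fixedField_eq_adjoin_subst γ hG ?_ ?_ ?_
  · rintro ⟨c, hc⟩
    rw [hz, div_eq_iff (by simpa using hq0), ← RatFunc.algebraMap_C, ← map_mul] at hc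
    have := RatFunc.algebraMap_injective k hc
    have h2 := Polynomial.natDegree_C_mul_le c q
    rw [← this] at h2
    omega
  · rw [hz, ← hp]; exact natDegree_num_div_le hp0 hq0
  · rw [hz]; exact (natDegree_denom_div_le hq0).trans hq.le

end

/-! ### Orders of rational functions at points of the line -/

section

open Matrix OnePoint

variable {k : Type*} [Field k]

theorem ordAt_infty (f : RatFunc k) : ordAt ∞ f = -f.intDegree := rfl

theorem ordAt_coe (a : k) (f : RatFunc k) : ordAt (a : OnePoint k) f =
    (f.num.rootMultiplicity a : ℤ) - (f.denom.rootMultiplicity a : ℤ) := rfl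

/-- The reduced fraction of fg may involve cancellation, so root multiplicities are compared in the
polynomial identity `RatFunc.num_denom_mul`, which holds without it. -/
theorem ordAt_mul (P : OnePoint k) {f g : RatFunc k} (hf : f ≠ 0) (hg : g ≠ 0) :
    ordAt P (f * g) = ordAt P f + ordAt P g := by
  cases P with
  | infty => simp only [ordAt_infty, RatFunc.intDegree_mul hf hg]; ring
  | coe a =>
    have h := congrArg (Polynomial.rootMultiplicity a) (RatFunc.num_denom_mul f g)
    have hfg := mul_ne_zero hf hg
    have n1 := RatFunc.num_ne_zero hf
    have n2 := RatFunc.num_ne_zero hg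
    have n3 := RatFunc.num_ne_zero hfg
    have d1 := RatFunc.denom_ne_zero f
    have d2 := RatFunc.denom_ne_zero g
    have d3 := RatFunc.denom_ne_zero (f * g)
    rw [Polynomial.rootMultiplicity_mul (mul_ne_zero n3 (mul_ne_zero d1 d2)),
      Polynomial.rootMultiplicity_mul (mul_ne_zero d1 d2),
      Polynomial.rootMultiplicity_mul (mul_ne_zero (mul_ne_zero n1 n2) d3),
      Polynomial.rootMultiplicity_mul (mul_ne_zero n1 n2)] at h
    simp only [ordAt_coe]
    omega

@[simp] theorem ordAt_C (P : OnePoint k) (c : k) : ordAt P (RatFunc.C c) = 0 := by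
  cases P with
  | infty => simp [ordAt_infty]
  | coe a => simp [ordAt_coe]

theorem ordAt_one (P : OnePoint k) : ordAt P (1 : RatFunc k) = 0 := by
  rw [← map_one RatFunc.C, ordAt_C]

theorem ordAt_div (P : OnePoint k) {f g : RatFunc k} (hf : f ≠ 0) (hg : g ≠ 0) :
    ordAt P (f / g) = ordAt P f - ordAt P g := by
  have := ordAt_mul P (div_ne_zero hf hg) hg
  rw [div_mul_cancel₀ _ hg] at this
  omega

theorem ordAt_inv (P : OnePoint k) {f : RatFunc k} (hf : f ≠ 0) : ordAt P f⁻¹ = -ordAt P f := by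
  rw [← one_div, ordAt_div P one_ne_zero hf, ordAt_one, zero_sub]

theorem ordAt_finset_prod {ι : Type*} (s : Finset ι) (P : OnePoint k) (f : ι → RatFunc k)
    (hf : ∀ i ∈ s, f i ≠ 0) : ordAt P (∏ i ∈ s, f i) = ∑ i ∈ s, ordAt P (f i) := by
  induction s using Finset.cons_induction with
  | empty => simp [ordAt_one]
  | cons i s hi ih =>
    simp only [Finset.mem_cons, forall_eq_or_imp] at hf
    rw [Finset.prod_cons, Finset.sum_cons, ordAt_mul P hf.1 (Finset.prod_ne_zero_iff.2 hf.2),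
      ih hf.2]

theorem ordAt_coe_algebraMap (a : k) (p : Polynomial k) :
    ordAt (a : OnePoint k) (algebraMap _ (RatFunc k) p) = p.rootMultiplicity a := by
  simp [ordAt_coe]

theorem ordAt_infty_algebraMap (p : Polynomial k) :
    ordAt (∞ : OnePoint k) (algebraMap _ (RatFunc k) p) = -p.natDegree := by
  simp [ordAt_infty]

/-- The zero on the projective line of the linear form `u x + v`. -/
def linearZero (u v : k) : OnePoint k :=
  open Classical in if u = 0 then ∞ else ((-v / u : k) : OnePoint k)

open Classical in
theorem ordAt_linear (P : OnePoint k) {u v : k} (h : u ≠ 0 ∨ v ≠ 0) :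
    ordAt P (RatFunc.C u * RatFunc.X + RatFunc.C v) =
      (if P = linearZero u v then 1 else 0) - (if P = ∞ then 1 else 0) := by
  have hp : RatFunc.C u * RatFunc.X + RatFunc.C v =
      algebraMap _ (RatFunc k) (Polynomial.C u * Polynomial.X + Polynomial.C v) := by simp
  rw [hp]
  by_cases hu : u = 0
  · subst hu
    simp [linearZero]
  · cases P with
    | infty =>
      rw [ordAt_infty_algebraMap, Polynomial.natDegree_linear hu]
      simp [linearZero, hu]
    | coe a =>
      have : Polynomial.C u * Polynomial.X + Polynomial.C v =
          Polynomial.C u * (Polynomial.X - Polynomial.C (-v / u)) := by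
        rw [mul_sub, ← Polynomial.C_mul, mul_div_cancel₀ _ hu]
        simp
      rw [ordAt_coe_algebraMap, this, Polynomial.rootMultiplicity_mul
        (mul_ne_zero (by simpa using hu) (Polynomial.X_sub_C_ne_zero _)),
        Polynomial.rootMultiplicity_C, Polynomial.rootMultiplicity_X_sub_C]
      simp [linearZero, hu]

theorem X_sub_C_eq (a : k) :
    RatFunc.X - RatFunc.C a = RatFunc.C 1 * RatFunc.X + RatFunc.C (-a) := by simp [sub_eq_add_neg]

theorem X_sub_C_ne_zero' (a : k) : (RatFunc.X - RatFunc.C a : RatFunc k) ≠ 0 := by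
  rw [X_sub_C_eq]; exact linear_ne_zero (Or.inl one_ne_zero)

open Classical in
theorem ordAt_X_sub_C (P : OnePoint k) (a : k) :
    ordAt P (RatFunc.X - RatFunc.C a) =
      (if P = (a : OnePoint k) then 1 else 0) - (if P = ∞ then 1 else 0) := by
  rw [X_sub_C_eq, ordAt_linear P (Or.inl one_ne_zero)]
  simp [linearZero]

/-- The condition γ(P) = a is the vanishing of the numerator of γ(x) - a, stated so that it also
covers P = ∞. With its analogue for ∞ it locates the zero and the pole of a pulled back linear
factor. -/
theorem mk_smul_eq_coe_iff (γ : GL (Fin 2) k) (P : OnePoint k) (a : k) :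
    ProjGenLinGroup.mk γ • P = (a : OnePoint k) ↔
      P = linearZero (γ.1 0 0 - a * γ.1 1 0) (γ.1 0 1 - a * γ.1 1 1) := by
  have hdet := det_ne_zero' γ
  classical
  cases P with
  | infty =>
    rw [mk_smul_infty, linearZero]
    by_cases hc : γ.1 1 0 = 0
    · have h00 : γ.1 0 0 ≠ 0 := fun h => hdet (by simp [hc, h])
      simp [hc, h00]
    · simp [hc, div_eq_iff, sub_eq_zero]
  | coe b =>
    rw [mk_smul_coe, linearZero]
    by_cases hc : γ.1 0 0 - a * γ.1 1 0 = 0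
    · have h10 : γ.1 1 0 ≠ 0 := fun h => hdet (by
        have : γ.1 0 0 = 0 := by simpa [h] using hc
        simp [h, this])
      simp only [hc, if_true, OnePoint.coe_ne_infty, iff_false]
      split_ifs with h
      · simp
      · rw [OnePoint.coe_eq_coe, div_eq_iff h]
        intro H
        apply hdet
        linear_combination γ.1 1 1 * hc - γ.1 1 0 * (H - b * hc)
    · rw [if_neg hc]
      split_ifs with h
      · simp only [OnePoint.infty_ne_coe, OnePoint.coe_eq_coe, false_iff, eq_div_iff hc]
        intro H
        have h2 : γ.1 0 0 * b + γ.1 0 1 = 0 := by linear_combination H + a * h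
        by_cases h10 : γ.1 1 0 = 0
        · have h11 : γ.1 1 1 = 0 := by simpa [h10] using h
          exact hdet (by simp [h10, h11])
        · have : γ.1 1 0 * (γ.1 0 0 * γ.1 1 1 - γ.1 0 1 * γ.1 1 0) = 0 := by
            linear_combination γ.1 1 0 * γ.1 0 0 * h - γ.1 1 0 * γ.1 1 0 * h2
          exact hdet ((mul_eq_zero.1 this).resolve_left h10)
      · rw [OnePoint.coe_eq_coe, OnePoint.coe_eq_coe, div_eq_iff h, eq_div_iff hc]
        constructor <;> intro H <;> linear_combination H

theorem mk_smul_eq_infty_iff (γ : GL (Fin 2) k) (P : OnePoint k) :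
    ProjGenLinGroup.mk γ • P = ∞ ↔ P = linearZero (γ.1 1 0) (γ.1 1 1) := by
  have hdet := det_ne_zero' γ
  classical
  cases P with
  | infty =>
    rw [mk_smul_infty, linearZero]
    by_cases hc : γ.1 1 0 = 0 <;> simp [hc]
  | coe b =>
    rw [mk_smul_coe, linearZero]
    by_cases hc : γ.1 1 0 = 0
    · have h11 : γ.1 1 1 ≠ 0 := fun h => hdet (by simp [hc, h])
      simp [hc, h11]
    · rw [if_neg hc]
      simp only [OnePoint.coe_eq_coe, eq_div_iff hc, ite_eq_left_iff, OnePoint.coe_ne_infty,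
        imp_false, not_not]
      constructor <;> intro H <;> linear_combination H

theorem ordAt_subst_X_sub_C (P : OnePoint k) (γ : GL (Fin 2) k) (a : k) :
    ordAt P (subst γ (RatFunc.X - RatFunc.C a)) =
      ordAt (ProjGenLinGroup.mk γ • P) (RatFunc.X - RatFunc.C a) := by
  classical
  have hd : γ.1 1 0 ≠ 0 ∨ γ.1 1 1 ≠ 0 := by
    by_contra! h
    exact det_ne_zero' γ (by simp [h.1, h.2])
  have hn : γ.1 0 0 - a * γ.1 1 0 ≠ 0 ∨ γ.1 0 1 - a * γ.1 1 1 ≠ 0 := by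
    by_contra! h
    apply det_ne_zero' γ
    linear_combination γ.1 1 1 * h.1 - γ.1 1 0 * h.2
  have : subst γ (RatFunc.X - RatFunc.C a) =
      (RatFunc.C (γ.1 0 0 - a * γ.1 1 0) * RatFunc.X + RatFunc.C (γ.1 0 1 - a * γ.1 1 1)) /
      (RatFunc.C (γ.1 1 0) * RatFunc.X + RatFunc.C (γ.1 1 1)) := by
    rw [map_sub, subst_X, subst_C, moebius, eq_div_iff (linear_ne_zero hd), sub_mul,
      div_mul_cancel₀ _ (linear_ne_zero hd)]
    simp only [map_sub, map_mul]
    ring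
  rw [this, ordAt_div P (linear_ne_zero hn) (linear_ne_zero hd), ordAt_linear P hn,
    ordAt_linear P hd, ordAt_X_sub_C]
  simp only [mk_smul_eq_coe_iff, mk_smul_eq_infty_iff]
  ring

variable [IsAlgClosed k]

theorem algebraMap_eq_prod_roots (p : Polynomial k) :
    algebraMap _ (RatFunc k) p = RatFunc.C p.leadingCoeff *
      (p.roots.map fun a => (RatFunc.X - RatFunc.C a : RatFunc k)).prod := by
  conv_lhs => rw [(IsAlgClosed.splits p).eq_prod_roots]
  rw [map_mul, map_multiset_prod, Multiset.map_map, RatFunc.algebraMap_C]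
  congr 3
  ext a
  simp

theorem aeval_eq_prod_roots (f : RatFunc k) (p : Polynomial k) :
    Polynomial.aeval f p = RatFunc.C p.leadingCoeff *
      (p.roots.map fun a => (f - RatFunc.C a : RatFunc k)).prod := by
  conv_lhs => rw [(IsAlgClosed.splits p).eq_prod_roots]
  rw [map_mul, map_multiset_prod, Multiset.map_map, Polynomial.aeval_C]
  congr 3
  ext a
  simp

/-- Over an algebraically closed field a rational function is a constant times a quotient of
products of factors x - a, so the compatibility of orders with a change of coordinate reduces to a
single factor. -/
theorem ordAt_subst (P : OnePoint k) (γ : GL (Fin 2) k) {f : RatFunc k} (hf : f ≠ 0) :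
    ordAt P (subst γ f) = ordAt (ProjGenLinGroup.mk γ • P) f := by
  have key : ∀ s : Multiset k, (s.map fun a => (RatFunc.X - RatFunc.C a : RatFunc k)).prod ≠ 0 ∧
      ordAt P (subst γ (s.map fun a => (RatFunc.X - RatFunc.C a : RatFunc k)).prod) =
      ordAt (ProjGenLinGroup.mk γ • P) (s.map fun a => (RatFunc.X - RatFunc.C a : RatFunc k)).prod
          := by
    intro s
    induction s using Multiset.induction with
    | empty => simp [ordAt_one]
    | cons a s ih =>
      rw [Multiset.map_cons, Multiset.prod_cons]
      refine ⟨mul_ne_zero (X_sub_C_ne_zero' a) ih.1, ?_⟩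
      rw [map_mul, ordAt_mul _ ((map_ne_zero _).2 (X_sub_C_ne_zero' a)) ((map_ne_zero _).2 ih.1),
        ordAt_mul _ (X_sub_C_ne_zero' a) ih.1, ih.2, ordAt_subst_X_sub_C]
  have hpoly : ∀ p : Polynomial k, p ≠ 0 → ordAt P (subst γ (algebraMap _ (RatFunc k) p)) =
      ordAt (ProjGenLinGroup.mk γ • P) (algebraMap _ (RatFunc k) p) := by
    intro p hp
    have hlc : (RatFunc.C p.leadingCoeff : RatFunc k) ≠ 0 :=
      (map_ne_zero _).2 (Polynomial.leadingCoeff_ne_zero.2 hp)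
    rw [algebraMap_eq_prod_roots, map_mul, subst_C, ordAt_mul _ hlc ((map_ne_zero _).2 (key _).1),
      ordAt_mul _ hlc (key _).1, (key _).2, ordAt_C, ordAt_C]
  have h1 : algebraMap _ (RatFunc k) f.num ≠ 0 :=
    RatFunc.algebraMap_ne_zero (RatFunc.num_ne_zero hf)
  have h2 : algebraMap _ (RatFunc k) f.denom ≠ 0 :=
    RatFunc.algebraMap_ne_zero (RatFunc.denom_ne_zero f)
  rw [← RatFunc.num_div_denom f, map_div₀, ordAt_div _ ((map_ne_zero _).2 h1)
    ((map_ne_zero _).2 h2), ordAt_div _ h1 h2, hpoly _ (RatFunc.num_ne_zero hf),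
    hpoly _ (RatFunc.denom_ne_zero f)]

omit [IsAlgClosed k] in
theorem ordAt_coe_pos_iff {a : k} {f : RatFunc k} (hf : f ≠ 0) :
    0 < ordAt (a : OnePoint k) f ↔ f.num.eval a = 0 := by
  have hcop := RatFunc.isCoprime_num_denom f
  have hN := Polynomial.rootMultiplicity_pos (RatFunc.num_ne_zero hf) (x := a)
  have hD := Polynomial.rootMultiplicity_pos (RatFunc.denom_ne_zero f) (x := a)
  rw [Polynomial.IsRoot.def] at hN hD
  rw [ordAt_coe, ← hN]
  have : ¬ (f.num.eval a = 0 ∧ f.denom.eval a = 0) := by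
    rintro ⟨h1, h2⟩
    obtain ⟨u, v, huv⟩ := hcop
    have := congrArg (Polynomial.eval a) huv
    simp [h1, h2] at this
  rw [← hN, ← hD] at this
  omega

omit [IsAlgClosed k] in
theorem denom_eval_ne_zero {a : k} {f : RatFunc k} (h : f.num.eval a = 0) :
    f.denom.eval a ≠ 0 := fun h2 => by
  obtain ⟨u, v, huv⟩ := RatFunc.isCoprime_num_denom f
  have := congrArg (Polynomial.eval a) huv
  simp [h, h2] at this

omit [IsAlgClosed k] in
theorem ordAt_coe_of_pos {a : k} {f : RatFunc k} (h : f.num.eval a = 0) :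
    ordAt (a : OnePoint k) f = f.num.rootMultiplicity a := by
  rw [ordAt_coe, Polynomial.rootMultiplicity_eq_zero (denom_eval_ne_zero h)]
  simp

omit [IsAlgClosed k] in
theorem sub_C_eq_div (f : RatFunc k) (c : k) :
    f - RatFunc.C c = algebraMap _ (RatFunc k) (f.num - Polynomial.C c * f.denom) /
      algebraMap _ (RatFunc k) f.denom := by
  have h2 : algebraMap _ (RatFunc k) f.denom ≠ 0 :=
    RatFunc.algebraMap_ne_zero (RatFunc.denom_ne_zero f)
  rw [map_sub, sub_div, RatFunc.num_div_denom, map_mul, mul_div_cancel_right₀ _ h2,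
    RatFunc.algebraMap_C]

omit [IsAlgClosed k] in
theorem ordAt_coe_sub_C {a c : k} {f : RatFunc k} (h : f ≠ RatFunc.C c) :
    ordAt (a : OnePoint k) (f - RatFunc.C c) =
      ((f.num - Polynomial.C c * f.denom).rootMultiplicity a : ℤ) - f.denom.rootMultiplicity a := by
  have h2 := RatFunc.denom_ne_zero f
  have h1 : f.num - Polynomial.C c * f.denom ≠ 0 := fun h0 => h (by
    rw [← sub_eq_zero, sub_C_eq_div, h0, map_zero, zero_div])
  rw [sub_C_eq_div, ordAt_div _ (RatFunc.algebraMap_ne_zero h1) (RatFunc.algebraMap_ne_zero h2),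
    ordAt_coe_algebraMap, ordAt_coe_algebraMap]

/-- Any point, including ∞, is moved to 0, where orders can be read off by evaluating polynomials.
-/
theorem exists_ordAt_eq_ordAt_zero (P : OnePoint k) : ∃ γ : GL (Fin 2) k, ∀ f : RatFunc k, f ≠ 0 →
    ordAt P f = ordAt ((0 : k) : OnePoint k) (subst γ f) := by
  obtain ⟨γ, hγ⟩ : ∃ γ : PGL2 k, γ • ((0 : k) : OnePoint k) = P := by
    obtain ⟨γ, hγ⟩ := exists_smul_eq_infty P
    exact ⟨γ⁻¹ * inver 1, by simp [mul_smul, inv_smul_eq_iff, hγ]⟩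
  obtain ⟨γ, rfl⟩ := ProjGenLinGroup.mk_surjective γ
  exact ⟨γ, fun f hf => by rw [ordAt_subst _ _ hf, hγ]⟩

theorem ordAt_sub_C_of_pos {P : OnePoint k} {f : RatFunc k} (hf : f ≠ 0) (h : 0 < ordAt P f)
    {c : k} (hc : c ≠ 0) : ordAt P (f - RatFunc.C c) = 0 := by
  have hne : ∀ f : RatFunc k, f ≠ 0 → ∀ P, 0 < ordAt P f → f ≠ RatFunc.C c := by
    rintro _ _ P h rfl
    simp at h
  obtain ⟨γ, hγ⟩ := exists_ordAt_eq_ordAt_zero P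
  rw [hγ f hf] at h
  have hf' : subst γ f ≠ 0 := (map_ne_zero _).2 hf
  rw [hγ _ (sub_ne_zero.2 fun h0 => hne _ hf' _ h (by rw [h0, subst_C])), map_sub, subst_C,
    ordAt_coe_sub_C (hne _ hf' _ h)]
  rw [ordAt_coe_pos_iff hf'] at h
  have h2 := denom_eval_ne_zero h
  rw [Polynomial.rootMultiplicity_eq_zero (p := (subst γ f).denom) h2,
    Polynomial.rootMultiplicity_eq_zero]
  · simp
  · simp [h, hc, h2]

theorem ordAt_sub_C_of_neg {P : OnePoint k} {f : RatFunc k} (hf : f ≠ 0) (h : ordAt P f < 0)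
    (c : k) : ordAt P (f - RatFunc.C c) < 0 := by
  by_contra! hc
  by_cases hc0 : c = 0
  · simp only [hc0, map_zero, sub_zero] at hc
    omega
  have hf' : f⁻¹ ≠ 0 := inv_ne_zero hf
  have hpos : 0 < ordAt P f⁻¹ := by rw [ordAt_inv _ hf]; omega
  have h1 := ordAt_sub_C_of_pos hf' hpos (inv_ne_zero hc0)
  have hC : (RatFunc.C c : RatFunc k) ≠ 0 := (map_ne_zero _).2 hc0
  have hne : f - RatFunc.C c ≠ 0 := fun h0 => by
    rw [sub_eq_zero.1 h0] at h
    simp at h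
  -- Since 1/f vanishes at P, the left side has order 0 there; if f - c had no pole at P, the right
  -- side would have positive order.
  have h2 : f⁻¹ - RatFunc.C c⁻¹ = RatFunc.C (-c⁻¹) * ((f - RatFunc.C c) / f) := by
    rw [map_neg, map_inv₀]
    field_simp
    ring
  rw [h2, ordAt_mul _ (by simpa using hc0) (div_ne_zero hne hf), ordAt_C, ordAt_div _ hne hf] at h1
  omega

theorem exists_ordAt_sub_C_pos {P : OnePoint k} {f : RatFunc k} (hf : ¬ ∃ c, f = RatFunc.C c)
    (h : 0 ≤ ordAt P f) : ∃ c, 0 < ordAt P (f - RatFunc.C c) := by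
  have hf0 : f ≠ 0 := fun h0 => hf ⟨0, by simp [h0]⟩
  obtain ⟨γ, hγ⟩ := exists_ordAt_eq_ordAt_zero P
  have hf' : ¬ ∃ c, subst γ f = RatFunc.C c := by
    rintro ⟨c, hc⟩
    exact hf ⟨c, (subst γ).injective (hc.trans (subst_C γ c).symm)⟩
  rw [hγ f hf0] at h
  have hD : (subst γ f).denom.eval 0 ≠ 0 := by
    intro h0
    have := (Polynomial.rootMultiplicity_pos (RatFunc.denom_ne_zero (subst γ f)) (x := 0)).2 h0
    have hN : (subst γ f).num.eval 0 ≠ 0 := fun h1 => denom_eval_ne_zero h1 h0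
    rw [ordAt_coe, Polynomial.rootMultiplicity_eq_zero hN] at h
    omega
  -- The constant is the value of f at P, computed after P has been moved to 0.
  refine ⟨(subst γ f).num.eval 0 / (subst γ f).denom.eval 0, ?_⟩
  set c := (subst γ f).num.eval 0 / (subst γ f).denom.eval 0 with hc
  rw [hγ _ (sub_ne_zero.2 fun h0 => hf ⟨c, h0⟩), map_sub, subst_C,
    ordAt_coe_sub_C fun h0 => hf' ⟨c, h0⟩, Polynomial.rootMultiplicity_eq_zero
        (p := RatFunc.denom _) hD]
  have := (Polynomial.rootMultiplicity_pos (p := (subst γ f).num - Polynomial.C c *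
      (subst γ f).denom)
    (x := 0) (fun h0 => hf' ⟨c, by rw [← sub_eq_zero, sub_C_eq_div, h0, map_zero, zero_div]⟩)).2
    (by simp [hc, hD])
  simpa using this

/-- Every point lies above exactly one point of the target. -/
theorem exists_ordAt_pullParam_pos {w : RatFunc k} (hw : ¬ ∃ c, w = RatFunc.C c) (P : OnePoint k) :
    ∃ Q, 0 < ordAt P (pullParam w Q) := by
  have hw0 : w ≠ 0 := fun h0 => hw ⟨0, by simp [h0]⟩
  rcases lt_or_ge (ordAt P w) 0 with h | h
  · refine ⟨∞, ?_⟩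
    change 0 < ordAt P w⁻¹
    rw [ordAt_inv _ hw0]; omega
  · obtain ⟨c, hc⟩ := exists_ordAt_sub_C_pos hw h
    exact ⟨c, hc⟩

theorem pullParam_unique {w : RatFunc k} (hw : ¬ ∃ c, w = RatFunc.C c) {P Q R : OnePoint k}
    (hQ : 0 < ordAt P (pullParam w Q)) (hR : 0 < ordAt P (pullParam w R)) : Q = R := by
  have hw0 : w ≠ 0 := fun h0 => hw ⟨0, by simp [h0]⟩
  have hinf : ∀ c : k, 0 < ordAt P w⁻¹ → ¬ 0 < ordAt P (w - RatFunc.C c) := by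
    intro c h1
    rw [ordAt_inv _ hw0] at h1
    have := ordAt_sub_C_of_neg hw0 (P := P) (by omega) c
    omega
  cases Q with
  | infty =>
    cases R with
    | infty => rfl
    | coe c => exact absurd hR (hinf c hQ)
  | coe c =>
    cases R with
    | infty => exact absurd hQ (hinf c hR)
    | coe d =>
      by_contra hcd
      have hcd : d - c ≠ 0 := fun h0 => hcd (by rw [sub_eq_zero.1 h0])
      change 0 < ordAt P (w - RatFunc.C c) at hQ
      change 0 < ordAt P (w - RatFunc.C d) at hR
      have := ordAt_sub_C_of_pos (sub_ne_zero.2 fun h0 => hw ⟨c, h0⟩) hQ hcd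
      rw [map_sub, sub_sub_sub_cancel_right] at this
      omega

end

/-! ### Ramification read off from orbits and stabilizers -/

section

open Matrix OnePoint MulAction

variable {k : Type*} [Field k]

/-- The action of an element of `PGL₂(k)` on `k(x)`. -/
def psubst (g : PGL2 k) : RatFunc k →ₐ[k] RatFunc k :=
  subst (ProjGenLinGroup.mk_surjective g).choose

theorem psubst_mk (g : GL (Fin 2) k) : psubst (ProjGenLinGroup.mk g) = subst g :=
  subst_eq_of_mk_eq (ProjGenLinGroup.mk_surjective (ProjGenLinGroup.mk g)).choose_spec

theorem psubst_psubst (g h : PGL2 k) (f : RatFunc k) :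
    psubst g (psubst h f) = psubst (h * g) f := by
  obtain ⟨g, rfl⟩ := ProjGenLinGroup.mk_surjective g
  obtain ⟨h, rfl⟩ := ProjGenLinGroup.mk_surjective h
  rw [← map_mul, psubst_mk, psubst_mk, psubst_mk, subst_subst]

variable [IsAlgClosed k]

theorem ordAt_psubst (P : OnePoint k) (g : PGL2 k) {f : RatFunc k} (hf : f ≠ 0) :
    ordAt P (psubst g f) = ordAt (g • P) f := by
  obtain ⟨g, rfl⟩ := ProjGenLinGroup.mk_surjective g
  rw [psubst_mk, ordAt_subst P g hf]

/-- An element of k(f) is a constant times a product of powers of factors f - a. At a zero of f only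
the factor with a = 0 has nonzero order, so K is the exponent of f itself and is the same at all
zeros of f. -/
theorem exists_ordAt_of_mem_adjoin {f h : RatFunc k} (hf : ¬ ∃ c, f = RatFunc.C c)
    (hh : h ∈ k⟮f⟯) (hh0 : h ≠ 0) :
    ∃ K : ℤ, ∀ P, 0 < ordAt P f → ordAt P h = K * ordAt P f := by
  have hf0 : f ≠ 0 := fun h0 => hf ⟨0, by simp [h0]⟩
  have hsub : ∀ a, f - RatFunc.C a ≠ 0 := fun a h0 => hf ⟨a, sub_eq_zero.1 h0⟩
  have key : ∀ s : Multiset k, (s.map fun a => (f - RatFunc.C a : RatFunc k)).prod ≠ 0 ∧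
      ∃ K : ℤ, ∀ P, 0 < ordAt P f →
        ordAt P (s.map fun a => (f - RatFunc.C a : RatFunc k)).prod = K * ordAt P f := by
    intro s
    induction s using Multiset.induction with
    | empty => exact ⟨by simp, 0, by simp [ordAt_one]⟩
    | cons a s ih =>
      obtain ⟨h1, K, hK⟩ := ih
      simp only [Multiset.map_cons, Multiset.prod_cons]
      refine ⟨mul_ne_zero (hsub a) h1, ?_⟩
      by_cases ha : a = 0
      · refine ⟨K + 1, fun P hP => ?_⟩
        rw [ordAt_mul P (hsub a) h1, hK P hP, ha]
        simp
        ring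
      · refine ⟨K, fun P hP => ?_⟩
        rw [ordAt_mul P (hsub a) h1, hK P hP, ordAt_sub_C_of_pos hf0 hP ha, zero_add]
  have hpoly : ∀ p : Polynomial k, p ≠ 0 → Polynomial.aeval f p ≠ 0 ∧
      ∃ K : ℤ, ∀ P, 0 < ordAt P f → ordAt P (Polynomial.aeval f p) = K * ordAt P f := by
    intro p hp
    have hlc : (RatFunc.C p.leadingCoeff : RatFunc k) ≠ 0 :=
      (map_ne_zero _).2 (Polynomial.leadingCoeff_ne_zero.2 hp)
    obtain ⟨h1, K, hK⟩ := key p.roots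
    rw [aeval_eq_prod_roots]
    refine ⟨mul_ne_zero hlc h1, K, fun P hP => ?_⟩
    rw [ordAt_mul P hlc h1, hK P hP, ordAt_C, zero_add]
  obtain ⟨A, B, rfl⟩ := (IntermediateField.mem_adjoin_simple_iff k h).1 hh
  have hA : A ≠ 0 := by rintro rfl; simp at hh0
  have hB : B ≠ 0 := by rintro rfl; simp at hh0
  obtain ⟨a0, K, hK⟩ := hpoly A hA
  obtain ⟨b0, L, hL⟩ := hpoly B hB
  refine ⟨K - L, fun P hP => ?_⟩
  rw [ordAt_div P a0 b0, hK P hP, hL P hP]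
  ring

open Classical in
/-- A `G`-invariant function with zeros exactly at the orbit of `P₀` and poles exactly at the orbit
of `R`. -/
theorem exists_invariant_function (G : Subgroup (PGL2 k)) [Finite G] {P₀ R : OnePoint k}
    (hR : R ≠ P₀) : ∃ h ∈ fixedField G, h ≠ 0 ∧ ∀ P : OnePoint k, ordAt P h =
      (Nat.card {g : G // g • P = P₀} : ℤ) - Nat.card {g : G // g • P = R} := by
  obtain ⟨γ, hγR, hγP⟩ := exists_smul_pair hR
  have := Fintype.ofFinite G
  -- The function ℓ has a simple zero at P₀ and a simple pole at R; the invariant function is its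
  -- norm, the product of its translates under G.
  set ℓ : RatFunc k := psubst γ RatFunc.X with hℓ
  have hX0 : (RatFunc.X : RatFunc k) ≠ 0 := RatFunc.X_ne_zero
  have hℓ0 : ℓ ≠ 0 := (map_ne_zero _).2 hX0
  have ordX : ∀ P : OnePoint k, ordAt P (RatFunc.X : RatFunc k) =
      (if P = ((0 : k) : OnePoint k) then 1 else 0) - (if P = ∞ then 1 else 0) := fun P => by
    simpa using ordAt_X_sub_C P (0 : k)
  have ordℓ : ∀ P : OnePoint k, ordAt P ℓ =
      (if P = P₀ then 1 else 0) - (if P = R then 1 else 0) := fun P => by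
    rw [hℓ, ordAt_psubst P γ hX0, ordX, ← hγR, ← hγP]
    simp only [(MulAction.injective γ).eq_iff]
  refine ⟨∏ g : G, psubst (g : PGL2 k) ℓ, ?_, ?_, ?_⟩
  · intro g hg
    rw [map_prod, ← psubst_mk]
    simp only [psubst_psubst]
    exact Fintype.prod_equiv (Equiv.mulRight (⟨_, hg⟩ : G)) _ _ fun x => rfl
  · exact Finset.prod_ne_zero_iff.2 fun g _ => (map_ne_zero _).2 hℓ0
  · intro P
    rw [ordAt_finset_prod _ _ _ fun g _ => (map_ne_zero _).2 hℓ0]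
    simp only [ordAt_psubst P _ hℓ0, ordℓ, Finset.sum_sub_distrib, Finset.sum_boole]
    rw [Nat.card_eq_fintype_card, Nat.card_eq_fintype_card, Fintype.card_subtype,
      Fintype.card_subtype]
    rfl

omit [IsAlgClosed k] in
theorem card_smul_eq_self (G : Subgroup (PGL2 k)) (P : OnePoint k) :
    Nat.card {g : G // g • P = P} = Nat.card (stabilizer G P) := rfl

omit [IsAlgClosed k] in
theorem card_smul_eq_zero (G : Subgroup (PGL2 k)) {P Q : OnePoint k} (h : Q ∉ orbit G P) :
    Nat.card {g : G // g • P = Q} = 0 := by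
  have : IsEmpty {g : G // g • P = Q} := ⟨fun g => h ⟨g.1, g.2⟩⟩
  exact Nat.card_of_isEmpty

theorem exists_not_mem_finite {s : Set (OnePoint k)} (hs : s.Finite) : ∃ R, R ∉ s := by
  have : Infinite k := IsAlgClosed.instInfinite
  have : Infinite (OnePoint k) := Infinite.of_injective _ (OnePoint.coe_injective (X := k))
  exact hs.exists_notMem

omit [IsAlgClosed k] in
theorem finite_orbit (G : Subgroup (PGL2 k)) [Finite G] (P : OnePoint k) :
    (orbit G P).Finite := Set.finite_range _

/-- A constant f would make the fixed field equal to k, but there is an invariant function with a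
zero at ∞ and poles elsewhere. -/
theorem not_const_of_fixedField_eq {G : Subgroup (PGL2 k)} [Finite G] {f : RatFunc k}
    (hG : fixedField G = k⟮f⟯) : ¬ ∃ c, f = RatFunc.C c := by
  rintro ⟨c, rfl⟩
  obtain ⟨R, hR⟩ := exists_not_mem_finite (finite_orbit G (∞ : OnePoint k))
  obtain ⟨h, hh, h0, hord⟩ := exists_invariant_function G (P₀ := ∞) (R := R)
    (fun h => hR (h ▸ mem_orbit_self _))
  rw [hG, IntermediateField.adjoin_simple_eq_bot_iff.2 (show RatFunc.C c ∈ ⊥ from ⟨c, rfl⟩)] at hh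
  obtain ⟨d, rfl⟩ := hh
  have := hord ∞
  rw [card_smul_eq_zero G hR, card_smul_eq_self] at this
  have h2 : ordAt ∞ (algebraMap k (RatFunc k) d) = 0 := ordAt_C _ _
  have h3 : 0 < Nat.card (stabilizer G (∞ : OnePoint k)) := Nat.card_pos
  change ordAt ∞ (algebraMap k (RatFunc k) d) = _ at this
  omega

/-- If all zeros of `f` have the same order `m`, then `m` times their number is the degree. -/
theorem ordAt_mul_ncard {f : RatFunc k} (hf : ¬ ∃ c, f = RatFunc.C c) {O : Set (OnePoint k)}
    (hO : ∀ P, 0 < ordAt P f ↔ P ∈ O) {m : ℕ} (hm : ∀ P ∈ O, ordAt P f = m) :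
    m * O.ncard = max f.num.natDegree f.denom.natDegree := by
  classical
  have hf0 : f ≠ 0 := fun h0 => hf ⟨0, by simp [h0]⟩
  have hN := RatFunc.num_ne_zero hf0
  have hroots : ∀ a : k, a ∈ f.num.roots.toFinset ↔ (a : OnePoint k) ∈ O := fun a => by
    rw [Multiset.mem_toFinset, Polynomial.mem_roots hN, Polynomial.IsRoot.def, ← hO,
      ordAt_coe_pos_iff hf0]
  have hdeg : f.num.natDegree = m * f.num.roots.toFinset.card := by
    rw [(IsAlgClosed.splits f.num).natDegree_eq_card_roots,
      ← Multiset.toFinset_sum_count_eq, mul_comm, ← smul_eq_mul]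
    refine Finset.sum_eq_card_nsmul fun a ha => ?_
    have h1 := hm a ((hroots a).1 ha)
    rw [Multiset.mem_toFinset, Polynomial.mem_roots hN, Polynomial.IsRoot.def] at ha
    rw [ordAt_coe_of_pos ha] at h1
    rw [Polynomial.count_roots]
    exact_mod_cast h1
  have himg : ((f.num.roots.toFinset.image (fun a : k => (a : OnePoint k)) :
      Finset (OnePoint k)) : Set (OnePoint k)) = O \ {∞} := by
    ext P
    simp only [Finset.coe_image, Set.mem_image, Finset.mem_coe, hroots, Set.mem_sdiff,
      Set.mem_singleton_iff]
    constructor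
    · rintro ⟨a, ha, rfl⟩
      exact ⟨ha, OnePoint.coe_ne_infty a⟩
    · rintro ⟨hP, hne⟩
      obtain ⟨a, rfl⟩ := OnePoint.ne_infty_iff_exists.1 hne
      exact ⟨a, hP, rfl⟩
  have hcard : (O \ {∞}).ncard = f.num.roots.toFinset.card := by
    rw [← himg, Set.ncard_coe_finset, Finset.card_image_of_injective _ OnePoint.coe_injective]
  have hfin : (O \ {∞}).Finite := by rw [← himg]; exact Finset.finite_toSet _
  have hinf : ordAt ∞ f = f.denom.natDegree - f.num.natDegree := by
    rw [ordAt_infty, RatFunc.intDegree]; ring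
  -- The finite zeros account for the degree of the numerator; a zero at ∞ contributes exactly the
  -- excess of the degree of the denominator.
  by_cases h : ∞ ∈ O
  · have h1 := hm ∞ h
    have h2 := (hO ∞).2 h
    have h3 : O.ncard = (O \ {∞}).ncard + 1 := by
      rw [← Set.ncard_insert_of_notMem (a := ∞) (by simp) hfin, Set.insert_sdiff_singleton,
        Set.insert_eq_of_mem h]
    rw [h3, hcard, mul_add, ← hdeg]
    omega
  · have h1 : ¬ 0 < ordAt ∞ f := fun h0 => h ((hO ∞).1 h0)
    rw [Set.sdiff_singleton_eq_self h] at hcard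
    rw [hcard, ← hdeg]
    omega

omit [IsAlgClosed k] in
theorem card_stabilizer_mul_ncard_orbit (G : Subgroup (PGL2 k)) (P : OnePoint k) :
    Nat.card (stabilizer G P) * (orbit G P).ncard = Nat.card G := by
  rw [← (stabilizer G P).card_mul_index, index_stabilizer]

omit [IsAlgClosed k] in
theorem card_stabilizer_eq_of_mem_orbit (G : Subgroup (PGL2 k)) [Finite G] {P Q : OnePoint k}
    (h : Q ∈ orbit G P) : Nat.card (stabilizer G Q) = Nat.card (stabilizer G P) := by
  have h1 := card_stabilizer_mul_ncard_orbit G P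
  have h2 := card_stabilizer_mul_ncard_orbit G Q
  rw [orbit_eq_iff.2 h] at h2
  have h3 : 0 < (orbit G P).ncard :=
    (Set.ncard_pos (finite_orbit G P)).2 ⟨P, mem_orbit_self _⟩
  exact Nat.eq_of_mul_eq_mul_right h3 (h2.trans h1.symm)

/-- The zeros of a generator of the fixed field form one orbit, and the order of vanishing is the
order of the stabilizer. -/
theorem zeros_of_generator {G : Subgroup (PGL2 k)} [Finite G] {f : RatFunc k}
    (hG : fixedField G = k⟮f⟯) {P₀ : OnePoint k} (hP₀ : 0 < ordAt P₀ f) :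
    (∀ P, 0 < ordAt P f ↔ P ∈ orbit G P₀) ∧
      ∀ P ∈ orbit G P₀, ordAt P f = Nat.card (stabilizer G P₀) := by
  have hf := not_const_of_fixedField_eq hG
  have hf0 : f ≠ 0 := fun h0 => hf ⟨0, by simp [h0]⟩
  have hfG : f ∈ fixedField G := by rw [hG]; exact IntermediateField.mem_adjoin_simple_self k f
  have hinv : ∀ P ∈ orbit G P₀, ordAt P f = ordAt P₀ f := by
    rintro _ ⟨g, rfl⟩
    obtain ⟨γ, hγ⟩ := ProjGenLinGroup.mk_surjective (g : PGL2 k)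
    have := hfG γ (hγ ▸ g.2)
    change ordAt ((g : PGL2 k) • P₀) f = _
    rw [← hγ, ← ordAt_subst P₀ γ hf0, this]
  -- Take an invariant function h with zeros on the orbit of P₀ and poles away from the orbits of P₀
  -- and P'. Its order at each zero of f is K times that of f. At P₀ this order is |G_{P₀}| > 0, so
  -- K ≠ 0; outside the orbit of P₀ it would be 0 at P', so K = 0.
  have key : ∀ P', 0 < ordAt P' f → P' ∈ orbit G P₀ ∧
      ∃ K : ℤ, (Nat.card (stabilizer G P₀) : ℤ) = K * ordAt P₀ f := by
    intro P' hP'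
    obtain ⟨R, hR⟩ := exists_not_mem_finite ((finite_orbit G P₀).union (finite_orbit G P'))
    simp only [Set.mem_union, not_or] at hR
    obtain ⟨h, hh, h0, hord⟩ := exists_invariant_function G (P₀ := P₀) (R := R)
      (fun h => hR.1 (h ▸ mem_orbit_self _))
    rw [hG] at hh
    obtain ⟨K, hK⟩ := exists_ordAt_of_mem_adjoin hf hh h0
    have h1 := hord P₀
    rw [card_smul_eq_zero G hR.1, card_smul_eq_self, hK _ hP₀] at h1
    have h2 := hord P'
    rw [card_smul_eq_zero G hR.2, hK _ hP'] at h2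
    have hpos : 0 < Nat.card (stabilizer G P₀) := Nat.card_pos
    refine ⟨?_, K, by simpa using h1.symm⟩
    by_contra hc
    rw [card_smul_eq_zero G (fun hc' => hc (mem_orbit_symm.1 hc'))] at h2
    have hK0 : K = 0 := by
      rcases mul_eq_zero.1 (h2.trans (by simp)) with h | h
      · exact h
      · omega
    rw [hK0, zero_mul] at h1
    omega
  have hzeros : ∀ P, 0 < ordAt P f ↔ P ∈ orbit G P₀ :=
    fun P => ⟨fun hP => (key P hP).1, fun hP => by rw [hinv P hP]; exact hP₀⟩
  refine ⟨hzeros, fun P hP => ?_⟩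
  obtain ⟨-, K, hK⟩ := key P₀ hP₀
  obtain ⟨m, hm⟩ := Int.eq_ofNat_of_zero_le hP₀.le
  -- The degree of f is m times the size of the orbit and is at least |G|, so m ≥ |G_{P₀}|.
  -- Conversely |G_{P₀}| = K m with K ≥ 1.
  have hdeg := ordAt_mul_ncard hf hzeros (m := m) fun P hP => (hinv P hP).trans hm
  rw [← RatFunc.finrank_eq_max_natDegree] at hdeg
  have hle : Nat.card G ≤ Module.finrank k⟮f⟯ (RatFunc k) := by
    have := finiteDimensional_of_adjoin_le hf hG.ge
    have h := card_le_finrank G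
    rwa [hG] at h
  rw [← hdeg, ← card_stabilizer_mul_ncard_orbit G P₀] at hle
  have h3 : 0 < (orbit G P₀).ncard :=
    (Set.ncard_pos (finite_orbit G P₀)).2 ⟨P₀, mem_orbit_self _⟩
  have hle' := Nat.le_of_mul_le_mul_right hle h3
  have hpos : 0 < Nat.card (stabilizer G P₀) := Nat.card_pos
  rw [hinv P hP, hm]
  rw [hm] at hK
  have hKpos : 1 ≤ K := by
    by_contra! hc
    have : K * m ≤ 0 := mul_nonpos_of_nonpos_of_nonneg (by omega) (by positivity)
    omega
  have : (m : ℤ) ≤ K * m := le_mul_of_one_le_left (by positivity) hKpos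
  omega

/-- The list of the orders of the stabilizers at representatives of finitely many orbits, all other
points having trivial stabilizer. -/
def OrbitType (G : Subgroup (PGL2 k)) (e : List ℕ) : Prop :=
  ∃ P : Fin e.length → OnePoint k, (∀ i j, P i ∈ orbit G (P j) → i = j) ∧
    (∀ i, Nat.card (stabilizer G (P i)) = e.get i) ∧
    ∀ R, (∀ i, R ∉ orbit G (P i)) → Nat.card (stabilizer G R) = 1

-- Each local parameter of the target line generates the same field, so the description of the zeros
-- of a generator applies to every fibre.
omit [IsAlgClosed k] in
theorem adjoin_pullParam (w : RatFunc k) (Q : OnePoint k) : k⟮pullParam w Q⟯ = k⟮w⟯ := by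
  cases Q with
  | infty =>
    change k⟮w⁻¹⟯ = k⟮w⟯
    apply le_antisymm <;> rw [IntermediateField.adjoin_simple_le_iff]
    · exact inv_mem (IntermediateField.mem_adjoin_simple_self k w)
    · simpa using inv_mem (IntermediateField.mem_adjoin_simple_self k w⁻¹)
  | coe c =>
    change k⟮w - RatFunc.C c⟯ = k⟮w⟯
    apply le_antisymm <;> rw [IntermediateField.adjoin_simple_le_iff]
    · exact sub_mem (IntermediateField.mem_adjoin_simple_self k w)
        (IntermediateField.algebraMap_mem _ c)
    · simpa using add_mem (IntermediateField.mem_adjoin_simple_self k (w - RatFunc.C c))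
        (IntermediateField.algebraMap_mem k⟮w - RatFunc.C c⟯ c)

/-- The ramification of the quotient by `G` is read off from the stabilizers. -/
theorem hasRamification_of_orbitType {G : Subgroup (PGL2 k)} [Finite G] {w : RatFunc k}
    (hG : fixedField G = k⟮w⟯) {e : List ℕ} (he : OrbitType G e) : HasRamification w e := by
  obtain ⟨P, hinj, hcard, hfree⟩ := he
  have hw := not_const_of_fixedField_eq hG
  have hgen : ∀ Q, fixedField G = k⟮pullParam w Q⟯ := fun Q => by rw [adjoin_pullParam, hG]
  choose Q hQ using fun i => exists_ordAt_pullParam_pos hw (P i)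
  refine ⟨Q, fun i j hij => ?_, fun i R hR => ?_, fun R hR S hS => ?_⟩
  · have h1 := hQ i
    rw [hij] at h1
    exact hinj i j (((zeros_of_generator (hgen _) (hQ j)).1 _).1 h1)
  · obtain ⟨h1, h2⟩ := zeros_of_generator (hgen _) (hQ i)
    rw [h2 R ((h1 R).1 hR), hcard i]
  · obtain ⟨h1, h2⟩ := zeros_of_generator (hgen _) hS
    rw [h2 S (mem_orbit_self _), hfree S, Nat.cast_one]
    intro i hi
    have h3 := (h1 (P i)).2 (mem_orbit_symm.1 hi)
    exact hR ⟨i, pullParam_unique hw (hQ i) h3⟩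

/-- Every formula is established through this criterion. What remains in each case is to conjugate G
into the invariance group of z, to compare degrees, and to know the orbit type. -/
theorem fixedFieldGivenBy_of_div {G : Subgroup (PGL2 k)} [Finite G] {p q : Polynomial k}
    {z : RatFunc k} (hz : z = algebraMap _ (RatFunc k) p / algebraMap _ _ q)
    (γ : PGL2 k) (hG : conjSubgroup γ G ≤ invariance z)
    (hp : p.natDegree = Nat.card G) (hq : q.natDegree < Nat.card G) (hq0 : q ≠ 0)
    {e : List ℕ} (he : OrbitType G e) : FixedFieldGivenBy G z e := by
  obtain ⟨γ, rfl⟩ := ProjGenLinGroup.mk_surjective γ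
  have := fixedField_eq_adjoin_div hz γ hG hp hq hq0
  exact ⟨γ, this, hasRamification_of_orbitType this he⟩

end

/-! ### Counting fixed points -/

section

open Matrix OnePoint MulAction

variable {k : Type*} [Field k]

/-- The number of nontrivial elements of `G` whose only fixed point is `P`. -/
def uniqueFixCount (G : Subgroup (PGL2 k)) (P : OnePoint k) : ℕ :=
  Nat.card {g : G // g ≠ 1 ∧ ∀ R : OnePoint k, g • R = R ↔ R = P}

theorem uniqueFixCount_smul (G : Subgroup (PGL2 k)) (h : G) (P : OnePoint k) :
    uniqueFixCount G (h • P) = uniqueFixCount G P := by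
  refine (Nat.card_congr ((MulAut.conj h).toEquiv.subtypeEquiv fun g => ?_)).symm
  simp only [MulEquiv.toEquiv_eq_coe, EquivLike.coe_coe, MulAut.conj_apply]
  refine and_congr ?_ ?_
  · rw [not_iff_not, mul_inv_eq_one]
    simp
  · constructor
    · intro H R
      rw [mul_smul, mul_smul, ← eq_inv_smul_iff, H, inv_smul_eq_iff]
    · intro H R
      have := H (h • R)
      rw [mul_smul, mul_smul, inv_smul_smul] at this
      simpa using this

theorem card_stabilizer_smul (G : Subgroup (PGL2 k)) [Finite G] (h : G) (P : OnePoint k) :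
    Nat.card (stabilizer G (h • P)) = Nat.card (stabilizer G P) :=
  card_stabilizer_eq_of_mem_orbit G (mem_orbit _ _)

variable [IsAlgClosed k]

theorem exists_fixed_points_sub {G : Subgroup (PGL2 k)} {g : G} (hg : g ≠ 1) :
    ∃ P R : OnePoint k, ∀ Q, g • Q = Q ↔ Q = P ∨ Q = R :=
  exists_fixed_points (g := (g : PGL2 k)) fun h => hg (Subtype.ext h)

-- The second summand gives a lone fixed point multiplicity two, so every nontrivial element
-- contributes exactly 2.
open Classical in
theorem sum_fixed_eq_two {G : Subgroup (PGL2 k)} {g : G} (hg : g ≠ 1)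
    {s : Finset (OnePoint k)} (hs : ∀ P, g • P = P → P ∈ s) :
    ∑ P ∈ s, ((if g • P = P then 1 else 0) +
      (if ∀ R : OnePoint k, g • R = R ↔ R = P then 1 else 0)) = 2 := by
  obtain ⟨A, B, hAB⟩ := exists_fixed_points_sub hg
  rw [Finset.sum_add_distrib, Finset.sum_boole, Finset.sum_boole]
  by_cases h : A = B
  · subst h
    have h1 : s.filter (fun P => g • P = P) = {A} := by
      ext P
      simp only [Finset.mem_filter, Finset.mem_singleton, hAB, or_self]
      exact ⟨fun h => h.2, fun h => ⟨hs P (by rw [hAB]; simp [h]), h⟩⟩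
    have h2 : s.filter (fun P => ∀ R : OnePoint k, g • R = R ↔ R = P) = {A} := by
      ext P
      simp only [Finset.mem_filter, Finset.mem_singleton, hAB, or_self]
      constructor
      · exact fun h => ((h.2 A).1 rfl).symm
      · rintro rfl
        exact ⟨hs P (by rw [hAB]; simp), fun R => Iff.rfl⟩
    rw [h1, h2]
    simp
  · have h1 : s.filter (fun P => g • P = P) = {A, B} := by
      ext P
      simp only [Finset.mem_filter, Finset.mem_insert, Finset.mem_singleton, hAB]
      exact ⟨fun h => h.2, fun h => ⟨hs P (by rw [hAB]; exact h), h⟩⟩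
    have h2 : s.filter (fun P => ∀ R : OnePoint k, g • R = R ↔ R = P) = ∅ := by
      ext P
      simp only [Finset.mem_filter, hAB, Finset.notMem_empty, iff_false, not_and]
      intro _ H
      exact h (((H A).1 (Or.inl rfl)).trans ((H B).1 (Or.inr rfl)).symm)
    rw [h1, h2, Finset.card_pair h]
    simp

-- The left side plays the role of the different exponent at P in Riemann-Hurwitz: `uniqueFixCount`
-- is the wild contribution.
omit [IsAlgClosed k] in
open Classical in
theorem weight_eq_sum (G : Subgroup (PGL2 k)) [Fintype G] (P : OnePoint k) :
    Nat.card (stabilizer G P) - 1 + uniqueFixCount G P =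
      ∑ g ∈ (Finset.univ : Finset G).erase 1, ((if g • P = P then 1 else 0) +
        (if ∀ R : OnePoint k, g • R = R ↔ R = P then 1 else 0)) := by
  rw [Finset.sum_add_distrib, Finset.sum_boole, Finset.sum_boole]
  congr 1
  · rw [← card_smul_eq_self, Nat.card_eq_fintype_card, Fintype.card_subtype, Finset.filter_erase,
      Finset.card_erase_of_mem (by simp)]
    rfl
  · rw [uniqueFixCount, Nat.card_eq_fintype_card, Fintype.card_subtype]
    simp only [Nat.cast_id]
    congr 1
    ext g
    simp

/-- Representatives of the orbits with nontrivial stabilizers, and the count of fixed points. -/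
theorem exists_orbit_representatives (G : Subgroup (PGL2 k)) [Finite G] :
    ∃ (r : ℕ) (P : Fin r → OnePoint k), (∀ i j, P i ∈ orbit G (P j) → i = j) ∧
      (∀ i, 2 ≤ Nat.card (stabilizer G (P i))) ∧
      (∀ R, (∀ i, R ∉ orbit G (P i)) → Nat.card (stabilizer G R) = 1) ∧
      ∑ i, (orbit G (P i)).ncard * (Nat.card (stabilizer G (P i)) - 1 + uniqueFixCount G (P i)) =
        2 * (Nat.card G - 1) := by
  classical
  have := Fintype.ofFinite G
  -- Points with nontrivial stabilizer are fixed points of one of finitely many nontrivial elements,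
  -- each having at most two.
  have hfin : {P : OnePoint k | Nat.card (stabilizer G P) ≠ 1}.Finite := by
    have h1 : (⋃ g ∈ {g : G | g ≠ 1}, {P : OnePoint k | g • P = P}).Finite := by
      refine Set.Finite.biUnion (Set.toFinite _) fun g hg => ?_
      obtain ⟨A, B, hAB⟩ := exists_fixed_points_sub hg
      refine (Set.toFinite {A, B}).subset fun P hP => ?_
      simpa using (hAB P).1 hP
    refine h1.subset fun P hP => ?_
    have hne : stabilizer G P ≠ ⊥ := fun h => hP (by rw [h]; simp)
    obtain ⟨g, hg⟩ := Subgroup.ne_bot_iff_exists_ne_one.1 hne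
    simp only [Set.mem_iUnion]
    exact ⟨g.1, fun h => hg (Subtype.ext h), g.2⟩
  set s := hfin.toFinset with hs
  have mem_s : ∀ P, P ∈ s ↔ Nat.card (stabilizer G P) ≠ 1 := fun P => by simp [hs]
  have hfix : ∀ g : G, g ≠ 1 → ∀ P : OnePoint k, g • P = P → P ∈ s := by
    intro g hg P hP
    rw [mem_s, Ne, Subgroup.card_eq_one]
    intro h
    have : g ∈ stabilizer G P := hP
    rw [h] at this
    exact hg this
  -- Double counting of the pairs of a nontrivial element and a fixed point, with multiplicity.
  have hcount : ∑ P ∈ s, (Nat.card (stabilizer G P) - 1 + uniqueFixCount G P) =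
      2 * (Nat.card G - 1) := by
    simp only [weight_eq_sum]
    rw [Finset.sum_comm]
    rw [Finset.sum_congr rfl fun g hg => sum_fixed_eq_two (Finset.ne_of_mem_erase hg)
      (hfix g (Finset.ne_of_mem_erase hg))]
    rw [Finset.sum_const, Finset.card_erase_of_mem (Finset.mem_univ _), smul_eq_mul, mul_comm,
      Finset.card_univ, Nat.card_eq_fintype_card]
  let mk : OnePoint k → orbitRel.Quotient G (OnePoint k) := Quotient.mk _
  have mk_eq : ∀ P Q, mk P = mk Q ↔ P ∈ orbit G Q := fun P Q =>
    Quotient.eq (r := orbitRel G (OnePoint k)).trans orbitRel_apply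
  set Ω := s.image mk with hΩ
  have hmkout : ∀ ω : orbitRel.Quotient G (OnePoint k), mk ω.out = ω := fun ω => Quotient.out_eq _
  have orbit_sub : ∀ P Q, P ∈ orbit G Q → (P ∈ s ↔ Q ∈ s) := fun P Q h => by
    rw [mem_s, mem_s, card_stabilizer_eq_of_mem_orbit G h]
  have mem_Ω : ∀ ω ∈ Ω, ω.out ∈ s := by
    intro ω hω
    obtain ⟨P, hP, rfl⟩ := Finset.mem_image.1 hω
    exact (orbit_sub _ _ ((mk_eq _ _).1 (hmkout (mk P)))).2 hP
  rw [← Finset.sum_fiberwise_of_maps_to (s := s) (t := Ω) (g := mk)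
    fun P hP => Finset.mem_image_of_mem _ hP] at hcount
  -- The weight is constant on orbits, so the sum over points becomes a sum over orbits weighted by
  -- their sizes.
  have hfib : ∀ ω ∈ Ω, ∑ P ∈ s with mk P = ω,
      (Nat.card (stabilizer G P) - 1 + uniqueFixCount G P) = (orbit G ω.out).ncard *
        (Nat.card (stabilizer G ω.out) - 1 + uniqueFixCount G ω.out) := by
    intro ω hω
    have hset : ((s.filter fun P => mk P = ω : Finset (OnePoint k)) : Set (OnePoint k)) =
        orbit G ω.out := by
      ext P
      simp only [Finset.coe_filter, Set.mem_ofPred_eq]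
      conv_lhs => rw [← hmkout ω, mk_eq]
      exact ⟨fun h => h.2, fun h => ⟨(orbit_sub _ _ h).2 (mem_Ω ω hω), h⟩⟩
    rw [← hset, Set.ncard_coe_finset, ← smul_eq_mul]
    refine Finset.sum_eq_card_nsmul fun P hP => ?_
    have hP' : P ∈ orbit G ω.out := by rw [← hset]; exact hP
    obtain ⟨g, rfl⟩ := hP'
    change Nat.card (stabilizer G (g • ω.out)) - 1 + uniqueFixCount G (g • ω.out) = _
    rw [card_stabilizer_smul, uniqueFixCount_smul]
  rw [Finset.sum_congr rfl hfib] at hcount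
  refine ⟨Ω.card, fun i => (Ω.equivFin.symm i).1.out, ?_, ?_, ?_, ?_⟩
  · intro i j hij
    rw [← mk_eq, hmkout, hmkout] at hij
    exact Ω.equivFin.symm.injective (Subtype.ext hij)
  · intro i
    have h1 := (mem_s _).1 (mem_Ω _ (Ω.equivFin.symm i).2)
    have h2 : 0 < Nat.card (stabilizer G (Ω.equivFin.symm i).1.out) := Nat.card_pos
    change 2 ≤ Nat.card (stabilizer G (Ω.equivFin.symm i).1.out)
    omega
  · intro R hR
    by_contra hc
    have hRs : R ∈ s := (mem_s R).2 hc
    refine hR (Ω.equivFin ⟨mk R, Finset.mem_image_of_mem _ hRs⟩) ?_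
    rw [← mk_eq, hmkout, Equiv.symm_apply_apply]
  · rw [← hcount, ← Finset.sum_coe_sort Ω]
    exact Fintype.sum_equiv Ω.equivFin.symm _ _ fun i => rfl

end

/-! ### The stabilizer of ∞: translations and multipliers -/

section

open Matrix OnePoint MulAction

variable {k : Type*} [Field k]

/-- The group of all `b` such that `x ↦ x + b` lies in `G`. -/
def transl (G : Subgroup (PGL2 k)) : AddSubgroup k where
  carrier := {b | aff 1 b ∈ G}
  zero_mem' := by simp [G.one_mem]
  add_mem' {a b} ha hb := by
    have := G.mul_mem ha hb
    rw [aff_mul_aff] at this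
    simpa [add_comm] using this
  neg_mem' {a} ha := by
    have := G.inv_mem ha
    rw [aff_inv] at this
    simpa using this

/-- The group of all `a` such that some `x ↦ a x + b` lies in `G`. -/
def mults (G : Subgroup (PGL2 k)) : Subgroup kˣ where
  carrier := {a | ∃ b, aff a b ∈ G}
  one_mem' := ⟨0, by simp [G.one_mem]⟩
  mul_mem' := by
    rintro a a' ⟨b, hb⟩ ⟨b', hb'⟩
    exact ⟨_, by rw [← aff_mul_aff]; exact G.mul_mem hb hb'⟩
  inv_mem' := by
    rintro a ⟨b, hb⟩
    exact ⟨_, by rw [← aff_inv]; exact G.inv_mem hb⟩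

theorem mem_transl {G : Subgroup (PGL2 k)} {b : k} : b ∈ transl G ↔ aff 1 b ∈ G := Iff.rfl

theorem mem_mults {G : Subgroup (PGL2 k)} {a : kˣ} : a ∈ mults G ↔ ∃ b, aff a b ∈ G := Iff.rfl

theorem mults_mul_transl {G : Subgroup (PGL2 k)} {a : kˣ} (ha : a ∈ mults G) {b : k}
    (hb : b ∈ transl G) : (a : k) * b ∈ transl G := by
  obtain ⟨c, hc⟩ := ha
  rw [mem_transl, ← aff_conj_translation a c b]
  exact G.mul_mem (G.mul_mem hc hb) (G.inv_mem hc)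

/-- The stabilizer of `∞` is parametrized by translations and multipliers. -/
theorem exists_stabilizer_infty_equiv (G : Subgroup (PGL2 k)) :
    Nonempty (transl G × mults G ≃ stabilizer G (∞ : OnePoint k)) := by
  choose c hc using fun a : mults G => a.2
  have hst : ∀ x : transl G × mults G, (⟨aff 1 (x.1 : k) * aff x.2 (c x.2),
      G.mul_mem x.1.2 (hc _)⟩ : G) ∈ stabilizer G (∞ : OnePoint k) := fun x => by
    change (aff 1 (x.1 : k) * aff x.2 (c x.2)) • (∞ : OnePoint k) = ∞
    simp [mul_smul]
  refine ⟨Equiv.ofBijective (fun x => ⟨_, hst x⟩) ⟨?_, ?_⟩⟩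
  · rintro ⟨b, a⟩ ⟨b', a'⟩ h
    simp only [Subtype.mk.injEq, aff_mul_aff, aff_inj, one_mul] at h
    have h1 : a = a' := Subtype.ext h.1
    subst h1
    simp only [Units.val_one, one_mul, add_right_inj] at h
    rw [Prod.mk.injEq]
    exact ⟨Subtype.ext h.2, rfl⟩
  · rintro ⟨⟨g, hg⟩, hgs⟩
    obtain ⟨a, b, rfl⟩ := exists_aff (g := g) hgs
    have ha : a ∈ mults G := ⟨b, hg⟩
    have hb : b - c ⟨a, ha⟩ ∈ transl G := by
      rw [mem_transl]
      have := G.mul_mem hg (G.inv_mem (hc ⟨a, ha⟩))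
      rw [aff_inv, aff_mul_aff] at this
      simpa [sub_eq_add_neg, add_comm] using this
    refine ⟨(⟨_, hb⟩, ⟨a, ha⟩), ?_⟩
    apply Subtype.ext
    apply Subtype.ext
    simp [aff_mul_aff]

theorem card_stabilizer_infty (G : Subgroup (PGL2 k)) :
    Nat.card (stabilizer G (∞ : OnePoint k)) = Nat.card (transl G) * Nat.card (mults G) := by
  rw [← Nat.card_prod, Nat.card_congr (exists_stabilizer_infty_equiv G).some]

instance finite_transl (G : Subgroup (PGL2 k)) [Finite G] : Finite (transl G) :=
  Finite.of_injective (fun b : transl G => (⟨aff 1 (b : k), b.2⟩ : G)) fun a b h => by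
    exact Subtype.ext (aff_inj.1 (congrArg Subtype.val h)).2

instance finite_mults (G : Subgroup (PGL2 k)) [Finite G] : Finite (mults G) := by
  choose c hc using fun a : mults G => a.2
  exact Finite.of_injective (fun a : mults G => (⟨aff a (c a), hc a⟩ : G)) fun a b h => by
    simp only [Subtype.mk.injEq, aff_inj] at h
    exact Subtype.ext h.1

/-- If a ≠ 1, then x ↦ ax + b has the second fixed point b/(1 - a). -/
theorem unique_fix_infty_iff {g : PGL2 k} :
    (g ≠ 1 ∧ ∀ R : OnePoint k, g • R = R ↔ R = ∞) ↔ ∃ b ≠ 0, g = aff 1 b := by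
  constructor
  · rintro ⟨hg, h⟩
    obtain ⟨a, b, rfl⟩ := exists_aff ((h ∞).2 rfl)
    have ha : a = 1 := by
      by_contra ha
      have ha' : (1 : k) - a ≠ 0 := fun h0 => ha (Units.ext (by simpa using
          (sub_eq_zero.1 h0).symm))
      have := (h ((b / (1 - a) : k) : OnePoint k)).1 (by
        rw [aff_smul_coe, OnePoint.coe_eq_coe]
        field_simp
        ring)
      simp at this
    subst ha
    exact ⟨b, fun hb => hg (by simp [hb]), rfl⟩
  · rintro ⟨b, hb, rfl⟩
    refine ⟨fun h => hb (aff_eq_one.1 h).2, fun R => ?_⟩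
    cases R with
    | infty => simp
    | coe x => simp [hb]

/-- The extra 1 is the identity, counted as translation by 0. Through this the wild weight of a
point becomes the order of a group of translations. -/
theorem uniqueFixCount_infty (G : Subgroup (PGL2 k)) [Finite G] :
    uniqueFixCount G ∞ + 1 = Nat.card (transl G) := by
  have e : {g : G // g ≠ 1 ∧ ∀ R : OnePoint k, g • R = R ↔ R = ∞} ≃ {b : transl G // b ≠ 0} := by
    have hb : ∀ b : {b : transl G // b ≠ 0}, (⟨aff 1 (b.1 : k), b.1.2⟩ : G) ≠ 1 ∧
        ∀ R : OnePoint k, (⟨aff 1 (b.1 : k), b.1.2⟩ : G) • R = R ↔ R = ∞ := fun b => by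
      have := unique_fix_infty_iff.2 ⟨(b.1 : k), fun h => b.2 (Subtype.ext h), rfl⟩
      exact ⟨fun h => this.1 (congrArg Subtype.val h), this.2⟩
    refine (Equiv.ofBijective (fun b => ⟨_, hb b⟩) ⟨?_, ?_⟩).symm
    · intro b c h
      exact Subtype.ext (Subtype.ext
        (aff_inj.1 (congrArg (fun x => ((x.1 : G) : PGL2 k)) h)).2)
    · rintro ⟨⟨g, hg⟩, h1, h2⟩
      obtain ⟨b, hb, rfl⟩ := unique_fix_infty_iff.1 ⟨fun h => h1 (Subtype.ext h), h2⟩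
      exact ⟨⟨⟨b, hg⟩, fun h => hb (congrArg Subtype.val h)⟩, rfl⟩
  classical
  have := Fintype.ofFinite (transl G)
  rw [uniqueFixCount, Nat.card_congr e, Nat.card_eq_fintype_card, Nat.card_eq_fintype_card,
    Fintype.card_subtype_compl, Fintype.card_subtype_eq, Nat.sub_add_cancel Fintype.card_pos]

theorem conj_smul (γ g : PGL2 k) (P : OnePoint k) : (γ * g * γ⁻¹) • γ • P = γ • g • P := by
  simp [mul_smul]

theorem card_stabilizer_conj (γ : PGL2 k) (G : Subgroup (PGL2 k)) (P : OnePoint k) :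
    Nat.card (stabilizer (conjSubgroup γ G) (γ • P)) = Nat.card (stabilizer G P) := by
  refine (Nat.card_congr ((conjSubgroupEquiv γ G).toEquiv.subtypeEquiv fun g => ?_)).symm
  change (g : PGL2 k) • P = P ↔ (γ * g * γ⁻¹) • γ • P = γ • P
  rw [conj_smul, (MulAction.injective γ).eq_iff]

theorem uniqueFixCount_conj (γ : PGL2 k) (G : Subgroup (PGL2 k)) (P : OnePoint k) :
    uniqueFixCount (conjSubgroup γ G) (γ • P) = uniqueFixCount G P := by
  refine (Nat.card_congr ((conjSubgroupEquiv γ G).toEquiv.subtypeEquiv fun g => ?_)).symm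
  refine and_congr ?_ ?_
  · simp
  · constructor
    · intro H R
      have := H (γ⁻¹ • R)
      change (γ * g * γ⁻¹) • R = R ↔ _
      change (g : PGL2 k) • γ⁻¹ • R = γ⁻¹ • R ↔ _ at this
      rw [mul_smul, mul_smul, ← eq_inv_smul_iff, this, inv_smul_eq_iff]
    · intro H R
      have := H (γ • R)
      change (γ * g * γ⁻¹) • γ • R = γ • R ↔ _ at this
      rw [conj_smul, (MulAction.injective γ).eq_iff, (MulAction.injective γ).eq_iff] at this
      exact this

theorem mem_orbit_conj {γ : PGL2 k} {G : Subgroup (PGL2 k)} {P Q : OnePoint k} :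
    γ • P ∈ orbit (conjSubgroup γ G) (γ • Q) ↔ P ∈ orbit G Q := by
  constructor
  · rintro ⟨⟨_, g, hg, rfl⟩, h⟩
    refine ⟨⟨g, hg⟩, MulAction.injective γ ?_⟩
    change (γ * g * γ⁻¹) • γ • Q = γ • P at h
    rw [conj_smul] at h
    exact h
  · rintro ⟨g, rfl⟩
    exact ⟨⟨γ * g * γ⁻¹, conj_mem_conjSubgroup g.2⟩, conj_smul γ g Q⟩

theorem nonempty_addEquiv_fin (K V : Type*) [Field K] [AddCommGroup V] [Module K V] [Finite V] :
    Nonempty (V ≃+ (Fin (Module.finrank K V) → K)) :=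
  ⟨(Module.finBasis K V).equivFun.toAddEquiv⟩

section CharP

variable (p : ℕ) [CharP k p]

theorem card_addSubgroup_of_prime (hp : p.Prime) (H : AddSubgroup k) [Finite H] :
    ∃ t, Nat.card H = p ^ t ∧ Nonempty (H ≃+ (Fin t → ZMod p)) := by
  have : Fact p.Prime := ⟨hp⟩
  have hpH : ∀ x : H, p • x = 0 := fun x => Subtype.ext (by simp [nsmul_eq_mul])
  let inst : Module (ZMod p) H := AddCommGroup.zmodModule hpH
  refine ⟨Module.finrank (ZMod p) H, ?_, ?_⟩
  · rw [FiniteField.pow_finrank_eq_natCard]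
  · exact nonempty_addEquiv_fin (ZMod p) H

theorem card_addSubgroup_of_zero (h0 : p = 0) (H : AddSubgroup k) [Finite H] : Nat.card H = 1 := by
  subst h0
  have := CharP.charP_to_charZero k
  rw [Nat.card_eq_one_iff_unique]
  refine ⟨⟨fun x y => ?_⟩, ⟨0⟩⟩
  have key : ∀ x : H, x = 0 := fun x => by
    by_contra hx
    have hinj : Function.Injective fun n : ℕ => n • x := fun m n h => by
      have h2 := congrArg Subtype.val h
      simp only [AddSubgroup.coe_nsmul, nsmul_eq_mul] at h2
      have hx' : (x : k) ≠ 0 := fun h => hx (Subtype.ext h)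
      exact_mod_cast mul_right_cancel₀ hx' h2
    exact not_injective_infinite_finite _ hinj
  rw [key x, key y]

/-- In characteristic zero a nonzero element has infinitely many multiples. For odd p a nontrivial
finite group has order pᵗ, which is odd and at least 3; the lower bound is what the orbit arithmetic
needs. -/
theorem card_addSubgroup_cases (hp2 : p ≠ 2) (H : AddSubgroup k) [Finite H] :
    Nat.card H = 1 ∨ (p.Prime ∧ ∃ t, 0 < t ∧ Nat.card H = p ^ t ∧ 3 ≤ Nat.card H ∧
      Odd (Nat.card H)) := by
  rcases CharP.char_is_prime_or_zero k p with hp | hp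
  · obtain ⟨t, ht, -⟩ := card_addSubgroup_of_prime p hp H
    rcases Nat.eq_zero_or_pos t with h0 | h0
    · left; simp [ht, h0]
    · right
      have hodd : Odd p := hp.odd_of_ne_two hp2
      refine ⟨hp, t, h0, ht, ?_, ?_⟩
      · rw [ht]
        have h3 : 3 ≤ p := by have := hp.two_le; omega
        exact h3.trans (Nat.le_self_pow h0.ne' p)
      · rw [ht]; exact hodd.pow
  · left; exact card_addSubgroup_of_zero p hp H

/-- An element of order p would satisfy (x - 1)^p = x^p - 1 = 0. For p = 0 the claim only says that
the order is nonzero. -/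
theorem not_dvd_card_units (D : Subgroup kˣ) [Finite D] : ¬ p ∣ Nat.card D := by
  have hpos : 0 < Nat.card D := Nat.card_pos
  rcases CharP.char_is_prime_or_zero k p with hp | hp
  · intro h
    have : Fact p.Prime := ⟨hp⟩
    obtain ⟨x, hx⟩ := exists_prime_orderOf_dvd_card' p h
    have h1 : x ^ p = 1 := by rw [← hx]; exact pow_orderOf_eq_one x
    have h2 : ((x : kˣ) : k) ^ p = 1 := by
      have := congrArg (fun y : D => ((y : kˣ) : k)) h1
      simpa using this
    have h3 : (((x : kˣ) : k) - 1) ^ p = 0 := by rw [sub_pow_char, h2]; simp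
    have h4 : x = 1 := Subtype.ext (Units.ext (by
      simpa using sub_eq_zero.1 (pow_eq_zero_iff hp.ne_zero |>.1 h3)))
    rw [h4, orderOf_one] at hx
    exact hp.one_lt.ne hx
  · rw [hp, zero_dvd_iff]; omega

end CharP

/-- D lies in the group of roots of unity of order dividing |D|, which has at most |D| elements;
hence D is all of it. -/
theorem mem_iff_pow_card_eq_one (D : Subgroup kˣ) [Finite D] (a : kˣ) :
    a ∈ D ↔ a ^ Nat.card D = 1 := by
  constructor
  · intro h
    exact congrArg Subtype.val (pow_card_eq_one' (x := (⟨a, h⟩ : D)))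
  · intro h
    have hpos : 0 < Nat.card D := Nat.card_pos
    have : NeZero (Nat.card D) := ⟨hpos.ne'⟩
    have hle : D ≤ rootsOfUnity (Nat.card D) k := fun x hx => by
      rw [mem_rootsOfUnity]
      exact congrArg Subtype.val (pow_card_eq_one' (x := (⟨x, hx⟩ : D)))
    have hcard : Nat.card (rootsOfUnity (Nat.card D) k) ≤ Nat.card D := card_rootsOfUnity k _
    rw [Subgroup.eq_of_le_of_card_ge hle hcard]
    exact (mem_rootsOfUnity _ _).2 h

open Classical in
/-- A finite additive group stable under the `m`-th roots of unity is described by the `m`-th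
powers of its nonzero elements. -/
theorem exists_power_set (H : AddSubgroup k) [Finite H] (D : Subgroup kˣ) [Finite D]
    (hDH : ∀ a ∈ D, ∀ b ∈ H, (a : k) * b ∈ H) :
    ∃ B : Finset k, B.card * Nat.card D = Nat.card H - 1 ∧ 0 ∉ B ∧
      ∀ x : k, x ^ Nat.card D ∈ B ↔ x ∈ H ∧ x ≠ 0 := by
  set m := Nat.card D with hm
  have hm0 : m ≠ 0 := Nat.card_pos.ne'
  have hHfin : (H : Set k).Finite := Set.toFinite _
  set s := hHfin.toFinset.erase 0 with hs
  have mem_s : ∀ x, x ∈ s ↔ x ≠ 0 ∧ x ∈ H := fun x => by simp [hs]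
  have hscard : s.card = Nat.card H - 1 := by
    rw [hs, Finset.card_erase_of_mem (by simp [H.zero_mem])]
    rw [← Set.ncard_eq_toFinset_card (H : Set k)]
    rfl
  have hiff : ∀ x y : k, y ∈ s → x ^ m = y ^ m → ∃ a : kˣ, a ∈ D ∧ x = a * y := by
    intro x y hy hxy
    have hy0 := ((mem_s y).1 hy).1
    have hx0 : x ≠ 0 := by
      rintro rfl
      rw [zero_pow hm0] at hxy
      exact pow_ne_zero m hy0 hxy.symm
    refine ⟨Units.mk0 (x / y) (div_ne_zero hx0 hy0), ?_, by simp [hy0]⟩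
    rw [mem_iff_pow_card_eq_one]
    apply Units.ext
    simp [← hm, div_pow, hxy, pow_ne_zero m hy0]
  have hmul : ∀ a ∈ D, ∀ y ∈ s, (a : k) * y ∈ s := fun a ha y hy =>
    (mem_s _).2 ⟨mul_ne_zero a.ne_zero ((mem_s y).1 hy).1, hDH a ha y ((mem_s y).1 hy).2⟩
  refine ⟨s.image (· ^ m), ?_, ?_, ?_⟩
  -- On the nonzero elements of H the fibres of x ↦ xᵐ are the sets D·y, each with m elements.
  · rw [← hscard, Finset.card_eq_sum_card_image (· ^ m) s, ← smul_eq_mul]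
    refine (Finset.sum_eq_card_nsmul fun b hb => ?_).symm
    obtain ⟨y, hy, rfl⟩ := Finset.mem_image.1 hb
    have hy0 := ((mem_s y).1 hy).1
    have : ((s.filter fun x => x ^ m = y ^ m : Finset k) : Set k) =
        Set.range fun a : D => ((a : kˣ) : k) * y := by
      ext x
      simp only [Finset.coe_filter, Set.mem_ofPred_eq, Set.mem_range, Subtype.exists]
      constructor
      · rintro ⟨-, hxy⟩
        obtain ⟨a, ha, rfl⟩ := hiff x y hy hxy
        exact ⟨a, ha, rfl⟩
      · rintro ⟨a, ha, rfl⟩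
        refine ⟨hmul a ha y hy, ?_⟩
        have := congrArg Units.val ((mem_iff_pow_card_eq_one D a).1 ha)
        rw [mul_pow, hm]
        simp only [Units.val_pow_eq_pow_val, Units.val_one] at this
        rw [this, one_mul]
    rw [← Set.ncard_coe_finset, this, ← Set.image_univ, Set.ncard_image_of_injective,
      Set.ncard_univ]
    intro a b hab
    exact Subtype.ext (Units.ext (mul_right_cancel₀ hy0 hab))
  · intro h0
    obtain ⟨y, hy, h⟩ := Finset.mem_image.1 h0
    exact pow_ne_zero m ((mem_s y).1 hy).1 h
  · intro x
    rw [Finset.mem_image]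
    constructor
    · rintro ⟨y, hy, hxy⟩
      obtain ⟨a, ha, rfl⟩ := hiff x y hy hxy.symm
      exact ((mem_s _).1 (hmul a ha y hy)).symm
    · rintro ⟨h1, h2⟩
      exact ⟨x, (mem_s x).2 ⟨h2, h1⟩, rfl⟩

/-- Multipliers act freely on the nonzero translations, and |D| times the number of power classes is
|H| - 1. -/
theorem card_mults_dvd (G : Subgroup (PGL2 k)) [Finite G] :
    Nat.card (mults G) ∣ Nat.card (transl G) - 1 := by
  obtain ⟨B, hB, -⟩ := exists_power_set (transl G) (mults G)
    fun a ha b hb => mults_mul_transl ha hb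
  exact ⟨B.card, by rw [← hB, mul_comm]⟩

end

/-! ### Possible orbit structures, tame and wild -/

section

open Matrix OnePoint MulAction

variable {k : Type*} [Field k] (p : ℕ) [CharP k p]

/-- `uniqueFixCount` plus one is the order of a group of translations, which is 1 or at least 3.
Excluding the value 1 is where p ≠ 2 enters the count. -/
theorem local_structure (hp2 : p ≠ 2) (G : Subgroup (PGL2 k)) [Finite G] (P : OnePoint k) :
    uniqueFixCount G P = 0 ∨ 2 ≤ uniqueFixCount G P := by
  obtain ⟨γ, hγ⟩ := exists_smul_eq_infty P
  have h1 := uniqueFixCount_conj γ G P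
  rw [hγ] at h1
  have h2 := uniqueFixCount_infty (conjSubgroup γ G)
  rcases card_addSubgroup_cases p hp2 (transl (conjSubgroup γ G)) with h | ⟨_, _, _, _, h, _⟩ <;>
    omega

variable [IsAlgClosed k]

/-- The orbits with nontrivial stabilizers when no nontrivial element has only one fixed point. -/
theorem tame_types (G : Subgroup (PGL2 k)) [Finite G]
    (htame : ∀ P, uniqueFixCount G P = 0) :
    OrbitType G [] ∧ Nat.card G = 1 ∨ OrbitType G [Nat.card G, Nat.card G] ∧ 2 ≤ Nat.card G ∨
      (∃ m, 2 ≤ m ∧ Nat.card G = 2 * m ∧ OrbitType G [2, 2, m]) ∨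
      (Nat.card G = 12 ∧ OrbitType G [2, 3, 3]) ∨ (Nat.card G = 24 ∧ OrbitType G [2, 3, 4]) ∨
      (Nat.card G = 60 ∧ OrbitType G [2, 3, 5]) := by
  obtain ⟨r, P, hinj, he, hfree, hsum⟩ := exists_orbit_representatives G
  -- Representatives are reordered so that the stabilizer orders increase.
  set σ := Tuple.sort fun i => Nat.card (stabilizer G (P i)) with hσ
  have hmono : Monotone ((fun i => Nat.card (stabilizer G (P i))) ∘ σ) := Tuple.monotone_sort _
  rw [← Equiv.sum_comp σ] at hsum
  have hinj' : ∀ i j, P (σ i) ∈ orbit G (P (σ j)) → i = j :=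
    fun i j h => σ.injective (hinj _ _ h)
  have hfree' : ∀ R, (∀ i, R ∉ orbit G (P (σ i))) → Nat.card (stabilizer G R) = 1 :=
    fun R hR => hfree R fun i => by simpa using hR (σ.symm i)
  set n := Nat.card G with hn
  have hn0 : 0 < n := Nat.card_pos
  set e : Fin r → ℕ := fun i => Nat.card (stabilizer G (P (σ i))) with he'
  set o : Fin r → ℕ := fun i => (orbit G (P (σ i))).ncard with ho'
  have heo : ∀ i, e i * o i = n := fun i => card_stabilizer_mul_ncard_orbit G _
  have he2 : ∀ i, 2 ≤ e i := fun i => he _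
  have hterm : ∀ i, o i * (e i - 1) + o i = n := fun i => by
    have h1 := heo i
    have h2 := he2 i
    obtain ⟨c, hc⟩ : ∃ c, e i = c + 1 := ⟨e i - 1, by omega⟩
    rw [hc] at h1 ⊢
    rw [Nat.add_sub_cancel]
    linarith
  have hsum' : ∑ i, o i * (e i - 1) = 2 * (n - 1) := by
    rw [← hsum]
    refine Finset.sum_congr rfl fun i _ => ?_
    rw [htame, add_zero]
  have hmono' : ∀ i j, i ≤ j → e i ≤ e j := fun i j h => hmono h
  have hhalf : ∀ i, n ≤ 2 * (o i * (e i - 1)) := fun i => by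
    have h1 := heo i
    have h2 := hterm i
    have h3 := he2 i
    have : 2 * o i ≤ e i * o i := Nat.mul_le_mul_right _ h3
    omega
  -- Each orbit contributes n - n/e ≥ n/2 to a total of 2n - 2, so four orbits are too many.
  have hr : r ≤ 3 := by
    have h1 : r * n ≤ ∑ i, 2 * (o i * (e i - 1)) := by
      calc r * n = ∑ _i : Fin r, n := by simp
        _ ≤ _ := Finset.sum_le_sum fun i _ => hhalf i
    rw [← Finset.mul_sum, hsum'] at h1
    by_contra! h
    have : 4 * n ≤ r * n := Nat.mul_le_mul_right _ h
    omega
  have hPe : ∀ i, Nat.card (stabilizer G (P (σ i))) = e i := fun i => rfl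
  clear_value e o σ
  interval_cases r
  · left
    refine ⟨⟨fun i => i.elim0, fun i => i.elim0, fun i => i.elim0, fun R _ => ?_⟩, ?_⟩
    · exact hfree' R fun i => i.elim0
    · rw [Fin.sum_univ_zero] at hsum'
      omega
  -- A single orbit contributes n - o < n, while n ≥ 2 makes the required total 2n - 2 at least n.
  · exfalso
    simp only [Fin.sum_univ_one] at hsum'
    have t0 := hterm 0
    have e0 := heo 0
    have : 2 * o 0 ≤ e 0 * o 0 := Nat.mul_le_mul_right _ (he2 0)
    have p0 : 0 < o 0 := Nat.pos_of_ne_zero fun h => by rw [h, mul_zero] at e0; omega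
    omega
  · right; left
    simp only [Fin.sum_univ_two] at hsum'
    have t0 := hterm 0
    have t1 := hterm 1
    have e0 := heo 0
    have e1 := heo 1
    have p0 : 0 < o 0 := Nat.pos_of_ne_zero fun h => by rw [h, mul_zero] at e0; omega
    have p1 : 0 < o 1 := Nat.pos_of_ne_zero fun h => by rw [h, mul_zero] at e1; omega
    have q0 : o 0 = 1 := by omega
    have q1 : o 1 = 1 := by omega
    rw [q0, mul_one] at e0
    rw [q1, mul_one] at e1
    refine ⟨⟨fun i => P (σ i), hinj', ?_, hfree'⟩, ?_⟩
    · intro i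
      rw [hPe]
      fin_cases i
      · exact e0
      · exact e1
    · rw [← e0]; exact he2 0
  · right; right
    simp only [Fin.sum_univ_three] at hsum'
    have t0 := hterm 0
    have t1 := hterm 1
    have t2 := hterm 2
    have e0 := heo 0
    have e1 := heo 1
    have e2 := heo 2
    have m01 := hmono' 0 1 (by decide)
    have m12 := hmono' 1 2 (by decide)
    have p2 : 0 < o 2 := Nat.pos_of_ne_zero fun h => by rw [h, mul_zero] at e2; omega
    -- In terms of the stabilizer orders this is 1/e₀ + 1/e₁ + 1/e₂ = 1 + 2/n; it forces e₀ = 2, e₁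
    -- ≤ 3, and e₂ ≤ 5 when e₁ = 3.
    have htot : o 0 + o 1 + o 2 = n + 2 := by omega
    have le3 : ∀ (c : ℕ) i, c ≤ e i → c * o i ≤ n := fun c i h => by
      rw [← heo i]; exact Nat.mul_le_mul_right _ h
    have mk : ∀ a b c, e 0 = a → e 1 = b → e 2 = c → OrbitType G [a, b, c] := by
      intro a b c ha hb hc
      refine ⟨fun i => P (σ i), hinj', ?_, hfree'⟩
      intro i
      rw [hPe]
      fin_cases i
      · exact ha
      · exact hb
      · exact hc
    have h0 : e 0 = 2 := by
      by_contra h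
      have h3 : 3 ≤ e 0 := by have := he2 0; omega
      have := le3 3 0 h3
      have := le3 3 1 (h3.trans m01)
      have := le3 3 2 (h3.trans (m01.trans m12))
      omega
    rw [h0] at e0
    have h1 : e 1 < 4 := by
      by_contra! h
      have := le3 4 1 h
      have := le3 4 2 (h.trans m12)
      omega
    have h1' := he2 1
    interval_cases h1v : e 1
    · left
      have o2 : o 2 = 2 := by omega
      rw [o2] at e2
      refine ⟨e 2, by omega, by omega, mk _ _ _ h0 rfl rfl⟩
    · right
      have h2 : e 2 < 6 := by
        by_contra! h
        have := le3 6 2 h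
        omega
      interval_cases h2v : e 2
      · left; exact ⟨by omega, mk _ _ _ h0 rfl rfl⟩
      · right; left; exact ⟨by omega, mk _ _ _ h0 rfl rfl⟩
      · right; right; exact ⟨by omega, mk _ _ _ h0 rfl rfl⟩

/-- The orbits with nontrivial stabilizers when some nontrivial element fixes only `P₀`. Here `q` is
one more than the number of these elements. -/
theorem wild_types (hp2 : p ≠ 2) (G : Subgroup (PGL2 k)) [Finite G] {P₀ : OnePoint k}
    (hwild : uniqueFixCount G P₀ ≠ 0) :
    ((∀ R, R ∉ orbit G P₀ → Nat.card (stabilizer G R) = 1) ∧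
      (orbit G P₀).ncard * (uniqueFixCount G P₀ - 1) + 2 = Nat.card G) ∨
    ∃ P₁, P₁ ∉ orbit G P₀ ∧ 2 ≤ Nat.card (stabilizer G P₁) ∧
      (∀ R, R ∉ orbit G P₀ → R ∉ orbit G P₁ → Nat.card (stabilizer G R) = 1) ∧
      (orbit G P₀).ncard * (uniqueFixCount G P₀ - 1) + 2 = (orbit G P₁).ncard := by
  obtain ⟨r, P, hinj, he, hfree, hsum⟩ := exists_orbit_representatives G
  have hloc := local_structure p hp2 G
  set n := Nat.card G with hn
  have hn0 : 0 < n := Nat.card_pos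
  -- An element fixing only P₀ lies in its stabilizer, so P₀ belongs to one of the represented
  -- orbits.
  obtain ⟨i₀, hi₀⟩ : ∃ i, P₀ ∈ orbit G (P i) := by
    by_contra! h
    have h1 := hfree P₀ h
    have h2 := hloc P₀
    have : Nontrivial {g : G // g ≠ 1 ∧ ∀ R : OnePoint k, g • R = R ↔ R = P₀} := by
      rw [← Finite.one_lt_card_iff_nontrivial]
      change 1 < uniqueFixCount G P₀
      omega
    obtain ⟨g, -⟩ := exists_pair_ne {g : G // g ≠ 1 ∧ ∀ R : OnePoint k, g • R = R ↔ R = P₀}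
    rw [Subgroup.card_eq_one] at h1
    have hg : g.1 ∈ stabilizer G P₀ := (g.2.2 P₀).2 rfl
    rw [h1] at hg
    exact g.2.1 hg
  have horb : orbit G P₀ = orbit G (P i₀) := orbit_eq_iff.2 hi₀
  have hu : uniqueFixCount G P₀ = uniqueFixCount G (P i₀) := by
    obtain ⟨g, rfl⟩ := hi₀
    exact uniqueFixCount_smul G g _
  rw [horb, hu]
  rw [hu] at hwild
  set e : Fin r → ℕ := fun i => Nat.card (stabilizer G (P i)) with he'
  set o : Fin r → ℕ := fun i => (orbit G (P i)).ncard with ho'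
  set u : Fin r → ℕ := fun i => uniqueFixCount G (P i) with hu'
  have heo : ∀ i, e i * o i = n := fun i => card_stabilizer_mul_ncard_orbit G _
  have he2 : ∀ i, 2 ≤ e i := he
  have ho : ∀ i, 0 < o i := fun i => Nat.pos_of_ne_zero fun h => by
    have := heo i
    simp [h] at this
    omega
  have hterm : ∀ i, o i * (e i - 1 + u i) + o i = n + o i * u i := fun i => by
    have h1 := heo i
    have h2 := he2 i
    obtain ⟨c, hc⟩ : ∃ c, e i = c + 1 := ⟨e i - 1, by omega⟩
    rw [hc] at h1 ⊢
    rw [Nat.add_sub_cancel]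
    linarith
  -- An orbit with u ≥ 2 alone contributes at least n + o out of 2n - 2. Hence a second one cannot
  -- occur.
  have hwterm : ∀ i, u i ≠ 0 → o i * (e i - 1 + u i) = n + o i * (u i - 1) ∧
      n + o i ≤ o i * (e i - 1 + u i) := fun i hi => by
    have h1 := hterm i
    have h2 : 2 ≤ u i := by
      rcases hloc (P i) with h | h
      · exact absurd h hi
      · exact h
    obtain ⟨c, hc⟩ : ∃ c, u i = c + 2 := ⟨u i - 2, by omega⟩
    rw [hc] at h1 ⊢
    have h3 : o i * (c + 2) = o i * c + 2 * o i := by ring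
    have h4 : o i * (c + 2 - 1) = o i * c + o i := by
      rw [show c + 2 - 1 = c + 1 from rfl]; ring
    omega
  have hhalf : ∀ i, n ≤ 2 * (o i * (e i - 1 + u i)) := fun i => by
    by_cases hi : u i = 0
    · have h1 := heo i
      have h2 := hterm i
      have : 2 * o i ≤ e i * o i := Nat.mul_le_mul_right _ (he2 i)
      rw [hi] at h2 ⊢
      omega
    · have := (hwterm i hi).2
      omega
  have hsum' : ∑ i, o i * (e i - 1 + u i) = 2 * (n - 1) := hsum
  have hsplit := Finset.add_sum_erase Finset.univ (fun i => o i * (e i - 1 + u i))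
    (Finset.mem_univ i₀)
  rw [hsum'] at hsplit
  have h0 := hwterm i₀ hwild
  -- Less than n remains after the orbit of P₀, and every other orbit takes at least n/2.
  have hcard : (Finset.univ.erase i₀).card ≤ 1 := by
    have h1 : (Finset.univ.erase i₀).card * n ≤
        ∑ i ∈ Finset.univ.erase i₀, 2 * (o i * (e i - 1 + u i)) := by
      rw [← smul_eq_mul]
      exact Finset.card_nsmul_le_sum _ _ _ fun i _ => hhalf i
    rw [← Finset.mul_sum] at h1
    by_contra! h
    have : 2 * n ≤ (Finset.univ.erase i₀).card * n := Nat.mul_le_mul_right _ h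
    have := ho i₀
    omega
  rcases Nat.lt_or_ge (Finset.univ.erase i₀).card 1 with hc | hc
  · left
    have hemp : Finset.univ.erase i₀ = ∅ := Finset.card_eq_zero.1 (by omega)
    have hall : ∀ i, i = i₀ := fun i => by
      by_contra h
      have : i ∈ Finset.univ.erase i₀ := Finset.mem_erase.2 ⟨h, Finset.mem_univ _⟩
      rw [hemp] at this
      simp at this
    refine ⟨fun R hR => hfree R fun i => by rw [hall i]; exact hR, ?_⟩
    rw [hemp, Finset.sum_empty, add_zero] at hsplit
    change o i₀ * (u i₀ - 1) + 2 = n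
    omega
  · right
    obtain ⟨i₁, hi₁⟩ := Finset.card_eq_one.1 (le_antisymm hcard hc)
    have hne : i₁ ≠ i₀ := by
      have : i₁ ∈ Finset.univ.erase i₀ := by rw [hi₁]; simp
      exact (Finset.mem_erase.1 this).1
    have hall : ∀ i, i = i₀ ∨ i = i₁ := fun i => by
      by_contra! h
      have : i ∈ Finset.univ.erase i₀ := Finset.mem_erase.2 ⟨h.1, Finset.mem_univ _⟩
      rw [hi₁] at this
      exact h.2 (Finset.mem_singleton.1 this)
    rw [hi₁, Finset.sum_singleton] at hsplit
    have hu1 : u i₁ = 0 := by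
      by_contra h
      have := (hwterm i₁ h).2
      omega
    have h1 := hterm i₁
    have h2 := ho i₀
    refine ⟨P i₁, fun h => hne (hinj _ _ h), he2 i₁, fun R hR hR' => hfree R fun i => ?_, ?_⟩
    · rcases hall i with h | h <;> rw [h] <;> assumption
    · change o i₀ * (u i₀ - 1) + 2 = o i₁
      rw [hu1] at h1 hsplit
      omega

end

/-! ### Recognition of A₄, S₄ and A₅ as abstract groups -/

section

open MulAction

/-- The image in the symmetric group has index 2, and the alternating group is the only such
subgroup. -/
theorem nonempty_mulEquiv_alternatingGroup {G α : Type*} [Group G] [Finite G] [Finite α] {n : ℕ}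
    (hα : Nat.card α = n) (f : G →* Equiv.Perm α) (hf : Function.Injective f)
    (hcard : 2 * Nat.card G = n.factorial) : Nonempty (G ≃* alternatingGroup (Fin n)) := by
  let e : α ≃ Fin n := Finite.equivFinOfCardEq hα
  let F : G →* Equiv.Perm (Fin n) := e.permCongrHom.toMonoidHom.comp f
  have hF : Function.Injective F := e.permCongrHom.injective.comp hf
  have hrange : Nat.card F.range = Nat.card G :=
    (Nat.card_congr (MonoidHom.ofInjective hF).toEquiv).symm
  have hindex : F.range.index = 2 := by
    have h := F.range.card_mul_index
    rw [hrange, Nat.card_perm, Nat.card_fin, ← hcard, mul_comm] at h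
    exact Nat.eq_of_mul_eq_mul_right Nat.card_pos h
  have heq := Equiv.Perm.eq_alternatingGroup_of_index_eq_two hindex
  exact ⟨(MonoidHom.ofInjective hF).trans (MulEquiv.subgroupCongr heq)⟩

theorem nonempty_mulEquiv_perm {G α : Type*} [Group G] [Finite G] [Finite α] {n : ℕ}
    (hα : Nat.card α = n) (f : G →* Equiv.Perm α) (hf : Function.Injective f)
    (hcard : Nat.card G = n.factorial) : Nonempty (G ≃* Equiv.Perm (Fin n)) := by
  let e : α ≃ Fin n := Finite.equivFinOfCardEq hα
  let F : G →* Equiv.Perm (Fin n) := e.permCongrHom.toMonoidHom.comp f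
  have hF : Function.Injective F := e.permCongrHom.injective.comp hf
  refine ⟨MulEquiv.ofBijective F ((Nat.bijective_iff_injective_and_card F).2 ⟨hF, ?_⟩)⟩
  rw [hcard, Nat.card_perm, Nat.card_fin]

/-- A q-subgroup normalizing a Sylow q-subgroup is contained in it, and Sylow subgroups are maximal
among q-subgroups. -/
theorem sylow_le_of_le_normalizer {G : Type*} [Group G] [Finite G] {q : ℕ} [Fact q.Prime]
    {S T : Sylow q G} (h : (T : Subgroup G) ≤ Subgroup.normalizer (S : Set G)) : S = T := by
  have h1 := T.isPGroup'.inf_normalizer_sylow S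
  have h2 : (T : Subgroup G) ≤ S := by
    rw [inf_eq_left.2 h] at h1
    exact inf_eq_left.1 h1.symm
  exact Sylow.ext (T.is_maximal' S.isPGroup' h2)

/-- A group of order `24` without normal subgroups of order `2` or `3` is the symmetric group. -/
theorem nonempty_mulEquiv_perm_four {G : Type*} [Group G] [Finite G] (h24 : Nat.card G = 24)
    (h2 : ∀ K : Subgroup G, K.Normal → Nat.card K ≠ 2)
    (h3 : ∀ K : Subgroup G, K.Normal → Nat.card K ≠ 3) :
    Nonempty (G ≃* Equiv.Perm (Fin 4)) := by
  have : Fact (Nat.Prime 3) := ⟨Nat.prime_three⟩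
  obtain ⟨T⟩ : Nonempty (Sylow 3 G) := inferInstance
  have hTcard : Nat.card T = 3 ∧ (T : Subgroup G).index = 8 := by
    obtain ⟨a, ha⟩ := T.isPGroup'.exists_card_eq
    have h := (T : Subgroup G).card_mul_index
    have h' := T.not_dvd_index
    rw [h24, ha] at h
    have ha3 : a < 3 := by
      by_contra! hc
      have : 3 ^ 3 ∣ 24 := (pow_dvd_pow 3 hc).trans (Dvd.intro _ h)
      omega
    rw [ha]
    interval_cases a <;> omega
  -- The number of Sylow 3-subgroups divides 8, is 1 modulo 3, and is not 1 because a unique one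
  -- would be normal of order 3.
  have hn3 : Nat.card (Sylow 3 G) = 4 := by
    have hd := T.card_dvd_index
    rw [hTcard.2] at hd
    have hm := card_sylow_modEq_one (p := 3) (G := G)
    have hle := Nat.le_of_dvd (by norm_num) hd
    have hne : Nat.card (Sylow 3 G) ≠ 1 := by
      intro h
      have : Subsingleton (Sylow 3 G) := (Nat.card_eq_one_iff_unique.1 h).1
      exact h3 T T.normal_of_subsingleton hTcard.1
    unfold Nat.ModEq at hm
    interval_cases Nat.card (Sylow 3 G) <;> omega
  let φ := toPermHom G (Sylow 3 G)
  have hK : ∀ S : Sylow 3 G, φ.ker ≤ Subgroup.normalizer (S : Set G) := by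
    intro S g hg
    have h1 : g • S = S := congrArg (fun σ : Equiv.Perm (Sylow 3 G) => σ S) (MonoidHom.mem_ker.1 hg)
    exact Sylow.smul_eq_iff_mem_normalizer.1 h1
  have hN : Nat.card (Subgroup.normalizer (T : Set G)) = 6 := by
    have h := (Subgroup.normalizer (T : Set G)).card_mul_index
    rw [← T.card_eq_index_normalizer, hn3, h24] at h
    omega
  have hdvd := Subgroup.card_dvd_of_le (hK T)
  rw [hN] at hdvd
  -- The kernel normalizes every Sylow 3-subgroup, so its order divides 6. An element of order 3 in
  -- it would generate a Sylow subgroup normalizing all the others, making it unique. Order 2 is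
  -- excluded by hypothesis.
  have hn3K : ¬ 3 ∣ Nat.card φ.ker := by
    intro h
    obtain ⟨x, hx⟩ := exists_prime_orderOf_dvd_card' 3 h
    have hxp : IsPGroup 3 (Subgroup.zpowers (x : G)) := by
      refine IsPGroup.of_card (n := 1) ?_
      rw [Nat.card_zpowers, Subgroup.orderOf_coe, hx, pow_one]
    obtain ⟨S, hS⟩ := hxp.exists_le_sylow
    have hScard : Nat.card S = 3 := by
      rw [Nat.card_congr (S.equiv T).toEquiv, hTcard.1]
    have hSK : (S : Subgroup G) ≤ φ.ker := by
      have : Subgroup.zpowers (x : G) = S := by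
        apply Subgroup.eq_of_le_of_card_ge hS
        rw [Nat.card_zpowers, Subgroup.orderOf_coe, hx]
        exact hScard.le
      rw [← this, Subgroup.zpowers_le]
      exact x.2
    have hall : ∀ S' : Sylow 3 G, S' = S := fun S' => sylow_le_of_le_normalizer (hSK.trans (hK S'))
    have : Nat.card (Sylow 3 G) = 1 :=
      Nat.card_eq_one_iff_unique.2 ⟨⟨fun a b => (hall a).trans (hall b).symm⟩, ⟨S⟩⟩
    omega
  have hKle := Nat.le_of_dvd (by norm_num) hdvd
  have hK2 := h2 φ.ker inferInstance
  have hKpos : 0 < Nat.card φ.ker := Nat.card_pos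
  have hK1 : Nat.card φ.ker = 1 := by
    generalize Nat.card φ.ker = c at *
    interval_cases c <;> omega
  refine nonempty_mulEquiv_perm hn3 φ ?_ (by rw [h24]; rfl)
  rw [← MonoidHom.ker_eq_bot_iff]
  exact Subgroup.card_eq_one.1 hK1

/-- A characterization of the alternating group `A₅` by its involutions. -/
theorem nonempty_mulEquiv_alternatingGroup_five {G : Type*} [Group G] [Finite G]
    (h60 : Nat.card G = 60)
    (hconj : ∀ s t : G, orderOf s = 2 → orderOf t = 2 → IsConj s t)
    (hcent : ∀ t : G, orderOf t = 2 → Nat.card (Subgroup.centralizer {t}) = 4)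
    (h4 : ∀ g : G, orderOf g ≠ 4) (h3 : ∀ K : Subgroup G, K.Normal → Nat.card K ≠ 3) :
    Nonempty (G ≃* alternatingGroup (Fin 5)) := by
  have : Fact (Nat.Prime 2) := ⟨Nat.prime_two⟩
  have hScard : ∀ S : Sylow 2 G, Nat.card S = 4 := by
    intro S
    obtain ⟨a, ha⟩ := S.isPGroup'.exists_card_eq
    have h := (S : Subgroup G).card_mul_index
    have h' := S.not_dvd_index
    rw [h60, ha] at h
    have ha3 : a < 3 := by
      by_contra! hc
      have : 2 ^ 3 ∣ 60 := (pow_dvd_pow 2 hc).trans (Dvd.intro _ h)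
      omega
    rw [ha]
    interval_cases a <;> omega
  have hord : ∀ (S : Sylow 2 G) (s : G), s ∈ S → s ≠ 1 → orderOf s = 2 := by
    intro S s hs hs1
    have h1 : orderOf (⟨s, hs⟩ : S) ∣ 4 := by rw [← hScard S]; exact orderOf_dvd_natCard _
    rw [← Subgroup.orderOf_coe] at h1
    change orderOf s ∣ 4 at h1
    have h2 := h4 s
    have h3 : orderOf s ≠ 1 := fun h => hs1 (orderOf_eq_one_iff.1 h)
    have hle := Nat.le_of_dvd (by norm_num) h1
    interval_cases orderOf s <;> omega
  have hsq : ∀ (S : Sylow 2 G) (s : G), s ∈ S → s * s = 1 := by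
    intro S s hs
    by_cases h : s = 1
    · simp [h]
    · rw [← pow_two, ← hord S s hs h]; exact pow_orderOf_eq_one s
  -- Without elements of order 4 a Sylow 2-subgroup is elementary abelian of order 4, so it lies in
  -- the centralizer of each of its involutions, which also has order 4.
  have hSc : ∀ (S : Sylow 2 G) (t : G), t ∈ S → t ≠ 1 →
      (S : Subgroup G) = Subgroup.centralizer {t} := by
    intro S t ht ht1
    apply Subgroup.eq_of_le_of_card_ge
    · intro s hs
      rw [Subgroup.mem_centralizer_singleton_iff]
      have h1 := hsq S s hs
      have h2 := hsq S t ht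
      have h3 := hsq S (s * t) (mul_mem hs ht)
      calc s * t = (s * t)⁻¹ := (inv_eq_of_mul_eq_one_right h3).symm
        _ = t⁻¹ * s⁻¹ := mul_inv_rev _ _
        _ = t * s := by rw [inv_eq_of_mul_eq_one_right h1, inv_eq_of_mul_eq_one_right h2]
    · exact (hcent t (hord S t ht ht1)).trans (hScard S).symm |>.le
  obtain ⟨t₀, ht₀⟩ : ∃ t : G, orderOf t = 2 :=
    exists_prime_orderOf_dvd_card' 2 (by rw [h60]; norm_num)
  -- The involutions form a single class, of size 60/4.
  have hinv : Nat.card {t : G // orderOf t = 2} = 15 := by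
    have h1 := (Subgroup.centralizer {t₀}).card_mul_index
    rw [hcent t₀ ht₀, h60] at h1
    have h2 : (stabilizer (ConjAct G) t₀).index = 15 := by
      have h3 := (stabilizer (ConjAct G) t₀).card_mul_index
      rw [← Subgroup.nat_card_centralizer_nat_card_stabilizer, hcent t₀ ht₀] at h3
      change _ = Nat.card G at h3
      omega
    rw [index_stabilizer] at h2
    rw [← h2]
    have : orbit (ConjAct G) t₀ = {t : G | orderOf t = 2} := by
      ext t
      rw [ConjAct.mem_orbit_conjAct]
      constructor
      · intro h
        obtain ⟨c, rfl⟩ := isConj_iff.1 h.symm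
        change orderOf (c * t₀ * c⁻¹) = 2
        rw [← ht₀]
        exact MulEquiv.orderOf_eq (MulAut.conj c) t₀
      · exact fun h => hconj _ _ h ht₀
    rw [this]
    rfl
  have hex : ∀ t : {t : G // orderOf t = 2}, ∃ S : Sylow 2 G, t.1 ∈ S := by
    intro t
    have hp : IsPGroup 2 (Subgroup.zpowers t.1) := by
      refine IsPGroup.of_card (n := 1) ?_
      rw [Nat.card_zpowers, t.2, pow_one]
    obtain ⟨S, hS⟩ := hp.exists_le_sylow
    exact ⟨S, hS (Subgroup.mem_zpowers _)⟩
  choose F hF using hex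
  have ne1 : ∀ t : G, orderOf t = 2 → t ≠ 1 := by
    rintro t ht rfl
    simp at ht
  -- Each involution lies in just one Sylow 2-subgroup, its centralizer, and each Sylow 2-subgroup
  -- contains three involutions. Thus there are 15/3 = 5 of them.
  have hfib : ∀ S : Sylow 2 G, Nat.card {t : {t : G // orderOf t = 2} // F t = S} = 3 := by
    intro S
    have e : {t : {t : G // orderOf t = 2} // F t = S} ≃ {s : S // s ≠ 1} :=
      { toFun := fun t => ⟨⟨t.1.1, by have := hF t.1; rwa [t.2] at this⟩,
          fun h => ne1 _ t.1.2 (congrArg Subtype.val h)⟩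
        invFun := fun s => ⟨⟨s.1.1, hord S _ s.1.2 fun h => s.2 (Subtype.ext h)⟩, by
          have h1 : (s.1.1 : G) ≠ 1 := fun h => s.2 (Subtype.ext h)
          apply Sylow.ext
          rw [hSc S s.1.1 s.1.2 h1, hSc _ s.1.1 (hF ⟨s.1.1, _⟩) h1]⟩
        left_inv := fun t => rfl
        right_inv := fun s => rfl }
    classical
    have := Fintype.ofFinite S
    rw [Nat.card_congr e, Nat.card_eq_fintype_card, Fintype.card_subtype_compl,
      Fintype.card_subtype_eq, ← Nat.card_eq_fintype_card]
    have := hScard S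
    change Nat.card (S : Subgroup G) - 1 = 3
    omega
  have hn2 : Nat.card (Sylow 2 G) = 5 := by
    have := Fintype.ofFinite (Sylow 2 G)
    rw [← Nat.card_congr (Equiv.sigmaFiberEquiv F), Nat.card_sigma,
      Finset.sum_congr rfl fun S _ => hfib S, Finset.sum_const, Finset.card_univ,
      ← Nat.card_eq_fintype_card, smul_eq_mul] at hinv
    omega
  let φ := toPermHom G (Sylow 2 G)
  have hK : ∀ S : Sylow 2 G, φ.ker ≤ Subgroup.normalizer (S : Set G) := by
    intro S g hg
    have h1 : g • S = S := congrArg (fun σ : Equiv.Perm (Sylow 2 G) => σ S) (MonoidHom.mem_ker.1 hg)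
    exact Sylow.smul_eq_iff_mem_normalizer.1 h1
  obtain ⟨S₀⟩ : Nonempty (Sylow 2 G) := inferInstance
  have hN : Nat.card (Subgroup.normalizer (S₀ : Set G)) = 12 := by
    have h := (Subgroup.normalizer (S₀ : Set G)).card_mul_index
    rw [← S₀.card_eq_index_normalizer, hn2, h60] at h
    omega
  have hdvd := Subgroup.card_dvd_of_le (hK S₀)
  rw [hN] at hdvd
  -- A normal subgroup containing one involution contains all of them, hence all Sylow 2-subgroups;
  -- inside a kernel normalizing each of these, that would make them equal. The order of the kernel
  -- divides 12, so only 1 and the excluded 3 remain.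
  have hodd : ¬ 2 ∣ Nat.card φ.ker := by
    intro h
    obtain ⟨x, hx⟩ := exists_prime_orderOf_dvd_card' 2 h
    rw [← Subgroup.orderOf_coe] at hx
    have hinK : ∀ t : G, orderOf t = 2 → t ∈ φ.ker := by
      intro t ht
      obtain ⟨c, rfl⟩ := isConj_iff.1 (hconj x t hx ht)
      exact (inferInstance : φ.ker.Normal).conj_mem _ x.2 c
    have hall : ∀ S' : Sylow 2 G, S' = S₀ := fun S' => by
      refine sylow_le_of_le_normalizer (le_trans ?_ (hK S'))
      intro s hs
      by_cases h1 : s = 1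
      · rw [h1]; exact one_mem _
      · exact hinK s (hord S₀ s hs h1)
    have : Nat.card (Sylow 2 G) = 1 :=
      Nat.card_eq_one_iff_unique.2 ⟨⟨fun a b => (hall a).trans (hall b).symm⟩, ⟨S₀⟩⟩
    omega
  have hKle := Nat.le_of_dvd (by norm_num) hdvd
  have hK3 := h3 φ.ker inferInstance
  have hKpos : 0 < Nat.card φ.ker := Nat.card_pos
  have hK1 : Nat.card φ.ker = 1 := by
    generalize Nat.card φ.ker = c at *
    interval_cases c <;> omega
  refine nonempty_mulEquiv_alternatingGroup hn2 φ ?_ (by rw [h60]; rfl)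
  rw [← MonoidHom.ker_eq_bot_iff]
  exact Subgroup.card_eq_one.1 hK1

end

/-! ### Stabilizers, involutions and the orbit criterion for A₅ -/

section

open Matrix OnePoint MulAction

variable {k : Type*} [Field k]

theorem OrbitType.card_stabilizer {G : Subgroup (PGL2 k)} [Finite G] {e : List ℕ}
    (he : OrbitType G e) (R : OnePoint k) :
    Nat.card (stabilizer G R) = 1 ∨ Nat.card (stabilizer G R) ∈ e := by
  obtain ⟨P, -, hcard, hfree⟩ := he
  by_cases h : ∀ i, R ∉ orbit G (P i)
  · exact Or.inl (hfree R h)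
  · push Not at h
    obtain ⟨i, hi⟩ := h
    right
    rw [card_stabilizer_eq_of_mem_orbit G hi, hcard]
    exact List.get_mem e i

/-- A free orbit may be listed with entry 1, and exists because the line is infinite. This supplies
the degenerate lists for the trivial group, the dihedral group with m = 1, and K₁. -/
theorem OrbitType.append_one [IsAlgClosed k] {G : Subgroup (PGL2 k)} [Finite G] {e : List ℕ}
    (he : OrbitType G e) : OrbitType G (e ++ [1]) := by
  obtain ⟨P, hinj, hcard, hfree⟩ := he
  obtain ⟨R, hR⟩ := exists_not_mem_finite (Set.finite_iUnion fun i => finite_orbit G (P i))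
  simp only [Set.mem_iUnion, not_exists] at hR
  have hlen : ∀ i : Fin (e ++ [1]).length, ¬ i.1 < e.length → i.1 = e.length := fun i hi => by
    have := i.2
    simp only [List.length_append, List.length_singleton] at this
    omega
  refine ⟨fun i => if h : i.1 < e.length then P ⟨i, h⟩ else R, fun i j => ?_, fun i => ?_,
    fun S hS => ?_⟩
  · dsimp only
    by_cases hi : i.1 < e.length <;> by_cases hj : j.1 < e.length <;>
      simp only [hi, hj, dite_true, dite_false]
    · intro h
      exact Fin.ext (Fin.mk.inj_iff.1 (hinj _ _ h))
    · intro h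
      exact absurd ((orbit_eq_iff.2 h) ▸ mem_orbit_self R) (hR _)
    · intro h
      exact absurd h (hR _)
    · intro _
      exact Fin.ext ((hlen i hi).trans (hlen j hj).symm)
  · dsimp only
    split_ifs with hi
    · rw [hcard]
      simp [hi]
    · rw [hfree R hR]
      simp [hlen i hi]
  · refine hfree S fun i => ?_
    have := hS ⟨i.1, by simp⟩
    simpa using this

theorem exists_orderOf_dvd_card_stabilizer [IsAlgClosed k] {G : Subgroup (PGL2 k)} (g : G) :
    ∃ P : OnePoint k, orderOf g ∣ Nat.card (stabilizer G P) := by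
  obtain ⟨P, hP⟩ := exists_fixed_point (g : PGL2 k)
  refine ⟨P, ?_⟩
  have h : g ∈ stabilizer G P := hP
  rw [← Subgroup.orderOf_mk g h]
  exact orderOf_dvd_natCard _

theorem exists_aff_pow (a : kˣ) (b : k) (n : ℕ) : ∃ c, aff a b ^ n = aff (a ^ n) c := by
  induction n with
  | zero => exact ⟨0, by simp⟩
  | succ n ih =>
    obtain ⟨c, hc⟩ := ih
    exact ⟨_, by rw [pow_succ, hc, aff_mul_aff, pow_succ]⟩

/-- A stabilizer without elements having a single fixed point is cyclic. -/
theorem exists_orderOf_eq_card_stabilizer {G : Subgroup (PGL2 k)} [Finite G] {P : OnePoint k}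
    (hP : uniqueFixCount G P = 0) : ∃ g : G, orderOf g = Nat.card (stabilizer G P) := by
  obtain ⟨γ, hγ⟩ := exists_smul_eq_infty P
  rw [← uniqueFixCount_conj γ, hγ] at hP
  rw [← card_stabilizer_conj γ, hγ]
  set K := conjSubgroup γ G
  suffices ∃ g : K, orderOf g = Nat.card (stabilizer K (∞ : OnePoint k)) by
    obtain ⟨g, hg⟩ := this
    exact ⟨(conjSubgroupEquiv γ G).symm g, by rw [MulEquiv.orderOf_eq, hg]⟩
  have ht := uniqueFixCount_infty K
  rw [hP] at ht
  obtain ⟨a, ha⟩ := IsCyclic.exists_ofOrder_eq_natCard (α := mults K)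
  obtain ⟨b, hb⟩ := a.2
  have hcard := card_stabilizer_infty K
  rw [← ht, zero_add, one_mul] at hcard
  have hst : (⟨aff a b, hb⟩ : K) ∈ stabilizer K (∞ : OnePoint k) := aff_smul_infty _ _
  refine ⟨⟨aff a b, hb⟩, Nat.dvd_antisymm ?_ ?_⟩
  · rw [← Subgroup.orderOf_mk _ hst]
    exact orderOf_dvd_natCard _
  · rw [hcard, ← ha, ← Subgroup.orderOf_coe, Subgroup.orderOf_mk]
    apply orderOf_dvd_of_pow_eq_one
    obtain ⟨c, hc⟩ := exists_aff_pow (a : kˣ) b (orderOf (aff (a : kˣ) b))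
    rw [pow_orderOf_eq_one, eq_comm, aff_eq_one] at hc
    exact hc.1

theorem card_transl_dvd (G : Subgroup (PGL2 k)) [Finite G] :
    Nat.card (transl G) ∣ Nat.card G := by
  refine dvd_trans ⟨_, card_stabilizer_infty G⟩ (Subgroup.card_subgroup_dvd_card _)

section CharP

variable (p : ℕ) [CharP k p]

/-- A nontrivial group of translations has order a positive power of p, and its order divides |G|.
-/
theorem uniqueFixCount_eq_zero_of_not_dvd (hp2 : p ≠ 2) {G : Subgroup (PGL2 k)} [Finite G]
    (h : ¬ p ∣ Nat.card G) (P : OnePoint k) : uniqueFixCount G P = 0 := by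
  obtain ⟨γ, hγ⟩ := exists_smul_eq_infty P
  rw [← uniqueFixCount_conj γ, hγ]
  have h1 := uniqueFixCount_infty (conjSubgroup γ G)
  have h2 := card_transl_dvd (conjSubgroup γ G)
  rw [card_conjSubgroup] at h2
  rcases card_addSubgroup_cases p hp2 (transl (conjSubgroup γ G)) with h3 | ⟨_, t, ht, h3, -⟩
  · omega
  · exact absurd ((dvd_pow_self p ht.ne').trans (h3 ▸ h2)) h

/-- An element of order p fixes a point. If the stabilizer there contains no translation, its order
is that of a finite group of multipliers, which is prime to p. -/
theorem not_dvd_of_uniqueFixCount_eq_zero [IsAlgClosed k] {G : Subgroup (PGL2 k)} [Finite G]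
    (h : ∀ P, uniqueFixCount G P = 0) : ¬ p ∣ Nat.card G := by
  intro hdvd
  rcases CharP.char_is_prime_or_zero k p with hp | hp
  · have : Fact p.Prime := ⟨hp⟩
    obtain ⟨g, hg⟩ := exists_prime_orderOf_dvd_card' p hdvd
    obtain ⟨P, hP⟩ := exists_fixed_point (g : PGL2 k)
    obtain ⟨γ, hγ⟩ := exists_smul_eq_infty P
    have h0 := h P
    rw [← uniqueFixCount_conj γ, hγ] at h0
    have h1 := uniqueFixCount_infty (conjSubgroup γ G)
    rw [h0, zero_add] at h1
    have hd : p ∣ Nat.card (stabilizer G P) := by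
      rw [← hg, ← Subgroup.orderOf_mk g (show g ∈ stabilizer G P from hP)]
      exact orderOf_dvd_natCard _
    rw [← card_stabilizer_conj γ, hγ, card_stabilizer_infty, ← h1, one_mul] at hd
    exact not_dvd_card_units p _ hd
  · rw [hp, zero_dvd_iff] at hdvd
    exact Nat.card_pos.ne' hdvd

end CharP

/-- A normal subgroup of prime order forces a point with a large stabilizer. -/
theorem exists_card_le_of_normal [IsAlgClosed k] {G : Subgroup (PGL2 k)} [Finite G]
    {K : Subgroup G} (hK : K.Normal) (hp : (Nat.card K).Prime) :
    ∃ P : OnePoint k, Nat.card G ≤ 2 * Nat.card (stabilizer G P) := by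
  have : Fact (Nat.card K).Prime := ⟨hp⟩
  obtain ⟨g, hg⟩ := exists_prime_orderOf_dvd_card' (G := K) (Nat.card K) dvd_rfl
  have hgen : ∀ h : K, h ∈ Subgroup.zpowers g := fun h => by
    have h1 : Subgroup.zpowers g = ⊤ :=
      Subgroup.eq_top_of_card_eq _ (by rw [Nat.card_zpowers, hg])
    simp [h1]
  have hg1 : (g : G) ≠ 1 := fun h => by
    rw [← Subgroup.orderOf_coe, h, orderOf_one] at hg
    exact hp.one_lt.ne hg
  obtain ⟨P, R, hPR⟩ := exists_fixed_points_sub hg1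
  refine ⟨P, ?_⟩
  have hPfix : ∀ h ∈ K, h • P = P := fun h hh => by
    obtain ⟨i, hi⟩ := hgen ⟨h, hh⟩
    have h1 : (g : G) ∈ stabilizer G P := (hPR P).2 (Or.inl rfl)
    have h2 : (g : G) ^ i = h := congrArg Subtype.val hi
    exact h2 ▸ (stabilizer G P).zpow_mem h1 i
  -- For h in G the conjugate h⁻¹gh lies in K and fixes P, so g fixes hP; but g has only the fixed
  -- points P and R.
  have hsub : orbit G P ⊆ {P, R} := by
    rintro _ ⟨h, rfl⟩
    have h1 := hPfix _ (hK.conj_mem _ g.2 h⁻¹)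
    rw [inv_inv, mul_smul, mul_smul, inv_smul_eq_iff] at h1
    exact (hPR _).1 h1
  have h2 := (Set.ncard_le_ncard hsub (Set.toFinite _)).trans (Set.ncard_insert_le _ _)
  rw [Set.ncard_singleton] at h2
  rw [← card_stabilizer_mul_ncard_orbit G P, mul_comm]
  exact Nat.mul_le_mul_right _ h2

theorem exists_double_eq (h2 : (2 : k) ≠ 0) (H : AddSubgroup k) [Finite H] {x : k} (hx : x ∈ H) :
    ∃ y ∈ H, 2 * y = x := by
  have hinj : Function.Injective fun y : H => y + y := fun y z h => by
    have h1 : (y : k) + y = z + z := congrArg Subtype.val h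
    exact Subtype.ext (mul_left_cancel₀ h2 (by rw [two_mul, two_mul, h1]))
  obtain ⟨y, hy⟩ := Finite.injective_iff_surjective.1 hinj ⟨x, hx⟩
  exact ⟨y, y.2, by rw [two_mul]; exact congrArg Subtype.val hy⟩

theorem units_eq_one_or_neg_one {a : kˣ} (h : a * a = 1) : a = 1 ∨ a = -1 := by
  have h1 : (a : k) * a = 1 := congrArg Units.val h
  rcases mul_self_eq_one_iff.1 h1 with h | h
  · exact Or.inl (Units.ext h)
  · exact Or.inr (Units.ext (by simpa using h))

theorem exists_aff_neg_one (h2 : (2 : k) ≠ 0) {s : PGL2 k} (hs1 : s ≠ 1) (hs : s * s = 1)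
    (h : s • (∞ : OnePoint k) = ∞) : ∃ b, s = aff (-1) b := by
  obtain ⟨a, b, rfl⟩ := exists_aff h
  rw [aff_mul_aff, aff_eq_one] at hs
  rcases units_eq_one_or_neg_one hs.1 with rfl | rfl
  · exfalso
    have hb : 2 * b = 0 := by simpa [two_mul] using hs.2
    exact hs1 (aff_eq_one.2 ⟨rfl, (mul_eq_zero.1 hb).resolve_left h2⟩)
  · exact ⟨b, rfl⟩

theorem mul_self_conj {γ s : PGL2 k} (hs : s * s = 1) :
    γ * s * γ⁻¹ * (γ * s * γ⁻¹) = 1 := by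
  rw [show γ * s * γ⁻¹ * (γ * s * γ⁻¹) = γ * (s * s) * γ⁻¹ by group, hs]
  group

/-- Two involutions with a common fixed point are conjugate under its stabilizer. -/
theorem exists_conj_of_involutions (h2 : (2 : k) ≠ 0) {G : Subgroup (PGL2 k)} [Finite G]
    {P : OnePoint k} {s t : PGL2 k} (hs : s ∈ G) (ht : t ∈ G) (hs1 : s ≠ 1) (ht1 : t ≠ 1)
    (hss : s * s = 1) (htt : t * t = 1) (hsP : s • P = P) (htP : t • P = P) :
    ∃ h ∈ G, h • P = P ∧ h * s * h⁻¹ = t := by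
  obtain ⟨γ, hγ⟩ := exists_smul_eq_infty P
  obtain ⟨b, hb⟩ := exists_aff_neg_one h2 (s := γ * s * γ⁻¹) (by simpa using hs1)
    (mul_self_conj hss) (by rw [← hγ, conj_smul, hsP])
  obtain ⟨c, hc⟩ := exists_aff_neg_one h2 (s := γ * t * γ⁻¹) (by simpa using ht1)
    (mul_self_conj htt) (by rw [← hγ, conj_smul, htP])
  -- The two involutions are -x + b and -x + c. Their product is translation by c - b, and
  -- translation by half of it conjugates the first into the second.
  have hmem : c - b ∈ transl (conjSubgroup γ G) := by
    rw [mem_transl]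
    have h3 := (conjSubgroup γ G).mul_mem (conj_mem_conjSubgroup (γ := γ) ht)
      (conj_mem_conjSubgroup (γ := γ) hs)
    rw [hb, hc, aff_mul_aff] at h3
    convert h3 using 2 <;> simp; ring
  obtain ⟨y, hy, hyx⟩ := exists_double_eq h2 _ hmem
  rw [mem_transl, mem_conjSubgroup] at hy
  refine ⟨_, hy, ?_, ?_⟩
  · rw [mul_smul, mul_smul, hγ, aff_smul_infty, ← hγ, inv_smul_smul]
  · have h4 : aff 1 y * (γ * s * γ⁻¹) * (aff 1 y)⁻¹ = γ * t * γ⁻¹ := by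
      rw [hb, hc, aff_inv, aff_mul_aff, aff_mul_aff]
      congr 1
      · simp
      · simp
        linear_combination hyx
    rw [show γ⁻¹ * aff 1 y * γ * s * (γ⁻¹ * aff 1 y * γ)⁻¹ =
      γ⁻¹ * (aff 1 y * (γ * s * γ⁻¹) * (aff 1 y)⁻¹) * γ by group, h4]
    group

/-- The hypothesis on |G_P| says that the multiplier group has order 2. With P at ∞, g is then ±x +
c, and commuting with -x + b forces c = 0 or c = b according to the sign. -/
theorem eq_one_or_eq_of_commute (h2 : (2 : k) ≠ 0) {G : Subgroup (PGL2 k)} [Finite G]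
    {P : OnePoint k} (hP : Nat.card (stabilizer G P) = 2 * (uniqueFixCount G P + 1))
    {g t : PGL2 k} (hg : g ∈ G) (ht1 : t ≠ 1) (htt : t * t = 1)
    (hgP : g • P = P) (htP : t • P = P) (hgt : g * t = t * g) : g = 1 ∨ g = t := by
  obtain ⟨γ, hγ⟩ := exists_smul_eq_infty P
  obtain ⟨b, hb⟩ := exists_aff_neg_one h2 (s := γ * t * γ⁻¹) (by simpa using ht1)
    (mul_self_conj htt) (by rw [← hγ, conj_smul, htP])
  obtain ⟨a, c, hc⟩ := exists_aff (g := γ * g * γ⁻¹) (by rw [← hγ, conj_smul, hgP])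
  rw [← uniqueFixCount_conj γ, hγ, ← card_stabilizer_conj γ, hγ, uniqueFixCount_infty,
    card_stabilizer_infty, mul_comm] at hP
  have hd : Nat.card (mults (conjSubgroup γ G)) = 2 :=
    Nat.eq_of_mul_eq_mul_right Nat.card_pos hP
  have ha : a ^ 2 = 1 := by
    rw [← hd, ← mem_iff_pow_card_eq_one, mem_mults]
    exact ⟨c, hc ▸ conj_mem_conjSubgroup hg⟩
  have hcomm : (γ * g * γ⁻¹) * (γ * t * γ⁻¹) = (γ * t * γ⁻¹) * (γ * g * γ⁻¹) := by
    rw [show (γ * g * γ⁻¹) * (γ * t * γ⁻¹) = γ * (g * t) * γ⁻¹ by group, hgt]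
    group
  rw [hb, hc, aff_mul_aff, aff_mul_aff, aff_inj] at hcomm
  rcases units_eq_one_or_neg_one (sq a ▸ ha) with rfl | rfl
  · left
    have hc0 : 2 * c = 0 := by
      have := hcomm.2
      simp at this
      linear_combination this
    rw [(mul_eq_zero.1 hc0).resolve_left h2, aff_one_zero] at hc
    simpa using hc
  · right
    have hc0 : 2 * (c - b) = 0 := by
      have := hcomm.2
      simp at this
      linear_combination this
    rw [← sub_eq_zero.1 ((mul_eq_zero.1 hc0).resolve_left h2), ← hc] at hb
    simpa using hb.symm

/-- With one fixed point at ∞ the involution is -x + b, which also fixes b/2. -/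
theorem exists_ne_fixed_points [IsAlgClosed k] (h2 : (2 : k) ≠ 0) {t : PGL2 k} (ht1 : t ≠ 1)
    (htt : t * t = 1) : ∃ P R : OnePoint k, P ≠ R ∧ ∀ Q, t • Q = Q ↔ Q = P ∨ Q = R := by
  obtain ⟨P, R, h⟩ := exists_fixed_points ht1
  refine ⟨P, R, ?_, h⟩
  rintro rfl
  obtain ⟨γ, hγ⟩ := exists_smul_eq_infty P
  obtain ⟨b, hb⟩ := exists_aff_neg_one h2 (s := γ * t * γ⁻¹) (by simpa using ht1)
    (mul_self_conj htt) (by rw [← hγ, conj_smul, (h P).2 (Or.inl rfl)])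
  have h3 : (γ * t * γ⁻¹) • ((b / 2 : k) : OnePoint k) = ((b / 2 : k) : OnePoint k) := by
    rw [hb, aff_smul_coe]
    congr 1
    simp
    field_simp
    ring
  rw [mul_smul, mul_smul, smul_eq_iff_eq_inv_smul, h, or_self, inv_smul_eq_iff, hγ] at h3
  exact OnePoint.coe_ne_infty _ h3

/-- The involutions are conjugate because the points with stabilizer of even order form one orbit.
The centralizer of an involution t acts transitively on its two fixed points, with stabilizer {1,
t}, so it has order 4. An element of order 4 would fix a point with stabilizer order divisible by 4,
and a normal subgroup of order 3 would give a stabilizer of order at least 30. The criterion serves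
both type (2,3,5) and type (6,5). -/
theorem nonempty_mulEquiv_alternatingGroup_five_of_orbits [IsAlgClosed k] (h2 : (2 : k) ≠ 0)
    (G : Subgroup (PGL2 k)) [Finite G] (h60 : Nat.card G = 60)
    (hev : ∀ P Q : OnePoint k, 2 ∣ Nat.card (stabilizer G P) → 2 ∣ Nat.card (stabilizer G Q) →
      P ∈ orbit G Q)
    (htwo : ∀ P : OnePoint k, 2 ∣ Nat.card (stabilizer G P) →
      Nat.card (stabilizer G P) = 2 * (uniqueFixCount G P + 1))
    (hfour : ∀ P : OnePoint k, ¬ 4 ∣ Nat.card (stabilizer G P))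
    (hlt : ∀ P : OnePoint k, Nat.card (stabilizer G P) < 30) :
    Nonempty (G ≃* alternatingGroup (Fin 5)) := by
  have hdvd : ∀ (t : G) (P : OnePoint k), orderOf t = 2 → (t : PGL2 k) • P = P →
      2 ∣ Nat.card (stabilizer G P) := fun t P ht hP => by
    have hP' : t ∈ stabilizer G P := hP
    have h := orderOf_dvd_natCard (⟨t, hP'⟩ : stabilizer G P)
    rwa [Subgroup.orderOf_mk, ht] at h
  have hne : ∀ t : G, orderOf t = 2 → (t : PGL2 k) ≠ 1 := fun t ht h => by
    rw [← Subgroup.orderOf_coe, h, orderOf_one] at ht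
    omega
  have hsq : ∀ t : G, orderOf t = 2 → (t : PGL2 k) * t = 1 := fun t ht => by
    have := pow_orderOf_eq_one t
    rw [ht, sq] at this
    exact congrArg Subtype.val this
  have key : ∀ (s t : G) (P Q : OnePoint k), orderOf s = 2 → orderOf t = 2 →
      (s : PGL2 k) • P = P → (t : PGL2 k) • Q = Q →
      ∃ h : G, (h : PGL2 k) • P = Q ∧ h * s * h⁻¹ = t := by
    intro s t P Q hs ht hsP htQ
    obtain ⟨g, hg⟩ := hev Q P (hdvd t Q ht htQ) (hdvd s P hs hsP)
    change (g : PGL2 k) • P = Q at hg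
    obtain ⟨h, hh, hhQ, hhs⟩ := exists_conj_of_involutions h2 (G := G) (P := Q)
      (s := g * s * (g : PGL2 k)⁻¹) (t := t) (g * s * g⁻¹ : G).2 t.2 (by simpa using hne s hs)
      (hne t ht) (mul_self_conj (hsq s hs)) (hsq t ht) (by rw [← hg, conj_smul, hsP]) htQ
    refine ⟨⟨h, hh⟩ * g, ?_, Subtype.ext ?_⟩
    · change (h * g) • P = Q
      rw [mul_smul, hg, hhQ]
    · change (h * g) * s * (h * g)⁻¹ = (t : PGL2 k)
      rw [← hhs]
      group
  refine nonempty_mulEquiv_alternatingGroup_five h60 ?_ ?_ ?_ ?_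
  · intro s t hs ht
    obtain ⟨P, hP⟩ := exists_fixed_point (s : PGL2 k)
    obtain ⟨Q, hQ⟩ := exists_fixed_point (t : PGL2 k)
    obtain ⟨h, -, hh⟩ := key s t P Q hs ht hP hQ
    exact isConj_iff.2 ⟨h, hh⟩
  · intro t ht
    obtain ⟨P, Q, hPQ, hfix⟩ := exists_ne_fixed_points h2 (hne t ht) (hsq t ht)
    have htP := (hfix P).2 (Or.inl rfl)
    have htQ := (hfix Q).2 (Or.inr rfl)
    obtain ⟨g, hgP, hg⟩ := key t t P Q ht ht htP htQ
    set C := Subgroup.centralizer {t} with hC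
    have hmemC : ∀ c : G, c ∈ C ↔ c * t = t * c := fun c => by
      rw [hC, Subgroup.mem_centralizer_singleton_iff]
    have horb : orbit C P = {P, Q} := by
      ext R
      constructor
      · rintro ⟨c, rfl⟩
        change ((c : G) : PGL2 k) • P = P ∨ ((c : G) : PGL2 k) • P = Q
        rw [← hfix, ← mul_smul]
        have h3 : (t : PGL2 k) * (c : G) = (c : G) * t :=
          congrArg Subtype.val ((hmemC c).1 c.2).symm
        rw [h3, mul_smul, htP]
      · rintro (rfl | rfl)
        · exact mem_orbit_self _
        · exact ⟨⟨g, (hmemC g).2 (mul_inv_eq_iff_eq_mul.1 hg)⟩, hgP⟩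
    have hstab : Nat.card (stabilizer C P) = 2 := by
      have htC : t ∈ C := (hmemC t).2 rfl
      have h1 : stabilizer C P = Subgroup.zpowers ⟨t, htC⟩ := by
        apply le_antisymm
        · rintro c hc
          rcases eq_one_or_eq_of_commute h2 (htwo P (hdvd t P ht htP)) (c : G).2 (hne t ht)
            (hsq t ht) hc htP (congrArg Subtype.val ((hmemC c).1 c.2)) with h | h
          · rw [show c = 1 from Subtype.ext (Subtype.ext h)]
            exact one_mem _
          · rw [show c = ⟨t, htC⟩ from Subtype.ext (Subtype.ext h)]
            exact Subgroup.mem_zpowers _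
        · rw [Subgroup.zpowers_le]
          exact htP
      rw [h1, Nat.card_zpowers, Subgroup.orderOf_mk, ht]
    have h3 := (stabilizer C P).card_mul_index
    rw [index_stabilizer, horb, Set.ncard_pair hPQ, hstab] at h3
    exact h3.symm
  · intro g hg
    obtain ⟨P, hP⟩ := exists_orderOf_dvd_card_stabilizer g
    exact hfour P (hg ▸ hP)
  · intro K hK h3
    obtain ⟨P, hP⟩ := exists_card_le_of_normal hK (h3 ▸ Nat.prime_three)
    have := hlt P
    omega

end

/-! ### Cyclic and dihedral groups -/

section

open Matrix OnePoint MulAction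

section Groups

theorem nonempty_mulEquiv_zmod {G : Type*} [Group G] [Finite G] {g : G}
    (hg : orderOf g = Nat.card G) : Nonempty (G ≃* Multiplicative (ZMod (Nat.card G))) :=
  ⟨(zmodCyclicMulEquiv (isCyclic_of_orderOf_eq_card g hg)).symm⟩

theorem nonempty_mulEquiv_dihedralGroup {G : Type*} [Group G] [Finite G] {m : ℕ} (hm : 0 < m)
    {r s : G} (hr : orderOf r = m) (hs : s * s = 1) (hsr : s * r * s = r⁻¹)
    (hs' : s ∉ Subgroup.zpowers r) (hcard : Nat.card G = 2 * m) :
    Nonempty (G ≃* DihedralGroup m) := by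
  have : NeZero m := ⟨hm.ne'⟩
  have hadd : ∀ i j : ZMod m, r ^ (i + j).val = r ^ i.val * r ^ j.val := fun i j => by
    have h := pow_mod_orderOf r (i.val + j.val)
    rw [hr] at h
    rw [ZMod.val_add, ← pow_add, h]
  have hneg : ∀ i : ZMod m, r ^ (-i).val = (r ^ i.val)⁻¹ := fun i => by
    rw [eq_inv_iff_mul_eq_one, ← hadd]
    simp
  have hsub : ∀ i j : ZMod m, r ^ (j - i).val = (r ^ i.val)⁻¹ * r ^ j.val := fun i j => by
    rw [sub_eq_add_neg, add_comm, hadd, hneg]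
  have hs1 : s⁻¹ = s := inv_eq_of_mul_eq_one_right hs
  have hconj : ∀ n : ℕ, r ^ n * s = s * (r ^ n)⁻¹ := fun n => by
    have h1 : (s * r * s⁻¹) ^ n = s * r ^ n * s⁻¹ := conj_pow
    rw [hs1, hsr, inv_pow] at h1
    rw [h1, ← mul_assoc, ← mul_assoc, hs, one_mul]
  let F : DihedralGroup m →* G :=
    { toFun := fun x => match x with
        | DihedralGroup.r i => r ^ i.val
        | DihedralGroup.sr i => s * r ^ i.val
      map_one' := by
        rw [DihedralGroup.one_def]
        simp
      map_mul' := by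
        rintro (i | i) (j | j)
        · exact hadd i j
        · change s * r ^ (j - i).val = r ^ i.val * (s * r ^ j.val)
          rw [hsub, ← mul_assoc (r ^ i.val), hconj, mul_assoc]
        · change s * r ^ (i + j).val = s * r ^ i.val * r ^ j.val
          rw [hadd, mul_assoc]
        · change r ^ (j - i).val = s * r ^ i.val * (s * r ^ j.val)
          rw [hsub, mul_assoc s, ← mul_assoc (r ^ i.val), hconj, ← mul_assoc, ← mul_assoc, hs,
            one_mul] }
  have hinj : Function.Injective F := by
    rw [injective_iff_map_eq_one]
    rintro (i | i) h
    · change r ^ i.val = 1 at h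
      have h1 := orderOf_dvd_of_pow_eq_one h
      rw [hr] at h1
      have h2 := Nat.eq_zero_of_dvd_of_lt h1 (ZMod.val_lt i)
      rw [ZMod.val_eq_zero] at h2
      rw [h2, DihedralGroup.one_def]
    · change s * r ^ i.val = 1 at h
      refine absurd ?_ hs'
      rw [mul_eq_one_iff_eq_inv.1 h]
      exact inv_mem (pow_mem (Subgroup.mem_zpowers r) _)
  refine ⟨(MulEquiv.ofBijective F ((Nat.bijective_iff_injective_and_card F).2 ⟨hinj, ?_⟩)).symm⟩
  rw [hcard, DihedralGroup.nat_card]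

-- Bounds on element orders serve to rule out the cyclic and dihedral orbit types, which force
-- elements of order |G| or |G|/2.
set_option maxRecDepth 4000 in
theorem orderOf_perm_four_le (x : Equiv.Perm (Fin 4)) : orderOf x ≤ 4 := by
  have h : ∀ x : Equiv.Perm (Fin 4), x ^ 2 = 1 ∨ x ^ 3 = 1 ∨ x ^ 4 = 1 := by decide
  rcases h x with h | h | h
  · exact (orderOf_le_of_pow_eq_one (by norm_num) h).trans (by norm_num)
  · exact (orderOf_le_of_pow_eq_one (by norm_num) h).trans (by norm_num)
  · exact orderOf_le_of_pow_eq_one (by norm_num) h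

set_option maxRecDepth 4000 in
theorem orderOf_perm_five_le (x : Equiv.Perm (Fin 5)) : orderOf x ≤ 6 := by
  have h : ∀ x : Equiv.Perm (Fin 5), x ^ 4 = 1 ∨ x ^ 5 = 1 ∨ x ^ 6 = 1 := by decide
  rcases h x with h | h | h
  · exact (orderOf_le_of_pow_eq_one (by norm_num) h).trans (by norm_num)
  · exact (orderOf_le_of_pow_eq_one (by norm_num) h).trans (by norm_num)
  · exact orderOf_le_of_pow_eq_one (by norm_num) h

end Groups

variable {k : Type*} [Field k]

theorem conjSubgroup_mul (γ δ : PGL2 k) (G : Subgroup (PGL2 k)) :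
    conjSubgroup (γ * δ) G = conjSubgroup γ (conjSubgroup δ G) := by
  ext g
  rw [mem_conjSubgroup, mem_conjSubgroup, mem_conjSubgroup]
  simp [mul_assoc]

theorem moebius_aff (a : kˣ) (b : k) (h) :
    moebius (glOf (a : k) b 0 1 h) = RatFunc.C (a : k) * RatFunc.X + RatFunc.C b := by
  simp [moebius]

theorem moebius_inver (c : kˣ) (h) :
    moebius (glOf 0 (c : k) 1 0 h) = RatFunc.C (c : k) / RatFunc.X := by
  simp [moebius]

theorem aff_mem_invariance {a : kˣ} {b : k} {z : RatFunc k} :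
    aff a b ∈ invariance z ↔ subst (glOf (a : k) b 0 1 (by simp)) z = z := mk_mem_invariance

theorem inver_mem_invariance {c : kˣ} {z : RatFunc k} :
    inver c ∈ invariance z ↔ subst (glOf 0 (c : k) 1 0 (by simp)) z = z := mk_mem_invariance

theorem smul_eq_self_of_card_stabilizer {G : Subgroup (PGL2 k)} [Finite G] {P : OnePoint k}
    (h : Nat.card (stabilizer G P) = Nat.card G) {g : PGL2 k} (hg : g ∈ G) : g • P = P := by
  have h1 := Subgroup.eq_top_of_card_eq _ h
  have h2 : (⟨g, hg⟩ : G) ∈ stabilizer G P := by rw [h1]; trivial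
  exact h2

/-- A group fixing two points consists, in a suitable coordinate, of homotheties. -/
theorem exists_conj_homothety {G : Subgroup (PGL2 k)} [Finite G] {P Q : OnePoint k} (hPQ : P ≠ Q)
    (hP : Nat.card (stabilizer G P) = Nat.card G) (hQ : Nat.card (stabilizer G Q) = Nat.card G) :
    ∃ γ, ∀ g ∈ conjSubgroup γ G, ∃ a : kˣ, a ^ Nat.card G = 1 ∧ g = aff a 0 := by
  obtain ⟨γ, h1, h2⟩ := exists_smul_pair hPQ
  refine ⟨γ, fun g hg => ?_⟩
  obtain ⟨a, ha⟩ := exists_aff_zero (g := g)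
    (smul_eq_self_of_card_stabilizer
      (by rw [← h1, card_stabilizer_conj, card_conjSubgroup, hP]) hg)
    (smul_eq_self_of_card_stabilizer
      (by rw [← h2, card_stabilizer_conj, card_conjSubgroup, hQ]) hg)
  refine ⟨a, ?_, ha⟩
  have h3 := pow_card_eq_one' (x := (⟨g, hg⟩ : conjSubgroup γ G))
  rw [card_conjSubgroup] at h3
  have h4 : g ^ Nat.card G = 1 := congrArg Subtype.val h3
  rw [ha, aff_pow_zero, aff_eq_one] at h4
  exact h4.1

/-- A group of order `2 m` with a point whose stabilizer has order `m` is, in a suitable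
coordinate, the group of the maps `x ↦ a x` and `x ↦ a / x` with `a ^ m = 1`. -/
theorem exists_conj_dihedral [IsAlgClosed k] {G : Subgroup (PGL2 k)} [Finite G] {m : ℕ}
    (hG : Nat.card G = 2 * m) {P : OnePoint k} (hP : Nat.card (stabilizer G P) = m)
    (hu : uniqueFixCount G P = 0) :
    ∃ γ, inver 1 ∈ conjSubgroup γ G ∧ Nat.card (mults (conjSubgroup γ G)) = m ∧
      ∀ g ∈ conjSubgroup γ G, ∃ a : kˣ, a ^ m = 1 ∧ (g = aff a 0 ∨ g = inver a) := by
  have hm : 0 < m := hP ▸ Nat.card_pos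
  -- The two points of this orbit are moved to ∞ and 0; each element of G then fixes or exchanges
  -- them, so it is ax or c/x.
  have h2 : (orbit G P).ncard = 2 := by
    have := card_stabilizer_mul_ncard_orbit G P
    rw [hP, hG, mul_comm] at this
    exact Nat.eq_of_mul_eq_mul_right hm this
  obtain ⟨Q, hPQ, horb⟩ : ∃ Q, P ≠ Q ∧ orbit G P = {P, Q} := by
    obtain ⟨A, B, hAB, horb⟩ := Set.ncard_eq_two.1 h2
    have hmem : P ∈ ({A, B} : Set (OnePoint k)) := horb ▸ mem_orbit_self P
    rcases hmem with rfl | h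
    · exact ⟨B, hAB, horb⟩
    · rw [Set.mem_singleton_iff.1 h]
      exact ⟨A, hAB.symm, by rw [Set.pair_comm, ← horb, Set.mem_singleton_iff.1 h]⟩
  obtain ⟨δ, hδP, hδQ⟩ := exists_smul_pair hPQ
  set K := conjSubgroup δ G with hK
  have horbK : orbit K (∞ : OnePoint k) = {∞, ((0 : k) : OnePoint k)} := by
    ext R
    obtain ⟨S, rfl⟩ : ∃ S, R = δ • S := ⟨δ⁻¹ • R, by simp⟩
    rw [← hδP, mem_orbit_conj, horb, ← hδQ]
    simp
  have hform : ∀ g ∈ K, (∃ a, g = aff a 0) ∨ ∃ c, g = inver c := by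
    intro g hg
    have h1 : g • (∞ : OnePoint k) ∈ orbit K (∞ : OnePoint k) := ⟨⟨g, hg⟩, rfl⟩
    have h0 : g • ((0 : k) : OnePoint k) ∈ orbit K (∞ : OnePoint k) := by
      have h3 : ((0 : k) : OnePoint k) ∈ orbit K (∞ : OnePoint k) := by rw [horbK]; simp
      obtain ⟨h, hh⟩ := h3
      exact ⟨⟨g, hg⟩ * h, (mul_smul (⟨g, hg⟩ : K) h _).trans (congrArg (g • ·) hh)⟩
    have hne : g • (∞ : OnePoint k) ≠ g • ((0 : k) : OnePoint k) := fun h =>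
      OnePoint.infty_ne_coe _ (MulAction.injective g h)
    rw [horbK, Set.mem_insert_iff, Set.mem_singleton_iff] at h1 h0
    rcases h1 with h1 | h1 <;> rcases h0 with h0 | h0
    · exact absurd (h1.trans h0.symm) hne
    · exact Or.inl (exists_aff_zero h1 h0)
    · exact Or.inr (exists_inver h1 h0)
    · exact absurd (h1.trans h0.symm) hne
  obtain ⟨c, hc⟩ : ∃ c, inver c ∈ K := by
    have h3 : ((0 : k) : OnePoint k) ∈ orbit K (∞ : OnePoint k) := by rw [horbK]; simp
    obtain ⟨⟨g, hg⟩, hh⟩ := h3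
    change g • (∞ : OnePoint k) = _ at hh
    rcases hform g hg with ⟨a, rfl⟩ | ⟨c, rfl⟩
    · simp at hh
    · exact ⟨c, hg⟩
  -- Conjugation by x ↦ ux replaces c/x by u²c/x; the choice u² = 1/c normalizes one element to 1/x.
  obtain ⟨u, hu2⟩ := IsAlgClosed.exists_pow_nat_eq ((c : k)⁻¹) (n := 2) (by norm_num)
  have hu0 : u ≠ 0 := by
    rintro rfl
    simp [eq_comm] at hu2
  let v : kˣ := Units.mk0 u hu0
  have hv : v ^ 2 * c = 1 := Units.ext (by simp [v, hu2])
  have hmap : (aff v 0 * δ) • P = ∞ := by rw [mul_smul, hδP, aff_smul_infty]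
  have hinver : inver 1 ∈ conjSubgroup (aff v 0 * δ) G := by
    rw [conjSubgroup_mul, ← hv, ← conj_inver v c 0 rfl]
    exact conj_mem_conjSubgroup hc
  have hmults : Nat.card (mults (conjSubgroup (aff v 0 * δ) G)) = m := by
    rw [← uniqueFixCount_conj (aff v 0 * δ), hmap] at hu
    have h1 := uniqueFixCount_infty (conjSubgroup (aff v 0 * δ) G)
    have h3 := card_stabilizer_infty (conjSubgroup (aff v 0 * δ) G)
    rw [← hmap, card_stabilizer_conj, hP, ← h1, hu, zero_add, one_mul] at h3
    exact h3.symm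
  have hpow : ∀ a : kˣ, aff a 0 ∈ conjSubgroup (aff v 0 * δ) G → a ^ m = 1 := fun a ha => by
    rw [← hmults, ← mem_iff_pow_card_eq_one]
    exact ⟨0, ha⟩
  refine ⟨aff v 0 * δ, hinver, hmults, fun g hg => ?_⟩
  have hg' := hg
  rw [conjSubgroup_mul] at hg'
  obtain ⟨h, hh, rfl⟩ := hg'
  rcases hform h hh with ⟨a, rfl⟩ | ⟨d, rfl⟩
  · refine ⟨a, hpow a ?_, Or.inl (conj_aff_zero v a)⟩
    convert hg using 1
    exact (conj_aff_zero v a).symm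
  · have h4 : (MulAut.conj (aff v 0)).toMonoidHom (inver d) = inver (v ^ 2 * d) :=
      conj_inver v d 0 rfl
    rw [h4] at hg ⊢
    refine ⟨v ^ 2 * d, hpow _ ?_, Or.inr rfl⟩
    have := (conjSubgroup (aff v 0 * δ) G).mul_mem hg hinver
    rwa [inver_mul_inver, inv_one, mul_one] at this

theorem nonempty_mulEquiv_dihedralGroup_of_stabilizer [IsAlgClosed k] {G : Subgroup (PGL2 k)}
    [Finite G] {m : ℕ} (hG : Nat.card G = 2 * m) {P : OnePoint k}
    (hP : Nat.card (stabilizer G P) = m) (hu : uniqueFixCount G P = 0) :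
    Nonempty (G ≃* DihedralGroup m) := by
  have hm : 0 < m := hP ▸ Nat.card_pos
  obtain ⟨γ, hinv, hmults, hform⟩ := exists_conj_dihedral hG hP hu
  obtain ⟨a, ha⟩ := IsCyclic.exists_ofOrder_eq_natCard (α := mults (conjSubgroup γ G))
  rw [hmults, ← Subgroup.orderOf_coe] at ha
  have hmem : aff (a : kˣ) 0 ∈ conjSubgroup γ G := by
    obtain ⟨b, hb⟩ := a.2
    obtain ⟨c, hc, h | h⟩ := hform _ hb
    · rw [aff_inj] at h
      rwa [h.2] at hb
    · exact absurd h.symm (inver_ne_aff _ _ _)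
  obtain ⟨e⟩ := nonempty_mulEquiv_dihedralGroup (G := conjSubgroup γ G) hm
    (r := ⟨aff (a : kˣ) 0, hmem⟩) (s := ⟨inver 1, hinv⟩)
    (by
      rw [Subgroup.orderOf_mk, ← ha]
      refine orderOf_eq_orderOf_iff.2 fun n => ?_
      rw [aff_pow_zero, aff_eq_one]
      simp)
    (Subtype.ext (inver_mul_self 1))
    (Subtype.ext (by
      change inver 1 * aff (a : kˣ) 0 * inver 1 = (aff (a : kˣ) 0)⁻¹
      rw [inver_mul_aff, inver_mul_inver, aff_inv]
      simp))
    (by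
      rintro ⟨i, hi⟩
      have h1 : aff (a : kˣ) 0 ^ i = inver 1 := congrArg Subtype.val hi
      have h2 : aff (a : kˣ) (0 : k) ^ i ∈ stabilizer (PGL2 k) (∞ : OnePoint k) :=
        zpow_mem (show aff (a : kˣ) (0 : k) ∈ stabilizer (PGL2 k) (∞ : OnePoint k) from
          aff_smul_infty _ _) i
      rw [h1, mem_stabilizer_iff, inver_smul_infty] at h2
      exact OnePoint.coe_ne_infty _ h2)
    (by rw [card_conjSubgroup, hG])
  exact ⟨(conjSubgroupEquiv γ G).trans e⟩

theorem fixedFieldGivenBy_pow [IsAlgClosed k] {G : Subgroup (PGL2 k)} [Finite G] {n : ℕ}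
    (hn : Nat.card G = n) (he : OrbitType G [n, n]) :
    FixedFieldGivenBy G (RatFunc.X ^ n) [n, n] := by
  have he' := he
  obtain ⟨P, hinj, hcard, -⟩ := he'
  have hPQ : P 0 ≠ P 1 := fun h => by
    have := hinj 0 1 (h ▸ mem_orbit_self _)
    exact absurd (Fin.mk.inj_iff.1 this) zero_ne_one
  obtain ⟨γ, hγ⟩ := exists_conj_homothety hPQ ((hcard 0).trans hn.symm) ((hcard 1).trans hn.symm)
  have hn0 : 0 < n := hn ▸ Nat.card_pos
  refine fixedFieldGivenBy_of_div (p := Polynomial.X ^ n) (q := 1) (by simp) γ ?_ (by simp [hn])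
    (by simpa [hn] using hn0) one_ne_zero he
  intro g hg
  obtain ⟨a, ha, rfl⟩ := hγ g hg
  rw [hn] at ha
  have ha' : (a : k) ^ n = 1 := by rw [← Units.val_pow_eq_pow_val, ha, Units.val_one]
  rw [aff_mem_invariance, map_pow, subst_X, moebius_aff, map_zero, add_zero, mul_pow, ← map_pow,
    ha', map_one, one_mul]

theorem fixedFieldGivenBy_pow_add_inv [IsAlgClosed k] {G : Subgroup (PGL2 k)} [Finite G] {m : ℕ}
    (hm : Nat.card G = 2 * m) (he : OrbitType G [2, 2, m])
    (hu : ∀ P, uniqueFixCount G P = 0) :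
    FixedFieldGivenBy G (RatFunc.X ^ m + 1 / RatFunc.X ^ m) [2, 2, m] := by
  have he' := he
  obtain ⟨P, hinj, hcard, -⟩ := he'
  obtain ⟨γ, -, -, hγ⟩ := exists_conj_dihedral hm (hcard 2) (hu _)
  have hm0 : 0 < m := by
    have : 0 < Nat.card G := Nat.card_pos
    omega
  have hX : (RatFunc.X : RatFunc k) ^ m ≠ 0 := pow_ne_zero _ RatFunc.X_ne_zero
  refine fixedFieldGivenBy_of_div (p := Polynomial.X ^ (2 * m) + Polynomial.C 1)
    (q := Polynomial.X ^ m) ?_ γ ?_ ?_ ?_ (pow_ne_zero _ Polynomial.X_ne_zero) he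
  · simp only [map_add, map_pow, RatFunc.algebraMap_X, map_one]
    field_simp
    ring
  · intro g hg
    obtain ⟨a, ha, h⟩ := hγ g hg
    have ha' : (RatFunc.C (a : k) : RatFunc k) ^ m = 1 := by
      rw [← map_pow, ← Units.val_pow_eq_pow_val, ha]
      simp
    rcases h with rfl | rfl
    · rw [aff_mem_invariance]
      simp only [map_add, map_div₀, map_one, map_pow, subst_X, moebius_aff, map_zero, add_zero,
        mul_pow, ha', one_mul]
    · rw [inver_mem_invariance]
      simp only [map_add, map_div₀, map_one, map_pow, subst_X, moebius_inver, div_pow, ha']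
      rw [one_div_one_div, add_comm]
  · rw [Polynomial.natDegree_X_pow_add_C, hm]
  · rw [Polynomial.natDegree_X_pow, hm]
    omega

end

/-! ### Tetrahedral and octahedral groups -/

section

open Matrix OnePoint MulAction

variable {k : Type*} [Field k]

/-- An element of finite order prime to the characteristic is a homothety in a suitable
coordinate. -/
theorem exists_conj_aff_zero [IsAlgClosed k] {g : PGL2 k} (hg : g ≠ 1) {n : ℕ} (hn : (n : k) ≠ 0)
    (hgn : g ^ n = 1) : ∃ (γ : PGL2 k) (ζ : kˣ), γ * g * γ⁻¹ = aff ζ 0 ∧ ζ ≠ 1 ∧ ζ ^ n = 1 := by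
  obtain ⟨P, hP⟩ := exists_fixed_point g
  obtain ⟨δ, hδ⟩ := exists_smul_eq_infty P
  obtain ⟨a, b, hab⟩ := exists_aff (g := δ * g * δ⁻¹) (by rw [← hδ, conj_smul, hP])
  have hpow : aff a b ^ n = 1 := by rw [← hab, conj_pow, hgn, mul_one, mul_inv_cancel]
  have hne : aff a b ≠ 1 := by simpa [← hab] using hg
  -- For a = 1 the n-th power is translation by nb, which is nonzero unless b = 0.
  have ha : a ≠ 1 := by
    rintro rfl
    rw [aff_one_pow, aff_eq_one] at hpow
    exact hne (aff_eq_one.2 ⟨rfl, (mul_eq_zero.1 hpow.2).resolve_left hn⟩)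
  have ha' : (1 : k) - a ≠ 0 := fun h => ha (Units.ext (by simpa using (sub_eq_zero.1 h).symm))
  -- The second fixed point b/(1 - a) is translated to 0.
  refine ⟨aff 1 (-(b / (1 - a))) * δ, a, ?_, ha, ?_⟩
  · rw [show aff 1 (-(b / (1 - a))) * δ * g * (aff 1 (-(b / (1 - a))) * δ)⁻¹ =
      aff 1 (-(b / (1 - a))) * (δ * g * δ⁻¹) * (aff 1 (-(b / (1 - a))))⁻¹ by group, hab, aff_inv,
      aff_mul_aff, aff_mul_aff, aff_inj]
    constructor
    · simp
    · simp
      field_simp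
      ring
  · obtain ⟨c, hc⟩ := exists_aff_pow a b n
    rw [hpow, eq_comm, aff_eq_one] at hc
    exact hc.1

theorem exists_sq_mul_eq [IsAlgClosed k] (c d : kˣ) : ∃ u : kˣ, u ^ 2 * c = d := by
  obtain ⟨u, hu⟩ := IsAlgClosed.exists_pow_nat_eq ((d : k) / c) (n := 2) (by norm_num)
  have hu0 : u ≠ 0 := by
    rintro rfl
    simp [eq_comm] at hu
  exact ⟨Units.mk0 u hu0, Units.ext (by simp [hu])⟩

/-- An element commuting with -x permutes its two fixed points ∞ and 0. -/
theorem aff_or_inver_of_commute (h2 : (2 : k) ≠ 0) {g : PGL2 k}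
    (h : g * aff (-1) (0 : k) = aff (-1) (0 : k) * g) : (∃ a, g = aff a 0) ∨ ∃ c, g = inver c := by
  have hfix : ∀ P : OnePoint k, aff (-1) (0 : k) • P = P → P = ∞ ∨ P = ((0 : k) : OnePoint k) := by
    intro P hP
    cases P with
    | infty => exact Or.inl rfl
    | coe x =>
      right
      rw [aff_smul_coe, OnePoint.coe_eq_coe] at hP
      have : 2 * x = 0 := by
        simp at hP
        linear_combination -hP
      rw [(mul_eq_zero.1 this).resolve_left h2]
  have h1 := hfix (g • ∞) (by rw [← mul_smul, ← h, mul_smul, aff_smul_infty])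
  have h0 := hfix (g • ((0 : k) : OnePoint k))
    (by rw [← mul_smul, ← h, mul_smul, aff_smul_coe]; simp)
  have hne : g • (∞ : OnePoint k) ≠ g • ((0 : k) : OnePoint k) := fun h =>
    OnePoint.infty_ne_coe _ (MulAction.injective g h)
  rcases h1 with h1 | h1 <;> rcases h0 with h0 | h0
  · exact absurd (h1.trans h0.symm) hne
  · exact Or.inl (exists_aff_zero h1 h0)
  · exact Or.inr (exists_inver h1 h0)
  · exact absurd (h1.trans h0.symm) hne

/-- Commuting involutions in a suitable coordinate. -/
theorem exists_conj_commuting_involutions [IsAlgClosed k] (h2 : (2 : k) ≠ 0) {s t : PGL2 k}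
    (hs1 : s ≠ 1) (ht1 : t ≠ 1) (hst1 : s ≠ t) (hs : s * s = 1) (ht : t * t = 1)
    (hst : s * t = t * s) :
    ∃ γ : PGL2 k, γ * s * γ⁻¹ = aff (-1) (0 : k) ∧ γ * t * γ⁻¹ = inver 1 := by
  obtain ⟨δ, ζ, hδ, hζ1, hζ2⟩ := exists_conj_aff_zero hs1 (n := 2) (by exact_mod_cast h2)
    (by rw [sq, hs])
  have hζ : ζ = -1 := (units_eq_one_or_neg_one (by rw [← sq, hζ2])).resolve_left hζ1
  rw [hζ] at hδ
  have hcomm : (δ * t * δ⁻¹) * aff (-1) (0 : k) = aff (-1) (0 : k) * (δ * t * δ⁻¹) := by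
    rw [← hδ, show δ * t * δ⁻¹ * (δ * s * δ⁻¹) = δ * (t * s) * δ⁻¹ by group, ← hst]
    group
  have hss := mul_self_conj (γ := δ) ht
  -- A nontrivial homothety of order two is -x, which is already s; so t is some c/x, and rescaling
  -- makes c = 1.
  rcases aff_or_inver_of_commute h2 hcomm with ⟨a, ha⟩ | ⟨c, hc⟩
  · exfalso
    rw [ha, aff_mul_aff, aff_eq_one] at hss
    rcases units_eq_one_or_neg_one hss.1 with rfl | rfl
    · rw [aff_one_zero] at ha
      exact ht1 (by simpa using ha)
    · rw [← hδ] at ha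
      exact hst1 (by simpa using ha.symm)
  · obtain ⟨u, hu⟩ := exists_sq_mul_eq c 1
    refine ⟨aff u 0 * δ, ?_, ?_⟩
    · rw [← conj_aff_zero u (-1), ← hδ]
      group
    · rw [← hu, ← conj_inver u c 0 rfl, ← hc]
      group

/-- The four-group {x, -x, 1/x, -1/x} is its own centralizer in `PGL2 k`. -/
theorem mem_of_commute_four {W : Subgroup (PGL2 k)} (h2 : (2 : k) ≠ 0)
    (hW1 : aff (-1) (0 : k) ∈ W) (hW2 : inver 1 ∈ W) {g : PGL2 k}
    (h : g * aff (-1) (0 : k) = aff (-1) (0 : k) * g) (h' : g * inver 1 = inver 1 * g) : g ∈ W := by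
  have key : ∀ a : kˣ, a = a⁻¹ → aff a 0 ∈ W := fun a ha => by
    rcases units_eq_one_or_neg_one (mul_eq_one_iff_eq_inv.2 ha) with rfl | rfl
    · rw [aff_one_zero]
      exact one_mem W
    · exact hW1
  rcases aff_or_inver_of_commute h2 h with ⟨a, rfl⟩ | ⟨c, rfl⟩
  · rw [aff_mul_inver, inver_mul_aff, inver_inj] at h'
    exact key a (by simpa using h')
  · rw [inver_mul_inver, inver_mul_inver, aff_inj] at h'
    have := W.mul_mem (key c (by simpa using h'.1)) hW2
    rwa [aff_mul_inver, mul_one] at this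

/-- An element is determined, up to the four-group, by its conjugation action on -x and 1/x. So an
abstract generator is shown to lie in W by comparing it with a concrete g₀ in W having the same
action. -/
theorem mem_of_conj_eq {W : Subgroup (PGL2 k)} (h2 : (2 : k) ≠ 0)
    (hW1 : aff (-1) (0 : k) ∈ W) (hW2 : inver 1 ∈ W) {g g₀ : PGL2 k} (hg₀ : g₀ ∈ W)
    (h : g * aff (-1) (0 : k) * g⁻¹ = g₀ * aff (-1) (0 : k) * g₀⁻¹)
    (h' : g * inver 1 * g⁻¹ = g₀ * inver 1 * g₀⁻¹) : g ∈ W := by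
  have hcomm : ∀ s : PGL2 k, g * s * g⁻¹ = g₀ * s * g₀⁻¹ → g₀⁻¹ * g * s = s * (g₀⁻¹ * g) := by
    intro s hs
    rw [mul_inv_eq_iff_eq_mul] at hs
    rw [mul_assoc, hs]
    group
  have := W.mul_mem hg₀ (mem_of_commute_four h2 hW1 hW2 (hcomm _ h) (hcomm _ h'))
  rwa [mul_inv_cancel_left] at this

/-- The class of the transformation `x ↦ (x + i) / (x - i)`. -/
def cayley (i : k) (h2 : (2 : k) ≠ 0) (hi : i ^ 2 = -1) : PGL2 k :=
  ProjGenLinGroup.mk (glOf 1 i 1 (-i) (by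
    intro h
    have hi0 : i = 0 := by
      have : 2 * i = 0 := by linear_combination -h
      exact (mul_eq_zero.1 this).resolve_left h2
    rw [hi0] at hi
    simp at hi))

/-- Together with `cayley_mul_inver` this says that conjugation by (x + i)/(x - i) cycles the
involutions -x, 1/x, -1/x, as a 3-cycle does with the four-group in A₄. -/
theorem cayley_mul_aff (i : k) (h2 : (2 : k) ≠ 0) (hi : i ^ 2 = -1) :
    cayley i h2 hi * aff (-1) (0 : k) = inver 1 * cayley i h2 hi := by
  rw [cayley, aff, inver, ← map_mul, ← map_mul]
  refine mk_eq_mk_of_smul (-1) (by simp) ?_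
  ext a b
  fin_cases a <;> fin_cases b <;> simp [Matrix.mul_apply]

theorem cayley_mul_inver (i : k) (h2 : (2 : k) ≠ 0) (hi : i ^ 2 = -1) :
    cayley i h2 hi * inver 1 = aff (-1) (0 : k) * inver 1 * cayley i h2 hi := by
  have hi0 : i ≠ 0 := by
    rintro rfl
    simp at hi
  have hii : i * i = -1 := by rw [← sq, hi]
  rw [cayley, aff, inver, ← map_mul, ← map_mul, ← map_mul]
  refine mk_eq_mk_of_smul i hi0 ?_
  ext a b
  fin_cases a <;> fin_cases b <;> simp [Matrix.mul_apply, hii]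

theorem conj_le_of_closure {A : Type*} [Group A] {G W : Subgroup (PGL2 k)} (e : G ≃* A) {S : Set A}
    (hS : Subgroup.closure S = ⊤) (γ : PGL2 k) (h : ∀ s ∈ S, γ * e.symm s * γ⁻¹ ∈ W) :
    conjSubgroup γ G ≤ W := by
  have h1 : Subgroup.closure S ≤ W.comap
      ((MulAut.conj γ).toMonoidHom.comp (G.subtype.comp e.symm.toMonoidHom)) :=
    (Subgroup.closure_le _).2 h
  rw [hS] at h1
  rintro _ ⟨g, hg, rfl⟩
  have := h1 (Subgroup.mem_top (e ⟨g, hg⟩))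
  simpa using this

/-- Normal forms in the chosen generators reduce the generation statements to a finite check. -/
theorem perm_four_even_words : ∀ x : Equiv.Perm (Fin 4), Equiv.Perm.sign x = 1 →
    ∃ (i j : Fin 2) (l : Fin 3), x =
      (c[0, 1] * c[2, 3]) ^ i.1 * (c[0, 2] * c[1, 3]) ^ j.1 * c[1, 2, 3] ^ l.1 := by
  decide

theorem perm_four_words : ∀ x : Equiv.Perm (Fin 4), ∃ (i j : Fin 2) (l : Fin 3) (m : Fin 2), x =
      (c[0, 1] * c[2, 3]) ^ i.1 * (c[0, 2] * c[1, 3]) ^ j.1 * c[1, 2, 3] ^ l.1 * c[0, 1] ^ m.1 := by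
  decide

/-- Generators of the tetrahedral group. -/
theorem alternatingGroup_four_generators : ∃ s t c : alternatingGroup (Fin 4),
    s ≠ 1 ∧ t ≠ 1 ∧ s ≠ t ∧ s * s = 1 ∧ t * t = 1 ∧ s * t = t * s ∧
    c * s * c⁻¹ = t ∧ c * t * c⁻¹ = s * t ∧ Subgroup.closure {s, t, c} = ⊤ := by
  refine ⟨⟨c[0, 1] * c[2, 3], Equiv.Perm.mem_alternatingGroup.2 (by decide)⟩,
    ⟨c[0, 2] * c[1, 3], Equiv.Perm.mem_alternatingGroup.2 (by decide)⟩,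
    ⟨c[1, 2, 3], Equiv.Perm.mem_alternatingGroup.2 (by decide)⟩, by decide, by decide, by decide,
    by decide, by decide, by decide, by decide, by decide, ?_⟩
  rw [eq_top_iff]
  rintro ⟨x, hx⟩ -
  obtain ⟨i, j, l, h⟩ := perm_four_even_words x (Equiv.Perm.mem_alternatingGroup.1 hx)
  rw [show (⟨x, hx⟩ : alternatingGroup (Fin 4)) =
    ⟨c[0, 1] * c[2, 3], Equiv.Perm.mem_alternatingGroup.2 (by decide)⟩ ^ i.1 *
    ⟨c[0, 2] * c[1, 3], Equiv.Perm.mem_alternatingGroup.2 (by decide)⟩ ^ j.1 *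
    ⟨c[1, 2, 3], Equiv.Perm.mem_alternatingGroup.2 (by decide)⟩ ^ l.1 from Subtype.ext h]
  exact mul_mem (mul_mem (pow_mem (Subgroup.subset_closure (by simp)) i.1)
    (pow_mem (Subgroup.subset_closure (by simp)) j.1))
    (pow_mem (Subgroup.subset_closure (by simp)) l.1)

theorem perm_four_generators : ∃ s t c d : Equiv.Perm (Fin 4),
    s ≠ 1 ∧ t ≠ 1 ∧ s ≠ t ∧ s * s = 1 ∧ t * t = 1 ∧ s * t = t * s ∧
    c * s * c⁻¹ = t ∧ c * t * c⁻¹ = s * t ∧ d * s * d⁻¹ = s ∧ d * t * d⁻¹ = s * t ∧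
    Subgroup.closure {s, t, c, d} = ⊤ := by
  refine ⟨c[0, 1] * c[2, 3], c[0, 2] * c[1, 3], c[1, 2, 3], c[0, 1], by decide, by decide,
    by decide, by decide, by decide, by decide, by decide, by decide, by decide, by decide, ?_⟩
  rw [eq_top_iff]
  intro x _
  obtain ⟨i, j, l, m, h⟩ := perm_four_words x
  rw [h]
  exact mul_mem (mul_mem (mul_mem (pow_mem (Subgroup.subset_closure (by simp)) i.1)
    (pow_mem (Subgroup.subset_closure (by simp)) j.1))
    (pow_mem (Subgroup.subset_closure (by simp)) l.1))
    (pow_mem (Subgroup.subset_closure (by simp)) m.1)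

/-- A group generated by two commuting involutions and elements permuting them in one of two
standard ways has a conjugate in any subgroup containing the standard transformations. -/
theorem exists_conj_le_of_generators [IsAlgClosed k] (h2 : (2 : k) ≠ 0) {A : Type*} [Group A]
    {G W : Subgroup (PGL2 k)} (e : G ≃* A) {i : k} (hi : i ^ 2 = -1)
    (hW1 : aff (-1) (0 : k) ∈ W) (hW2 : inver 1 ∈ W) (hWc : cayley i h2 hi ∈ W)
    {s t : A} (hs : s ≠ 1) (ht : t ≠ 1) (hst : s ≠ t) (hss : s * s = 1) (htt : t * t = 1)
    (hcomm : s * t = t * s) {S : Set A} (htop : Subgroup.closure S = ⊤)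
    (hS : ∀ x ∈ S, x = s ∨ x = t ∨ (x * s * x⁻¹ = t ∧ x * t * x⁻¹ = s * t) ∨
      (x * s * x⁻¹ = s ∧ x * t * x⁻¹ = s * t ∧ ∃ d : kˣ, (d : k) ^ 2 = -1 ∧ aff d 0 ∈ W)) :
    ∃ γ, conjSubgroup γ G ≤ W := by
  have hmap : ∀ x y : A, (e.symm (x * y) : PGL2 k) = e.symm x * e.symm y := fun x y => by simp
  have hone : ∀ x : A, (e.symm x : PGL2 k) = 1 ↔ x = 1 := fun x => by simp
  obtain ⟨γ, h1, h3⟩ := exists_conj_commuting_involutions h2 (s := e.symm s) (t := e.symm t)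
    (by rwa [Ne, hone]) (by rwa [Ne, hone]) (fun h => hst (e.symm.injective (Subtype.ext h)))
    (by rw [← hmap, hss, hone]) (by rw [← hmap, htt, hone]) (by rw [← hmap, ← hmap, hcomm])
  let φ : A →* PGL2 k := (MulAut.conj γ).toMonoidHom.comp (G.subtype.comp e.symm.toMonoidHom)
  have hφs : φ s = aff (-1) 0 := h1
  have hφt : φ t = inver 1 := h3
  refine ⟨γ, conj_le_of_closure e htop γ fun x hx => ?_⟩
  change φ x ∈ W
  rcases hS x hx with rfl | rfl | ⟨hxs, hxt⟩ | ⟨hxs, hxt, d, hd, hdW⟩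
  · rwa [hφs]
  · rwa [hφt]
  · refine mem_of_conj_eq h2 hW1 hW2 hWc ?_ ?_
    · rw [cayley_mul_aff, mul_inv_cancel_right, ← hφs, ← hφt, ← hxs]
      simp
    · rw [cayley_mul_inver, mul_inv_cancel_right, ← hφs, ← hφt, ← map_mul φ s t, ← hxt]
      simp
  · refine mem_of_conj_eq h2 hW1 hW2 hdW ?_ ?_
    · rw [conj_aff_zero, ← hφs]
      conv_rhs => rw [← hxs]
      simp
    · have hd' : d ^ 2 = -1 := Units.ext (by simpa using hd)
      rw [conj_inver d 1 0 rfl, hd', ← aff_mul_inver, ← hφs, ← hφt, ← map_mul φ s t, ← hxt]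
      simp

/-- Homogenization in degrees 12 and 24: the powers of y in numerator and denominator cancel. -/
theorem subst_cayley_form {F : Type*} [Field F] {x y : F} (hy : y ≠ 0) :
    (((x / y) ^ 12 - 33 * (x / y) ^ 8 - 33 * (x / y) ^ 4 + 1) /
        ((x / y) ^ 2 * ((x / y) ^ 4 - 1) ^ 2) =
      (x ^ 12 - 33 * x ^ 8 * y ^ 4 - 33 * x ^ 4 * y ^ 8 + y ^ 12) /
        (x ^ 2 * y ^ 2 * (x ^ 4 - y ^ 4) ^ 2)) ∧
    (((x / y) ^ 8 + 14 * (x / y) ^ 4 + 1) ^ 3 / (108 * (x / y * ((x / y) ^ 4 - 1)) ^ 4) =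
      (x ^ 8 + 14 * x ^ 4 * y ^ 4 + y ^ 8) ^ 3 / (108 * (x * y * (x ^ 4 - y ^ 4)) ^ 4)) := by
  constructor
  · rw [show (x / y) ^ 12 - 33 * (x / y) ^ 8 - 33 * (x / y) ^ 4 + 1 =
        (x ^ 12 - 33 * x ^ 8 * y ^ 4 - 33 * x ^ 4 * y ^ 8 + y ^ 12) / y ^ 12 by field_simp,
      show (x / y) ^ 2 * ((x / y) ^ 4 - 1) ^ 2 =
        (x ^ 2 * y ^ 2 * (x ^ 4 - y ^ 4) ^ 2) / y ^ 12 by field_simp,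
      div_div_div_cancel_right₀ (pow_ne_zero _ hy)]
  · rw [show ((x / y) ^ 8 + 14 * (x / y) ^ 4 + 1) ^ 3 =
        (x ^ 8 + 14 * x ^ 4 * y ^ 4 + y ^ 8) ^ 3 / y ^ 24 by field_simp,
      show 108 * (x / y * ((x / y) ^ 4 - 1)) ^ 4 =
        (108 * (x * y * (x ^ 4 - y ^ 4)) ^ 4) / y ^ 24 by field_simp,
      div_div_div_cancel_right₀ (pow_ne_zero _ hy)]

/-- These are Klein's vertex, face and edge forms of the octahedron, which the Cayley map only
rescales. With u, v = x ± i, P = uv and S = u⁴ + v⁴, the face form is S² + 12P⁴ and the edge form S³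
- 36P⁴S, so only P, S and u⁴ - v⁴ need be expanded. -/
theorem cayley_forms {F : Type*} [CommRing F] {x i : F} (hi : i ^ 2 = -1) :
    (x + i) * (x - i) * ((x + i) ^ 4 - (x - i) ^ 4) = 8 * i * (x * (x ^ 4 - 1)) ∧
    (x + i) ^ 8 + 14 * (x + i) ^ 4 * (x - i) ^ 4 + (x - i) ^ 8 =
      16 * (x ^ 8 + 14 * x ^ 4 + 1) ∧
    (x + i) ^ 12 - 33 * (x + i) ^ 8 * (x - i) ^ 4 - 33 * (x + i) ^ 4 * (x - i) ^ 8 + (x - i) ^ 12 =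
      -64 * (x ^ 12 - 33 * x ^ 8 - 33 * x ^ 4 + 1) := by
  have hP : (x + i) * (x - i) = x ^ 2 + 1 := by linear_combination -hi
  have hD : (x + i) ^ 4 - (x - i) ^ 4 = 8 * i * x * (x ^ 2 - 1) := by
    linear_combination 8 * i * x * hi
  have hS : (x + i) ^ 4 + (x - i) ^ 4 = 4 * (x ^ 2 - 1) ^ 2 - 2 * (x ^ 2 + 1) ^ 2 := by
    linear_combination (12 * x ^ 2 + 2 * i ^ 2 - 2) * hi
  refine ⟨?_, ?_, ?_⟩
  · rw [hP, hD]
    ring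
  · rw [show (x + i) ^ 8 + 14 * (x + i) ^ 4 * (x - i) ^ 4 + (x - i) ^ 8 =
      ((x + i) ^ 4 + (x - i) ^ 4) ^ 2 + 12 * ((x + i) * (x - i)) ^ 4 by ring, hP, hS]
    ring
  · rw [show (x + i) ^ 12 - 33 * (x + i) ^ 8 * (x - i) ^ 4 - 33 * (x + i) ^ 4 * (x - i) ^ 8 +
      (x - i) ^ 12 = ((x + i) ^ 4 + (x - i) ^ 4) ^ 3 -
        36 * ((x + i) * (x - i)) ^ 4 * ((x + i) ^ 4 + (x - i) ^ 4) by ring, hP, hS]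
    ring

section Formulas

open RatFunc

theorem moebius_cayley (i : k) (h) : moebius (glOf 1 i 1 (-i) h) = (X + C i) / (X - C i) := by
  simp [moebius, sub_eq_add_neg]

variable [IsAlgClosed k]

theorem fixedFieldGivenBy_tetrahedral (h2 : (2 : k) ≠ 0) {G : Subgroup (PGL2 k)} [Finite G]
    (e : G ≃* alternatingGroup (Fin 4)) (he : OrbitType G [2, 3, 3]) (hG : Nat.card G = 12) :
    FixedFieldGivenBy G
      ((X ^ 12 - 33 * X ^ 8 - 33 * X ^ 4 + 1) / (X ^ 2 * (X ^ 4 - 1) ^ 2)) [2, 3, 3] := by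
  obtain ⟨i, hi⟩ := IsAlgClosed.exists_pow_nat_eq (-1 : k) (n := 2) (by norm_num)
  have hI : (C i : RatFunc k) ^ 2 = -1 := by rw [← map_pow, hi]; simp
  have h2' : (2 : RatFunc k) ≠ 0 := by
    rw [← map_ofNat C]
    exact (map_ne_zero _).2 h2
  have hX : (X : RatFunc k) ≠ 0 := X_ne_zero
  set z : RatFunc k := (X ^ 12 - 33 * X ^ 8 - 33 * X ^ 4 + 1) / (X ^ 2 * (X ^ 4 - 1) ^ 2) with hz
  have hsub : ∀ g, subst g z = ((moebius g) ^ 12 - 33 * (moebius g) ^ 8 - 33 * (moebius g) ^ 4 + 1)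
      /
      ((moebius g) ^ 2 * ((moebius g) ^ 4 - 1) ^ 2) := fun g => by
    simp only [hz, map_div₀, map_add, map_sub, map_mul, map_pow, map_one, map_ofNat, subst_X]
  obtain ⟨s, t, c, hs, ht, hst, hss, htt, hcomm, hcs, hct, htop⟩ := alternatingGroup_four_generators
  obtain ⟨γ, hγ⟩ := exists_conj_le_of_generators h2 e (W := invariance z) hi
    (by
      rw [aff_mem_invariance, hsub, moebius_aff, hz]
      simp
      ring)
    (by
      rw [inver_mem_invariance, hsub, moebius_inver, (subst_cayley_form hX).1, hz]
      simp
      ring)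
    (by
      -- The edge form acquires the factor -64 and the square of the vertex form the factor (8i)² =
      -- -64.
      rw [cayley, mk_mem_invariance, hsub, moebius_cayley]
      obtain ⟨h1, -, h3⟩ := cayley_forms (x := (X : RatFunc k)) hI
      have hne : (X - C i : RatFunc k) ≠ 0 := by
        have := linear_ne_zero (a := (1 : k)) (b := -i) (Or.inl one_ne_zero)
        simpa [sub_eq_add_neg] using this
      rw [(subst_cayley_form hne).1, h3, show (X + C i) ^ 2 * (X - C i) ^ 2 *
        ((X + C i) ^ 4 - (X - C i) ^ 4) ^ 2 = ((X + C i) * (X - C i) *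
        ((X + C i) ^ 4 - (X - C i) ^ 4)) ^ 2 by ring, h1,
        show (8 * C i * (X * (X ^ 4 - 1))) ^ 2 = -64 * (X ^ 2 * (X ^ 4 - 1) ^ 2 : RatFunc k) by
          linear_combination (64 * X ^ 2 * (X ^ 4 - 1) ^ 2 : RatFunc k) * hI]
      refine mul_div_mul_left _ _ ?_
      rw [neg_ne_zero, show (64 : RatFunc k) = 2 ^ 6 by norm_num]
      exact pow_ne_zero _ h2')
    hs ht hst hss htt hcomm htop (by
      rintro x (rfl | rfl | rfl)
      · exact Or.inl rfl
      · exact Or.inr (Or.inl rfl)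
      · exact Or.inr (Or.inr (Or.inl ⟨hcs, hct⟩)))
  have hq : (Polynomial.X ^ 2 * (Polynomial.X ^ 4 - 1) ^ 2 : Polynomial k).natDegree = 10 := by
    compute_degree!
  refine fixedFieldGivenBy_of_div
    (p := Polynomial.X ^ 12 - 33 * Polynomial.X ^ 8 - 33 * Polynomial.X ^ 4 + 1)
    (q := Polynomial.X ^ 2 * (Polynomial.X ^ 4 - 1) ^ 2) (by simp only
        [hz, map_add, map_sub, map_mul, map_pow, map_one, map_ofNat, algebraMap_X])
    γ hγ ?_ ?_ ?_ he
  · rw [hG]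
    compute_degree!
  · rw [hG, hq]
    norm_num
  · intro h
    rw [h] at hq
    simp at hq

theorem fixedFieldGivenBy_octahedral (h2 : (2 : k) ≠ 0) (h3 : (3 : k) ≠ 0) {G : Subgroup (PGL2 k)}
    [Finite G]
    (e : G ≃* Equiv.Perm (Fin 4)) (he : OrbitType G [2, 3, 4]) (hG : Nat.card G = 24) :
    FixedFieldGivenBy G
      ((X ^ 8 + 14 * X ^ 4 + 1) ^ 3 / (108 * (X * (X ^ 4 - 1)) ^ 4)) [2, 3, 4] := by
  obtain ⟨i, hi⟩ := IsAlgClosed.exists_pow_nat_eq (-1 : k) (n := 2) (by norm_num)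
  have hI : (C i : RatFunc k) ^ 2 = -1 := by rw [← map_pow, hi]; simp
  have hi0 : i ≠ 0 := by
    rintro rfl
    simp at hi
  have h2' : (2 : RatFunc k) ≠ 0 := by
    rw [← map_ofNat C]
    exact (map_ne_zero _).2 h2
  have hX : (X : RatFunc k) ≠ 0 := X_ne_zero
  set z : RatFunc k := (X ^ 8 + 14 * X ^ 4 + 1) ^ 3 / (108 * (X * (X ^ 4 - 1)) ^ 4) with hz
  have hsub : ∀ g, subst g z = ((moebius g) ^ 8 + 14 * (moebius g) ^ 4 + 1) ^ 3 /
      (108 * (moebius g * ((moebius g) ^ 4 - 1)) ^ 4) := fun g => by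
    simp only [hz, map_div₀, map_add, map_sub, map_mul, map_pow, map_one, map_ofNat, subst_X]
  obtain ⟨s, t, c, d, hs, ht, hst, hss, htt, hcomm, hcs, hct, hds, hdt, htop⟩ :=
    perm_four_generators
  obtain ⟨γ, hγ⟩ := exists_conj_le_of_generators h2 e (W := invariance z) hi
    (by
      rw [aff_mem_invariance, hsub, moebius_aff, hz]
      simp
      ring)
    (by
      rw [inver_mem_invariance, hsub, moebius_inver, (subst_cayley_form hX).2, hz]
      simp
      ring)
    (by
      -- Both sides of the fraction acquire 4096, as 16³ and as (8i)⁴.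
      rw [cayley, mk_mem_invariance, hsub, moebius_cayley]
      obtain ⟨h1, h4, -⟩ := cayley_forms (x := (X : RatFunc k)) hI
      have hne : (X - C i : RatFunc k) ≠ 0 := by
        have := linear_ne_zero (a := (1 : k)) (b := -i) (Or.inl one_ne_zero)
        simpa [sub_eq_add_neg] using this
      rw [(subst_cayley_form hne).2, h4, h1,
        show 108 * (8 * C i * (X * (X ^ 4 - 1))) ^ 4 =
          4096 * (108 * (X * (X ^ 4 - 1)) ^ 4 : RatFunc k) by
          linear_combination (108 * 4096 * (X * (X ^ 4 - 1)) ^ 4 * (C i ^ 2 - 1) : RatFunc k) * hI,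
        show (16 * (X ^ 8 + 14 * X ^ 4 + 1)) ^ 3 =
          4096 * ((X ^ 8 + 14 * X ^ 4 + 1) ^ 3 : RatFunc k) by ring]
      refine mul_div_mul_left _ _ ?_
      rw [show (4096 : RatFunc k) = 2 ^ 12 by norm_num]
      exact pow_ne_zero _ h2')
    hs ht hst hss htt hcomm htop (by
      rintro x (rfl | rfl | rfl | rfl)
      · exact Or.inl rfl
      · exact Or.inr (Or.inl rfl)
      · exact Or.inr (Or.inr (Or.inl ⟨hcs, hct⟩))
      -- The map ix commutes with -x and conjugates 1/x into -1/x, which is the action of d on s and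
      -- t.
      · refine Or.inr (Or.inr (Or.inr ⟨hds, hdt, Units.mk0 i hi0, hi, ?_⟩))
        rw [aff_mem_invariance, hsub, moebius_aff, hz]
        have hI4 : (C i : RatFunc k) ^ 4 = 1 := by
          linear_combination (C i ^ 2 - 1 : RatFunc k) * hI
        have hI8 : (C i : RatFunc k) ^ 8 = 1 := by
          linear_combination (C i ^ 4 + 1 : RatFunc k) * hI4
        simp only [Units.val_mk0, map_zero, add_zero, mul_pow, hI4, hI8, one_mul])
  have h108 : (108 : k) ≠ 0 := by
    rw [show (108 : k) = 2 ^ 2 * 3 ^ 3 by norm_num]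
    exact mul_ne_zero (pow_ne_zero _ h2) (pow_ne_zero _ h3)
  have hq : (108 * (Polynomial.X * (Polynomial.X ^ 4 - 1)) ^ 4 : Polynomial k).natDegree = 20 := by
    compute_degree!
  refine fixedFieldGivenBy_of_div
    (p := (Polynomial.X ^ 8 + 14 * Polynomial.X ^ 4 + 1) ^ 3)
    (q := 108 * (Polynomial.X * (Polynomial.X ^ 4 - 1)) ^ 4) (by simp only
        [hz, map_add, map_sub, map_mul, map_pow, map_one, map_ofNat, algebraMap_X])
    γ hγ ?_ ?_ ?_ he
  · rw [hG]
    compute_degree!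
  · rw [hG, hq]
    norm_num
  · intro h
    rw [h] at hq
    simp at hq

end Formulas

end

/-! ### The icosahedral group -/

section

open Matrix OnePoint MulAction

variable {k : Type*} [Field k]

/-- Klein's forms of degrees 12 and 20 are relative invariants of (1 -φ; -φ -1), whose determinant
is -1 - φ² = φ - 2; the factors are its 6th and 10th powers. All powers of φ are first reduced to
linear expressions by φ² = 1 - φ. -/
theorem icosahedral_forms {F : Type*} [CommRing F] {x φ : F} (hφ : φ ^ 2 = 1 - φ) :
    (x - φ) * (-φ * x - 1) * ((x - φ) ^ 10 + 11 * (x - φ) ^ 5 * (-φ * x - 1) ^ 5 -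
      (-φ * x - 1) ^ 10) = (φ - 2) ^ 6 * (x * (x ^ 10 + 11 * x ^ 5 - 1)) ∧
    -(x - φ) ^ 20 + 228 * (x - φ) ^ 15 * (-φ * x - 1) ^ 5 - 494 * (x - φ) ^ 10 * (-φ * x - 1) ^ 10 -
      228 * (x - φ) ^ 5 * (-φ * x - 1) ^ 15 - (-φ * x - 1) ^ 20 =
      (φ - 2) ^ 10 * (-x ^ 20 + 228 * x ^ 15 - 494 * x ^ 10 - 228 * x ^ 5 - 1) := by
  have h3 : φ ^ 3 = 2 * φ - 1 := by linear_combination (φ - 1) * hφ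
  have h4 : φ ^ 4 = 2 - 3 * φ := by linear_combination φ * h3 + 2 * hφ
  have h5 : φ ^ 5 = 5 * φ - 3 := by linear_combination φ * h4 - 3 * hφ
  have hd2 : (φ - 2) ^ 2 = 5 * (1 - φ) := by linear_combination hφ
  have hd4 : (φ - 2) ^ 4 = 25 * (2 - 3 * φ) := by
    linear_combination ((φ - 2) ^ 2 + 5 * (1 - φ)) * hd2 + 25 * hφ
  have hd6 : (φ - 2) ^ 6 = 625 - 1000 * φ := by
    linear_combination (φ - 2) ^ 2 * hd4 + 25 * (2 - 3 * φ) * hd2 + 375 * hφ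
  have hd10 : (φ - 2) ^ 10 = 106250 - 171875 * φ := by
    linear_combination (φ - 2) ^ 4 * hd6 + (625 - 1000 * φ) * hd4 + 75000 * hφ
  set A1 : F := -5 * x ^ 4 - 10 * x ^ 3 - 20 * x ^ 2 - 15 * x - 5 with hA1
  set B1 : F := -5 * x ^ 5 + 15 * x ^ 4 - 20 * x ^ 3 + 10 * x ^ 2 - 5 * x with hB1
  have hA : (x - φ) ^ 5 = (x ^ 5 + 10 * x ^ 3 + 10 * x ^ 2 + 10 * x + 3) + A1 * φ := by
    linear_combination 10 * x ^ 3 * hφ - 10 * x ^ 2 * h3 + 5 * x * h4 - h5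
  have hB : (-φ * x - 1) ^ 5 = (3 * x ^ 5 - 10 * x ^ 4 + 10 * x ^ 3 - 10 * x ^ 2 - 1) + B1 * φ := by
    linear_combination -x ^ 5 * h5 - 5 * x ^ 4 * h4 - 10 * x ^ 3 * h3 - 10 * x ^ 2 * hφ
  have hA2 : (x - φ) ^ 10 =
      (x ^ 10 + 45 * x ^ 8 + 120 * x ^ 7 + 420 * x ^ 6 + 756 * x ^ 5 + 1050 * x ^ 4 + 960 *
      x ^ 3 + 585 * x ^ 2 + 210 * x + 34) + (-10 * x ^ 9 - 45 * x ^ 8 - 240 * x ^ 7 - 630 *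
      x ^ 6 - 1260 * x ^ 5 - 1680 * x ^ 4 - 1560 * x ^ 3 - 945 * x ^ 2 - 340 * x - 55) * φ := by
    linear_combination ((x - φ) ^ 5 + (x ^ 5 + 10 * x ^ 3 + 10 * x ^ 2 + 10 * x + 3) + A1 * φ) * hA
        + A1 ^ 2 * hφ
  have hB2 : (-φ * x - 1) ^ 10 =
      (34 * x ^ 10 - 210 * x ^ 9 + 585 * x ^ 8 - 960 * x ^ 7 + 1050 * x ^ 6 - 756 * x ^ 5 +
      420 * x ^ 4 - 120 * x ^ 3 + 45 * x ^ 2 + 1) + (-55 * x ^ 10 + 340 * x ^ 9 - 945 * x ^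
      8 + 1560 * x ^ 7 - 1680 * x ^ 6 + 1260 * x ^ 5 - 630 * x ^ 4 + 240 * x ^ 3 - 45 * x ^
      2 + 10 * x) * φ := by
    linear_combination ((-φ * x - 1) ^ 5 + (3 * x ^ 5 - 10 * x ^ 4 + 10 * x ^ 3 - 10 * x ^ 2 - 1) +
        B1 * φ) * hB + B1 ^ 2 * hφ
  have hAB : (x - φ) ^ 5 * (-φ * x - 1) ^ 5 =
      (3 * x ^ 10 + 15 * x ^ 9 + 15 * x ^ 8 - 30 * x ^ 7 - 45 * x ^ 6 + 33 * x ^ 5 + 45 * x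
      ^ 4 - 30 * x ^ 3 - 15 * x ^ 2 + 15 * x - 3) + (-5 * x ^ 10 - 25 * x ^ 9 - 25 * x ^ 8 +
      50 * x ^ 7 + 75 * x ^ 6 - 55 * x ^ 5 - 75 * x ^ 4 + 50 * x ^ 3 + 25 * x ^ 2 - 25 * x +
      5) * φ := by
    rw [hA, hB]
    linear_combination A1 * B1 * hφ
  have hab : (x - φ) * (-φ * x - 1) = (-x ^ 2 - x + 1) * φ := by linear_combination x * hφ
  constructor
  · rw [show (x - φ) ^ 10 + 11 * (x - φ) ^ 5 * (-φ * x - 1) ^ 5 - (-φ * x - 1) ^ 10 =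
      (x - φ) ^ 10 + 11 * ((x - φ) ^ 5 * (-φ * x - 1) ^ 5) - (-φ * x - 1) ^ 10 by ring, hA2, hB2,
      hAB, hd6, hab]
    linear_combination (-x ^ 2 - x + 1) * (-625 * x ^ 9 + 625 * x ^ 8 - 1250 * x ^ 7 +
      1875 * x ^ 6 - 3125 * x ^ 5 - 1875 * x ^ 4 - 1250 * x ^ 3 - 625 * x ^ 2 - 625 * x) * hφ
  · rw [show -(x - φ) ^ 20 + 228 * (x - φ) ^ 15 * (-φ * x - 1) ^ 5 -
      494 * (x - φ) ^ 10 * (-φ * x - 1) ^ 10 - 228 * (x - φ) ^ 5 * (-φ * x - 1) ^ 15 -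
      (-φ * x - 1) ^ 20 = -((x - φ) ^ 10) ^ 2 + 228 * (x - φ) ^ 10 *
      ((x - φ) ^ 5 * (-φ * x - 1) ^ 5) - 494 * ((x - φ) ^ 5 * (-φ * x - 1) ^ 5) ^ 2 -
      228 * ((x - φ) ^ 5 * (-φ * x - 1) ^ 5) * (-φ * x - 1) ^ 10 - ((-φ * x - 1) ^ 10) ^ 2 by ring,
      hA2, hB2, hAB, hd10]
    linear_combination
      (-(-10 * x ^ 9 - 45 * x ^ 8 - 240 * x ^ 7 - 630 * x ^ 6 - 1260 * x ^ 5 - 1680 * x ^ 4 - 1560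
          * x ^ 3 - 945 * x ^ 2 - 340 * x - 55) ^ 2
      + 228 * (-10 * x ^ 9 - 45 * x ^ 8 - 240 * x ^ 7 - 630 * x ^ 6 - 1260 * x ^ 5 - 1680 * x ^ 4 -
          1560 * x ^ 3 - 945 * x ^ 2 - 340 * x - 55) * (-5 * x ^ 10 - 25 * x ^ 9 - 25 * x ^ 8 + 50
          * x ^ 7 + 75 * x ^ 6 - 55 * x ^ 5 - 75 * x ^ 4 + 50 * x ^ 3 + 25 * x ^ 2 - 25 * x + 5)
      - 494 * (-5 * x ^ 10 - 25 * x ^ 9 - 25 * x ^ 8 + 50 * x ^ 7 + 75 * x ^ 6 - 55 * x ^ 5 - 75 *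
          x ^ 4 + 50 * x ^ 3 + 25 * x ^ 2 - 25 * x + 5) ^ 2
      - 228 * (-5 * x ^ 10 - 25 * x ^ 9 - 25 * x ^ 8 + 50 * x ^ 7 + 75 * x ^ 6 - 55 * x ^ 5 - 75 *
          x ^ 4 + 50 * x ^ 3 + 25 * x ^ 2 - 25 * x + 5) * (-55 * x ^ 10 + 340 * x ^ 9 - 945 * x ^ 8
          + 1560 * x ^ 7 - 1680 * x ^ 6 + 1260 * x ^ 5 - 630 * x ^ 4 + 240 * x ^ 3 - 45 * x ^ 2 +
          10 * x)
      - (-55 * x ^ 10 + 340 * x ^ 9 - 945 * x ^ 8 + 1560 * x ^ 7 - 1680 * x ^ 6 + 1260 * x ^ 5 -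
          630 * x ^ 4 + 240 * x ^ 3 - 45 * x ^ 2 + 10 * x) ^ 2) * hφ

theorem mk_eq_one {g : GL (Fin 2) k} (h01 : g.1 0 1 = 0) (h10 : g.1 1 0 = 0)
    (h : g.1 0 0 = g.1 1 1) : ProjGenLinGroup.mk g = (1 : PGL2 k) := by
  have h0 : g.1 1 1 ≠ 0 := fun h0 => det_ne_zero' g (by simp [h01, h0])
  rw [← map_one ProjGenLinGroup.mk]
  refine mk_eq_mk_of_smul (g.1 1 1)⁻¹ (inv_ne_zero h0) ?_
  ext i j
  fin_cases i <;> fin_cases j <;> simp [h01, h10, h, h0]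

theorem entries_of_mk_eq_one {g : GL (Fin 2) k} (h : ProjGenLinGroup.mk g = (1 : PGL2 k)) :
    g.1 0 1 = 0 ∧ g.1 1 0 = 0 ∧ g.1 0 0 = g.1 1 1 := by
  rw [← map_one ProjGenLinGroup.mk] at h
  obtain ⟨u, -, h⟩ := exists_smul_of_mk_eq_mk h.symm
  rw [← h]
  simp

/-- By Cayley-Hamilton M² = tr(M)·M - det(M); if M² is scalar and M is not, the trace vanishes. -/
theorem trace_eq_zero_of_involution {g : GL (Fin 2) k}
    (h1 : ProjGenLinGroup.mk g ≠ (1 : PGL2 k))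
    (h2 : ProjGenLinGroup.mk g * ProjGenLinGroup.mk g = (1 : PGL2 k)) :
    g.1 0 0 + g.1 1 1 = 0 := by
  rw [← map_mul] at h2
  obtain ⟨h01, h10, hd⟩ := entries_of_mk_eq_one h2
  simp only [Units.val_mul, Matrix.mul_apply, Fin.sum_univ_two] at h01 h10 hd
  by_contra hc
  refine h1 (mk_eq_one ?_ ?_ ?_)
  · exact (mul_eq_zero.1 (show g.1 0 1 * (g.1 0 0 + g.1 1 1) = 0 by
      linear_combination h01)).resolve_right hc
  · exact (mul_eq_zero.1 (show g.1 1 0 * (g.1 0 0 + g.1 1 1) = 0 by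
      linear_combination h10)).resolve_right hc
  · exact sub_eq_zero.1 ((mul_eq_zero.1 (show (g.1 0 0 - g.1 1 1) * (g.1 0 0 + g.1 1 1) = 0 by
      linear_combination hd)).resolve_right hc)

/-- By Cayley-Hamilton M³ is (tr² - det)·M plus a scalar; if M³ is scalar and M is not, then tr² =
det. -/
theorem sq_trace_eq_det_of_pow_three {g : GL (Fin 2) k}
    (h1 : ProjGenLinGroup.mk g ≠ (1 : PGL2 k))
    (h3 : (ProjGenLinGroup.mk g : PGL2 k) ^ 3 = 1) :
    (g.1 0 0 + g.1 1 1) ^ 2 = g.1 0 0 * g.1 1 1 - g.1 0 1 * g.1 1 0 := by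
  rw [← map_pow, pow_succ, sq] at h3
  obtain ⟨h01, h10, hd⟩ := entries_of_mk_eq_one h3
  simp only [Units.val_mul, Matrix.mul_apply, Fin.sum_univ_two] at h01 h10 hd
  rw [← sub_eq_zero]
  by_contra hc
  refine h1 (mk_eq_one ?_ ?_ ?_)
  · exact (mul_eq_zero.1 (show g.1 0 1 * ((g.1 0 0 + g.1 1 1) ^ 2 -
      (g.1 0 0 * g.1 1 1 - g.1 0 1 * g.1 1 0)) = 0 by linear_combination h01)).resolve_right hc
  · exact (mul_eq_zero.1 (show g.1 1 0 * ((g.1 0 0 + g.1 1 1) ^ 2 -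
      (g.1 0 0 * g.1 1 1 - g.1 0 1 * g.1 1 0)) = 0 by linear_combination h10)).resolve_right hc
  · exact sub_eq_zero.1 ((mul_eq_zero.1 (show (g.1 0 0 - g.1 1 1) * ((g.1 0 0 + g.1 1 1) ^ 2 -
      (g.1 0 0 * g.1 1 1 - g.1 0 1 * g.1 1 0)) = 0 by linear_combination hd)).resolve_right hc)

set_option maxRecDepth 4000 in
/-- Generators of the icosahedral group. -/
theorem alternatingGroup_five_generators : ∃ a b : alternatingGroup (Fin 5),
    a ≠ 1 ∧ b ≠ 1 ∧ a * b ≠ 1 ∧ a ^ 5 = 1 ∧ b * b = 1 ∧ (a * b) ^ 3 = 1 ∧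
      Subgroup.closure {a, b} = ⊤ := by
  obtain ⟨a, b, ha, hb, hab, ha5, hb2, hab3⟩ : ∃ a b : alternatingGroup (Fin 5),
    a ≠ 1 ∧ b ≠ 1 ∧ a * b ≠ 1 ∧ a ^ 5 = 1 ∧ b * b = 1 ∧ (a * b) ^ 3 = 1 :=
    ⟨⟨c[0, 1, 2, 3, 4], Equiv.Perm.mem_alternatingGroup.2 (by decide)⟩,
      ⟨c[1, 2] * c[3, 4], Equiv.Perm.mem_alternatingGroup.2 (by decide)⟩,
      by decide, by decide, by decide, by decide, by decide, by decide⟩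
  refine ⟨a, b, ha, hb, hab, ha5, hb2, hab3, ?_⟩
  set K := Subgroup.closure {a, b} with hK
  have haK : a ∈ K := Subgroup.subset_closure (by simp)
  have hbK : b ∈ K := Subgroup.subset_closure (by simp)
  have hord : ∀ (x : alternatingGroup (Fin 5)) (n : ℕ), n.Prime → x ≠ 1 → x ^ n = 1 → x ∈ K →
      n ∣ Nat.card K := fun x n hn hx hxn hxK => by
    have : Fact n.Prime := ⟨hn⟩
    rw [← orderOf_eq_prime hxn hx, ← Subgroup.orderOf_mk x hxK]
    exact orderOf_dvd_natCard _
  have h5 := hord a 5 (by norm_num) ha ha5 haK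
  have h2 := hord b 2 (by norm_num) hb (by rw [sq, hb2]) hbK
  have h3 := hord (a * b) 3 (by norm_num) hab hab3 (mul_mem haK hbK)
  have h60 : Nat.card (alternatingGroup (Fin 5)) = 60 := by
    rw [nat_card_alternatingGroup, Nat.card_fin]
    rfl
  have hmul := K.card_mul_index
  rw [h60] at hmul
  -- Elements of orders 2, 3 and 5 make 30 divide |K|. Index 2 would make K normal, against the
  -- simplicity of A₅.
  have hidx : K.index = 1 ∨ K.index = 2 := by
    obtain ⟨c, hc⟩ : 30 ∣ Nat.card K := by omega
    rw [hc] at hmul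
    have : c * K.index = 2 := by
      have : 30 * (c * K.index) = 30 * 2 := by rw [← mul_assoc, hmul]
      omega
    have h := Nat.le_of_dvd (by norm_num) (Dvd.intro_left c this)
    have h0 : K.index ≠ 0 := by
      rintro h0
      simp [h0] at this
    omega
  rcases hidx with h | h
  · exact Subgroup.index_eq_one.1 h
  · have hn : K.Normal := Subgroup.normal_of_index_eq_two h
    rcases hn.eq_bot_or_eq_top with h' | h'
    · rw [h'] at haK
      exact absurd (Subgroup.mem_bot.1 haK) ha
    · exact h'

/-- The class of the transformation `x ↦ (x - φ) / (-φ x - 1)`. -/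
def icoInvolution (φ : k) (h : 1 * -1 - -φ * -φ ≠ 0) : PGL2 k :=
  ProjGenLinGroup.mk (glOf 1 (-φ) (-φ) (-1) h)

/-- The relations a⁵ = b² = (ab)³ = 1 determine the pair up to conjugation and the choice of the
fifth root of unity: a becomes ζx, the trace conditions fix the diagonal of b and the product of its
off-diagonal entries, and a homothety, which commutes with ζx, balances these two entries. -/
theorem exists_conj_icosahedral [IsAlgClosed k] (h5 : (5 : k) ≠ 0) {a b : PGL2 k} (ha : a ≠ 1)
    (hb : b ≠ 1) (hab : a * b ≠ 1) (ha5 : a ^ 5 = 1) (hb2 : b * b = 1) (hab3 : (a * b) ^ 3 = 1) :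
    ∃ (γ : PGL2 k) (ζ : kˣ) (φ : k) (h : _), ζ ^ 5 = 1 ∧ φ ^ 2 = 1 - φ ∧
      γ * a * γ⁻¹ = aff ζ 0 ∧ γ * b * γ⁻¹ = icoInvolution φ h := by
  obtain ⟨δ, ζ, hδ, hζ1, hζ5⟩ := exists_conj_aff_zero ha (n := 5) (by exact_mod_cast h5) ha5
  have hζ0 : (ζ : k) ≠ 0 := ζ.ne_zero
  have hζ5' : (ζ : k) ^ 5 = 1 := by rw [← Units.val_pow_eq_pow_val, hζ5, Units.val_one]
  have hζ1' : (ζ : k) - 1 ≠ 0 := fun h => hζ1 (Units.ext (by simpa using sub_eq_zero.1 h))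
  have hsum : (ζ : k) ^ 4 + ζ ^ 3 + ζ ^ 2 + ζ + 1 = 0 := by
    have : ((ζ : k) - 1) * (ζ ^ 4 + ζ ^ 3 + ζ ^ 2 + ζ + 1) = 0 := by linear_combination hζ5'
    exact (mul_eq_zero.1 this).resolve_left hζ1'
  -- The equation φ² = 1 - φ is the vanishing of the sum of the fifth roots of unity.
  set φ : k := ζ + (ζ : k)⁻¹ with hφ
  have hφζ : φ * ζ = ζ ^ 2 + 1 := by rw [hφ]; field_simp
  have hφ2 : φ ^ 2 = 1 - φ := by
    rw [hφ]
    field_simp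
    linear_combination hsum
  have hφ0 : φ ≠ 0 := fun h => by simp [h] at hφ2
  obtain ⟨M, hM⟩ := ProjGenLinGroup.mk_surjective (δ * b * δ⁻¹)
  have htr := trace_eq_zero_of_involution (g := M) (by rw [hM]; simpa using hb)
    (by rw [hM]; exact mul_self_conj hb2)
  have hprod : ProjGenLinGroup.mk (glOf (ζ : k) 0 0 1 (by simp) * M) = δ * (a * b) * δ⁻¹ := by
    rw [map_mul, hM]
    change aff ζ 0 * _ = _
    rw [← hδ]
    group
  have h3 := sq_trace_eq_det_of_pow_three (g := glOf (ζ : k) 0 0 1 (by simp) * M)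
    (by rw [hprod]; simpa using hab) (by rw [hprod, conj_pow, hab3]; simp)
  simp only [Units.val_mul, glOf_val, Matrix.mul_apply, Fin.sum_univ_two, Matrix.of_apply,
    Matrix.cons_val', Matrix.cons_val_zero, Matrix.cons_val_one, Matrix.cons_val_fin_one,
    zero_mul, one_mul, add_zero, zero_add] at h3
  have hdet := det_ne_zero' M
  have h11 : M.1 1 1 = -M.1 0 0 := by linear_combination htr
  rw [h11] at h3 hdet
  -- For M = (α β; γ -α) the condition tr² = det on diag(ζ,1)·M gives βγ = α²(1 - φ) = (αφ)².
  have hβγ : M.1 0 1 * M.1 1 0 = (M.1 0 0 * φ) ^ 2 := by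
    refine mul_left_cancel₀ hζ0 ?_
    linear_combination h3 - M.1 0 0 ^ 2 * ζ * hφ2 + M.1 0 0 ^ 2 * hφζ
  have hα : M.1 0 0 ≠ 0 := fun h => hdet (by
    rw [h] at hβγ ⊢
    linear_combination -hβγ)
  have hβ : M.1 0 1 ≠ 0 := fun h => by
    rw [h, zero_mul, eq_comm, sq_eq_zero_iff] at hβγ
    exact mul_ne_zero hα hφ0 hβγ
  have hne : 1 * -1 - -φ * -φ ≠ 0 := fun h => hdet (by
    linear_combination M.1 0 0 ^ 2 * h - hβγ)
  -- Conjugation by x ↦ ux multiplies β by u and divides γ by u; with this u both become -αφ.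
  have hu : -(φ * M.1 0 0 / M.1 0 1) ≠ 0 :=
    neg_ne_zero.2 (div_ne_zero (mul_ne_zero hφ0 hα) hβ)
  refine ⟨aff (Units.mk0 _ hu) 0 * δ, ζ, φ, hne, hζ5, hφ2, ?_, ?_⟩
  · rw [← conj_aff_zero (Units.mk0 _ hu) ζ, ← hδ]
    group
  · rw [show aff (Units.mk0 _ hu) 0 * δ * b * (aff (Units.mk0 _ hu) 0 * δ)⁻¹ =
      aff (Units.mk0 _ hu) 0 * (δ * b * δ⁻¹) * (aff (Units.mk0 _ hu) 0)⁻¹ by group, ← hM,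
      mul_inv_eq_iff_eq_mul, aff, icoInvolution, ← map_mul, ← map_mul]
    refine mk_eq_mk_of_smul (M.1 0 0)⁻¹ (inv_ne_zero hα) ?_
    ext i j
    fin_cases i <;> fin_cases j <;> simp [Matrix.mul_apply, Matrix.vecMul, dotProduct,
        Fin.sum_univ_two, h11]
    · field_simp
    · field_simp
    · field_simp
      linear_combination hβγ
    · field_simp

section Formulas

open RatFunc

theorem moebius_icoInvolution (φ : k) (h) :
    moebius (glOf 1 (-φ) (-φ) (-1) h) = (X - C φ) / (-C φ * X - 1) := by
  simp [moebius, sub_eq_add_neg]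

/-- Homogenization: numerator and denominator both carry y⁶⁰, as 20·3 and 12·5. -/
theorem icosahedral_div {F : Type*} [Field F] {x y : F} (hy : y ≠ 0) :
    (-(x / y) ^ 20 + 228 * (x / y) ^ 15 - 494 * (x / y) ^ 10 - 228 * (x / y) ^ 5 - 1) ^ 3 /
        (x / y * ((x / y) ^ 10 + 11 * (x / y) ^ 5 - 1)) ^ 5 =
      (-x ^ 20 + 228 * x ^ 15 * y ^ 5 - 494 * x ^ 10 * y ^ 10 - 228 * x ^ 5 * y ^ 15 - y ^ 20) ^ 3 /
        (x * y * (x ^ 10 + 11 * x ^ 5 * y ^ 5 - y ^ 10)) ^ 5 := by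
  rw [show -(x / y) ^ 20 + 228 * (x / y) ^ 15 - 494 * (x / y) ^ 10 - 228 * (x / y) ^ 5 - 1 =
      (-x ^ 20 + 228 * x ^ 15 * y ^ 5 - 494 * x ^ 10 * y ^ 10 - 228 * x ^ 5 * y ^ 15 - y ^ 20) /
        y ^ 20 by field_simp,
    show x / y * ((x / y) ^ 10 + 11 * (x / y) ^ 5 - 1) =
      (x * y * (x ^ 10 + 11 * x ^ 5 * y ^ 5 - y ^ 10)) / y ^ 12 by field_simp,
    div_pow, div_pow, ← pow_mul, ← pow_mul, div_div_div_cancel_right₀ (pow_ne_zero _ hy)]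

variable [IsAlgClosed k]

theorem exists_conj_le_invariance_icosahedral (h5 : (5 : k) ≠ 0)
    {G : Subgroup (PGL2 k)} (e : G ≃* alternatingGroup (Fin 5)) :
    ∃ γ, conjSubgroup γ G ≤ invariance
      ((-X ^ 20 + 228 * X ^ 15 - 494 * X ^ 10 - 228 * X ^ 5 - 1) ^ 3 /
        (X * (X ^ 10 + 11 * X ^ 5 - 1)) ^ 5) := by
  set z : RatFunc k := (-X ^ 20 + 228 * X ^ 15 - 494 * X ^ 10 - 228 * X ^ 5 - 1) ^ 3 /
    (X * (X ^ 10 + 11 * X ^ 5 - 1)) ^ 5 with hz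
  obtain ⟨a, b, ha, hb, hab, ha5, hb2, hab3, htop⟩ := alternatingGroup_five_generators
  let f : alternatingGroup (Fin 5) →* PGL2 k := G.subtype.comp e.symm.toMonoidHom
  have hf : Function.Injective f := Subtype.val_injective.comp e.symm.injective
  have hf1 : ∀ x, x ≠ 1 → f x ≠ 1 := fun x hx h => hx (hf (h.trans (map_one f).symm))
  obtain ⟨γ, ζ, φ, h, hζ, hφ, hγa, hγb⟩ := exists_conj_icosahedral h5 (a := f a) (b := f b)
    (hf1 a ha) (hf1 b hb) (by rw [← map_mul]; exact hf1 _ hab) (by rw [← map_pow, ha5, map_one])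
    (by rw [← map_mul, hb2, map_one]) (by rw [← map_mul, ← map_pow, hab3, map_one])
  have hsub : ∀ g, subst g z = (-(moebius g) ^ 20 + 228 * (moebius g) ^ 15 -
      494 * (moebius g) ^ 10 - 228 * (moebius g) ^ 5 - 1) ^ 3 /
      (moebius g * ((moebius g) ^ 10 + 11 * (moebius g) ^ 5 - 1)) ^ 5 := fun g => by
    simp only [hz, map_div₀, map_add, map_sub, map_neg, map_mul, map_pow, map_one, map_ofNat,
      subst_X]
  refine ⟨γ, conj_le_of_closure e htop γ ?_⟩
  rintro x (rfl | rfl)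
  · change γ * f x * γ⁻¹ ∈ _
    rw [hγa, aff_mem_invariance, hsub, moebius_aff, hz]
    have h5' : (C (ζ : k) : RatFunc k) ^ 5 = 1 := by
      rw [← map_pow, ← Units.val_pow_eq_pow_val, hζ]
      simp
    have h10 : (C (ζ : k) : RatFunc k) ^ 10 = 1 := by
      linear_combination (C (ζ : k) ^ 5 + 1 : RatFunc k) * h5'
    have h15 : (C (ζ : k) : RatFunc k) ^ 15 = 1 := by
      linear_combination (C (ζ : k) ^ 10 : RatFunc k) * h5' + h10
    have h20 : (C (ζ : k) : RatFunc k) ^ 20 = 1 := by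
      linear_combination (C (ζ : k) ^ 15 : RatFunc k) * h5' + h15
    simp only [map_zero, add_zero, mul_pow, h5', h10, h15, h20, one_mul]
  · change γ * f x * γ⁻¹ ∈ _
    rw [hγb, icoInvolution, mk_mem_invariance, hsub, moebius_icoInvolution]
    have hφ' : (C φ : RatFunc k) ^ 2 = 1 - C φ := by rw [← map_pow, hφ]; simp
    obtain ⟨h1, h3⟩ := icosahedral_forms (x := (X : RatFunc k)) hφ'
    have hne : (-C φ * X - 1 : RatFunc k) ≠ 0 := by
      have := linear_ne_zero (a := -φ) (b := (-1 : k)) (Or.inr (by simp))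
      simpa [sub_eq_add_neg] using this
    have hφ2 : (C φ - 2 : RatFunc k) ≠ 0 := by
      have : φ - 2 ≠ 0 := fun h0 => h (by linear_combination h0 - hφ)
      have h4 := (map_ne_zero (C : k →+* RatFunc k)).2 this
      simpa only [map_sub, map_ofNat] using h4
    rw [icosahedral_div hne, h1, h3, hz, mul_pow, mul_pow _ _ 5, ← pow_mul, ← pow_mul]
    exact mul_div_mul_left _ _ (pow_ne_zero _ hφ2)

theorem fixedFieldGivenBy_icosahedral (h5 : (5 : k) ≠ 0) {G : Subgroup (PGL2 k)} [Finite G]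
    (e : G ≃* alternatingGroup (Fin 5)) (he : OrbitType G [2, 3, 5]) (hG : Nat.card G = 60) :
    FixedFieldGivenBy G
      ((-X ^ 20 + 228 * X ^ 15 - 494 * X ^ 10 - 228 * X ^ 5 - 1) ^ 3 /
        (X * (X ^ 10 + 11 * X ^ 5 - 1)) ^ 5) [2, 3, 5] := by
  obtain ⟨γ, hγ⟩ := exists_conj_le_invariance_icosahedral h5 e
  have hq : ((Polynomial.X * (Polynomial.X ^ 10 + 11 * Polynomial.X ^ 5 - 1)) ^ 5 :
      Polynomial k).natDegree = 55 := by
    compute_degree!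
  refine fixedFieldGivenBy_of_div
    (p := (-Polynomial.X ^ 20 + 228 * Polynomial.X ^ 15 - 494 * Polynomial.X ^ 10 -
      228 * Polynomial.X ^ 5 - 1) ^ 3)
    (q := (Polynomial.X * (Polynomial.X ^ 10 + 11 * Polynomial.X ^ 5 - 1)) ^ 5)
    (by simp only [map_add, map_sub, map_neg, map_mul, map_pow, map_one, map_ofNat, algebraMap_X])
    γ hγ ?_ ?_ ?_ he
  · rw [hG]
    compute_degree!
  · rw [hG, hq]
    norm_num
  · intro h
    rw [h] at hq
    simp at hq

omit [IsAlgClosed k] in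
theorem invariance_le_const_mul (c : k) (z : RatFunc k) :
    invariance z ≤ invariance (C c * z) := fun g hg => by
  obtain ⟨g, rfl⟩ := ProjGenLinGroup.mk_surjective g
  rw [mk_mem_invariance] at hg ⊢
  rw [map_mul, subst_C, hg]

omit [IsAlgClosed k] in
theorem conj_le_invariance_subst {G : Subgroup (PGL2 k)} {γ : PGL2 k} {z : RatFunc k}
    (h : conjSubgroup γ G ≤ invariance z) (δ : GL (Fin 2) k) :
    conjSubgroup ((ProjGenLinGroup.mk δ)⁻¹ * γ) G ≤ invariance (subst δ z) := by
  intro g hg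
  rw [conjSubgroup_mul, mem_conjSubgroup, inv_inv] at hg
  have hg' := h hg
  obtain ⟨g, rfl⟩ := ProjGenLinGroup.mk_surjective g
  rw [← map_inv, ← map_mul, ← map_mul, mk_mem_invariance] at hg'
  rw [mk_mem_invariance, subst_subst]
  conv_rhs => rw [← hg', subst_subst]
  congr 2
  group

/-- The general icosahedral invariant survives in characteristic 3. Substituting lx with l⁵ = -i
makes its degree 20 form -(x¹⁰ - 1)², because 228 = 0 and 494 = 2 there; the constant factor -i then
absorbs the scaling of the denominator. -/
theorem fixedFieldGivenBy_icosahedral_three [CharP k 3] {G : Subgroup (PGL2 k)} [Finite G]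
    (e : G ≃* alternatingGroup (Fin 5)) (he : OrbitType G [6, 5]) (hG : Nat.card G = 60) {i : k}
    (hi : i ^ 2 = -1) :
    FixedFieldGivenBy G
      ((X ^ 10 - 1) ^ 6 / (X * (X ^ 10 + 2 * C i * X ^ 5 + 1)) ^ 5) [6, 5] := by
  have h3 : (3 : k) = 0 := by exact_mod_cast CharP.cast_eq_zero k 3
  have h5 : (5 : k) ≠ 0 := fun h => one_ne_zero (α := k) (by linear_combination 2 * h3 - h)
  have h3' : (3 : RatFunc k) = 0 := by rw [← map_ofNat C, h3, map_zero]
  obtain ⟨γ, hγ⟩ := exists_conj_le_invariance_icosahedral h5 e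
  have hi0 : i ≠ 0 := by
    rintro rfl
    simp at hi
  obtain ⟨l, hl⟩ := IsAlgClosed.exists_pow_nat_eq (-i) (n := 5) (by norm_num)
  have hl0 : l ≠ 0 := by
    rintro rfl
    simp [eq_comm, hi0] at hl
  have hL : (C l : RatFunc k) ^ 5 = -C i := by rw [← map_pow, hl]; simp
  have hI : (C i : RatFunc k) ^ 2 = -1 := by rw [← map_pow, hi]; simp
  have hL10 : (C l : RatFunc k) ^ 10 = -1 := by
    linear_combination (C l ^ 5 - C i : RatFunc k) * hL + hI
  have hL20 : (C l : RatFunc k) ^ 20 = 1 := by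
    linear_combination (C l ^ 10 - 1 : RatFunc k) * hL10
  have hI0 : (C i : RatFunc k) ≠ 0 := (map_ne_zero _).2 hi0
  have hγ' := (conj_le_invariance_subst hγ (glOf l 0 0 1 (by simpa using hl0))).trans
    (invariance_le_const_mul (-i) _)
  have hz : C (-i) * subst (glOf l 0 0 1 (by simpa using hl0))
      ((-X ^ 20 + 228 * X ^ 15 - 494 * X ^ 10 - 228 * X ^ 5 - 1) ^ 3 /
        (X * (X ^ 10 + 11 * X ^ 5 - 1)) ^ 5) =
      (X ^ 10 - 1) ^ 6 / (X * (X ^ 10 + 2 * C i * X ^ 5 + 1)) ^ 5 := by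
    have hm : moebius (glOf l 0 0 1 (by simpa using hl0)) = C l * X :=
      (moebius_aff (Units.mk0 l hl0) 0 _).trans (by simp)
    simp only [map_div₀, map_add, map_sub, map_neg, map_mul, map_pow, map_one, map_ofNat,
      subst_X, hm]
    have hN : -(C l * X) ^ 20 + 228 * (C l * X) ^ 15 - 494 * (C l * X) ^ 10 -
        228 * (C l * X) ^ 5 - 1 = -(X ^ 10 - 1 : RatFunc k) ^ 2 := by
      linear_combination (-X ^ 20 : RatFunc k) * hL20 - (494 * X ^ 10 : RatFunc k) * hL10 +
        (164 * X ^ 10 + 76 * C l ^ 15 * X ^ 15 - 76 * C l ^ 5 * X ^ 5 : RatFunc k) * h3'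
    have hD : (C l * X * ((C l * X) ^ 10 + 11 * (C l * X) ^ 5 - 1)) ^ 5 =
        C i * (X * (X ^ 10 + 2 * C i * X ^ 5 + 1) : RatFunc k) ^ 5 := by
      rw [show C l * X * ((C l * X) ^ 10 + 11 * (C l * X) ^ 5 - 1) =
        -C l * (X * (X ^ 10 + 2 * C i * X ^ 5 + 1) : RatFunc k) by
          linear_combination (C l * X ^ 11 : RatFunc k) * hL10 +
            (11 * C l * X ^ 6 : RatFunc k) * hL - (3 * C l * C i * X ^ 6 : RatFunc k) * h3']
      linear_combination (-(X * (X ^ 10 + 2 * C i * X ^ 5 + 1)) ^ 5 : RatFunc k) * hL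
    rw [hN, hD, mul_div_assoc', show -C i * (-(X ^ 10 - 1 : RatFunc k) ^ 2) ^ 3 =
      C i * (X ^ 10 - 1) ^ 6 by ring, mul_div_mul_left _ _ hI0]
  rw [hz] at hγ'
  have hq : ((Polynomial.X * (Polynomial.X ^ 10 + 2 * Polynomial.C i * Polynomial.X ^ 5 + 1)) ^ 5 :
      Polynomial k).natDegree = 55 := by
    compute_degree!
  refine fixedFieldGivenBy_of_div
    (p := (Polynomial.X ^ 10 - 1) ^ 6)
    (q := (Polynomial.X * (Polynomial.X ^ 10 + 2 * Polynomial.C i * Polynomial.X ^ 5 + 1)) ^ 5)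
    (by simp only [map_add, map_sub, map_mul, map_pow, map_one, map_ofNat, algebraMap_X,
      algebraMap_C])
    _ hγ' ?_ ?_ ?_ he
  · rw [hG]
    compute_degree!
  · rw [hG, hq]
    norm_num
  · intro h
    rw [h] at hq
    simp at hq

end Formulas

end

/-! ### Tame groups: from orbit types to isomorphism types and back -/

section

open Matrix OnePoint MulAction

variable {k : Type*} [Field k]

/-- A property of stabilizer orders that fails for 1 and holds for at most one entry of the list
isolates a single orbit. It is applied to evenness. -/
theorem OrbitType.mem_orbit {G : Subgroup (PGL2 k)} [Finite G] {e : List ℕ} (he : OrbitType G e)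
    (q : ℕ → Prop) (hq1 : ¬ q 1) (hq : ∀ i j, q (e.get i) → q (e.get j) → i = j)
    {R S : OnePoint k} (hR : q (Nat.card (stabilizer G R))) (hS : q (Nat.card (stabilizer G S))) :
    R ∈ orbit G S := by
  obtain ⟨P, -, hcard, hfree⟩ := he
  have key : ∀ T : OnePoint k, q (Nat.card (stabilizer G T)) →
      ∃ i, T ∈ orbit G (P i) ∧ q (e.get i) := fun T hT => by
    by_contra! h
    have hT1 : ∀ i, T ∉ orbit G (P i) := fun i hi => h i hi (by
      rwa [card_stabilizer_eq_of_mem_orbit G hi, hcard] at hT)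
    rw [hfree T hT1] at hT
    exact hq1 hT
  obtain ⟨i, hi, hqi⟩ := key R hR
  obtain ⟨j, hj, hqj⟩ := key S hS
  rw [hq i j hqi hqj] at hi
  rwa [orbit_eq_iff.2 hj]

theorem natCast_ne_zero_of_char_ne (p : ℕ) [CharP k p] {q : ℕ} (hq : q.Prime) (hp : p ≠ q) :
    (q : k) ≠ 0 := fun h => by
  have h1 : p ∣ q := (CharP.cast_eq_zero_iff k p q).1 h
  rcases (Nat.dvd_prime hq).1 h1 with h | h
  · exact CharP.char_ne_one k p h
  · exact hp h

theorem two_ne_zero_of_char_ne_two (p : ℕ) [CharP k p] (hp2 : p ≠ 2) : (2 : k) ≠ 0 := by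
  exact_mod_cast natCast_ne_zero_of_char_ne (k := k) p Nat.prime_two hp2

theorem not_dvd_two_pow_mul_three_pow (p : ℕ) [CharP k p] (hp2 : p ≠ 2) (hp3 : p ≠ 3) (a b : ℕ) :
    ¬ p ∣ 2 ^ a * 3 ^ b := fun h => by
  have h2 := natCast_ne_zero_of_char_ne (k := k) p Nat.prime_two hp2
  have h3 := natCast_ne_zero_of_char_ne (k := k) p Nat.prime_three hp3
  have h := (CharP.cast_eq_zero_iff k p _).2 h
  push_cast at h h2 h3
  exact mul_ne_zero (pow_ne_zero a h2) (pow_ne_zero b h3) h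

/-- A point with stabilizer of order 3 has four translates, and the action on them is faithful
because three fixed points force the identity. -/
theorem OrbitType.nonempty_mulEquiv_alternatingGroup_four {G : Subgroup (PGL2 k)} [Finite G]
    (hG : Nat.card G = 12) (he : OrbitType G [2, 3, 3]) :
    Nonempty (G ≃* alternatingGroup (Fin 4)) := by
  obtain ⟨P, -, hcard, -⟩ := he
  have h3 : Nat.card (stabilizer G (P 1)) = 3 := hcard 1
  have h4 := card_stabilizer_mul_ncard_orbit G (P 1)
  rw [h3, hG] at h4
  have h4 : (orbit G (P 1)).ncard = 4 := by omega
  have : Finite (orbit G (P 1)) := finite_orbit G (P 1)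
  refine nonempty_mulEquiv_alternatingGroup (α := orbit G (P 1)) h4 (toPermHom G _) ?_
    (by rw [hG]; rfl)
  rw [injective_iff_map_eq_one]
  intro g hg
  have hfix : ∀ Q ∈ orbit G (P 1), (g : PGL2 k) • Q = Q := fun Q hQ =>
    congrArg (fun σ : Equiv.Perm (orbit G (P 1)) => (σ ⟨Q, hQ⟩ : OnePoint k)) hg
  obtain ⟨A, B, D, hA, hB, hD, hAB, hAD, hBD⟩ := (Set.two_lt_ncard_iff (finite_orbit G (P 1))).1
    (by omega : 2 < (orbit G (P 1)).ncard)
  exact Subtype.ext (eq_one_of_fix_three hAB hAD hBD (hfix A hA) (hfix B hB) (hfix D hD))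

theorem card_of_alternatingGroup_five {G : Type*} [Group G] (e : G ≃* alternatingGroup (Fin 5)) :
    Nat.card G = 60 := by
  rw [Nat.card_congr e.toEquiv, nat_card_alternatingGroup, Nat.card_fin]
  rfl

section Tame

variable [IsAlgClosed k]

/-- A normal subgroup of prime order would require a stabilizer of order at least 12, while all have
order at most 4. -/
theorem OrbitType.nonempty_mulEquiv_perm_four {G : Subgroup (PGL2 k)} [Finite G]
    (hG : Nat.card G = 24) (he : OrbitType G [2, 3, 4]) : Nonempty (G ≃* Equiv.Perm (Fin 4)) := by
  have key : ∀ K : Subgroup G, K.Normal → ¬ (Nat.card K).Prime := fun K hK hp => by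
    obtain ⟨P, hP⟩ := exists_card_le_of_normal hK hp
    have := he.card_stabilizer P
    simp only [List.mem_cons, List.not_mem_nil, or_false] at this
    omega
  exact FiniteMoebius.nonempty_mulEquiv_perm_four hG
    (fun K hK h => key K hK (by rw [h]; exact Nat.prime_two))
        (fun K hK h => key K hK (by rw [h]; exact Nat.prime_three))

theorem OrbitType.nonempty_mulEquiv_alternatingGroup_five (h2 : (2 : k) ≠ 0)
    {G : Subgroup (PGL2 k)} [Finite G] (hG : Nat.card G = 60) (he : OrbitType G [2, 3, 5])
    (htame : ∀ P, uniqueFixCount G P = 0) : Nonempty (G ≃* alternatingGroup (Fin 5)) := by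
  have key : ∀ P : OnePoint k, Nat.card (stabilizer G P) = 1 ∨ Nat.card (stabilizer G P) = 2 ∨
      Nat.card (stabilizer G P) = 3 ∨ Nat.card (stabilizer G P) = 5 := fun P => by
    simpa using he.card_stabilizer P
  refine nonempty_mulEquiv_alternatingGroup_five_of_orbits h2 G hG
    (fun P Q hP hQ => he.mem_orbit (2 ∣ ·) (by norm_num) (by decide) hP hQ)
    (fun P hP => ?_) (fun P => ?_) (fun P => ?_)
  · have := key P
    rw [htame]
    omega
  · have := key P
    omega
  · have := key P
    omega

/-- A tame stabilizer is cyclic, so types (n,n) and (2,2,m) produce elements of order |G| and |G|/2,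
which the bound excludes. -/
theorem orbitType_of_orderOf_le {G : Subgroup (PGL2 k)} [Finite G]
    (htame : ∀ P, uniqueFixCount G P = 0) (h12 : 12 ≤ Nat.card G) {n : ℕ}
    (hn : 2 * n < Nat.card G) (hord : ∀ g : G, orderOf g ≤ n) :
    (Nat.card G = 12 ∧ OrbitType G [2, 3, 3]) ∨ (Nat.card G = 24 ∧ OrbitType G [2, 3, 4]) ∨
      (Nat.card G = 60 ∧ OrbitType G [2, 3, 5]) := by
  rcases tame_types G htame with ⟨he, h⟩ | ⟨he, -⟩ | ⟨m', hm', h, he⟩ | h | h | h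
  · omega
  · obtain ⟨Q, -, hcard, -⟩ := he
    obtain ⟨g, hg⟩ := exists_orderOf_eq_card_stabilizer (htame (Q 0))
    have h1 : Nat.card (stabilizer G (Q 0)) = Nat.card G := hcard 0
    have := hord g
    omega
  · obtain ⟨Q, -, hcard, -⟩ := he
    obtain ⟨g, hg⟩ := exists_orderOf_eq_card_stabilizer (htame (Q 2))
    have h1 : Nat.card (stabilizer G (Q 2)) = m' := hcard 2
    have := hord g
    omega
  · exact Or.inl h
  · exact Or.inr (Or.inl h)
  · exact Or.inr (Or.inr h)

variable (p : ℕ) [CharP k p]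

theorem tame_groups (hp2 : p ≠ 2) (G : Subgroup (PGL2 k)) [Finite G]
    (htame : ∀ P, uniqueFixCount G P = 0) :
    (∃ m : ℕ, ¬ p ∣ m ∧ Nonempty (G ≃* Multiplicative (ZMod m))) ∨
      (∃ m : ℕ, 2 ≤ m ∧ ¬ p ∣ m ∧ Nonempty (G ≃* DihedralGroup m)) ∨
      (p ≠ 3 ∧ Nonempty (G ≃* alternatingGroup (Fin 4))) ∨
      (p ≠ 3 ∧ Nonempty (G ≃* Equiv.Perm (Fin 4))) ∨
      (p ≠ 5 ∧ Nonempty (G ≃* alternatingGroup (Fin 5))) := by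
  have hp := not_dvd_of_uniqueFixCount_eq_zero p htame
  rcases tame_types G htame with ⟨-, h⟩ | ⟨he, -⟩ | ⟨m, hm, hG, he⟩ | ⟨hG, he⟩ | ⟨hG, he⟩ |
    ⟨hG, he⟩
  · exact Or.inl ⟨_, hp, nonempty_mulEquiv_zmod (g := (1 : G)) (by rw [orderOf_one, h])⟩
  · obtain ⟨P, -, hcard, -⟩ := he
    obtain ⟨g, hg⟩ := exists_orderOf_eq_card_stabilizer (htame (P 0))
    exact Or.inl ⟨_, hp, nonempty_mulEquiv_zmod (hg.trans (hcard 0))⟩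
  · obtain ⟨P, -, hcard, -⟩ := he
    exact Or.inr (Or.inl ⟨m, hm, fun h => hp (hG ▸ h.mul_left 2),
      nonempty_mulEquiv_dihedralGroup_of_stabilizer hG (hcard 2) (htame _)⟩)
  · refine Or.inr (Or.inr (Or.inl ⟨?_, he.nonempty_mulEquiv_alternatingGroup_four hG⟩))
    rintro rfl
    omega
  · refine Or.inr (Or.inr (Or.inr (Or.inl ⟨?_, he.nonempty_mulEquiv_perm_four hG⟩)))
    rintro rfl
    omega
  · refine Or.inr (Or.inr (Or.inr (Or.inr ⟨?_, he.nonempty_mulEquiv_alternatingGroup_five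
      (two_ne_zero_of_char_ne_two p hp2) hG htame⟩)))
    rintro rfl
    omega

/-- A generator fixes a point, whose stabilizer is then all of G; only type (m,m) allows this. The
trivial group gets its two entries 1 from free orbits. -/
theorem fixedFieldGivenBy_of_cyclic (hp2 : p ≠ 2) {G : Subgroup (PGL2 k)} [Finite G] {m : ℕ}
    (hm : ¬ p ∣ m)
    (e : G ≃* Multiplicative (ZMod m)) : FixedFieldGivenBy G (RatFunc.X ^ m) [m, m] := by
  have hG : Nat.card G = m := by
    rw [Nat.card_congr e.toEquiv]
    exact Nat.card_zmod m
  have hcyc : IsCyclic G := isCyclic_of_surjective e.symm e.symm.surjective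
  obtain ⟨g, hg⟩ := IsCyclic.exists_ofOrder_eq_natCard (α := G)
  obtain ⟨P, hP⟩ := exists_orderOf_dvd_card_stabilizer g
  rw [hg, hG] at hP
  have hle := Nat.le_of_dvd Nat.card_pos hP
  have htame := uniqueFixCount_eq_zero_of_not_dvd p hp2 (hG.symm ▸ hm)
  have key : OrbitType G [m, m] := by
    rcases tame_types G htame with ⟨he, h⟩ | ⟨he, -⟩ | ⟨m', hm', h, he⟩ | ⟨h, he⟩ | ⟨h, he⟩ |
      ⟨h, he⟩
    · rw [hG] at h
      rw [h]
      exact he.append_one.append_one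
    · rwa [hG] at he
    all_goals
      exfalso
      have := he.card_stabilizer P
      simp only [List.mem_cons, List.not_mem_nil, or_false] at this
      omega
  exact fixedFieldGivenBy_pow hG key

/-- The rotation of order m fixes a point, so m divides a stabilizer order, which excludes the three
polyhedral types. The type (2m,2m) makes G cyclic, hence m = 1, and (2,2) is then padded to (2,2,1).
-/
theorem fixedFieldGivenBy_of_dihedral (hp2 : p ≠ 2) {G : Subgroup (PGL2 k)} [Finite G] {m : ℕ}
    (hm : ¬ p ∣ m)
    (e : G ≃* DihedralGroup m) :
    FixedFieldGivenBy G (RatFunc.X ^ m + 1 / RatFunc.X ^ m) [2, 2, m] := by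
  have hG : Nat.card G = 2 * m := by rw [Nat.card_congr e.toEquiv, DihedralGroup.nat_card]
  have hm0 : 0 < m := by
    have : 0 < Nat.card G := Nat.card_pos
    omega
  obtain ⟨P, hP⟩ := exists_orderOf_dvd_card_stabilizer (e.symm (DihedralGroup.r 1))
  rw [MulEquiv.orderOf_eq, DihedralGroup.orderOf_r_one] at hP
  have hpG : ¬ p ∣ Nat.card G := by
    rw [hG]
    intro h
    rcases CharP.char_is_prime_or_zero k p with hp | hp
    · rcases hp.dvd_mul.1 h with h | h
      · exact hp2 ((Nat.prime_dvd_prime_iff_eq hp Nat.prime_two).1 h)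
      · exact hm h
    · rw [hp, zero_dvd_iff] at h
      omega
  have htame := uniqueFixCount_eq_zero_of_not_dvd p hp2 hpG
  have key : OrbitType G [2, 2, m] := by
    rcases tame_types G htame with ⟨he, h⟩ | ⟨he, -⟩ | ⟨m', hm', h, he⟩ | ⟨h, he⟩ | ⟨h, he⟩ |
      ⟨h, he⟩
    · omega
    · have hm1 : m = 1 := by
        obtain ⟨Q, -, hcard, -⟩ := he
        obtain ⟨g, hg⟩ := exists_orderOf_eq_card_stabilizer (htame (Q 0))
        have hcyc : IsCyclic G := isCyclic_of_orderOf_eq_card g (hg.trans (hcard 0))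
        exact DihedralGroup.isCyclic_iff.1 (isCyclic_of_surjective e e.surjective)
      rw [hG, hm1] at he
      rw [hm1]
      exact he.append_one
    · rwa [show m = m' by omega]
    all_goals
      exfalso
      have h1 := he.card_stabilizer P
      have h2 := Nat.le_of_dvd Nat.card_pos hP
      simp only [List.mem_cons, List.not_mem_nil, or_false] at h1
      omega
  exact fixedFieldGivenBy_pow_add_inv hG key htame

open RatFunc

theorem fixedFieldGivenBy_of_alternatingGroup_four (hp2 : p ≠ 2) (hp3 : p ≠ 3)
    {G : Subgroup (PGL2 k)} [Finite G]
    (e : G ≃* alternatingGroup (Fin 4)) :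
    FixedFieldGivenBy G
      ((X ^ 12 - 33 * X ^ 8 - 33 * X ^ 4 + 1) / (X ^ 2 * (X ^ 4 - 1) ^ 2)) [2, 3, 3] := by
  have hG : Nat.card G = 12 := by
    rw [Nat.card_congr e.toEquiv, nat_card_alternatingGroup, Nat.card_fin]
    rfl
  have htame := uniqueFixCount_eq_zero_of_not_dvd p hp2 (by
    rw [hG]
    exact not_dvd_two_pow_mul_three_pow (k := k) p hp2 hp3 2 1)
  rcases orbitType_of_orderOf_le htame (by omega) (n := 4) (by omega) (fun g => by
    rw [← MulEquiv.orderOf_eq e, ← Subgroup.orderOf_coe]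
    exact orderOf_perm_four_le _) with ⟨-, he⟩ | ⟨h, -⟩ | ⟨h, -⟩
  · exact fixedFieldGivenBy_tetrahedral (two_ne_zero_of_char_ne_two p hp2) e he hG
  · omega
  · omega

theorem fixedFieldGivenBy_of_perm_four (hp2 : p ≠ 2) (hp3 : p ≠ 3) {G : Subgroup (PGL2 k)}
    [Finite G]
    (e : G ≃* Equiv.Perm (Fin 4)) :
    FixedFieldGivenBy G
      ((X ^ 8 + 14 * X ^ 4 + 1) ^ 3 / (108 * (X * (X ^ 4 - 1)) ^ 4)) [2, 3, 4] := by
  have hG : Nat.card G = 24 := by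
    rw [Nat.card_congr e.toEquiv, Nat.card_perm, Nat.card_fin]
    rfl
  have htame := uniqueFixCount_eq_zero_of_not_dvd p hp2 (by
    rw [hG]
    exact not_dvd_two_pow_mul_three_pow (k := k) p hp2 hp3 3 1)
  rcases orbitType_of_orderOf_le htame (by omega) (n := 4) (by omega) (fun g => by
    rw [← MulEquiv.orderOf_eq e]
    exact orderOf_perm_four_le _) with ⟨h, -⟩ | ⟨-, he⟩ | ⟨h, -⟩
  · omega
  · exact fixedFieldGivenBy_octahedral (two_ne_zero_of_char_ne_two p hp2)
      (by exact_mod_cast natCast_ne_zero_of_char_ne (k := k) p Nat.prime_three hp3) e he hG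
  · omega

theorem fixedFieldGivenBy_of_alternatingGroup_five (hp2 : p ≠ 2) (hp3 : p ≠ 3) (hp5 : p ≠ 5)
    {G : Subgroup (PGL2 k)} [Finite G] (e : G ≃* alternatingGroup (Fin 5)) :
    FixedFieldGivenBy G
      ((-X ^ 20 + 228 * X ^ 15 - 494 * X ^ 10 - 228 * X ^ 5 - 1) ^ 3 /
        (X * (X ^ 10 + 11 * X ^ 5 - 1)) ^ 5) [2, 3, 5] := by
  have hG := card_of_alternatingGroup_five e
  have h5 := natCast_ne_zero_of_char_ne (k := k) p Nat.prime_five hp5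
  have htame := uniqueFixCount_eq_zero_of_not_dvd p hp2 (by
    rw [hG]
    intro h
    have h4 := (CharP.cast_eq_zero_iff k p 60).2 h
    rw [show (60 : ℕ) = 2 ^ 2 * 3 ^ 1 * 5 from rfl, Nat.cast_mul] at h4
    refine not_dvd_two_pow_mul_three_pow (k := k) p hp2 hp3 2 1
        ((CharP.cast_eq_zero_iff k p _).1 ?_)
    exact (mul_eq_zero.1 h4).resolve_right h5)
  rcases orbitType_of_orderOf_le htame (by omega) (n := 6) (by omega) (fun g => by
    rw [← MulEquiv.orderOf_eq e, ← Subgroup.orderOf_coe]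
    exact orderOf_perm_five_le _) with ⟨h, -⟩ | ⟨h, -⟩ | ⟨-, he⟩
  · omega
  · omega
  · exact fixedFieldGivenBy_icosahedral (by exact_mod_cast h5) e he hG

end Tame

end

/-! ### Arithmetic of the wild orbits -/

section

open Matrix OnePoint MulAction

theorem card_dvd_ncard_of_free {A X : Type*} [Group A] [Finite A] [MulAction A X] {O : Set X}
    (hO : ∀ a : A, ∀ x ∈ O, a • x ∈ O) (hfin : O.Finite)
    (hfree : ∀ x ∈ O, ∀ a : A, a • x = x → a = 1) : Nat.card A ∣ O.ncard := by
  classical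
  let S : SubMulAction A X := ⟨O, fun a {x} hx => hO a x hx⟩
  have : Finite S := hfin
  have := Fintype.ofFinite S
  have := Fintype.ofFinite A
  have := Fintype.ofFinite (Quotient (orbitRel A S))
  have h := card_eq_sum_card_group_div_card_stabilizer A S
  have hst : ∀ x : S, Fintype.card (stabilizer A x) = 1 := fun x => by
    have h1 : stabilizer A x = ⊥ := by
      rw [eq_bot_iff]
      intro a ha
      exact Subgroup.mem_bot.2 (hfree x.1 x.2 a (congrArg Subtype.val ha))
    rw [← Nat.card_eq_fintype_card, h1, Subgroup.card_bot]
  simp only [hst, Nat.div_one, Finset.sum_const, smul_eq_mul] at h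
  rw [Nat.card_eq_fintype_card]
  refine Dvd.intro_left _ (h.symm.trans ?_)
  rw [← Nat.card_eq_fintype_card]
  rfl

variable {k : Type*} [Field k]

theorem smul_mem_orbit_iff' (G : Subgroup (PGL2 k)) (g : G) {P Q : OnePoint k} :
    g • P ∈ orbit G Q ↔ P ∈ orbit G Q := by
  rw [← orbit_eq_iff, orbit_smul, orbit_eq_iff]

theorem OrbitType.of_conj {γ : PGL2 k} {G : Subgroup (PGL2 k)} {e : List ℕ}
    (he : OrbitType (conjSubgroup γ G) e) : OrbitType G e := by
  obtain ⟨P, hinj, hcard, hfree⟩ := he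
  refine ⟨fun i => γ⁻¹ • P i, fun i j h => hinj i j ?_, fun i => ?_, fun R hR => ?_⟩
  · rw [← mem_orbit_conj (γ := γ)] at h
    simpa using h
  · rw [← card_stabilizer_conj γ, smul_inv_smul, hcard]
  · rw [← card_stabilizer_conj γ]
    refine hfree _ fun i h => hR i ?_
    rw [← mem_orbit_conj (γ := γ), smul_inv_smul]
    exact h

/-- A suitable coordinate for the stabilizer of a point. -/
theorem exists_conj_aff_zero_mem (G : Subgroup (PGL2 k)) [Finite G] (P : OnePoint k) :
    ∃ γ : PGL2 k, γ • P = ∞ ∧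
      ∀ a ∈ mults (conjSubgroup γ G), aff a 0 ∈ conjSubgroup γ G := by
  obtain ⟨δ, hδ⟩ := exists_smul_eq_infty P
  -- The multiplier group is cyclic; translating the finite fixed point of a lift of its generator
  -- to 0 makes every multiplier a homothety in the group.
  obtain ⟨⟨a, b, hab⟩, ha⟩ := IsCyclic.exists_generator (α := mults (conjSubgroup δ G))
  obtain ⟨c, hc⟩ : ∃ c : k, aff a 0 ∈ conjSubgroup (aff 1 c) (conjSubgroup δ G) := by
    by_cases h1 : a = 1
    · exact ⟨0, by rw [h1, aff_one_zero]; exact one_mem _⟩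
    · have ha' : (1 : k) - a ≠ 0 := fun h => h1 (Units.ext (by simpa using (sub_eq_zero.1 h).symm))
      refine ⟨-(b / (1 - a)), ?_⟩
      convert conj_mem_conjSubgroup (γ := aff 1 (-(b / (1 - a)))) hab using 1
      rw [eq_comm, aff_inv, aff_mul_aff, aff_mul_aff, aff_inj]
      constructor
      · simp
      · simp
        field_simp
        ring
  refine ⟨aff 1 c * δ, by rw [mul_smul, hδ, aff_smul_infty], ?_⟩
  rw [conjSubgroup_mul]
  rintro a' ⟨b', hb'⟩
  have hmem : a' ∈ mults (conjSubgroup δ G) := by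
    rw [mem_conjSubgroup, aff_inv, aff_mul_aff, aff_mul_aff] at hb'
    exact ⟨_, by simpa using hb'⟩
  obtain ⟨i, hi⟩ := ha ⟨a', hmem⟩
  have hi' : a ^ i = a' := congrArg Subtype.val hi
  have hpow : ∀ i : ℤ, aff a (0 : k) ^ i = aff (a ^ i) 0 := fun i => by
    cases i with
    | ofNat n => simpa using aff_pow_zero a n
    | negSucc n => simp [zpow_negSucc, aff_pow_zero, aff_inv]
  rw [← hi', ← hpow]
  exact zpow_mem hc i

section Normal

variable {G : Subgroup (PGL2 k)} (hG : ∀ a ∈ mults G, aff a 0 ∈ G)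

include hG

/-- In this coordinate the stabilizer of ∞ is the semidirect product of translations and
homotheties. -/
theorem mem_of_aff_mem {a : kˣ} {b : k} (h : aff a b ∈ G) : a ∈ mults G ∧ b ∈ transl G := by
  have ha : a ∈ mults G := ⟨b, h⟩
  refine ⟨ha, ?_⟩
  have := G.mul_mem h (G.inv_mem (hG a ha))
  rw [aff_inv, aff_mul_aff] at this
  rw [mem_transl]
  simpa using this

theorem aff_mem_of_mem {a : kˣ} {b : k} (ha : a ∈ mults G) (hb : b ∈ transl G) : aff a b ∈ G := by
  have := G.mul_mem hb (hG a ha)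
  rw [aff_mul_aff] at this
  simpa using this

-- Multiplication by 1 - a is injective on the finite group of translations, hence bijective.
omit hG in
theorem mem_transl_of_sub_mul_mem [Finite G] {a : kˣ} (ha : a ∈ mults G) (ha1 : a ≠ 1) {x : k}
    (hx : (1 - a) * x ∈ transl G) : x ∈ transl G := by
  have ha' : (1 : k) - a ≠ 0 := fun h => ha1 (Units.ext (by simpa using (sub_eq_zero.1 h).symm))
  let f : transl G → transl G := fun y => ⟨(1 - a) * y, by
    rw [sub_mul, one_mul]
    exact sub_mem y.2 (mults_mul_transl ha y.2)⟩
  have hf : Function.Injective f := fun y z h =>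
    Subtype.ext (mul_left_cancel₀ ha' (congrArg Subtype.val h))
  obtain ⟨y, hy⟩ := Finite.injective_iff_surjective.1 hf ⟨_, hx⟩
  have : x = y := (mul_left_cancel₀ ha' (congrArg Subtype.val hy)).symm
  rw [this]
  exact y.2

/-- If 0 lies in the orbit of ∞, so does all of H. On the remaining points the stabilizer of ∞ acts
freely, since a finite fixed point of a nontrivial ax + b in G lies in H. -/
theorem card_dvd_ncard_orbit [Finite G]
    (h0 : ((0 : k) : OnePoint k) ∈ orbit G (∞ : OnePoint k)) :
    ∃ j, (orbit G (∞ : OnePoint k)).ncard =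
      1 + Nat.card (transl G) + Nat.card (transl G) * Nat.card (mults G) * j := by
  set H : Set (OnePoint k) := (fun x : k => (x : OnePoint k)) '' (transl G : Set k) with hH
  have hHcard : H.ncard = Nat.card (transl G) := by
    rw [hH, Set.ncard_image_of_injective _ OnePoint.coe_injective]
    rfl
  have hfin := finite_orbit G (∞ : OnePoint k)
  have hHfin : H.Finite := Set.Finite.image _ (show (transl G : Set k).Finite from inferInstanceAs
      (Finite (transl G)))
  have hinf : (∞ : OnePoint k) ∉ H := by
    rintro ⟨x, -, hx⟩
    exact OnePoint.coe_ne_infty x hx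
  have hsub : insert (∞ : OnePoint k) H ⊆ orbit G (∞ : OnePoint k) := by
    rintro _ (rfl | ⟨b, hb, rfl⟩)
    · exact mem_orbit_self _
    · have := (smul_mem_orbit_iff' G (⟨aff 1 b, hb⟩ : G)).2 h0
      change aff 1 b • ((0 : k) : OnePoint k) ∈ _ at this
      simpa using this
  set O := orbit G (∞ : OnePoint k) \ insert (∞ : OnePoint k) H with hO
  have hcard : O.ncard + (1 + Nat.card (transl G)) = (orbit G (∞ : OnePoint k)).ncard := by
    rw [hO, ← Set.ncard_sdiff_add_ncard_of_subset hsub hfin, Set.ncard_insert_of_notMem hinf hHfin,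
      hHcard, add_comm 1]
  have hdvd : Nat.card (stabilizer G (∞ : OnePoint k)) ∣ O.ncard := by
    have haff : ∀ g : stabilizer G (∞ : OnePoint k), ∃ a ∈ mults G, ∃ b ∈ transl G,
        ((g : G) : PGL2 k) = aff a b := fun g => by
      obtain ⟨a, b, hab⟩ := exists_aff (g := ((g : G) : PGL2 k)) g.2
      obtain ⟨h1, h2⟩ := mem_of_aff_mem hG (hab ▸ (g : G).2)
      exact ⟨a, h1, b, h2, hab⟩
    have hHst : ∀ g : stabilizer G (∞ : OnePoint k), ∀ x ∈ insert (∞ : OnePoint k) H,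
        g • x ∈ insert (∞ : OnePoint k) H := by
      rintro g x (rfl | ⟨y, hy, rfl⟩)
      · exact Or.inl g.2
      · obtain ⟨a, ha, b, hb, hab⟩ := haff g
        right
        refine ⟨a * y + b, add_mem (mults_mul_transl ha hy) hb, ?_⟩
        change _ = ((g : G) : PGL2 k) • ((y : k) : OnePoint k)
        rw [hab, aff_smul_coe]
    refine card_dvd_ncard_of_free ?_ (hfin.subset Set.sdiff_subset) ?_
    · rintro g x ⟨hx1, hx2⟩
      refine ⟨(smul_mem_orbit_iff' G (g : G)).2 hx1, fun h => hx2 ?_⟩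
      have := hHst g⁻¹ _ h
      rwa [inv_smul_smul] at this
    · rintro x ⟨-, hx⟩ g hg
      obtain ⟨a, ha, b, hb, hab⟩ := haff g
      have hgx : ((g : G) : PGL2 k) • x = x := hg
      rw [hab] at hgx
      cases x with
      | infty => exact absurd (Or.inl rfl) hx
      | coe y =>
        rw [aff_smul_coe, OnePoint.coe_eq_coe] at hgx
        by_cases ha1 : a = 1
        · subst ha1
          have hb0 : b = 0 := by simpa using hgx
          refine Subtype.ext (Subtype.ext ?_)
          rw [hab, hb0, aff_one_zero]
          rfl
        · refine absurd (Or.inr ⟨y, ?_, rfl⟩) hx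
          refine mem_transl_of_sub_mul_mem ha ha1 ?_
          rw [show (1 - (a : k)) * y = b by linear_combination hgx.symm]
          exact hb
  obtain ⟨j, hj⟩ := hdvd
  rw [card_stabilizer_infty] at hj
  exact ⟨j, by omega⟩

end Normal

/-- Here r is the size of the orbit of ∞ and e the stabilizer order in the second orbit; the
equation computes |G| from both orbits. With e = cd it becomes c(r(q - 2) + 2) = rq; c = 1 forces r
= 1, and larger c leaves only c = 2, q = 3, r = 4. -/
theorem wild_arithmetic_infty {q d e r : ℕ} (hq : 3 ≤ q) (hd : d ∣ e) (hd0 : 0 < d) (hr : 1 < r)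
    (h : e * (r * (q - 2) + 2) = r * (q * d)) : r = q + 1 := by
  obtain ⟨c, rfl⟩ := hd
  obtain ⟨s, rfl⟩ : ∃ s, q = s + 3 := ⟨q - 3, by omega⟩
  have h1 : c * (r * (s + 1) + 2) = r * (s + 3) := by
    rw [show s + 3 - 2 = s + 1 by omega] at h
    refine Nat.eq_of_mul_eq_mul_left hd0 ?_
    linarith
  rcases lt_or_ge c 2 with hc | hc
  · interval_cases c
    · have : 0 < r * (s + 3) := by positivity
      omega
    · nlinarith
  · rcases Nat.eq_zero_or_pos s with rfl | hs
    · rcases lt_or_ge c 3 with hc3 | hc3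
      · interval_cases c
        omega
      · nlinarith
    · nlinarith [Nat.mul_le_mul_right (r * (s + 1) + 2) hc, Nat.mul_le_mul_left r hs]

/-- The case j = 0 is r = q + 1. Otherwise put c = (q - 1)/d, w = c + j(q - 2), D = 1 + dj. The
equation gives ew = 1 + qD, and dw = 1 + (q - 2)D, so (e - d)w = 2D, while w + j = cD. Since 2j < D,
this forces c = 1, then e - d = 3, d = 2 and j = 1. -/
theorem wild_arithmetic_zero {q d e r j : ℕ} (hq : 3 ≤ q) (hdq : d ∣ q - 1) (hd : 2 ≤ d)
    (hr : r = 1 + q + q * d * j) (h : e * (r * (q - 2) + 2) = r * (q * d)) :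
    r = q + 1 ∨ (q = 3 ∧ d = 2 ∧ r = 10 ∧ e = 5) := by
  rcases Nat.eq_zero_or_pos j with rfl | hj
  · left
    rw [hr]
    ring
  right
  obtain ⟨c, hc⟩ := hdq
  obtain ⟨s, rfl⟩ : ∃ s, q = s + 2 := ⟨q - 2, by omega⟩
  have hcs : s + 1 = d * c := by omega
  have hc0 : 0 < c := by
    rcases Nat.eq_zero_or_pos c with rfl | h
    · omega
    · exact h
  rw [show s + 2 - 2 = s by omega] at h
  have h1 : e * (c + j * s) = 1 + (s + 2) * (1 + d * j) := by
    have : (d * (s + 2)) * (e * (c + j * s)) = (d * (s + 2)) * (1 + (s + 2) * (1 + d * j)) := by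
      rw [show d * (s + 2) * (1 + (s + 2) * (1 + d * j)) =
        (1 + (s + 2) + (s + 2) * d * j) * ((s + 2) * d) by ring, ← hr, ← h, hr]
      have h2 : d * (c + j * s) = 1 + s * (1 + d * j) := by
        rw [mul_add, ← hcs]
        ring
      calc d * (s + 2) * (e * (c + j * s)) = (s + 2) * e * (d * (c + j * s)) := by ring
        _ = _ := by rw [h2]; ring
    exact Nat.eq_of_mul_eq_mul_left (by positivity) this
  have h2 : d * (c + j * s) = 1 + s * (1 + d * j) := by
    rw [mul_add, ← hcs]
    ring
  have hw : c + j * s + j = c * (1 + d * j) := by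
    calc c + j * s + j = c + j * (s + 1) := by ring
      _ = _ := by rw [hcs]; ring
  set w := c + j * s with hwdef
  set D := 1 + d * j with hD
  have hw0 : 0 < w := by omega
  have hjD : 2 * j < D := by nlinarith
  obtain ⟨m, rfl⟩ : ∃ m, e = d + m := by
    refine ⟨e - d, ?_⟩
    have : d ≤ e := by
      by_contra! hlt
      nlinarith
    omega
  have hm : m * w = 2 * D := by nlinarith
  have hm0 : 0 < m := by
    rcases Nat.eq_zero_or_pos m with rfl | h
    · omega
    · exact h
  have hc2 : c ≤ 2 := by
    by_contra! h3
    nlinarith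
  interval_cases c
  · have hm3 : 3 ≤ m := by
      by_contra! h3
      interval_cases m <;> omega
    have hw2 : w ≤ 2 * j := by nlinarith
    have hd2 : d = 2 := by
      have : d < 3 := by
        by_contra! h3
        nlinarith
      omega
    subst hd2
    have hwj : w = j + 1 := by omega
    have hm4 : m < 4 := by
      by_contra! h4
      nlinarith
    have : m = 3 := by omega
    subst this
    have : j = 1 := by omega
    subst this
    have : s = 1 := by omega
    subst this
    omega
  · exfalso
    have hm2 : 2 ≤ m := by
      by_contra! h3
      interval_cases m
      omega
    nlinarith

end

/-! ### Wild orbit structures and groups of translations -/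

section

open Matrix OnePoint MulAction

variable {k : Type*} [Field k]

theorem orbitType_singleton {G : Subgroup (PGL2 k)} {P : OnePoint k}
    (h : ∀ R, R ∉ orbit G P → Nat.card (stabilizer G R) = 1) :
    OrbitType G [Nat.card (stabilizer G P)] := by
  refine ⟨fun _ => P, fun i j _ => ?_, fun i => ?_, fun R hR => h R (hR 0)⟩
  · exact Subsingleton.elim (α := Fin 1) i j
  · have : i = 0 := Subsingleton.elim (α := Fin 1) i 0
    subst this
    rfl

theorem orbitType_pair {G : Subgroup (PGL2 k)} {P Q : OnePoint k} (hQP : Q ∉ orbit G P)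
    (h : ∀ R, R ∉ orbit G P → R ∉ orbit G Q → Nat.card (stabilizer G R) = 1) :
    OrbitType G [Nat.card (stabilizer G P), Nat.card (stabilizer G Q)] := by
  refine ⟨![P, Q], fun (i j : Fin 2) hij => ?_, fun (i : Fin 2) => ?_, fun R hR => h R (hR 0)
      (hR 1)⟩
  · fin_cases i <;> fin_cases j
    · rfl
    · exact absurd (mem_orbit_symm.1 hij) hQP
    · exact absurd hij hQP
    · rfl
  · fin_cases i <;> rfl

theorem orderOf_aff_zero (a : kˣ) : orderOf (aff a (0 : k)) = orderOf a :=
  orderOf_eq_orderOf_iff.2 fun n => by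
    rw [aff_pow_zero, aff_eq_one]
    simp

theorem card_mults_dvd_card_stabilizer_zero {G : Subgroup (PGL2 k)} [Finite G]
    (hG : ∀ a ∈ mults G, aff a 0 ∈ G) :
    Nat.card (mults G) ∣ Nat.card (stabilizer G ((0 : k) : OnePoint k)) := by
  obtain ⟨a, ha⟩ := IsCyclic.exists_ofOrder_eq_natCard (α := mults G)
  rw [← Subgroup.orderOf_coe, ← orderOf_aff_zero] at ha
  have h0 : (⟨aff (a : kˣ) 0, hG a a.2⟩ : G) ∈ stabilizer G ((0 : k) : OnePoint k) := by
    change aff (a : kˣ) 0 • ((0 : k) : OnePoint k) = _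
    simp
  have h := orderOf_dvd_natCard (⟨_, h0⟩ : stabilizer G ((0 : k) : OnePoint k))
  rwa [Subgroup.orderOf_mk, Subgroup.orderOf_mk, ha] at h

/-- The possible orbit structures of a group with a nontrivial translation. -/
theorem wild_cases [IsAlgClosed k] (p : ℕ) [CharP k p] (hp2 : p ≠ 2) (G : Subgroup (PGL2 k))
    [Finite G] (hG : ∀ a ∈ mults G, aff a 0 ∈ G) (hu : uniqueFixCount G ∞ ≠ 0) :
    ((orbit G (∞ : OnePoint k)).ncard = 1 ∧ Nat.card (mults G) = 1 ∧
      OrbitType G [Nat.card (transl G)]) ∨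
    ((orbit G (∞ : OnePoint k)).ncard = 1 ∧ 2 ≤ Nat.card (mults G) ∧
      OrbitType G [Nat.card (transl G) * Nat.card (mults G), Nat.card (mults G)]) ∨
    ((orbit G (∞ : OnePoint k)).ncard = Nat.card (transl G) + 1 ∧
      ∃ e, OrbitType G [Nat.card (transl G) * Nat.card (mults G), e] ∧
        e * (Nat.card (transl G) - 1) = Nat.card (mults G) * (Nat.card (transl G) + 1)) ∨
    (Nat.card (transl G) = 3 ∧ Nat.card (mults G) = 2 ∧
      (orbit G (∞ : OnePoint k)).ncard = 10 ∧ OrbitType G [6, 5]) := by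
  have hu1 := uniqueFixCount_infty G
  have hst := card_stabilizer_infty G
  have hn := card_stabilizer_mul_ncard_orbit G (∞ : OnePoint k)
  have hdq := card_mults_dvd G
  have hd0 : 0 < Nat.card (mults G) := Nat.card_pos
  have hq : 3 ≤ Nat.card (transl G) := by
    rcases card_addSubgroup_cases p hp2 (transl G) with h | ⟨_, _, _, _, h, _⟩
    · omega
    · exact h
  have hr : 0 < (orbit G (∞ : OnePoint k)).ncard :=
    (Set.ncard_pos (finite_orbit G _)).2 ⟨_, mem_orbit_self _⟩
  have hu2 : uniqueFixCount G ∞ - 1 = Nat.card (transl G) - 2 := by omega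
  rcases wild_types p hp2 G hu with ⟨hfree, heq⟩ | ⟨P, hP, he2, hfree, heq⟩
  · rw [hu2, ← hn, hst] at heq
    have he := orbitType_singleton hfree
    rw [hst] at he
    set q := Nat.card (transl G)
    set d := Nat.card (mults G)
    set r := (orbit G (∞ : OnePoint k)).ncard
    -- With a single nonfree orbit r(q - 2) + 2 = qdr: d ≥ 2 makes the right side too large, and d =
    -- 1 gives r = 1.
    have hd1 : d = 1 := by
      by_contra hne
      have : 2 ≤ d := by omega
      obtain ⟨s, hs⟩ : ∃ s, q = s + 2 := ⟨q - 2, by omega⟩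
      rw [hs, show s + 2 - 2 = s by omega] at heq
      nlinarith [Nat.mul_le_mul_left ((s + 2) * r) this]
    rw [hd1, mul_one] at heq he
    obtain ⟨s, hs⟩ : ∃ s, q = s + 2 := ⟨q - 2, by omega⟩
    have hr1 : r = 1 := by
      rw [hs, show s + 2 - 2 = s by omega] at heq
      nlinarith
    exact Or.inl ⟨hr1, hd1, he⟩
  · have he := orbitType_pair hP hfree
    rw [hst] at he
    have hn1 := card_stabilizer_mul_ncard_orbit G P
    rw [hu2] at heq
    rw [← heq, ← hn, hst, mul_comm (_ * _)] at hn1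
    set e := Nat.card (stabilizer G P) with hedef
    rcases Nat.lt_or_ge 1 (orbit G (∞ : OnePoint k)).ncard with hr1 | hr1
    · have key : (orbit G (∞ : OnePoint k)).ncard = Nat.card (transl G) + 1 ∨
          (Nat.card (transl G) = 3 ∧ Nat.card (mults G) = 2 ∧
            (orbit G (∞ : OnePoint k)).ncard = 10 ∧ e = 5) := by
        -- If d ≥ 2 and 0 is outside the orbit of ∞, the homotheties in G give 0 a nontrivial
        -- stabilizer, so 0 lies in the second orbit and d divides e.
        by_cases h0 : ((0 : k) : OnePoint k) ∈ orbit G (∞ : OnePoint k) ∧ 2 ≤ Nat.card (mults G)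
        · obtain ⟨j, hj⟩ := card_dvd_ncard_orbit hG h0.1
          exact wild_arithmetic_zero hq hdq h0.2 hj hn1
        · left
          refine wild_arithmetic_infty hq ?_ hd0 hr1 hn1
          by_cases hd1 : Nat.card (mults G) = 1
          · rw [hd1]
            exact one_dvd _
          · have h0' : ((0 : k) : OnePoint k) ∉ orbit G (∞ : OnePoint k) :=
              fun h => h0 ⟨h, by omega⟩
            have hdvd := card_mults_dvd_card_stabilizer_zero hG
            have h0P : ((0 : k) : OnePoint k) ∈ orbit G P := by
              by_contra hc
              rw [hfree _ h0' hc] at hdvd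
              exact hd1 (Nat.dvd_one.1 hdvd)
            rwa [card_stabilizer_eq_of_mem_orbit G h0P] at hdvd
      rcases key with h | ⟨h1, h2, h3, h4⟩
      · refine Or.inr (Or.inr (Or.inl ⟨h, e, he, ?_⟩))
        rw [h] at hn1
        obtain ⟨s, hs⟩ : ∃ s, Nat.card (transl G) = s + 2 :=
          ⟨Nat.card (transl G) - 2, by omega⟩
        rw [hs] at hn1 ⊢
        rw [show s + 2 - 2 = s by omega] at hn1
        rw [show s + 2 - 1 = s + 1 by omega]
        refine Nat.eq_of_mul_eq_mul_left (show 0 < s + 2 by omega) ?_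
        linarith
      · refine Or.inr (Or.inr (Or.inr ⟨h1, h2, h3, ?_⟩))
        rw [h1, h2, h4] at he
        exact he
    · have hr1 : (orbit G (∞ : OnePoint k)).ncard = 1 := by omega
      have hed : e = Nat.card (mults G) := by
        rw [hr1, one_mul, one_mul, show Nat.card (transl G) - 2 + 2 = Nat.card (transl G) by omega,
          mul_comm] at hn1
        exact Nat.eq_of_mul_eq_mul_left (by omega) hn1
      rw [hed] at he he2
      exact Or.inr (Or.inl ⟨hr1, he2, he⟩)

theorem exists_aff_of_ncard_orbit {G : Subgroup (PGL2 k)} [Finite G]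
    (hG : ∀ a ∈ mults G, aff a 0 ∈ G)
    (hr : (orbit G (∞ : OnePoint k)).ncard = 1) {g : PGL2 k} (hg : g ∈ G) :
    ∃ a ∈ mults G, ∃ b ∈ transl G, g = aff a b := by
  have h := card_stabilizer_mul_ncard_orbit G (∞ : OnePoint k)
  rw [hr, mul_one] at h
  obtain ⟨a, b, rfl⟩ := exists_aff (smul_eq_self_of_card_stabilizer h hg)
  obtain ⟨ha, hb⟩ := mem_of_aff_mem hG hg
  exact ⟨a, ha, b, hb, rfl⟩

section Translations

open RatFunc

/-- A group of translations is isomorphic to the additive group of the displacements. -/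
theorem nonempty_mulEquiv_transl {G : Subgroup (PGL2 k)} (h : ∀ g ∈ G, ∃ b, g = aff 1 b) :
    Nonempty (Multiplicative (transl G) ≃* G) := by
  let f : Multiplicative (transl G) →* G :=
    { toFun := fun b => ⟨aff 1 (b.toAdd : k), b.toAdd.2⟩
      map_one' := Subtype.ext aff_one_zero
      map_mul' := fun a b => Subtype.ext (by
        change aff 1 _ = aff 1 _ * aff 1 _
        rw [aff_mul_aff]
        simp [add_comm]) }
  refine ⟨MulEquiv.ofBijective f ⟨fun a b hab => ?_, fun g => ?_⟩⟩
  · have := (aff_inj.1 (congrArg Subtype.val hab)).2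
    exact Multiplicative.toAdd.injective (Subtype.ext this)
  · obtain ⟨b, hb⟩ := h g g.2
    exact ⟨Multiplicative.ofAdd ⟨b, by rw [mem_transl, ← hb]; exact g.2⟩, Subtype.ext hb.symm⟩

theorem fixedFieldGivenBy_translations [IsAlgClosed k] {G : Subgroup (PGL2 k)} [Finite G]
    {γ : PGL2 k} (h : ∀ g ∈ conjSubgroup γ G, ∃ b, g = aff 1 b)
    (he : OrbitType G [Nat.card G]) :
    Nat.card (transl (conjSubgroup γ G)) = Nat.card G ∧
    FixedFieldGivenBy G (∏ᶠ a : transl (conjSubgroup γ G), (X + C (a : k))) [Nat.card G] := by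
  set H := transl (conjSubgroup γ G) with hH
  have hcard : Nat.card H = Nat.card G := by
    obtain ⟨e⟩ := nonempty_mulEquiv_transl h
    rw [← card_conjSubgroup γ G, ← Nat.card_congr e.toEquiv]
    rfl
  refine ⟨hcard, ?_⟩
  have := Fintype.ofFinite H
  rw [finprod_eq_prod_of_fintype]
  refine fixedFieldGivenBy_of_div (p := ∏ a : H, (Polynomial.X + Polynomial.C (a : k))) (q := 1)
    ?_ γ ?_ ?_ (by simp [Nat.card_pos]) one_ne_zero he
  · simp [map_prod]
  · intro g hg
    obtain ⟨b, rfl⟩ := h g hg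
    rw [aff_mem_invariance, map_prod]
    refine Fintype.prod_equiv (Equiv.addLeft (⟨b, hg⟩ : H)) _ _ fun a => ?_
    rw [map_add, subst_X, subst_C, moebius_aff, Equiv.coe_addLeft, AddSubgroup.coe_add,
      Units.val_one, map_one, one_mul, map_add, add_assoc]
  · rw [Polynomial.natDegree_prod_of_monic _ _ fun a _ => Polynomial.monic_X_add_C _]
    simp [← hcard]

end Translations

end

/-! ### The affine groups `groupK` -/

section

open Matrix OnePoint MulAction

variable {k : Type*} [Field k]

/-- The group of the transformations `x ↦ a x + b` with `a ∈ D` and `b ∈ H`. -/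
def affSubgroup (D : Subgroup kˣ) (H : AddSubgroup k) (hDH : ∀ a ∈ D, ∀ b ∈ H, (a : k) * b ∈ H) :
    Subgroup (PGL2 k) where
  carrier := {g | ∃ a ∈ D, ∃ b ∈ H, g = aff a b}
  one_mem' := ⟨1, one_mem D, 0, zero_mem H, aff_one_zero.symm⟩
  mul_mem' := by
    rintro _ _ ⟨a, ha, b, hb, rfl⟩ ⟨a', ha', b', hb', rfl⟩
    exact ⟨_, mul_mem ha ha', _, add_mem (hDH a ha b' hb') hb, aff_mul_aff _ _ _ _⟩
  inv_mem' := by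
    rintro _ ⟨a, ha, b, hb, rfl⟩
    exact ⟨_, inv_mem ha, _, neg_mem (hDH _ (inv_mem ha) b hb), aff_inv _ _⟩

theorem mem_affSubgroup {D : Subgroup kˣ} {H : AddSubgroup k} {hDH} {g : PGL2 k} :
    g ∈ affSubgroup D H hDH ↔ ∃ a ∈ D, ∃ b ∈ H, g = aff a b := Iff.rfl

theorem card_affSubgroup (D : Subgroup kˣ) (H : AddSubgroup k) (hDH) :
    Nat.card (affSubgroup D H hDH) = Nat.card H * Nat.card D := by
  rw [← Nat.card_prod]
  refine Nat.card_congr (Equiv.ofBijective (fun x : H × D => (⟨aff (x.2 : kˣ) (x.1 : k),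
    _, x.2.2, _, x.1.2, rfl⟩ : affSubgroup D H hDH)) ⟨?_, ?_⟩).symm
  · rintro ⟨b, a⟩ ⟨b', a'⟩ h
    obtain ⟨h1, h2⟩ := aff_inj.1 (congrArg Subtype.val h)
    exact Prod.ext (Subtype.ext h2) (Subtype.ext h1)
  · rintro ⟨_, a, ha, b, hb, rfl⟩
    exact ⟨(⟨b, hb⟩, ⟨a, ha⟩), rfl⟩

theorem mem_rootSetU {m n : ℕ} {b : Fin n → k} {x : k} :
    x ∈ rootSetU m b ↔ x = 0 ∨ ∃ j, x ^ m = b j := by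
  simp [rootSetU, Finset.prod_eq_zero_iff, sub_eq_zero]

theorem mul_mem_of_eq_rootSetU {m n : ℕ} {b : Fin n → k} {H : AddSubgroup k}
    (hH : (H : Set k) = rootSetU m b) {a : kˣ} (ha : a ∈ rootsOfUnity m k) {x : k} (hx : x ∈ H) :
    (a : k) * x ∈ H := by
  have ha' : (a : k) ^ m = 1 := by
    rw [← Units.val_pow_eq_pow_val, (mem_rootsOfUnity m a).1 ha, Units.val_one]
  rw [← SetLike.mem_coe, hH, mem_rootSetU] at hx ⊢
  rcases hx with rfl | ⟨j, hj⟩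
  · exact Or.inl (mul_zero _)
  · exact Or.inr ⟨j, by rw [mul_pow, ha', one_mul, hj]⟩

/-- Since ξ² is a primitive m-th root of unity, its powers are all the m-th roots of unity, and
these preserve the root set because it is defined through m-th powers. -/
theorem groupK_eq_affSubgroup {m n : ℕ} (hm : 0 < m) {ξ : k} (hξ : IsPrimitiveRoot ξ (2 * m))
    {b : Fin n → k} {H : AddSubgroup k} (hH : (H : Set k) = rootSetU m b) :
    groupK m ξ b = affSubgroup (rootsOfUnity m k) H
      (fun _ ha _ hx => mul_mem_of_eq_rootSetU hH ha hx) := by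
  have hξ0 : ξ ≠ 0 := hξ.ne_zero (by omega)
  have hprim : IsPrimitiveRoot (ξ ^ 2) m := hξ.pow (by omega) rfl
  have hgen1 : ∀ a ∈ H, aff 1 a ∈ groupK m ξ b := fun a ha =>
    Subgroup.subset_closure ⟨_, Or.inl ⟨a, hH ▸ ha, by simp⟩, rfl⟩
  have hgen2 : aff (Units.mk0 ξ hξ0 ^ 2) 0 ∈ groupK m ξ b :=
    Subgroup.subset_closure ⟨_, Or.inr (by simp), rfl⟩
  apply le_antisymm
  · rw [groupK, Subgroup.closure_le]
    rintro _ ⟨g, ⟨a, ha, hg⟩ | hg, rfl⟩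
    · refine ⟨1, one_mem _, a, ?_, mk_eq_mk_of_smul 1 one_ne_zero (by simp [hg])⟩
      rwa [← SetLike.mem_coe, hH]
    · refine ⟨Units.mk0 ξ hξ0 ^ 2, ?_, 0, zero_mem _,
        mk_eq_mk_of_smul 1 one_ne_zero (by simp [hg])⟩
      rw [mem_rootsOfUnity]
      exact Units.ext (by simpa using hprim.pow_eq_one)
  · rintro _ ⟨a, ha, x, hx, rfl⟩
    have ha' : (a : k) ^ m = 1 := by
      rw [← Units.val_pow_eq_pow_val, (mem_rootsOfUnity m a).1 ha, Units.val_one]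
    have : NeZero m := ⟨hm.ne'⟩
    obtain ⟨i, -, hi⟩ := hprim.eq_pow_of_pow_eq_one ha'
    have h1 : a = (Units.mk0 ξ hξ0 ^ 2) ^ i := Units.ext (by simpa using hi.symm)
    have h2 := mul_mem (hgen1 x hx) (pow_mem hgen2 i)
    rw [aff_pow_zero, aff_mul_aff, ← h1] at h2
    simpa using h2

theorem card_rootsOfUnity_of_primitive {m : ℕ} (hm : 0 < m) {ξ : k}
    (hξ : IsPrimitiveRoot ξ (2 * m)) : Nat.card (rootsOfUnity m k) = m := by
  have : NeZero m := ⟨hm.ne'⟩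
  have hprim : IsPrimitiveRoot (ξ ^ 2) m := hξ.pow (by omega) rfl
  exact hprim.card_rootsOfUnity

theorem finite_rootSetU {m n : ℕ} (hm : 0 < m) (b : Fin n → k) : (rootSetU m b).Finite := by
  have h : rootSetU m b ⊆ {0} ∪ ⋃ j, ((Polynomial.X ^ m - Polynomial.C (b j) :
      Polynomial k).rootSet k) := by
    intro x hx
    rw [mem_rootSetU] at hx
    rcases hx with rfl | ⟨j, hj⟩
    · simp
    · right
      rw [Set.mem_iUnion]
      refine ⟨j, ?_⟩
      rw [Polynomial.mem_rootSet]
      refine ⟨Polynomial.X_pow_sub_C_ne_zero hm _, by simp [hj]⟩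
  refine Set.Finite.subset ?_ h
  exact (Set.finite_singleton _).union (Set.finite_iUnion fun j => Polynomial.rootSet_finite _ _)

theorem IsKmData.m_pos {p t m : ℕ} {ξ : k} {b : Fin ((p ^ t - 1) / m) → k}
    (h : IsKmData p t m ξ b) : 0 < m := by
  rcases Nat.eq_zero_or_pos m with rfl | hm
  · have h1 := zero_dvd_iff.1 h.dvd
    have h2 := Nat.one_lt_pow h.pos.ne' h.prime.one_lt
    omega
  · exact hm

/-- The m-th powers of the nonzero elements are exactly the (pᵗ - 1)/m values bⱼ, each with m roots;
together with 0 this gives pᵗ elements. -/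
theorem IsKmData.card_eq [IsAlgClosed k] {p t m : ℕ} {ξ : k} {b : Fin ((p ^ t - 1) / m) → k}
    (h : IsKmData p t m ξ b) {H : AddSubgroup k} (hH : (H : Set k) = rootSetU m b) :
    Nat.card H = p ^ t := by
  have hm := h.m_pos
  have hD := card_rootsOfUnity_of_primitive hm h.primitive
  have : Finite H := by
    have := finite_rootSetU hm b
    rw [← hH] at this
    exact this
  have : NeZero m := ⟨hm.ne'⟩
  obtain ⟨B, hB, hB0, hBx⟩ := exists_power_set H (rootsOfUnity m k)
    (fun _ ha _ hx => mul_mem_of_eq_rootSetU hH ha hx)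
  rw [hD] at hB hBx
  classical
  have hBb : B = Finset.univ.image b := by
    ext y
    obtain ⟨x, rfl⟩ := IsAlgClosed.exists_pow_nat_eq y hm
    rw [hBx, ← SetLike.mem_coe, hH, mem_rootSetU]
    simp only [Finset.mem_image, Finset.mem_univ, true_and]
    constructor
    · rintro ⟨rfl | ⟨j, hj⟩, hx⟩
      · exact absurd rfl hx
      · exact ⟨j, hj.symm⟩
    · rintro ⟨j, hj⟩
      refine ⟨Or.inr ⟨j, hj.symm⟩, ?_⟩
      rintro rfl
      exact h.ne_zero j (by rw [hj, zero_pow hm.ne'])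
  rw [hBb, Finset.card_image_of_injective _ h.injective, Finset.card_univ, Fintype.card_fin,
    Nat.div_mul_cancel h.dvd] at hB
  have h1 : 0 < Nat.card H := Nat.card_pos
  have h2 := Nat.pow_pos (n := t) h.prime.pos
  omega

theorem IsKmData.card_groupK [IsAlgClosed k] {p t m : ℕ} {ξ : k}
    {b : Fin ((p ^ t - 1) / m) → k} (h : IsKmData p t m ξ b) :
    Nat.card (groupK m ξ b) = p ^ t * m := by
  obtain ⟨H, hH⟩ := h.additive
  rw [groupK_eq_affSubgroup h.m_pos h.primitive hH, card_affSubgroup, h.card_eq hH,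
    card_rootsOfUnity_of_primitive h.m_pos h.primitive]

/-- The data `b` for a group of affine transformations. -/
theorem exists_isKmData [IsAlgClosed k] {p t m : ℕ} (hp : p.Prime) (ht : 0 < t) {ξ : k}
    (hm : 0 < m) (hξ : IsPrimitiveRoot ξ (2 * m)) {H : AddSubgroup k} [Finite H]
    (hH : Nat.card H = p ^ t) (hDH : ∀ a ∈ rootsOfUnity m k, ∀ x ∈ H, (a : k) * x ∈ H) :
    ∃ b : Fin ((p ^ t - 1) / m) → k, IsKmData p t m ξ b ∧ (H : Set k) = rootSetU m b := by
  have : NeZero m := ⟨hm.ne'⟩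
  have hD := card_rootsOfUnity_of_primitive hm hξ
  obtain ⟨B, hB, hB0, hBx⟩ := exists_power_set H (rootsOfUnity m k) hDH
  rw [hD, hH] at hB
  rw [hD] at hBx
  have hBcard : B.card = (p ^ t - 1) / m := by rw [← hB, Nat.mul_div_cancel _ hm]
  let e := (B.equivFinOfCardEq hBcard).symm
  have heq : (H : Set k) = rootSetU m fun j => (e j : k) := by
    ext x
    rw [mem_rootSetU, SetLike.mem_coe]
    constructor
    · intro hx
      by_cases hx0 : x = 0
      · exact Or.inl hx0
      · exact Or.inr ⟨e.symm ⟨_, (hBx x).2 ⟨hx, hx0⟩⟩, by simp⟩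
    · rintro (rfl | ⟨j, hj⟩)
      · exact zero_mem H
      · exact ((hBx x).1 (hj ▸ (e j).2)).1
  exact ⟨fun j => e j, ⟨hp, ht, Dvd.intro_left _ hB, hξ,
    fun i j hij => e.injective (Subtype.ext hij),
    fun j hj => hB0 (hj ▸ (e j).2), H, heq⟩, heq⟩

section Formula

-- Both sides are monic of degree |H|, and each element of H is a root of the left side.
open Polynomial in
theorem X_mul_prod_eq {m n : ℕ} (hm : 0 < m) {b : Fin n → k} {H : AddSubgroup k} [Fintype H]
    (hH : (H : Set k) = rootSetU m b) (hcard : Nat.card H = 1 + n * m) :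
    (X * ∏ j, (X ^ m - C (b j)) : Polynomial k) = ∏ h : H, (X - C (h : k)) := by
  have hmon : (∏ j, (X ^ m - C (b j)) : Polynomial k).Monic :=
    monic_prod_of_monic _ _ fun j _ => monic_X_pow_sub_C _ hm.ne'
  refine eq_of_monic_of_dvd_of_natDegree_le
    (monic_prod_of_monic _ _ fun h _ => monic_X_sub_C _) (monic_X.mul hmon) ?_ ?_
  · refine Fintype.prod_dvd_of_coprime (fun h h' hh => ?_) fun h => ?_
    · exact isCoprime_X_sub_C_of_isUnit_sub (sub_ne_zero.2 fun hc => hh (Subtype.ext hc)).isUnit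
    · rw [dvd_iff_isRoot]
      have h1 : (h : k) ∈ rootSetU m b := hH ▸ h.2
      simpa [rootSetU, eval_prod] using h1
  · rw [monic_X.natDegree_mul hmon, natDegree_prod_of_monic _ _ fun j _ =>
      monic_X_pow_sub_C _ hm.ne', natDegree_prod_of_monic _ _ fun h _ => monic_X_sub_C _]
    simp only [natDegree_X, natDegree_X_pow_sub_C, natDegree_X_sub_C, Finset.sum_const,
      Finset.card_univ, Fintype.card_fin, smul_eq_mul, mul_one, ← Nat.card_eq_fintype_card (α := H),
      hcard, le_refl]

-- Invariance under translations is visible in the product over H, invariance under homotheties in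
-- the expression through xᵐ - bⱼ; the outer m-th power removes the remaining root of unity.
open RatFunc in
theorem fixedFieldGivenBy_groupK [IsAlgClosed k] {G : Subgroup (PGL2 k)} [Finite G] {m n : ℕ}
    (hm : 0 < m) {b : Fin n → k} {H : AddSubgroup k} [Finite H]
    (hH : (H : Set k) = rootSetU m b) (hcard : Nat.card H = 1 + n * m)
    (hG : Nat.card G = m * Nat.card H) {γ : PGL2 k}
    (hγ : ∀ g ∈ conjSubgroup γ G, ∃ a ∈ rootsOfUnity m k, ∃ x ∈ H, g = aff a x)
    (he : OrbitType G [m * Nat.card H, m]) :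
    FixedFieldGivenBy G ((X * ∏ j, (X ^ m - C (b j))) ^ m) [m * Nat.card H, m] := by
  have := Fintype.ofFinite H
  have hpoly := X_mul_prod_eq hm hH hcard
  have hrat : (X * ∏ j, (X ^ m - C (b j)) : RatFunc k) = ∏ h : H, (X - C (h : k)) := by
    have := congrArg (algebraMap (Polynomial k) (RatFunc k)) hpoly
    simpa [map_prod] using this
  refine fixedFieldGivenBy_of_div
    (p := (Polynomial.X * ∏ j, (Polynomial.X ^ m - Polynomial.C (b j))) ^ m) (q := 1)
    (by simp [map_prod]) γ ?_ ?_ (by simp [Nat.card_pos]) one_ne_zero he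
  · intro g hg
    obtain ⟨a, ha, x, hx, rfl⟩ := hγ g hg
    have ha' : (C (a : k) : RatFunc k) ^ m = 1 := by
      rw [← map_pow, ← Units.val_pow_eq_pow_val, (mem_rootsOfUnity m a).1 ha, Units.val_one,
        map_one]
    rw [show aff a x = aff 1 x * aff a 0 by rw [aff_mul_aff]; simp]
    refine mul_mem ?_ ?_
    · rw [aff_mem_invariance, hrat, map_pow, map_prod]
      congr 1
      refine Fintype.prod_equiv (Equiv.addRight (⟨-x, neg_mem hx⟩ : H)) _ _ fun h => ?_
      rw [map_sub, subst_X, subst_C, moebius_aff, Equiv.coe_addRight, AddSubgroup.coe_add,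
        Units.val_one, map_one, one_mul, map_add, map_neg]
      ring
    · rw [aff_mem_invariance]
      simp only [map_pow, map_mul, map_prod, map_sub, subst_X, subst_C, moebius_aff, map_zero,
        add_zero, mul_pow, ha', one_mul]
  · rw [hpoly, Polynomial.natDegree_pow,
      Polynomial.natDegree_prod_of_monic _ _ fun h _ => Polynomial.monic_X_sub_C _, hG]
    simp

end Formula

end

/-! ### Subfields from Hua's identity; orders of the linear groups -/

section

open Matrix OnePoint MulAction

variable {k : Type*} [Field k]

/-- A form of Hua's theorem: a finite additive subgroup containing `1` and stable under
`h ↦ c / h` is a subfield. -/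
theorem mul_inv_mem_of_div_mem (h2 : (2 : k) ≠ 0) (H : AddSubgroup k) [Finite H] {c : k}
    (hc : c ≠ 0) (h1 : (1 : k) ∈ H) (hdiv : ∀ h ∈ H, h ≠ 0 → c / h ∈ H) :
    (∀ a ∈ H, ∀ b ∈ H, a * b ∈ H) ∧ ∀ a ∈ H, a⁻¹ ∈ H := by
  -- Hua's identity: a - c/(c/a + c/(c/b - a)) = a²b/c, built only from differences and h ↦ c/h. The
  -- degenerate cases ab = 0 and ab = c are immediate.
  have key : ∀ a ∈ H, ∀ b ∈ H, a ^ 2 * b / c ∈ H := by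
    intro a ha b hb
    by_cases ha0 : a = 0
    · simp [ha0, zero_mem]
    by_cases hb0 : b = 0
    · simp [hb0, zero_mem]
    by_cases hab : a * b = c
    · rw [← hab, show a ^ 2 * b / (a * b) = a by field_simp]
      exact ha
    have hne : c - a * b ≠ 0 := sub_ne_zero.2 (Ne.symm hab)
    have he : c / b - a ∈ H := sub_mem (hdiv b hb hb0) ha
    have he' : c / b - a = (c - a * b) / b := by field_simp
    have he0 : c / b - a ≠ 0 := by rw [he']; exact div_ne_zero hne hb0
    have hf := add_mem (hdiv a ha ha0) (hdiv _ he he0)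
    have hf' : c / a + c / (c / b - a) = c ^ 2 / (a * (c - a * b)) := by
      rw [he']
      field_simp
      ring
    rw [hf'] at hf
    have hg := hdiv _ hf (div_ne_zero (pow_ne_zero 2 hc) (mul_ne_zero ha0 hne))
    have := sub_mem ha hg
    rwa [show a - c / (c ^ 2 / (a * (c - a * b))) = a ^ 2 * b / c by field_simp; ring] at this
  -- The case a = 1 gives division by c, which is bijective on the finite H, so H is also stable
  -- under multiplication by c and then under squaring. Products come from (a + b)² - a² - b² by
  -- halving.
  have hdc : ∀ b ∈ H, b / c ∈ H := fun b hb => by simpa using key 1 h1 b hb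
  have hmc : ∀ b ∈ H, c * b ∈ H := by
    let f : H → H := fun b => ⟨b / c, hdc b b.2⟩
    have hf : Function.Injective f := fun x y h =>
      Subtype.ext ((div_left_inj' hc).1 (congrArg Subtype.val h))
    intro b hb
    obtain ⟨y, hy⟩ := Finite.injective_iff_surjective.1 hf ⟨b, hb⟩
    have hy' : (y : k) / c = b := congrArg Subtype.val hy
    rw [← hy', mul_div_cancel₀ _ hc]
    exact y.2
  have hsq : ∀ a ∈ H, a ^ 2 ∈ H := fun a ha => by
    have := hmc _ (key a ha 1 h1)
    rwa [mul_one, mul_div_cancel₀ _ hc] at this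
  refine ⟨fun a ha b hb => ?_, fun a ha => ?_⟩
  · have h := sub_mem (sub_mem (hsq _ (add_mem ha hb)) (hsq a ha)) (hsq b hb)
    obtain ⟨y, hy, hyx⟩ := exists_double_eq h2 H h
    have : y = a * b := mul_left_cancel₀ h2 (by rw [hyx]; ring)
    exact this ▸ hy
  · by_cases ha0 : a = 0
    · simp [ha0, zero_mem]
    · have := hdc _ (hdiv a ha ha0)
      rwa [show c / a / c = a⁻¹ by field_simp] at this

/-- A finite additive subgroup which is a subfield is the image of a Galois field. -/
theorem exists_ringHom_of_mul_inv_mem (p : ℕ) [Fact p.Prime] [CharP k p] {s : ℕ}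
    (H : AddSubgroup k) [Finite H] (hs : Nat.card H = p ^ s) (hs0 : s ≠ 0) (h1 : (1 : k) ∈ H)
    (hmul : ∀ a ∈ H, ∀ b ∈ H, a * b ∈ H) (hinv : ∀ a ∈ H, a⁻¹ ∈ H) :
    ∃ ι : GaloisField p s →+* k, ∀ x, x ∈ H ↔ ∃ y, ι y = x := by
  let F : Subfield k :=
    { carrier := H
      mul_mem' := fun ha hb => hmul _ ha _ hb
      one_mem' := h1
      add_mem' := fun ha hb => add_mem ha hb
      zero_mem' := zero_mem H
      neg_mem' := fun ha => neg_mem ha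
      inv_mem' := fun a ha => hinv a ha }
  have : Finite F := ‹Finite H›
  have := Fintype.ofFinite F
  have := Fintype.ofFinite (GaloisField p s)
  have hcard : Fintype.card (GaloisField p s) = Fintype.card F := by
    rw [← Nat.card_eq_fintype_card, ← Nat.card_eq_fintype_card, GaloisField.card p s hs0]
    exact hs.symm
  let e := FiniteField.ringEquivOfCardEq hcard
  refine ⟨F.subtype.comp e.toRingHom, fun x => ⟨fun hx => ⟨e.symm ⟨x, hx⟩, ?_⟩, ?_⟩⟩
  · change ((e (e.symm ⟨x, hx⟩) : F) : k) = x
    rw [e.apply_symm_apply]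
  · rintro ⟨y, rfl⟩
    exact (e y).2

section Cardinality

variable (F : Type*) [Field F] [Finite F]

theorem card_GL_two : Nat.card (GL (Fin 2) F) =
    (Nat.card F - 1) * (Nat.card F * (Nat.card F - 1) * (Nat.card F + 1)) := by
  have := Fintype.ofFinite F
  have := card_GL_field (𝔽 := F) 2
  rw [this, Fin.prod_univ_two, ← Nat.card_eq_fintype_card]
  have h1 : 0 < Nat.card F := Nat.card_pos
  obtain ⟨r, hr⟩ : ∃ r, Nat.card F = r + 1 := ⟨Nat.card F - 1, by omega⟩
  rw [hr]
  simp only [Fin.val_zero, Fin.val_one, pow_zero, pow_one, Nat.add_sub_cancel]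
  rw [show (r + 1) ^ 2 = r * (r + 2) + 1 by ring, Nat.add_sub_cancel,
    show r * (r + 2) + 1 = r * (r + 1) + (r + 1) by ring, Nat.add_sub_cancel]
  ring

theorem card_PGL2 : Nat.card (PGL2 F) =
    Nat.card F * (Nat.card F - 1) * (Nat.card F + 1) := by
  have h := Subgroup.card_mul_index (Subgroup.center (GL (Fin 2) F))
  have hc : Nat.card (Subgroup.center (GL (Fin 2) F)) = Nat.card F - 1 := by
    have := Fintype.ofFinite F
    rw [GeneralLinearGroup.center_eq_range_scalar, ← Nat.card_units]
    refine (Nat.card_congr (Equiv.ofInjective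
      (GeneralLinearGroup.scalar (Fin 2) : Fˣ → GL (Fin 2) F) ?_)).symm
    intro a b hab
    have := congrArg (fun g : GL (Fin 2) F => g.1 0 0) hab
    exact Units.ext (by simpa using this)
  rw [hc, card_GL_two] at h
  have h1 : 1 < Nat.card F := Finite.one_lt_card
  exact Nat.eq_of_mul_eq_mul_left (by omega) h

theorem card_SL_two : Nat.card (SpecialLinearGroup (Fin 2) F) =
    Nat.card F * (Nat.card F - 1) * (Nat.card F + 1) := by
  have hdet : Function.Surjective (GeneralLinearGroup.det : GL (Fin 2) F →* Fˣ) := fun u =>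
    ⟨glOf (u : F) 0 0 1 (by simp), Units.ext (by simp [det_fin_two])⟩
  have h := Subgroup.card_mul_index (GeneralLinearGroup.det : GL (Fin 2) F →* Fˣ).ker
  rw [Subgroup.index_ker, MonoidHom.range_eq_top.2 hdet, Subgroup.card_top, Nat.card_units,
    card_GL_two] at h
  have hk : Nat.card (GeneralLinearGroup.det : GL (Fin 2) F →* Fˣ).ker =
      Nat.card (SpecialLinearGroup (Fin 2) F) := by
    refine (Nat.card_congr (Equiv.ofBijective (fun g : SpecialLinearGroup (Fin 2) F =>
      (⟨SpecialLinearGroup.toGL g, by rw [MonoidHom.mem_ker]; exact Units.ext (by simp)⟩ :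
        (GeneralLinearGroup.det : GL (Fin 2) F →* Fˣ).ker)) ⟨fun a b hab => ?_, ?_⟩)).symm
    · have := congrArg (fun g => (g.1 : GL (Fin 2) F).1) hab
      exact Subtype.ext this
    · rintro ⟨g, hg⟩
      refine ⟨⟨g.1, ?_⟩, Subtype.ext (Units.ext rfl)⟩
      have := congrArg Units.val (MonoidHom.mem_ker.1 hg)
      simpa using this
  rw [hk, mul_comm] at h
  have h1 : 1 < Nat.card F := Finite.one_lt_card
  exact Nat.eq_of_mul_eq_mul_left (by omega) h

theorem two_mul_card_PSL2 (h2 : (2 : F) ≠ 0) :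
    2 * Nat.card (ProjectiveSpecialLinearGroup (Fin 2) F) =
      Nat.card F * (Nat.card F - 1) * (Nat.card F + 1) := by
  have h := Subgroup.card_mul_index (Subgroup.center (SpecialLinearGroup (Fin 2) F))
  have hprim : IsPrimitiveRoot (-1 : F) 2 := by
    refine IsPrimitiveRoot.mk_of_lt _ (by norm_num) (by norm_num) fun l hl hl2 => ?_
    obtain rfl : l = 1 := by omega
    intro h
    apply h2
    linear_combination -h
  have hc : Nat.card (Subgroup.center (SpecialLinearGroup (Fin 2) F)) = 2 := by
    rw [Nat.card_congr (SpecialLinearGroup.center_equiv_rootsOfUnity (n := Fin 2)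
      (R := F)).toEquiv]
    exact hprim.card_rootsOfUnity
  rw [hc, card_SL_two] at h
  exact h

end Cardinality

end

/-! ### Base change and a normal coordinate for the orbit of size q + 1 -/

section

open Matrix OnePoint MulAction

variable {k : Type*} [Field k]

section BaseChange

variable {F : Type*} [Field F] (ι : F →+* k)

/-- The homomorphism `PGL₂(F) → PGL₂(k)` induced by an embedding of fields. -/
def pglMap : PGL2 F →* PGL2 k :=
  QuotientGroup.lift _ (ProjGenLinGroup.mk.comp (GeneralLinearGroup.map ι)) (by
    rw [GeneralLinearGroup.center_eq_range_scalar]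
    rintro _ ⟨u, rfl⟩
    rw [MonoidHom.mem_ker, MonoidHom.comp_apply, ← ProjGenLinGroup.mk_scalar (Units.map ι u)]
    congr 1
    ext i j
    fin_cases i <;> fin_cases j <;> simp)

theorem pglMap_mk (g : GL (Fin 2) F) :
    pglMap ι (ProjGenLinGroup.mk g) = ProjGenLinGroup.mk (GeneralLinearGroup.map ι g) := rfl

theorem pglMap_injective : Function.Injective (pglMap ι) := by
  rw [injective_iff_map_eq_one]
  intro x hx
  obtain ⟨g, rfl⟩ := ProjGenLinGroup.mk_surjective x
  rw [pglMap_mk, ← map_one ProjGenLinGroup.mk] at hx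
  obtain ⟨u, hu, h⟩ := exists_smul_of_mk_eq_mk hx
  have h00 := congrFun (congrFun h 0) 0
  have h01 := congrFun (congrFun h 0) 1
  have h10 := congrFun (congrFun h 1) 0
  have h11 := congrFun (congrFun h 1) 1
  simp [hu] at h00 h01 h10 h11
  have hg : g.1 0 0 = g.1 1 1 := by
    apply ι.injective
    apply mul_left_cancel₀ hu
    rw [h00, h11]
  have hne : g.1 0 0 ≠ 0 := fun h0 => by
    rw [h0] at h00
    simp at h00
  rw [← map_one ProjGenLinGroup.mk]
  symm
  refine mk_eq_mk_of_smul (g.1 0 0) hne ?_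
  ext i j
  fin_cases i <;> fin_cases j <;> simp [h01, h10, hg]

theorem pglMap_aff (a : Fˣ) (b : F) : pglMap ι (aff a b) = aff (Units.map ι a) (ι b) := by
  rw [aff, pglMap_mk, aff]
  congr 1
  ext i j
  fin_cases i <;> fin_cases j <;> simp

theorem pglMap_inver (c : Fˣ) : pglMap ι (inver c) = inver (Units.map ι c) := by
  rw [inver, pglMap_mk, inver]
  congr 1
  ext i j
  fin_cases i <;> fin_cases j <;> simp

end BaseChange

section NormalForm

theorem transl_conj_aff (a : kˣ) (b : k) {K : Subgroup (PGL2 k)} {x : k} :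
    (a : k) * x ∈ transl (conjSubgroup (aff a b) K) ↔ x ∈ transl K := by
  rw [mem_transl, mem_transl, ← aff_conj_translation a b x, mem_conjSubgroup]
  simp [mul_assoc]

theorem card_transl_conj {δ : PGL2 k} (hδ : δ • (∞ : OnePoint k) = ∞) (K : Subgroup (PGL2 k))
    [Finite K] :
    Nat.card (transl (conjSubgroup δ K)) = Nat.card (transl K) := by
  rw [← uniqueFixCount_infty, ← uniqueFixCount_infty, ← uniqueFixCount_conj δ K, hδ]

theorem card_mults_conj {δ : PGL2 k} (hδ : δ • (∞ : OnePoint k) = ∞) (K : Subgroup (PGL2 k))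
    [Finite K] :
    Nat.card (mults (conjSubgroup δ K)) = Nat.card (mults K) := by
  have h := card_stabilizer_conj δ K ∞
  rw [hδ, card_stabilizer_infty, card_stabilizer_infty, card_transl_conj hδ] at h
  exact Nat.eq_of_mul_eq_mul_left Nat.card_pos h

theorem add_mem_orbit_infty {K : Subgroup (PGL2 k)} {x y : k} (hy : y ∈ transl K)
    (hx : (x : OnePoint k) ∈ orbit K (∞ : OnePoint k)) :
    ((x + y : k) : OnePoint k) ∈ orbit K (∞ : OnePoint k) := by
  have := (smul_mem_orbit_iff' K ⟨aff 1 y, hy⟩).2 hx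
  change aff 1 y • (x : OnePoint k) ∈ _ at this
  simpa using this

/-- If the orbit of `∞` has one point more than the group of translations, then its finite part is
a coset of the group of translations. -/
theorem mem_orbit_infty_iff {K : Subgroup (PGL2 k)} [Finite K]
    (hr : (orbit K (∞ : OnePoint k)).ncard = Nat.card (transl K) + 1) {x₀ : k}
    (hx₀ : (x₀ : OnePoint k) ∈ orbit K (∞ : OnePoint k)) (x : k) :
    (x : OnePoint k) ∈ orbit K (∞ : OnePoint k) ↔ x - x₀ ∈ transl K := by
  set S : Set (OnePoint k) := insert ∞ ((fun y : k => ((x₀ + y : k) : OnePoint k)) ''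
    (transl K : Set k)) with hS
  have hsub : S ⊆ orbit K (∞ : OnePoint k) := by
    rintro _ (rfl | ⟨y, hy, rfl⟩)
    · exact mem_orbit_self _
    · exact add_mem_orbit_infty hy hx₀
  have hcard : S.ncard = Nat.card (transl K) + 1 := by
    have hfin : (transl K : Set k).Finite := finite_transl K
    rw [hS, Set.ncard_insert_of_notMem (by rintro ⟨y, -, hy⟩; exact OnePoint.coe_ne_infty _ hy)
      (hfin.image _), Set.ncard_image_of_injective]
    · rfl
    · intro y z h
      simpa using h
  have hEq : S = orbit K (∞ : OnePoint k) :=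
    Set.eq_of_subset_of_ncard_le hsub (by rw [hr, hcard]) (finite_orbit K _)
  rw [← hEq]
  constructor
  · rintro (h | ⟨y, hy, h⟩)
    · exact absurd h (OnePoint.coe_ne_infty _)
    · have : x₀ + y = x := by simpa using h
      rw [← this, add_sub_cancel_left]
      exact hy
  · intro h
    exact Or.inr ⟨x - x₀, h, by simp⟩

/-- In the situation of `mem_orbit_infty_iff` there is a coordinate in which the finite part of the
orbit of `∞` is the group of translations, and contains `1`. -/
theorem exists_normal_coordinate {K : Subgroup (PGL2 k)} [Finite K]
    (hK : ∀ a ∈ mults K, aff a 0 ∈ K) (hq : 1 < Nat.card (transl K))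
    (hr : (orbit K (∞ : OnePoint k)).ncard = Nat.card (transl K) + 1) :
    ∃ δ : PGL2 k, δ • (∞ : OnePoint k) = ∞ ∧
      (∀ a ∈ mults (conjSubgroup δ K), aff a 0 ∈ conjSubgroup δ K) ∧
      (1 : k) ∈ transl (conjSubgroup δ K) ∧
      ∀ x : k, (x : OnePoint k) ∈ orbit (conjSubgroup δ K) (∞ : OnePoint k) ↔
        x ∈ transl (conjSubgroup δ K) := by
  obtain ⟨P, hP, hPi⟩ : ∃ P ∈ orbit K (∞ : OnePoint k), P ≠ ∞ :=
    Set.exists_ne_of_one_lt_ncard (by omega) _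
  obtain ⟨x₀, rfl⟩ := OnePoint.ne_infty_iff_exists.1 hPi
  have hx₀ := mem_orbit_infty_iff hr hP
  obtain ⟨h, hh0⟩ : ∃ h : transl K, h ≠ 0 := by
    have := (Finite.one_lt_card_iff_nontrivial).1 hq
    exact exists_ne 0
  have hh0' : (h : k) ≠ 0 := fun hc => hh0 (Subtype.ext hc)
  -- Translation by c carries the coset to H without disturbing the homotheties: c = -x₀ if there is
  -- no nontrivial multiplier; otherwise ax₀ - x₀ ∈ H puts x₀ in H, and c = 0.
  obtain ⟨c, hc, hcK⟩ : ∃ c : k, (∀ x : k, (x : OnePoint k) ∈ orbit K (∞ : OnePoint k) ↔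
      x + c ∈ transl K) ∧ ∀ a ∈ mults K, (1 - a) * c = 0 := by
    by_cases hd : ∀ a ∈ mults K, a = 1
    · refine ⟨-x₀, fun x => by rw [hx₀, sub_eq_add_neg], fun a ha => by simp [hd a ha]⟩
    · push Not at hd
      obtain ⟨a, ha, ha1⟩ := hd
      refine ⟨0, fun x => ?_, fun a _ => mul_zero _⟩
      have h1 := (smul_mem_orbit_iff' K ⟨aff a 0, hK a ha⟩).2 hP
      change aff a 0 • (x₀ : OnePoint k) ∈ _ at h1
      rw [aff_smul_coe, hx₀, ← neg_mem_iff] at h1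
      have h2 : x₀ ∈ transl K := mem_transl_of_sub_mul_mem ha ha1 (by
        convert h1 using 1
        ring)
      rw [hx₀, add_zero]
      exact ⟨fun hx => by simpa using add_mem hx h2, fun hx => sub_mem hx h2⟩
  -- Scaling by the inverse of a nonzero translation h puts 1 among the translations.
  set u : kˣ := (Units.mk0 (h : k) hh0')⁻¹ with hu
  have hu' : (u : k) = (h : k)⁻¹ := by simp [hu]
  refine ⟨aff u (u * c), aff_smul_infty _ _, ?_, ?_, fun x => ?_⟩
  · rintro a ⟨b, hb⟩
    rw [mem_conjSubgroup] at hb ⊢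
    have ha : a ∈ mults K := by
      rw [aff_inv, aff_mul_aff, aff_mul_aff] at hb
      refine ⟨_, by simpa [mul_comm] using hb⟩
    have := hK a ha
    rw [aff_inv, aff_mul_aff, aff_mul_aff]
    convert this using 1
    rw [aff_inj]
    constructor
    · rw [mul_right_comm, inv_mul_cancel, one_mul]
    · have h1 := hcK a ha
      simp only [Units.val_mul, mul_zero, zero_add]
      have h2 : ((u⁻¹ : kˣ) : k) * u = 1 := by simp
      linear_combination (a * c - c) * h2 - h1
  · have := (transl_conj_aff u (u * c) (K := K)).2 h.2
    rwa [hu', inv_mul_cancel₀ hh0'] at this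
  · obtain ⟨y, rfl⟩ : ∃ y, x = u * y := ⟨(u⁻¹ : kˣ) * x, by simp⟩
    rw [transl_conj_aff, show ((u * y : k) : OnePoint k) =
      aff u (u * c) • ((y - c : k) : OnePoint k) by rw [aff_smul_coe]; congr 1; ring,
      ← aff_smul_infty u (u * c), mem_orbit_conj, hc, sub_add_cancel]

end NormalForm

section Structure

variable {K : Subgroup (PGL2 k)} (hK : ∀ a ∈ mults K, aff a 0 ∈ K) (h1 : (1 : k) ∈ transl K)
  (horb : ∀ x : k, (x : OnePoint k) ∈ orbit K (∞ : OnePoint k) ↔ x ∈ transl K)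
include h1 horb

-- Some g in K sends ∞ to 0, and x = g⁻¹(∞) is finite in the orbit, hence a translation in K.
-- Composing g with it exchanges 0 and ∞.
omit h1 in
theorem exists_inver_mem : ∃ c : kˣ, inver c ∈ K := by
  obtain ⟨⟨g, hg⟩, hgi⟩ := (horb 0).2 (zero_mem _)
  change g • (∞ : OnePoint k) = _ at hgi
  have hinv : g⁻¹ • (∞ : OnePoint k) ∈ orbit K (∞ : OnePoint k) := ⟨⟨g⁻¹, inv_mem hg⟩, rfl⟩
  obtain ⟨x, hx⟩ : ∃ x : k, (x : OnePoint k) = g⁻¹ • (∞ : OnePoint k) := by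
    refine OnePoint.ne_infty_iff_exists.1 fun hc => ?_
    rw [inv_smul_eq_iff, hgi] at hc
    exact OnePoint.infty_ne_coe _ hc
  rw [← hx, horb] at hinv
  obtain ⟨c, hc⟩ := exists_inver (g := g * aff 1 x) (by rw [mul_smul, aff_smul_infty, hgi]) (by
    rw [mul_smul, aff_smul_coe, mul_zero, zero_add, hx, smul_inv_smul])
  exact ⟨c, hc ▸ mul_mem hg hinv⟩

omit h1 in
theorem div_mem_transl {c : kˣ} (hc : inver c ∈ K) {h : k} (hh : h ∈ transl K) (hh0 : h ≠ 0) :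
    (c : k) / h ∈ transl K := by
  rw [← horb, ← inver_smul_coe c hh0]
  exact (smul_mem_orbit_iff' K ⟨inver c, hc⟩).2 ((horb h).2 hh)

/-- The composite of x + 1, c/x, x - c, c/x, x + 1 is -1/x; here c = c/1 is itself a translation of
K. -/
theorem inver_neg_one_mem : inver (-1 : kˣ) ∈ K := by
  obtain ⟨c, hc⟩ := exists_inver_mem horb
  have hcH : (c : k) ∈ transl K := by simpa using div_mem_transl horb hc h1 one_ne_zero
  have h := mul_mem (mul_mem (show aff 1 1 ∈ K from h1)
    (mul_mem (mul_mem hc (show aff 1 (-(c : k)) ∈ K from neg_mem hcH)) hc))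
    (show aff 1 1 ∈ K from h1)
  convert h using 1
  simp only [aff, inver, ← map_mul]
  refine mk_eq_mk_of_smul (-(c : k)) (neg_ne_zero.2 c.ne_zero) ?_
  ext i j
  fin_cases i <;> fin_cases j <;> simp

-- Bruhat decomposition: an element moving ∞ to y becomes affine after translation by -y and -1/x.
include hK in
theorem eq_aff_or_eq_mul {g : PGL2 k} (hg : g ∈ K) :
    ∃ a ∈ mults K, ∃ b ∈ transl K, g = aff a b ∨
      ∃ y ∈ transl K, g = aff 1 y * inver (-1) * aff a b := by
  by_cases hgi : g • (∞ : OnePoint k) = ∞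
  · obtain ⟨a, b, rfl⟩ := exists_aff hgi
    obtain ⟨ha, hb⟩ := mem_of_aff_mem hK hg
    exact ⟨a, ha, b, hb, Or.inl rfl⟩
  · obtain ⟨y, hy⟩ := OnePoint.ne_infty_iff_exists.1 hgi
    have hyH : y ∈ transl K := (horb y).1 ⟨⟨g, hg⟩, hy.symm⟩
    have hmem := mul_mem (mul_mem (inver_neg_one_mem h1 horb)
      (show aff 1 (-y) ∈ K from neg_mem hyH)) hg
    obtain ⟨a, b, hab⟩ := exists_aff (g := inver (-1) * aff 1 (-y) * g) (by
      rw [mul_smul, mul_smul, ← hy, aff_smul_coe]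
      simp)
    rw [hab] at hmem
    obtain ⟨ha, hb⟩ := mem_of_aff_mem hK hmem
    refine ⟨a, ha, b, hb, Or.inr ⟨y, hyH, ?_⟩⟩
    rw [← hab, ← mul_assoc, ← mul_assoc, mul_assoc (aff 1 y), inver_mul_self, mul_one,
      aff_mul_aff]
    simp

end Structure

end

/-! ### Identification with PSL₂(q) and PGL₂(q), and their invariants -/

section

open Matrix OnePoint MulAction

variable {k : Type*} [Field k]

section Identification

variable {F : Type*} [Field F] [Finite F] (ι : F →+* k) {K : Subgroup (PGL2 k)} [Finite K]
  (hK : ∀ a ∈ mults K, aff a 0 ∈ K)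
  (horb : ∀ x : k, (x : OnePoint k) ∈ orbit K (∞ : OnePoint k) ↔ x ∈ transl K)
  (hι : ∀ x, x ∈ transl K ↔ ∃ y, ι y = x)
include horb hι

-- Each Bruhat factor comes from F: the translations are the image of F, and a multiplier is the
-- image of the translation 1 under itself.
include hK in
omit [Finite F] [Finite K] in
theorem le_range_pglMap : K ≤ (pglMap ι).range := by
  have h1 : (1 : k) ∈ transl K := (hι 1).2 ⟨1, map_one ι⟩
  have haff : ∀ a ∈ mults K, ∀ b ∈ transl K, aff a b ∈ (pglMap ι).range := by
    intro a ha b hb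
    obtain ⟨b', rfl⟩ := (hι b).1 hb
    obtain ⟨a', ha'⟩ := (hι _).1 (mults_mul_transl ha h1)
    rw [mul_one] at ha'
    have ha0 : a' ≠ 0 := fun h => a.ne_zero (by rw [← ha', h, map_zero])
    refine ⟨aff (Units.mk0 a' ha0) b', ?_⟩
    rw [pglMap_aff]
    congr 1
    exact Units.ext ha'
  intro g hg
  obtain ⟨a, ha, b, hb, rfl | ⟨y, hy, rfl⟩⟩ := eq_aff_or_eq_mul hK h1 horb hg
  · exact haff a ha b hb
  · refine mul_mem (mul_mem (haff 1 (one_mem _) y hy) ⟨inver (-1), ?_⟩) (haff a ha b hb)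
    rw [pglMap_inver]
    congr 1
    exact Units.ext (by simp)

include hK in
omit [Finite F] in
theorem nonempty_mulEquiv_PGL2 (hcard : Nat.card K = Nat.card (PGL2 F)) :
    Nonempty (K ≃* PGL2 F) := by
  have hle := le_range_pglMap ι hK horb hι
  have hfin : Finite (PGL2 F) := Nat.finite_of_card_ne_zero (hcard ▸ Nat.card_pos.ne')
  have hr : Nat.card (pglMap ι).range = Nat.card (PGL2 F) :=
    Nat.card_congr (MonoidHom.ofInjective (pglMap_injective ι)).toEquiv.symm
  have : Finite (pglMap ι).range := Nat.finite_of_card_ne_zero (by rw [hr]; exact Nat.card_pos.ne')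
  have h := Subgroup.eq_of_le_of_card_ge hle (by rw [hr, hcard])
  exact ⟨(MulEquiv.subgroupCongr h).trans (MonoidHom.ofInjective (pglMap_injective ι)).symm⟩

-- In the Bruhat factorization of a matrix of determinant 1 the multiplier is a nonzero square, and
-- a² lies in the multiplier group of order d because (a²)ᵈ = a^(q-1) = 1.
include hK in
theorem pglMap_toPGL_mem (hd : 2 * Nat.card (mults K) = Nat.card F - 1)
    (x : ProjectiveSpecialLinearGroup (Fin 2) F) :
    pglMap ι (ProjectiveSpecialLinearGroup.toPGL x) ∈ K := by
  have h1 : (1 : k) ∈ transl K := (hι 1).2 ⟨1, map_one ι⟩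
  have haff : ∀ (a b : F) (ha : a ≠ 0), aff (Units.mk0 (ι a ^ 2) (by simpa using ha)) (ι b) ∈ K :=
      by
    intro a b ha
    refine aff_mem_of_mem hK ?_ ((hι _).2 ⟨b, rfl⟩)
    rw [mem_iff_pow_card_eq_one]
    have := Fintype.ofFinite F
    refine Units.ext ?_
    rw [Units.val_pow_eq_pow_val, Units.val_mk0, ← pow_mul, hd, ← map_pow,
      Nat.card_eq_fintype_card, FiniteField.pow_card_sub_one_eq_one a ha, map_one, Units.val_one]
  obtain ⟨g, rfl⟩ := QuotientGroup.mk_surjective x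
  rw [ProjectiveSpecialLinearGroup.toPGL_mk, pglMap_mk]
  have hdet : g.1 0 0 * g.1 1 1 - g.1 0 1 * g.1 1 0 = 1 := by rw [← det_fin_two, g.2]
  have hdet' := congrArg ι hdet
  simp only [map_sub, map_mul, map_one] at hdet'
  by_cases hc : g.1 1 0 = 0
  · rw [hc, mul_zero, sub_zero] at hdet
    have ha : g.1 0 0 ≠ 0 := left_ne_zero_of_mul_eq_one hdet
    have h := haff (g.1 0 0) (g.1 0 0 * g.1 0 1) ha
    convert h using 1
    refine mk_eq_mk_of_smul (ι (g.1 0 0)) (by simpa using ha) ?_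
    have hdet2 := congrArg ι hdet
    simp only [map_mul, map_one] at hdet2
    ext i j
    fin_cases i <;> fin_cases j <;> simp [hc, hdet2, sq]
  · have h := mul_mem (mul_mem (show aff 1 (ι (g.1 0 0 / g.1 1 0)) ∈ K from (hι _).2 ⟨_, rfl⟩)
      (inver_neg_one_mem h1 horb)) (haff (g.1 1 0) (g.1 1 0 * g.1 1 1) hc)
    have hc' : ι (g.1 1 0) ≠ 0 := by simpa using hc
    convert h using 1
    simp only [aff, inver, ← map_mul]
    refine mk_eq_mk_of_smul (ι (g.1 1 0)) hc' ?_
    ext i j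
    fin_cases i <;> fin_cases j
    · simp
      field_simp
    · simp
      field_simp
      linear_combination -hdet'
    · simp [sq]
    · simp

include hK in
theorem nonempty_mulEquiv_PSL2 (hd : 2 * Nat.card (mults K) = Nat.card F - 1)
    (hcard : Nat.card K = Nat.card (ProjectiveSpecialLinearGroup (Fin 2) F)) :
    Nonempty (K ≃* ProjectiveSpecialLinearGroup (Fin 2) F) := by
  let f : ProjectiveSpecialLinearGroup (Fin 2) F →* K :=
    ((pglMap ι).comp ProjectiveSpecialLinearGroup.toPGL).codRestrict K
      (pglMap_toPGL_mem ι hK horb hι hd)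
  have hinj : Function.Injective f := fun x y h =>
    ProjectiveSpecialLinearGroup.toPGL_injective (pglMap_injective ι (congrArg Subtype.val h))
  have : Finite (ProjectiveSpecialLinearGroup (Fin 2) F) := Finite.of_injective f hinj
  exact ⟨(MulEquiv.ofBijective f
    ((Nat.bijective_iff_injective_and_card f).2 ⟨hinj, hcard.symm⟩)).symm⟩

end Identification

section Formula

open RatFunc

/-- This governs the numerator under x ↦ -1/x. After multiplication by x^q - x it becomes the
Frobenius relation (x^q - x)^q = x^(q²) - x^q. -/
theorem subst_neg_inv_identity (p : ℕ) [Fact p.Prime] [CharP k p] {s q : ℕ} (hq : q = p ^ s)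
    (hq1 : 1 < q) :
    ((X ^ q - X) ^ (q - 1) + X ^ (q ^ 2 - 1) : RatFunc k) =
      X ^ (q - 1) * ((X ^ q - X) ^ (q - 1) + 1) := by
  have : CharP (RatFunc k) p := charP_of_injective_algebraMap (algebraMap k (RatFunc k)).injective p
  have hfrob : ((X ^ q - X) ^ q : RatFunc k) = X ^ (q ^ 2) - X ^ q := by
    rw [hq, sub_pow_char_pow, ← pow_mul, sq]
  have hX : (X : RatFunc k) ≠ 0 := X_ne_zero
  have hL : (X ^ q - X : RatFunc k) ≠ 0 := by
    have h : (Polynomial.X ^ q - Polynomial.X : Polynomial k) ≠ 0 :=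
      FiniteField.X_pow_card_sub_X_ne_zero k hq1
    have := (map_ne_zero_iff _ (algebraMap_injective k)).2 h
    simpa using this
  obtain ⟨r, rfl⟩ : ∃ r, q = r + 1 := ⟨q - 1, by omega⟩
  obtain ⟨j, hj⟩ : ∃ j, (r + 1) ^ 2 = j + 1 := ⟨r ^ 2 + 2 * r, by ring⟩
  rw [hj] at hfrob ⊢
  simp only [Nat.add_sub_cancel]
  apply mul_right_cancel₀ hL
  set L : RatFunc k := X ^ (r + 1) - X with hLdef
  have h1 : L ^ r * L = X ^ (j + 1) - X ^ (r + 1) := by rw [← pow_succ, hfrob]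
  calc (L ^ r + X ^ j) * L = L ^ r * L + X ^ j * L := by ring
    _ = X ^ r * (L ^ r * L + L) := by rw [h1, hLdef]; ring
    _ = _ := by ring

/-- The function fixed by a group between `PSL₂(q)` and `PGL₂(q)`. -/
theorem fixedFieldGivenBy_projective [IsAlgClosed k] (p : ℕ) [Fact p.Prime] [CharP k p]
    (hp2 : p ≠ 2)
    {G : Subgroup (PGL2 k)} [Finite G] {γ : PGL2 k}
    (hK : ∀ a ∈ mults (conjSubgroup γ G), aff a 0 ∈ conjSubgroup γ G)
    (h1 : (1 : k) ∈ transl (conjSubgroup γ G))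
    (horb : ∀ x : k, (x : OnePoint k) ∈ orbit (conjSubgroup γ G) (∞ : OnePoint k) ↔
      x ∈ transl (conjSubgroup γ G)) {s q d n : ℕ} (hq : q = p ^ s) (hq1 : 1 < q)
    (hpow : ∀ x ∈ transl (conjSubgroup γ G), x ^ q = x)
    (hd : ∀ a ∈ mults (conjSubgroup γ G), a ^ d = 1) (hn : n * (q - 1) = d * (q + 1))
    (hcard : Nat.card G = q * d * (q + 1)) {e : List ℕ} (he : OrbitType G e) :
    FixedFieldGivenBy G (((X ^ q - X) ^ (q - 1) + 1) ^ n / (X ^ q - X) ^ (q * d)) e := by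
  have hodd : Odd q := hq ▸ ((Fact.out : p.Prime).odd_of_ne_two hp2).pow
  have : CharP (RatFunc k) p := charP_of_injective_algebraMap (algebraMap k (RatFunc k)).injective p
  have hX : (X : RatFunc k) ≠ 0 := X_ne_zero
  have hLdeg : (Polynomial.X ^ q - Polynomial.X : Polynomial k).natDegree = q :=
    FiniteField.X_pow_card_sub_X_natDegree_eq k hq1
  have hL0 : (Polynomial.X ^ q - Polynomial.X : Polynomial k) ≠ 0 :=
    FiniteField.X_pow_card_sub_X_ne_zero k hq1
  have hdq : 0 < q * d := by
    have : 0 < Nat.card G := Nat.card_pos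
    rw [hcard] at this
    exact Nat.pos_of_mul_pos_right this
  refine fixedFieldGivenBy_of_div
    (p := ((Polynomial.X ^ q - Polynomial.X) ^ (q - 1) + 1) ^ n)
    (q := (Polynomial.X ^ q - Polynomial.X) ^ (q * d))
    (by simp) γ ?_ ?_ ?_ (pow_ne_zero _ hL0) he
  -- Translations by solutions of y^q = y leave x^q - x unchanged; a multiplier a scales it by a,
  -- which disappears because a^(q-1) = 1 and a^d = 1.
  · have htr : ∀ y ∈ transl (conjSubgroup γ G), aff 1 y ∈
        invariance (((X ^ q - X) ^ (q - 1) + 1) ^ n / (X ^ q - X) ^ (q * d) : RatFunc k) := by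
      intro y hy
      have hL : ((X + C y) ^ q - (X + C y) : RatFunc k) = X ^ q - X := by
        rw [hq, add_pow_char_pow, ← map_pow, ← hq, hpow y hy]
        ring
      rw [aff_mem_invariance]
      simp only [map_div₀, map_pow, map_add, map_sub, map_one, subst_X, moebius_aff]
      simp only [Units.val_one, map_one, one_mul, hL]
    have hmul : ∀ a ∈ mults (conjSubgroup γ G), aff a 0 ∈
        invariance (((X ^ q - X) ^ (q - 1) + 1) ^ n / (X ^ q - X) ^ (q * d) : RatFunc k) := by
      intro a ha
      have haq : (a : k) ^ q = a := hpow a (by simpa using mults_mul_transl ha h1)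
      have haq1 : (a : k) ^ (q - 1) = 1 := by
        apply mul_right_cancel₀ a.ne_zero
        rw [← pow_succ, Nat.sub_add_cancel hq1.le, haq, one_mul]
      have had : (a : k) ^ (q * d) = 1 := by
        rw [mul_comm, pow_mul, ← Units.val_pow_eq_pow_val, hd a ha, Units.val_one, one_pow]
      have hL : ((C (a : k) * X) ^ q - C (a : k) * X : RatFunc k) = C (a : k) * (X ^ q - X) := by
        rw [mul_pow, ← map_pow, haq]
        ring
      rw [aff_mem_invariance]
      simp only [map_div₀, map_pow, map_add, map_sub, map_one, subst_X, moebius_aff, map_zero,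
        add_zero, hL]
      rw [mul_pow, mul_pow, ← map_pow, ← map_pow, haq1, had, map_one, one_mul, one_mul]
    -- The denominators x^(q(q-1)n) and x^((q+1)qd) that arise cancel by the relation n(q - 1) = d(q
    -- + 1).
    have hinv : inver (-1 : kˣ) ∈
        invariance (((X ^ q - X) ^ (q - 1) + 1) ^ n / (X ^ q - X) ^ (q * d) : RatFunc k) := by
      have hL : ((-1 / X) ^ q - -1 / X : RatFunc k) = (X ^ q - X) / X ^ (q + 1) := by
        rw [div_pow, hodd.neg_one_pow, pow_succ]
        field_simp
        ring
      have hM : ((X ^ q - X) / X ^ (q + 1)) ^ (q - 1) + 1 =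
          ((X ^ q - X) ^ (q - 1) + 1 : RatFunc k) / X ^ (q * (q - 1)) := by
        have h := subst_neg_inv_identity (k := k) p hq hq1
        have e1 : (q + 1) * (q - 1) = q ^ 2 - 1 := by
          rw [← Nat.sq_sub_sq]
        have e2 : q ^ 2 - 1 = (q - 1) + q * (q - 1) := by rw [← e1]; ring
        rw [div_pow, ← pow_mul, e1, div_add_one (pow_ne_zero _ hX), h, e2, pow_add,
          mul_div_mul_left _ _ (pow_ne_zero _ hX)]
      have hexp : q * (q - 1) * n = (q + 1) * (q * d) := by
        calc q * (q - 1) * n = q * (n * (q - 1)) := by ring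
          _ = _ := by rw [hn]; ring
      rw [inver_mem_invariance]
      simp only [map_div₀, map_pow, map_add, map_sub, map_one, subst_X, moebius_inver]
      simp only [Units.val_neg, Units.val_one, map_neg, map_one, hL, hM]
      rw [div_pow, div_pow, ← pow_mul, ← pow_mul, hexp,
        div_div_div_cancel_right₀ (pow_ne_zero _ hX)]
    intro g hg
    obtain ⟨a, ha, b, hb, rfl | ⟨y, hy, rfl⟩⟩ := eq_aff_or_eq_mul hK h1 horb hg
    · rw [show aff a b = aff 1 b * aff a 0 by rw [aff_mul_aff]; simp]
      exact mul_mem (htr b hb) (hmul a ha)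
    · rw [show aff a b = aff 1 b * aff a 0 by rw [aff_mul_aff]; simp]
      exact mul_mem (mul_mem (htr y hy) hinv) (mul_mem (htr b hb) (hmul a ha))
  · have hdeg : ((Polynomial.X ^ q - Polynomial.X) ^ (q - 1) + 1 : Polynomial k).natDegree =
        q * (q - 1) := by
      rw [← map_one Polynomial.C, Polynomial.natDegree_add_C, Polynomial.natDegree_pow, hLdeg,
        mul_comm]
    rw [Polynomial.natDegree_pow, hdeg, hcard]
    calc n * (q * (q - 1)) = q * (n * (q - 1)) := by ring
      _ = _ := by rw [hn]; ring
  · rw [Polynomial.natDegree_pow, hLdeg, hcard]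
    exact Nat.mul_lt_mul_of_pos_left (Nat.lt_succ_self q) hdq

end Formula

end

/-! ### Wild groups: the isomorphism types -/

section

open Matrix OnePoint MulAction RatFunc

variable {k : Type*} [Field k] [IsAlgClosed k] (p : ℕ) [Fact p.Prime] [CharP k p]
  {G : Subgroup (PGL2 k)} [Finite G] {γ : PGL2 k}

omit [IsAlgClosed k] in
theorem nonempty_mulEquiv_elementary
    (h : ∀ g ∈ conjSubgroup γ G, ∃ b, g = aff 1 b) {t : ℕ}
    (ht : Nat.card (transl (conjSubgroup γ G)) = p ^ t) :
    Nonempty (G ≃* Multiplicative (Fin t → ZMod p)) := by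
  obtain ⟨s, hs, ⟨e⟩⟩ := card_addSubgroup_of_prime p Fact.out (transl (conjSubgroup γ G))
  obtain rfl : s = t := Nat.pow_right_injective (Fact.out : p.Prime).two_le (hs.symm.trans ht)
  obtain ⟨f⟩ := nonempty_mulEquiv_transl h
  exact ⟨(conjSubgroupEquiv γ G).trans (f.symm.trans (AddEquiv.toMultiplicative e))⟩

-- A group fixing ∞ is affine with multipliers exactly the m-th roots of unity, so after conjugation
-- it is literally the group `groupK` of the data extracted from its translations.
omit [CharP k p] in
theorem groupK_of_ncard_orbit
    (hK : ∀ a ∈ mults (conjSubgroup γ G), aff a 0 ∈ conjSubgroup γ G)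
    (hr : (orbit (conjSubgroup γ G) (∞ : OnePoint k)).ncard = 1) {t m : ℕ} (ht0 : 0 < t)
    (ht : Nat.card (transl (conjSubgroup γ G)) = p ^ t)
    (hm : Nat.card (mults (conjSubgroup γ G)) = m) (he : OrbitType G [p ^ t * m, m]) {ξ : k}
    (hξ : IsPrimitiveRoot ξ (2 * m)) :
    ∃ b : Fin ((p ^ t - 1) / m) → k, IsKmData p t m ξ b ∧ Nonempty (G ≃* groupK m ξ b) ∧
      FixedFieldGivenBy G ((X * ∏ j, (X ^ m - C (b j))) ^ m) [m * p ^ t, m] := by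
  set K := conjSubgroup γ G with hKdef
  have hm0 : 0 < m := hm ▸ Nat.card_pos
  have hD : ∀ a, a ∈ mults K ↔ a ∈ rootsOfUnity m k := fun a => by
    rw [mem_iff_pow_card_eq_one, mem_rootsOfUnity, hm]
  have hDH : ∀ a ∈ rootsOfUnity m k, ∀ x ∈ transl K, (a : k) * x ∈ transl K :=
    fun a ha x hx => mults_mul_transl ((hD a).2 ha) hx
  obtain ⟨b, hb, hH⟩ := exists_isKmData Fact.out ht0 hm0 hξ ht hDH
  have hKeq : K = groupK m ξ b := by
    rw [groupK_eq_affSubgroup hm0 hξ hH]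
    ext g
    rw [mem_affSubgroup]
    constructor
    · intro hg
      obtain ⟨a, ha, x, hx, rfl⟩ := exists_aff_of_ncard_orbit hK hr hg
      exact ⟨a, (hD a).1 ha, x, hx, rfl⟩
    · rintro ⟨a, ha, x, hx, rfl⟩
      exact aff_mem_of_mem hK ((hD a).2 ha) hx
  have hcard : Nat.card G = m * p ^ t := by
    rw [← card_conjSubgroup γ, ← hKdef, ← card_stabilizer_mul_ncard_orbit K ∞,
      card_stabilizer_infty, hr, ht, hm, mul_one, mul_comm]
  refine ⟨b, hb, ⟨(conjSubgroupEquiv γ G).trans (MulEquiv.subgroupCongr hKeq)⟩, ?_⟩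
  have hff := fixedFieldGivenBy_groupK hm0 hH (by
      rw [ht, Nat.div_mul_cancel hb.dvd]
      have := Nat.pow_pos (n := t) (Fact.out : p.Prime).pos
      omega) (by rw [hcard, ht]) (γ := γ) (fun g hg => by
      obtain ⟨a, ha, x, hx, rfl⟩ := exists_aff_of_ncard_orbit hK hr hg
      exact ⟨a, (hD a).1 ha, x, hx, rfl⟩) (by
      rw [ht, mul_comm]
      exact he)
  rwa [ht] at hff

/-- The quotient c = (q - 1)/d divides both q - 1 and q + 1, hence divides 2. -/
theorem eq_or_of_mul_sub_one {q d e : ℕ} (hq : 1 < q) (hd : d ∣ q - 1)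
    (he : e * (q - 1) = d * (q + 1)) : 2 * d = q - 1 ∨ d = q - 1 := by
  obtain ⟨c, hc⟩ := hd
  have hd0 : 0 < d := by
    rcases Nat.eq_zero_or_pos d with rfl | h
    · omega
    · exact h
  have h1 : e * c = q + 1 := by
    refine Nat.eq_of_mul_eq_mul_left hd0 ?_
    rw [← he, hc]
    ring
  have h2 : c ∣ 2 := by
    have h3 : c ∣ q + 1 := Dvd.intro_left _ h1
    have h4 : c ∣ q - 1 := Dvd.intro_left _ hc.symm
    have := Nat.dvd_sub h3 h4
    rwa [show q + 1 - (q - 1) = 2 by omega] at this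
  rcases (Nat.dvd_prime Nat.prime_two).1 h2 with rfl | rfl
  · right; omega
  · left; omega

/-- In the normal coordinate the translations form a field of q elements by Hua's argument. The
multiplier order is (q - 1)/2 or q - 1, and comparison of orders turns the inclusion of PSL₂(q) in
G, respectively of G in PGL₂(q), into an equality. -/
theorem projective_of_ncard_orbit (hp2 : p ≠ 2)
    (hK : ∀ a ∈ mults (conjSubgroup γ G), aff a 0 ∈ conjSubgroup γ G) {t d e : ℕ} (ht0 : 0 < t)
    (ht : Nat.card (transl (conjSubgroup γ G)) = p ^ t)
    (hr : (orbit (conjSubgroup γ G) (∞ : OnePoint k)).ncard = p ^ t + 1)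
    (hd : Nat.card (mults (conjSubgroup γ G)) = d) (he : e * (p ^ t - 1) = d * (p ^ t + 1))
    (hG : OrbitType G [p ^ t * d, e]) :
    FixedFieldGivenBy G
      (((X ^ p ^ t - X) ^ (p ^ t - 1) + 1) ^ e / (X ^ p ^ t - X) ^ (p ^ t * d)) [p ^ t * d, e] ∧
    ((2 * d = p ^ t - 1 ∧
        Nonempty (G ≃* ProjectiveSpecialLinearGroup (Fin 2) (GaloisField p t))) ∨
      (d = p ^ t - 1 ∧ Nonempty (G ≃* ProjGenLinGroup (Fin 2) (GaloisField p t)))) := by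
  have hp : p.Prime := Fact.out
  have hq1 : 1 < p ^ t := Nat.one_lt_pow ht0.ne' hp.one_lt
  obtain ⟨δ, hδ, hK', h1, horb⟩ := exists_normal_coordinate hK (by rw [ht]; exact hq1)
    (by rw [hr, ht])
  have hcard : Nat.card G = p ^ t * d * (p ^ t + 1) := by
    rw [← card_conjSubgroup γ, ← card_stabilizer_mul_ncard_orbit (conjSubgroup γ G) ∞,
      card_stabilizer_infty, hr, ht, hd]
  have ht' : Nat.card (transl (conjSubgroup δ (conjSubgroup γ G))) = p ^ t := by
    rw [card_transl_conj hδ, ht]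
  have hd' : Nat.card (mults (conjSubgroup δ (conjSubgroup γ G))) = d := by
    rw [card_mults_conj hδ, hd]
  have hcard' : Nat.card (conjSubgroup δ (conjSubgroup γ G)) = Nat.card G := by
    rw [card_conjSubgroup, card_conjSubgroup]
  rw [← conjSubgroup_mul] at *
  set K := conjSubgroup (δ * γ) G with hKdef
  have h2 := two_ne_zero_of_char_ne_two (k := k) p hp2
  obtain ⟨c, hc⟩ := exists_inver_mem horb
  obtain ⟨hmul, hinv⟩ := mul_inv_mem_of_div_mem h2 (transl K) c.ne_zero h1
    fun h hh hh0 => div_mem_transl horb hc hh hh0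
  obtain ⟨ι, hι⟩ := exists_ringHom_of_mul_inv_mem p (transl K) ht' ht0.ne' h1 hmul hinv
  have hF : Nat.card (GaloisField p t) = p ^ t := GaloisField.card p t ht0.ne'
  have := Fintype.ofFinite (GaloisField p t)
  refine ⟨?_, ?_⟩
  · refine fixedFieldGivenBy_projective p hp2 hK' h1 horb rfl hq1 (fun x hx => ?_)
      (fun a ha => ?_) he hcard hG
    · obtain ⟨y, rfl⟩ := (hι x).1 hx
      rw [← map_pow, ← hF, Nat.card_eq_fintype_card, FiniteField.pow_card]
    · rw [← hd', ← mem_iff_pow_card_eq_one]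
      exact ha
  · have hdvd : d ∣ p ^ t - 1 := by
      have := card_mults_dvd K
      rwa [hd', ht'] at this
    have h2F : (2 : GaloisField p t) ≠ 0 := two_ne_zero_of_char_ne_two p hp2
    rcases eq_or_of_mul_sub_one hq1 hdvd he with hd2 | hd1
    · left
      obtain ⟨f⟩ := nonempty_mulEquiv_PSL2 ι hK' horb hι (by rw [hd', hF, hd2]) (by
        refine Nat.eq_of_mul_eq_mul_left (Nat.succ_pos 1) ?_
        rw [two_mul_card_PSL2 _ h2F, hcard', hcard, hF, ← hd2]
        ring)
      exact ⟨hd2, ⟨(conjSubgroupEquiv (δ * γ) G).trans f⟩⟩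
    · right
      obtain ⟨f⟩ := nonempty_mulEquiv_PGL2 ι hK' horb hι (by
        rw [card_PGL2, hcard', hcard, hF, ← hd1])
      exact ⟨hd1, ⟨(conjSubgroupEquiv (δ * γ) G).trans f⟩⟩

omit [Fact p.Prime] in
/-- Groups with an element of order `p`. -/
theorem wild_groups (hp2 : p ≠ 2) (hG : ∃ P, uniqueFixCount G P ≠ 0) :
    ∃ _ : Fact p.Prime, ∃ t, 0 < t ∧
    ((∃ d, d ∣ p ^ t - 1 ∧ Nat.card G = p ^ t * d ∧
        (d = 1 → Nonempty (G ≃* Multiplicative (Fin t → ZMod p)) ∧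
          ∃ H : AddSubgroup k, Nat.card H = p ^ t ∧
            FixedFieldGivenBy G (∏ᶠ a : H, (X + C (a : k))) [p ^ t]) ∧
        ∀ ξ : k, IsPrimitiveRoot ξ (2 * d) →
          ∃ b : Fin ((p ^ t - 1) / d) → k, IsKmData p t d ξ b ∧ Nonempty (G ≃* groupK d ξ b) ∧
            FixedFieldGivenBy G ((X * ∏ j, (X ^ d - C (b j))) ^ d) [d * p ^ t, d]) ∨
      (∃ d e, Nat.card G = p ^ t * (d * (p ^ t + 1)) ∧ e * (p ^ t - 1) = d * (p ^ t + 1) ∧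
        FixedFieldGivenBy G
          (((X ^ p ^ t - X) ^ (p ^ t - 1) + 1) ^ e / (X ^ p ^ t - X) ^ (p ^ t * d))
          [p ^ t * d, e] ∧
        ((2 * d = p ^ t - 1 ∧
            Nonempty (G ≃* ProjectiveSpecialLinearGroup (Fin 2) (GaloisField p t))) ∨
          (d = p ^ t - 1 ∧ Nonempty (G ≃* ProjGenLinGroup (Fin 2) (GaloisField p t))))) ∨
      (p = 3 ∧ Nat.card G = 60 ∧ OrbitType G [6, 5] ∧
        Nonempty (G ≃* alternatingGroup (Fin 5)))) := by
  obtain ⟨P, hP⟩ := hG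
  obtain ⟨γ, hγ, hK⟩ := exists_conj_aff_zero_mem G P
  have hu : uniqueFixCount (conjSubgroup γ G) ∞ ≠ 0 := by rwa [← hγ, uniqueFixCount_conj]
  have hu1 := uniqueFixCount_infty (conjSubgroup γ G)
  rcases card_addSubgroup_cases p hp2 (transl (conjSubgroup γ G)) with h |
    ⟨hp, t, ht0, ht, -, -⟩
  · omega
  have hfact : Fact p.Prime := ⟨hp⟩
  have hq1 : 1 < p ^ t := Nat.one_lt_pow ht0.ne' hp.one_lt
  have hn := card_stabilizer_mul_ncard_orbit (conjSubgroup γ G) (∞ : OnePoint k)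
  rw [card_stabilizer_infty, ht, card_conjSubgroup] at hn
  have hdvd := card_mults_dvd (conjSubgroup γ G)
  rw [ht] at hdvd
  refine ⟨hfact, t, ht0, ?_⟩
  rcases wild_cases p hp2 (conjSubgroup γ G) hK hu with ⟨hr, hd, he⟩ | ⟨hr, hd, he⟩ |
    ⟨hr, e, he, hed⟩ | ⟨hq, hd, hr, he⟩
  · have he := he.of_conj
    rw [ht] at he
    have hcard : Nat.card G = p ^ t := by rw [← hn, hr, hd, mul_one, mul_one]
    have htr : ∀ g ∈ conjSubgroup γ G, ∃ b, g = aff 1 b := fun g hg => by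
      obtain ⟨a, ha, b, -, rfl⟩ := exists_aff_of_ncard_orbit hK hr hg
      refine ⟨b, ?_⟩
      rw [mem_iff_pow_card_eq_one, hd, pow_one] at ha
      rw [ha]
    refine Or.inl ⟨1, one_dvd _, by rw [hcard, mul_one], fun _ => ⟨?_, ?_⟩, fun ξ hξ => ?_⟩
    · exact nonempty_mulEquiv_elementary p htr ht
    · have := fixedFieldGivenBy_translations htr (by rwa [hcard])
      rw [hcard] at this
      exact ⟨_, this⟩
    -- For d = 1 the group is also a K₁, whose list (pᵗ, 1) includes a free orbit.
    · refine groupK_of_ncard_orbit p hK hr ht0 ht hd ?_ hξ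
      rw [mul_one]
      exact he.append_one
  · have he := he.of_conj
    rw [ht] at he
    refine Or.inl ⟨_, hdvd, by rw [← hn, hr, mul_one], fun h => absurd h (by omega),
      fun ξ hξ => groupK_of_ncard_orbit p hK hr ht0 ht rfl he hξ⟩
  · have he := he.of_conj
    rw [ht] at he hr hed
    refine Or.inr (Or.inl ⟨_, e, by rw [← hn, hr, mul_assoc], hed, ?_⟩)
    exact projective_of_ncard_orbit p hp2 hK ht0 ht hr rfl hed he
  -- The exceptional structure: three translations force p = 3, and |G| = 3·2·10.
  · have hp3 : p = 3 := by
      have : p ∣ 3 := by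
        rw [← hq, ht]
        exact dvd_pow_self p ht0.ne'
      exact (Nat.prime_dvd_prime_iff_eq hp Nat.prime_three).1 this
    have hcard : Nat.card G = 60 := by rw [← hn, hr, ← ht, hq, hd]
    have he := he.of_conj
    refine Or.inr (Or.inr ⟨hp3, hcard, he, ?_⟩)
    -- Stabilizers of even order all have order 6 = 2(u + 1) with u = 2 and form one orbit, as the
    -- criterion for A₅ requires.
    have hst : ∀ R : OnePoint k, Nat.card (stabilizer G R) = 1 ∨ Nat.card (stabilizer G R) = 6 ∨
        Nat.card (stabilizer G R) = 5 := fun R => by simpa using he.card_stabilizer R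
    have hsP : Nat.card (stabilizer G P) = 6 := by
      rw [← card_stabilizer_conj γ, hγ, card_stabilizer_infty, hq, hd]
    have huP : uniqueFixCount G P = 2 := by
      rw [← uniqueFixCount_conj γ, hγ]
      omega
    have hsix : ∀ R : OnePoint k, 2 ∣ Nat.card (stabilizer G R) →
        Nat.card (stabilizer G R) = 6 := fun R hR => by
      rcases hst R with h | h | h <;> omega
    have horb : ∀ R S : OnePoint k, 2 ∣ Nat.card (stabilizer G R) →
        2 ∣ Nat.card (stabilizer G S) → R ∈ orbit G S := fun R S hR hS =>
      he.mem_orbit (2 ∣ ·) (by norm_num) (fun (i j : Fin 2) => by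
        fin_cases i <;> fin_cases j <;> simp) hR hS
    refine nonempty_mulEquiv_alternatingGroup_five_of_orbits
      (two_ne_zero_of_char_ne_two (k := k) p hp2) G hcard horb (fun R hR => ?_) (fun R => ?_)
      fun R => ?_
    · obtain ⟨g, hg⟩ := horb R P hR (by rw [hsP]; norm_num)
      rw [hsix R hR, ← hg]
      change 6 = 2 * (uniqueFixCount G (g • P) + 1)
      rw [uniqueFixCount_smul, huP]
    · rcases hst R with h | h | h <;> omega
    · rcases hst R with h | h | h <;> omega

end

/-! ### Wild groups: recovering the case from the group order -/

section

open Matrix OnePoint MulAction RatFunc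

variable {k : Type*} [Field k]

theorem eq_of_pow_mul_eq {p s t x y : ℕ} (hp : p.Prime) (hx : ¬ p ∣ x) (hy : ¬ p ∣ y)
    (h : p ^ s * x = p ^ t * y) : s = t ∧ x = y := by
  have hst : s = t := by
    rcases lt_trichotomy s t with hlt | heq | hlt
    · obtain ⟨j, rfl⟩ := Nat.exists_eq_add_of_lt hlt
      refine absurd ?_ hx
      have : x = p ^ (j + 1) * y := Nat.eq_of_mul_eq_mul_left (Nat.pow_pos hp.pos)
        (by rw [h, ← mul_assoc, ← pow_add]; ring_nf)
      rw [this]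
      exact (dvd_pow_self p (Nat.succ_ne_zero j)).mul_right y
    · exact heq
    · obtain ⟨j, rfl⟩ := Nat.exists_eq_add_of_lt hlt
      refine absurd ?_ hy
      have : y = p ^ (j + 1) * x := Nat.eq_of_mul_eq_mul_left (Nat.pow_pos hp.pos)
        (by rw [← h, ← mul_assoc, ← pow_add]; ring_nf)
      rw [this]
      exact (dvd_pow_self p (Nat.succ_ne_zero j)).mul_right x
  subst hst
  exact ⟨rfl, Nat.eq_of_mul_eq_mul_left (Nat.pow_pos hp.pos) h⟩

theorem not_dvd_of_dvd_pow_sub_one {p t d : ℕ} (hp : p.Prime) (ht : 0 < t)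
    (h : d ∣ p ^ t - 1) : ¬ p ∣ d := fun hd => by
  have h1 := dvd_pow_self p ht.ne'
  have h2 := Nat.dvd_sub h1 (hd.trans h)
  have h3 : 0 < p ^ t := Nat.pow_pos hp.pos
  rw [show p ^ t - (p ^ t - 1) = 1 by omega] at h2
  exact hp.one_lt.ne' (Nat.dvd_one.1 h2)

theorem not_dvd_pow_add_one {p t : ℕ} (hp : p.Prime) (ht : 0 < t) : ¬ p ∣ p ^ t + 1 := fun hd =>
  hp.one_lt.ne' (Nat.dvd_one.1 ((Nat.dvd_add_right (dvd_pow_self p ht.ne')).1 hd))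

variable [IsAlgClosed k] (p : ℕ) [CharP k p] {G : Subgroup (PGL2 k)} [Finite G]

/-- A group with an element of order `p`, with its order written as `pᵗ` times a number prime
to `p`. -/
theorem wild_groups_of_card (hp2 : p ≠ 2) [Fact p.Prime] {t y : ℕ} (ht : 0 < t) (hy : ¬ p ∣ y)
    (hG : Nat.card G = p ^ t * y) :
    (y ∣ p ^ t - 1 ∧
      (y = 1 → ∃ H : AddSubgroup k, Nat.card H = p ^ t ∧
        FixedFieldGivenBy G (∏ᶠ a : H, (X + C (a : k))) [p ^ t]) ∧
      ∀ ξ : k, IsPrimitiveRoot ξ (2 * y) →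
        ∃ b : Fin ((p ^ t - 1) / y) → k, IsKmData p t y ξ b ∧ Nonempty (G ≃* groupK y ξ b) ∧
          FixedFieldGivenBy G ((X * ∏ j, (X ^ y - C (b j))) ^ y) [y * p ^ t, y]) ∨
    (∃ d e, y = d * (p ^ t + 1) ∧ e * (p ^ t - 1) = d * (p ^ t + 1) ∧
      (2 * d = p ^ t - 1 ∨ d = p ^ t - 1) ∧
      FixedFieldGivenBy G
        (((X ^ p ^ t - X) ^ (p ^ t - 1) + 1) ^ e / (X ^ p ^ t - X) ^ (p ^ t * d))
        [p ^ t * d, e]) ∨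
    (p = 3 ∧ t = 1 ∧ y = 20 ∧ OrbitType G [6, 5]) := by
  have hp : p.Prime := Fact.out
  -- As p divides |G|, the tame situation is excluded; the decomposition of |G| into pᵗ and a factor
  -- prime to p then identifies t and y in each case.
  have hwild : ∃ P, uniqueFixCount G P ≠ 0 := by
    by_contra! h
    refine not_dvd_of_uniqueFixCount_eq_zero p h ?_
    rw [hG]
    exact (dvd_pow_self p ht.ne').mul_right y
  obtain ⟨_, s, hs, ⟨d, hd, hcard, h1, h2⟩ | ⟨d, e, hcard, he, hff, hor⟩ | ⟨hp3, hcard, he, -⟩⟩ :=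
    wild_groups p hp2 hwild
  · obtain ⟨rfl, rfl⟩ := eq_of_pow_mul_eq hp (not_dvd_of_dvd_pow_sub_one hp hs hd) hy
      (hcard.symm.trans hG)
    exact Or.inl ⟨hd, fun h => (h1 h).2, h2⟩
  · have hor' : 2 * d = p ^ s - 1 ∨ d = p ^ s - 1 := hor.imp And.left And.left
    have hd : ¬ p ∣ d * (p ^ s + 1) := by
      rw [hp.dvd_mul, not_or]
      refine ⟨not_dvd_of_dvd_pow_sub_one hp hs ?_, not_dvd_pow_add_one hp hs⟩
      rcases hor' with h | h
      · exact Dvd.intro_left _ h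
      · exact h.dvd
    obtain ⟨rfl, rfl⟩ := eq_of_pow_mul_eq hp hd hy (hcard.symm.trans hG)
    exact Or.inr (Or.inl ⟨d, e, rfl, he, hor', hff⟩)
  · subst hp3
    obtain ⟨rfl, rfl⟩ := eq_of_pow_mul_eq (s := 1) (x := 20) hp (by norm_num) hy
      (by rw [← hG, hcard]; norm_num)
    exact Or.inr (Or.inr ⟨rfl, rfl, rfl, he⟩)

theorem fixedFieldGivenBy_of_elementary (hp2 : p ≠ 2) (hp : p.Prime) {t : ℕ} (ht : 0 < t)
    (e : G ≃* Multiplicative (Fin t → ZMod p)) :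
    ∃ H : AddSubgroup k, Nat.card H = p ^ t ∧
      FixedFieldGivenBy G (∏ᶠ a : H, (X + C (a : k))) [p ^ t] := by
  have : Fact p.Prime := ⟨hp⟩
  have hG : Nat.card G = p ^ t * 1 := by
    rw [Nat.card_congr e.toEquiv, mul_one, Nat.card_congr Multiplicative.toAdd, Nat.card_fun]
    simp
  rcases wild_groups_of_card p hp2 ht hp.not_dvd_one hG with
    ⟨-, h, -⟩ | ⟨d, -, hd, -⟩ | ⟨-, -, h, -⟩
  · exact h rfl
  · have h1 : 0 < p ^ t := Nat.pow_pos hp.pos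
    have h2 := (Nat.eq_one_of_mul_eq_one_left hd.symm)
    omega
  · norm_num at h

/-- Since m ≤ pᵗ - 1, it is not a multiple of pᵗ + 1, which excludes the projective case; the
exceptional one would need 20 ≤ 3 - 1. -/
theorem fixedFieldGivenBy_of_groupK (hp2 : p ≠ 2) {t m : ℕ} {ξ : k}
    {b : Fin ((p ^ t - 1) / m) → k} (hb : IsKmData p t m ξ b) (e : G ≃* groupK m ξ b) :
    ∃ b' : Fin ((p ^ t - 1) / m) → k, IsKmData p t m ξ b' ∧ Nonempty (G ≃* groupK m ξ b') ∧
      FixedFieldGivenBy G ((X * ∏ j, (X ^ m - C (b' j))) ^ m) [m * p ^ t, m] := by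
  have : Fact p.Prime := ⟨hb.prime⟩
  have hG : Nat.card G = p ^ t * m := by rw [Nat.card_congr e.toEquiv, hb.card_groupK]
  have h1 := Nat.one_lt_pow hb.pos.ne' hb.prime.one_lt
  have hle := Nat.le_of_dvd (by omega) hb.dvd
  rcases wild_groups_of_card p hp2 hb.pos (not_dvd_of_dvd_pow_sub_one hb.prime hb.pos hb.dvd) hG
    with ⟨-, -, h⟩ | ⟨d, -, hd, -⟩ | ⟨rfl, rfl, rfl, -⟩
  · exact h ξ hb.primitive
  · have hm := hb.m_pos
    have hd0 : 0 < d := Nat.pos_of_mul_pos_right (hd ▸ hm)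
    have := Nat.le_mul_of_pos_left (p ^ t + 1) hd0
    omega
  · norm_num at hle

/-- The order is q·j(q + 1) with j = (q - 1)/2. As j(q + 1) > q - 1 the affine case is impossible,
cancelling q + 1 gives d = j, and the exceptional case would have q = 3 with j(q + 1) = 4 instead of
20. -/
theorem fixedFieldGivenBy_of_PSL2 (hp2 : p ≠ 2) [Fact p.Prime] {f q : ℕ} (hf : 0 < f)
    (hq : q = p ^ f) (e : G ≃* ProjectiveSpecialLinearGroup (Fin 2) (GaloisField p f)) :
    FixedFieldGivenBy G
      (((X ^ q - X) ^ (q - 1) + 1) ^ ((q + 1) / 2) / (X ^ q - X) ^ (q * (q - 1) / 2))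
      [q * (q - 1) / 2, (q + 1) / 2] := by
  subst hq
  have hp : p.Prime := Fact.out
  obtain ⟨j, hj⟩ : Odd (p ^ f) := (hp.odd_of_ne_two hp2).pow
  have hq1 := Nat.one_lt_pow hf.ne' hp.one_lt
  have hG : Nat.card G = p ^ f * (j * (p ^ f + 1)) := by
    have h := two_mul_card_PSL2 (GaloisField p f) (two_ne_zero_of_char_ne_two p hp2)
    rw [← Nat.card_congr e.toEquiv, GaloisField.card p f hf.ne',
      show p ^ f - 1 = 2 * j by omega] at h
    refine Nat.eq_of_mul_eq_mul_left (Nat.succ_pos 1) (h.trans ?_)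
    ring
  have hjd : j ∣ p ^ f - 1 := ⟨2, by omega⟩
  have hy : ¬ p ∣ j * (p ^ f + 1) := by
    rw [hp.dvd_mul, not_or]
    exact ⟨not_dvd_of_dvd_pow_sub_one hp hf hjd, not_dvd_pow_add_one hp hf⟩
  rcases wild_groups_of_card p hp2 hf hy hG with ⟨h, -⟩ | ⟨d, n, hd, hn, -, hff⟩ |
    ⟨rfl, rfl, h, -⟩
  · have h1 := Nat.le_of_dvd (by omega) h
    have := Nat.le_mul_of_pos_left (p ^ f + 1) (show 0 < j by omega)
    omega
  · obtain rfl : j = d := Nat.eq_of_mul_eq_mul_right (Nat.succ_pos _) hd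
    obtain rfl : n = j + 1 := by
      refine Nat.eq_of_mul_eq_mul_right (show 0 < p ^ f - 1 by omega) (hn.trans ?_)
      rw [hj]
      simp only [Nat.add_sub_cancel]
      ring
    have h1 : (p ^ f + 1) / 2 = j + 1 := by omega
    have h2 : p ^ f * (p ^ f - 1) / 2 = p ^ f * j := by
      rw [show p ^ f - 1 = 2 * j by omega, mul_left_comm, Nat.mul_div_cancel_left _ (by norm_num)]
    rwa [h1, h2]
  · omega

theorem fixedFieldGivenBy_of_PGL2 (hp2 : p ≠ 2) [Fact p.Prime] {f q : ℕ} (hf : 0 < f)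
    (hq : q = p ^ f) (e : G ≃* ProjGenLinGroup (Fin 2) (GaloisField p f)) :
    FixedFieldGivenBy G
      (((X ^ q - X) ^ (q - 1) + 1) ^ (q + 1) / (X ^ q - X) ^ (q * (q - 1)))
      [q * (q - 1), q + 1] := by
  subst hq
  have hp : p.Prime := Fact.out
  have hq1 := Nat.one_lt_pow hf.ne' hp.one_lt
  have hG : Nat.card G = p ^ f * ((p ^ f - 1) * (p ^ f + 1)) := by
    rw [Nat.card_congr e.toEquiv, card_PGL2, GaloisField.card p f hf.ne', mul_assoc]
  have hy : ¬ p ∣ (p ^ f - 1) * (p ^ f + 1) := by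
    rw [hp.dvd_mul, not_or]
    exact ⟨not_dvd_of_dvd_pow_sub_one hp hf dvd_rfl, not_dvd_pow_add_one hp hf⟩
  rcases wild_groups_of_card p hp2 hf hy hG with ⟨h, -⟩ | ⟨d, n, hd, hn, -, hff⟩ |
    ⟨rfl, rfl, h, -⟩
  · have h1 := Nat.le_of_dvd (by omega) h
    have := Nat.le_mul_of_pos_left (p ^ f + 1) (show 0 < p ^ f - 1 by omega)
    omega
  · obtain rfl : p ^ f - 1 = d := Nat.eq_of_mul_eq_mul_right (Nat.succ_pos _) hd
    obtain rfl : n = p ^ f + 1 := by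
      refine Nat.eq_of_mul_eq_mul_right (show 0 < p ^ f - 1 by omega) (hn.trans ?_)
      ring
    exact hff
  · norm_num at h

/-- With 60 = 3·20 the affine case needs 20 to divide 2, and the projective one needs 20 = 4d with d
≤ 2. -/
theorem fixedFieldGivenBy_of_alternatingGroup_five_three [CharP k 3]
    (e : G ≃* alternatingGroup (Fin 5)) {i : k} (hi : i ^ 2 = -1) :
    FixedFieldGivenBy G
      ((X ^ 10 - 1) ^ 6 / (X * (X ^ 10 + 2 * C i * X ^ 5 + 1)) ^ 5) [6, 5] := by
  have : Fact (Nat.Prime 3) := ⟨Nat.prime_three⟩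
  have hG := card_of_alternatingGroup_five e
  refine fixedFieldGivenBy_icosahedral_three e ?_ hG hi
  rcases wild_groups_of_card (k := k) 3 (by norm_num) (t := 1) (y := 20) one_pos (by norm_num) hG
    with ⟨h, -⟩ | ⟨d, n, hd, -, hor, -⟩ | ⟨-, -, -, h⟩
  · norm_num at h
  · omega
  · exact h

theorem wild_group_cases (hp2 : p ≠ 2) (hG : ∃ P, uniqueFixCount G P ≠ 0) :
    (p ≠ 5 ∧ Nonempty (G ≃* alternatingGroup (Fin 5))) ∨
      (p.Prime ∧ ∃ t : ℕ, 0 < t ∧ Nonempty (G ≃* Multiplicative (Fin t → ZMod p))) ∨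
      (∃ (t m : ℕ) (ξ : k) (b : Fin ((p ^ t - 1) / m) → k),
        2 ≤ m ∧ IsKmData p t m ξ b ∧ Nonempty (G ≃* groupK m ξ b)) ∨
      (∃ (_ : Fact p.Prime) (f : ℕ), 0 < f ∧
        Nonempty (G ≃* ProjectiveSpecialLinearGroup (Fin 2) (GaloisField p f))) ∨
      (∃ (_ : Fact p.Prime) (f : ℕ), 0 < f ∧
        Nonempty (G ≃* ProjGenLinGroup (Fin 2) (GaloisField p f))) := by
  obtain ⟨hp, t, ht, ⟨d, hd, hcard, h1, h2⟩ | ⟨d, e, -, -, -, ⟨-, h⟩ | ⟨-, h⟩⟩ | ⟨hp3, -, -, h⟩⟩ :=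
    wild_groups p hp2 hG
  · by_cases hd1 : d = 1
    · exact Or.inr (Or.inl ⟨hp.out, t, ht, (h1 hd1).1⟩)
    · have hpd := not_dvd_of_dvd_pow_sub_one hp.out ht hd
      have hd0 : d ≠ 0 := fun h => hpd (h ▸ dvd_zero p)
      -- A primitive 2d-th root of unity exists because p divides neither 2 nor d.
      have hne : NeZero ((2 * d : ℕ) : k) := ⟨fun h => by
        rw [CharP.cast_eq_zero_iff k p, hp.out.dvd_mul] at h
        rcases h with h | h
        · exact hp2 ((Nat.prime_dvd_prime_iff_eq hp.out Nat.prime_two).1 h)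
        · exact hpd h⟩
      obtain ⟨ξ, hξ⟩ := HasEnoughRootsOfUnity.exists_primitiveRoot k (2 * d)
      obtain ⟨b, hb, hK, -⟩ := h2 ξ hξ
      exact Or.inr (Or.inr (Or.inl ⟨t, d, ξ, b, by omega, hb, hK⟩))
  · exact Or.inr (Or.inr (Or.inr (Or.inl ⟨hp, t, ht, h⟩)))
  · exact Or.inr (Or.inr (Or.inr (Or.inr ⟨hp, t, ht, h⟩)))
  · exact Or.inl ⟨by omega, h⟩

end

end FiniteMoebius

end

/-! ### The classification assembled -/

open FiniteMoebius RatFunc in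
theorem lemma1 {k : Type*} [Field k] [IsAlgClosed k] (p : ℕ) [CharP k p] (hp2 : p ≠ 2)
    (G : Subgroup (Matrix.ProjGenLinGroup (Fin 2) k)) [Finite G] :
    -- the possible groups
    ((∃ m : ℕ, ¬ p ∣ m ∧ Nonempty (G ≃* Multiplicative (ZMod m))) ∨
      (∃ m : ℕ, 2 ≤ m ∧ ¬ p ∣ m ∧ Nonempty (G ≃* DihedralGroup m)) ∨
      (p ≠ 3 ∧ Nonempty (G ≃* alternatingGroup (Fin 4))) ∨
      (p ≠ 3 ∧ Nonempty (G ≃* Equiv.Perm (Fin 4))) ∨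
      (p ≠ 5 ∧ Nonempty (G ≃* alternatingGroup (Fin 5))) ∨
      (p.Prime ∧ ∃ t : ℕ, 0 < t ∧ Nonempty (G ≃* Multiplicative (Fin t → ZMod p))) ∨
      (∃ (t m : ℕ) (ξ : k) (b : Fin ((p ^ t - 1) / m) → k),
        2 ≤ m ∧ IsKmData p t m ξ b ∧ Nonempty (G ≃* groupK m ξ b)) ∨
      (∃ (_ : Fact p.Prime) (f : ℕ), 0 < f ∧
        Nonempty (G ≃* Matrix.ProjectiveSpecialLinearGroup (Fin 2) (GaloisField p f))) ∨
      (∃ (_ : Fact p.Prime) (f : ℕ), 0 < f ∧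
        Nonempty (G ≃* Matrix.ProjGenLinGroup (Fin 2) (GaloisField p f)))) ∧
    -- the fixed field and the ramification in each case
    (∀ m : ℕ, ¬ p ∣ m → Nonempty (G ≃* Multiplicative (ZMod m)) →
      FixedFieldGivenBy G (X ^ m) [m, m]) ∧
    (∀ m : ℕ, ¬ p ∣ m → Nonempty (G ≃* DihedralGroup m) →
      FixedFieldGivenBy G (X ^ m + 1 / X ^ m) [2, 2, m]) ∧
    (p ≠ 3 → Nonempty (G ≃* alternatingGroup (Fin 4)) →
      FixedFieldGivenBy G
        ((X ^ 12 - 33 * X ^ 8 - 33 * X ^ 4 + 1) / (X ^ 2 * (X ^ 4 - 1) ^ 2)) [2, 3, 3]) ∧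
    (p ≠ 3 → Nonempty (G ≃* Equiv.Perm (Fin 4)) →
      FixedFieldGivenBy G
        ((X ^ 8 + 14 * X ^ 4 + 1) ^ 3 / (108 * (X * (X ^ 4 - 1)) ^ 4)) [2, 3, 4]) ∧
    (p ≠ 3 → p ≠ 5 → Nonempty (G ≃* alternatingGroup (Fin 5)) →
      FixedFieldGivenBy G
        ((-X ^ 20 + 228 * X ^ 15 - 494 * X ^ 10 - 228 * X ^ 5 - 1) ^ 3 /
          (X * (X ^ 10 + 11 * X ^ 5 - 1)) ^ 5) [2, 3, 5]) ∧
    (p = 3 → Nonempty (G ≃* alternatingGroup (Fin 5)) → ∀ i : k, i ^ 2 = -1 →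
      FixedFieldGivenBy G
        ((X ^ 10 - 1) ^ 6 / (X * (X ^ 10 + 2 * C i * X ^ 5 + 1)) ^ 5) [6, 5]) ∧
    (p.Prime → ∀ t : ℕ, 0 < t → Nonempty (G ≃* Multiplicative (Fin t → ZMod p)) →
      ∃ H : AddSubgroup k, Nat.card H = p ^ t ∧
        FixedFieldGivenBy G (∏ᶠ a : H, (X + C (a : k))) [p ^ t]) ∧
    (∀ (t m : ℕ) (ξ : k) (b : Fin ((p ^ t - 1) / m) → k),
      IsKmData p t m ξ b → Nonempty (G ≃* groupK m ξ b) →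
      ∃ b' : Fin ((p ^ t - 1) / m) → k,
        IsKmData p t m ξ b' ∧ Nonempty (G ≃* groupK m ξ b') ∧
        FixedFieldGivenBy G ((X * ∏ j, (X ^ m - C (b' j))) ^ m) [m * p ^ t, m]) ∧
    (∀ [Fact p.Prime] (f q : ℕ), 0 < f → q = p ^ f →
      Nonempty (G ≃* Matrix.ProjectiveSpecialLinearGroup (Fin 2) (GaloisField p f)) →
      FixedFieldGivenBy G
        (((X ^ q - X) ^ (q - 1) + 1) ^ ((q + 1) / 2) / (X ^ q - X) ^ (q * (q - 1) / 2))
        [q * (q - 1) / 2, (q + 1) / 2]) ∧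
    (∀ [Fact p.Prime] (f q : ℕ), 0 < f → q = p ^ f →
      Nonempty (G ≃* Matrix.ProjGenLinGroup (Fin 2) (GaloisField p f)) →
      FixedFieldGivenBy G
        (((X ^ q - X) ^ (q - 1) + 1) ^ (q + 1) / (X ^ q - X) ^ (q * (q - 1)))
        [q * (q - 1), q + 1]) := by
  refine ⟨?_, fun m hm ⟨e⟩ => fixedFieldGivenBy_of_cyclic p hp2 hm e,
    fun m hm ⟨e⟩ => fixedFieldGivenBy_of_dihedral p hp2 hm e,
    fun hp3 ⟨e⟩ => fixedFieldGivenBy_of_alternatingGroup_four p hp2 hp3 e,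
    fun hp3 ⟨e⟩ => fixedFieldGivenBy_of_perm_four p hp2 hp3 e,
    fun hp3 hp5 ⟨e⟩ => fixedFieldGivenBy_of_alternatingGroup_five p hp2 hp3 hp5 e,
    fun hp3 ⟨e⟩ i hi => ?_,
    fun hp t ht ⟨e⟩ => fixedFieldGivenBy_of_elementary p hp2 hp ht e,
    fun t m ξ b hb ⟨e⟩ => fixedFieldGivenBy_of_groupK p hp2 hb e,
    fun f q hf hq ⟨e⟩ => fixedFieldGivenBy_of_PSL2 p hp2 hf hq e,
    fun f q hf hq ⟨e⟩ => fixedFieldGivenBy_of_PGL2 p hp2 hf hq e⟩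
  -- The division is by whether some nontrivial element has a single fixed point; A₅ can arise on
  -- both sides.
  · by_cases htame : ∀ P, uniqueFixCount G P = 0
    · rcases tame_groups p hp2 G htame with h | h | h | h | h
      · exact Or.inl h
      · exact Or.inr (Or.inl h)
      · exact Or.inr (Or.inr (Or.inl h))
      · exact Or.inr (Or.inr (Or.inr (Or.inl h)))
      · exact Or.inr (Or.inr (Or.inr (Or.inr (Or.inl h))))
    · push Not at htame
      exact Or.inr (Or.inr (Or.inr (Or.inr (wild_group_cases p hp2 htame))))
  · subst hp3
    exact fixedFieldGivenBy_of_alternatingGroup_five_three e hi
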